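/- Conventions. A tropical variety of dimension $m$ in $\mathbb{R}^n$ is a finite polyhedral complex of pure dimension $m$ whose faces have directions defined over $\mathbb{Z}$, with positive integer weights on its facets, satisfying the balancing condition at each face of dimension $m-1$. Its degree is its intersection number (points counted with tropical multiplicity) with a generic translate of the standard fan tropical linear space of dimension $n-m$, that is, the fan whose cones are generated by the subsets of at most $n-m$ of the vectors $-e_1,\dots,-e_n,(1,\dots,1)$, with weights $1$. A tropical plane is a tropical surface of degree $1$. A tropical curve $C$ is a tropical variety of dimension $1$; its degree equals $\sum_e w_e\max\{0,u_{e,1},\dots,u_{e,n}\}$, where $e$ runs over the unbounded edges of $C$, $w_e$ is the weight of $e$ and $u_e$ is the primitive integer vector directing $e$ towards infinity. Its genus is its first Betti number (with coefficients in a fixed field $\mathbb{K}$). The recession fan $R(C)=\lim_{t\to0}t\cdot C$ consists of the rays from the origin in the directions $u_e$, the weight of a ray being the sum of the weights $w_e$ of the unbounded edges $e$ in its direction. A point $p$ is a transverse intersection point of two tropical curves $C, D$ contained in a tropical surface $L$ if near $p$ the sets $L$, $C$, $D$ are respectively a plane and two distinct lines in that plane, both curves have weight $1$ at $p$, and primitive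 integer directing vectors of the two lines form a basis of the lattice of integer vectors parallel to the plane. Theorem. For any field $\mathbb{K}$ and any integer $k\ge1$, there exist a tropical plane $L_k$ in $\mathbb{R}^{k+1}$ and a family $(C_{k,d})_{d\ge1}$ of tropical curves contained in $L_k$ such that: 1. for every $d\ge1$, $C_{k,d}$ has degree $d$ and genus $k\cdot\frac{(d-1)(d-2)}{2}$; 2. for every $d\ge2$, the intersection $C_{k,d}\cap C_{k,d-1}$ consists of exactly $(d-1)\big[2(d-1)+(k-2)(d-2)\big]$ transverse intersection points and $k-1$ pairwise disjoint closed bounded segments (not reduced to points); 3. for every $d\ge1$, the recession fan $R(C_{k,d})$ is $d$ times the fan tropical line, i.e. it consists of exactly one ray of weight $d$ in each of the directions $(-1,0,\dots,0),(0,-1,0,\dots,0),\dots,(0,\dots,0,-1),(1,\dots,1)$. -/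

import Mathlib

open scoped Topology

noncomputable section

namespace TropGeo

variable {n m : ℕ}

/-- The inclusion of the lattice `ℤⁿ` into `ℝⁿ`. -/
def toReal (u : Fin n → ℤ) : Fin n → ℝ := fun i => (u i : ℝ)

/-- A polyhedron with rational slopes: finitely many inequalities `⟨a, x⟩ ≤ b` with
`a ∈ ℤⁿ` and `b ∈ ℝ`. -/
def IsRationalPolyhedron (P : Set (Fin n → ℝ)) : Prop :=
  ∃ (r : ℕ) (a : Fin r → Fin n → ℤ) (b : Fin r → ℝ),
    P = {x | ∀ i, ∑ j, (a i j : ℝ) * x j ≤ b i}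

/-- The dimension of a polyhedron. -/
def cellDim (σ : Set (Fin n → ℝ)) : ℕ := Module.finrank ℝ (vectorSpan ℝ σ)

/-- The lattice of integer vectors parallel to a polyhedron. -/
def cellLattice (σ : Set (Fin n → ℝ)) : Submodule ℤ (Fin n → ℤ) where
  carrier := {u | toReal u ∈ vectorSpan ℝ σ}
  add_mem' := by
    intro a b ha hb
    have h : toReal (a + b) = toReal a + toReal b := by
      ext i; simp [toReal]
    change toReal _ ∈ vectorSpan ℝ σ
    rw [h]
    exact Submodule.add_mem _ ha hb
  zero_mem' := by
    have h : toReal (0 : Fin n → ℤ) = 0 := by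
      ext i; simp [toReal]
    change toReal _ ∈ vectorSpan ℝ σ
    rw [h]
    exact Submodule.zero_mem _
  smul_mem' := by
    intro c a ha
    have h : toReal (c • a) = (c : ℝ) • toReal a := by
      ext i; simp [toReal]
    change toReal _ ∈ vectorSpan ℝ σ
    rw [h]
    exact Submodule.smul_mem _ _ ha

/-- For a face `τ` of codimension one of `σ`: the integer vector `u` generates the lattice of `σ`
modulo the lattice of `τ`, and points from `τ` into `σ`. -/
def IsPrimitiveNormal (τ σ : Set (Fin n → ℝ)) (u : Fin n → ℤ) : Prop :=
  cellLattice σ = cellLattice τ ⊔ Submodule.span ℤ {u} ∧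
    ∃ x ∈ τ, ∃ ε : ℝ, 0 < ε ∧ x + ε • toReal u ∈ σ

/-- A finite polyhedral complex in `ℝⁿ` with rational slopes. Its cells are nonempty; the faces of
a polyhedron are its exposed subsets. -/
structure PolyhedralComplex (n : ℕ) where
  cells : Finset (Set (Fin n → ℝ))
  nonempty : ∀ σ ∈ cells, σ.Nonempty
  polyhedron : ∀ σ ∈ cells, IsRationalPolyhedron σ
  face_mem : ∀ σ ∈ cells, ∀ τ : Set (Fin n → ℝ), τ.Nonempty → IsExposed ℝ σ τ → τ ∈ cells
  inter_face : ∀ σ ∈ cells, ∀ τ ∈ cells, (σ ∩ τ).Nonempty → IsExposed ℝ σ (σ ∩ τ)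

open Classical in
/-- A tropical variety of pure dimension `m` in `ℝⁿ`: a finite rational polyhedral complex, each
cell of which lies in a facet (a cell of dimension `m`), with positive integer weights on the
facets, balanced at each cell of dimension `m - 1`. Only the weights of facets matter. -/
structure TropicalVariety (n m : ℕ) extends PolyhedralComplex n where
  pure : ∀ σ ∈ cells, ∃ F ∈ cells, σ ⊆ F ∧ cellDim F = m
  weight : Set (Fin n → ℝ) → ℕ
  weight_pos : ∀ F ∈ cells, cellDim F = m → 0 < weight F
  balanced : ∀ τ ∈ cells, cellDim τ + 1 = m →
    ∃ u : Set (Fin n → ℝ) → (Fin n → ℤ),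
      (∀ F ∈ cells, cellDim F = m → τ ⊆ F → IsPrimitiveNormal τ F (u F)) ∧
      ∑ F ∈ cells.filter (fun F => cellDim F = m ∧ τ ⊆ F),
        (weight F : ℝ) • toReal (u F) ∈ vectorSpan ℝ τ

/-- A tropical curve in `ℝⁿ`. -/
abbrev TropicalCurve (n : ℕ) := TropicalVariety n 1

/-- The subset of `ℝⁿ` underlying a tropical variety. -/
def TropicalVariety.support (X : TropicalVariety n m) : Set (Fin n → ℝ) :=
  {x | ∃ σ ∈ X.cells, x ∈ σ}

/-! ### Standard fans and the degree of a tropical variety -/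

/-- The `n + 1` standard directions `-e₁, …, -eₙ, (1, …, 1)` in `ℤⁿ`. -/
def stdDir (n : ℕ) : Option (Fin n) → (Fin n → ℤ)
  | some i => -Pi.single i 1
  | none => fun _ => 1

/-- The cone with apex `v` generated by the standard directions indexed by `I`. The translate by
`v` of the standard fan tropical linear space of dimension `r` consists of the cones with
`I.card ≤ r`; all its facets have weight one. -/
def stdCone (v : Fin n → ℝ) (I : Finset (Option (Fin n))) : Set (Fin n → ℝ) :=
  {x | ∃ c : Option (Fin n) → ℝ, (∀ i ∈ I, 0 ≤ c i) ∧ x = v + ∑ i ∈ I, c i • toReal (stdDir n i)}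

/-- `X` of dimension `m` meets the standard fan tropical linear space of dimension `n - m` with
apex `v` transversally: any two cells that meet span `ℝⁿ` together. -/
def TropicalVariety.MeetsTransversally (X : TropicalVariety n m) (v : Fin n → ℝ) : Prop :=
  ∀ σ ∈ X.cells, ∀ I : Finset (Option (Fin n)), I.card ≤ n - m → (σ ∩ stdCone v I).Nonempty →
    vectorSpan ℝ σ ⊔ Submodule.span ℝ ((fun i => toReal (stdDir n i)) '' (I : Set (Option (Fin n))))
      = ⊤

open Classical in
/-- The number of intersection points of `X` (of dimension `m`) with the standard fan tropical
linear space of dimension `n - m` with apex `v`, in the transverse case. Two facets meet in at most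
one point, which counts with the weight times the index in `ℤⁿ` of the sum of their lattices. -/
def TropicalVariety.intersectionNumber (X : TropicalVariety n m) (v : Fin n → ℝ) : ℕ :=
  ∑ F ∈ X.cells.filter (fun F => cellDim F = m),
    ∑ I ∈ (Finset.univ : Finset (Finset (Option (Fin n)))).filter (fun I => I.card = n - m),
      if (F ∩ stdCone v I).Nonempty then
        X.weight F *
          (cellLattice F ⊔
            Submodule.span ℤ (stdDir n '' (I : Set (Option (Fin n))))).toAddSubgroup.index
      else 0

/-- `X` has degree `d`: its intersection number with a generic standard fan tropical linear space
of complementary dimension is `d`. Generic means: for all apices in a dense open set. -/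
def TropicalVariety.HasDegree (X : TropicalVariety n m) (d : ℕ) : Prop :=
  ∃ U : Set (Fin n → ℝ), IsOpen U ∧ Dense U ∧
    ∀ v ∈ U, X.MeetsTransversally v ∧ X.intersectionNumber v = d

/-- A tropical plane is a tropical surface of degree one. -/
def IsTropicalPlane (L : TropicalVariety n 2) : Prop := L.HasDegree 1

/-! ### Tropical curves -/

/-- An integer vector with coprime coordinates. -/
def IsPrimitiveVector (u : Fin n → ℤ) : Prop := Finset.univ.gcd u = 1

/-- `e` is an unbounded edge of `C` and the primitive integer vector `u` directs it towards
infinity. (A ray has one such vector, a whole line has two.) -/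
def TropicalVariety.IsEnd (C : TropicalCurve n) (e : Set (Fin n → ℝ)) (u : Fin n → ℤ) : Prop :=
  e ∈ C.cells ∧ cellDim e = 1 ∧ IsPrimitiveVector u ∧
    ∀ x ∈ e, ∀ t : ℝ, 0 ≤ t → x + t • toReal u ∈ e

/-- The degree `∑ w_e max {0, u_{e,1}, …, u_{e,n}}` of a tropical curve, the sum being over the
unbounded edges `e`, directed towards infinity by the primitive integer vector `u_e`. -/
def TropicalVariety.curveDegree (C : TropicalCurve n) : ℕ :=
  ∑ᶠ p ∈ {p : Set (Fin n → ℝ) × (Fin n → ℤ) | C.IsEnd p.1 p.2},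
    C.weight p.1 * Finset.univ.sup (fun j => (p.2 j).toNat)

/-- A one-dimensional weighted fan, given by the weight of the ray in each primitive integer
direction (zero if there is no such ray; the value at vectors that are not primitive is zero). -/
abbrev FanCurve (n : ℕ) := (Fin n → ℤ) → ℕ

open Classical in
/-- The recession fan `lim_{t → 0} t • C`: the unbounded edges of `C` in direction `u` become one
ray in direction `u`, and their weights add up. -/
def TropicalVariety.recessionFan (C : TropicalCurve n) : FanCurve n := fun u =>
  ∑ e ∈ C.cells.filter (fun e => C.IsEnd e u), C.weight e

open Classical in
/-- The fan tropical line: a ray of weight one in each of the standard directions. -/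
def fanLine (n : ℕ) : FanCurve n := fun u => if ∃ i, u = stdDir n i then 1 else 0

/-- The vertices of a tropical curve. -/
def TropicalVariety.Vertex (C : TropicalCurve n) : Type := {v : Fin n → ℝ // {v} ∈ C.cells}

instance (C : TropicalCurve n) : Finite C.Vertex :=
  Finite.of_injective (β := {σ : Set (Fin n → ℝ) // σ ∈ C.cells}) (fun v => ⟨{v.1}, v.2⟩) (by
    intro v w h
    exact Subtype.ext (Set.singleton_injective (congrArg Subtype.val h)))

instance (C : TropicalCurve n) : Fintype C.Vertex := Fintype.ofFinite _

/-- Two vertices are adjacent if the segment between them is a (bounded) edge. -/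
def TropicalVariety.Adj (C : TropicalCurve n) (v w : C.Vertex) : Prop :=
  v ≠ w ∧ segment ℝ v.1 w.1 ∈ C.cells

/-- The cellular `1`-chains with coefficients in `K`: a chain assigns to each oriented bounded edge
`(v, w)` a coefficient that changes sign with the orientation. The rays are left out, since they
retract onto their vertices (and a line without a vertex is contractible). -/
def TropicalVariety.chainsOne (C : TropicalCurve n) (K : Type*) [Field K] :
    Submodule K (C.Vertex → C.Vertex → K) where
  carrier := {f | (∀ v w, f w v = -f v w) ∧ ∀ v w, ¬ C.Adj v w → f v w = 0}
  add_mem' := by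
    rintro f g ⟨hf, hf'⟩ ⟨hg, hg'⟩
    refine ⟨fun v w => ?_, fun v w h => ?_⟩
    · simp only [Pi.add_apply, hf v w, hg v w]; ring
    · simp only [Pi.add_apply, hf' v w h, hg' v w h, add_zero]
  zero_mem' := by simp
  smul_mem' := by
    rintro c f ⟨hf, hf'⟩
    refine ⟨fun v w => ?_, fun v w h => ?_⟩
    · simp only [Pi.smul_apply, hf v w, smul_neg]
    · simp only [Pi.smul_apply, hf' v w h, smul_zero]

/-- The cellular boundary map from `1`-chains to `0`-chains: the coefficient of `∂f` at a vertex
`v` is the sum of the coefficients of `f` on the edges oriented towards `v`. -/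
def TropicalVariety.boundary (C : TropicalCurve n) (K : Type*) [Field K] :
    C.chainsOne K →ₗ[K] (C.Vertex → K) where
  toFun f := fun v => ∑ w, f.1 w v
  map_add' f g := by
    ext v; simp [Finset.sum_add_distrib]
  map_smul' c f := by
    ext v; simp [Finset.mul_sum]

/-- The genus of a tropical curve: its first Betti number, the dimension over `K` of the first
homology group. As there are no cells of dimension two, this group is the kernel of `∂`. -/
def TropicalVariety.genus (C : TropicalCurve n) (K : Type*) [Field K] : ℕ :=
  Module.finrank K (LinearMap.ker (C.boundary K))

/-! ### Intersections of tropical curves in a tropical surface -/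

/-- `p` is a (tropically) transverse intersection point of the curves `C` and `D` in the surface
`L`: near `p`, the sets `L`, `C` and `D` are a plane and two lines in it, both curves have weight
one at `p`, and primitive integer directions of the two lines form a basis of the lattice of integer
vectors in the plane. -/
def IsTransverseAt (L : TropicalVariety n 2) (C D : TropicalCurve n) (p : Fin n → ℝ) : Prop :=
  ∃ u v : Fin n → ℤ,
    LinearIndependent ℝ ![toReal u, toReal v] ∧
    (∀ w : Fin n → ℤ, toReal w ∈ Submodule.span ℝ {toReal u, toReal v} →
      w ∈ Submodule.span ℤ {u, v}) ∧
    (∀ᶠ x in 𝓝 p, x ∈ L.support ↔ x - p ∈ Submodule.span ℝ {toReal u, toReal v}) ∧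
    (∀ᶠ x in 𝓝 p, x ∈ C.support ↔ x - p ∈ Submodule.span ℝ {toReal u}) ∧
    (∀ᶠ x in 𝓝 p, x ∈ D.support ↔ x - p ∈ Submodule.span ℝ {toReal v}) ∧
    (∀ e ∈ C.cells, cellDim e = 1 → p ∈ e → C.weight e = 1) ∧
    (∀ e ∈ D.cells, cellDim e = 1 → p ∈ e → D.weight e = 1)

/-- A closed bounded segment, not reduced to a point. -/
def IsSegment (S : Set (Fin n → ℝ)) : Prop := ∃ a b, a ≠ b ∧ S = segment ℝ a b

end TropGeo

end

open TropGeo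

open scoped Topology

noncomputable section

namespace TropGeo

/-! ### The polyhedral complex of a maximum of affine functions -/

/-! The plane comes from a valuated matroid `p` of rank three on the `n + 1` indices `none, some 0,
…`, where `none` carries the homogeneous coordinate 0. It consists of the points `x` at which the
triples `B` maximizing `p B - ∑_{e ∈ B} x_e` cover all indices. These triples are the bases of a
loop-free matroid, and all geometry is read off from it. Facets are the cells whose matroid has
three parallel classes. Around a cell of dimension one the matroid has a rank one part `A`, the
facets correspond to the parallel classes outside `A`, and their normals are the class sums of the
standard directions, so the total is parallel to the cell. For a generic apex `v` the plane meets
the complementary linear space in one point: a common point forces the complement of the cone's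
index set to be the unique triple that is optimal at `v` (`isTropicalPlane_planeVariety`).

The matroid used here is uniform, valued by the spread of a triple, that is the largest minus the
smallest position in the chain `none < some 0 < some 1 < ⋯` (`isValuated_spread`). For each interior
position `j + 1` the triples with middle element `j + 1` tie on a two-dimensional region. Thus the
plane contains `k` planar regions with lattice-preserving charts (`isSplit_chart`). Consecutive
regions meet in one point (`chart_eq_chart`), and the vertical line leaving one region through that
point continues as the horizontal line of the next one (`emb_down`).

In each region lies a plane curve dual to a subdivision of the triangle with vertices (0,0), (d,0),
(0,d). A side facing a neighbouring region is left undivided, so that a single ray of weight `d`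
leaves the region through the common point; there it is joined to the corresponding ray of the
neighbour. Apart from the origin and the corners of undivided sides, the lattice points carry a
convex quadratic height, which makes the inner part a honeycomb. The triangles next to an undivided
side form a fan with apex the origin, called the frame below. Regularity of such a subdivision makes
its dual graph a tropical curve (`planar_isRegular`, `LabelledGraph.IsRegular.isTropical`), and
gluing preserves this (`glue_isTropical`). The glued graph is connected and trivalent, so its genus
follows from the numbers of vertices and rays (`two_mul_genus`): each piece has `d²` triangles,
minus `d - 1` for every undivided side.

Two rates control the intersection of the curves of degrees `d` and `e = d - 1`. The honeycomb
shrinks so fast with the degree that the honeycomb of degree `d` sits inside one cell of the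
complement of the curve of degree `e`. The frame moves outwards with the degree. Hence the weighted
ray of degree `d` is contained in that of degree `e`, which gives the `k - 1` common segments. All
other common points lie on the long horizontal and vertical edges from the honeycomb to the frame,
or to infinity; there the other curve is a family of diagonal rays and one frame edge, all crossed
with determinant ±1 (`Admissible.meets`, `Admissible.exists_crossing`). Charts overlap only in the
gluing points, so the count is a sum over the pieces (`gluedCurve_inter`, `card_crossingIndices`).
-/

/-- A family of affine functions on `ℝⁿ` with integer slopes. -/
structure AffineFamily (n : ℕ) (ι : Type*) where
  slope : ι → Fin n → ℤ
  const : ι → ℝ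

namespace AffineFamily

variable {n : ℕ} {ι : Type*} (f : AffineFamily n ι)

/-- The linear part of a member of the family. -/
def lin (i : ι) : (Fin n → ℝ) →L[ℝ] ℝ :=
  ∑ j, (f.slope i j : ℝ) • ContinuousLinearMap.proj (R := ℝ) (φ := fun _ : Fin n => ℝ) j

theorem lin_apply (i : ι) (x : Fin n → ℝ) : f.lin i x = ∑ j, (f.slope i j : ℝ) * x j := by
  simp [lin]

/-- The value of a member of the family. -/
def val (i : ι) (x : Fin n → ℝ) : ℝ := f.lin i x + f.const i

/-- The members of the family that attain the maximum at `x`. -/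
def maxSet (x : Fin n → ℝ) : Set ι := {i | ∀ j, f.val j x ≤ f.val i x}

/-- The set where all members indexed by `A` attain the maximum. -/
def cell (A : Set ι) : Set (Fin n → ℝ) := {x | A ⊆ f.maxSet x}

/-- The directions along which the members indexed by `A` agree. -/
def eqDir (A : Set ι) : Submodule ℝ (Fin n → ℝ) where
  carrier := {y | ∀ i ∈ A, ∀ j ∈ A, f.lin i y = f.lin j y}
  add_mem' := by
    intro x y hx hy i hi j hj
    rw [map_add, map_add, hx i hi j hj, hy i hi j hj]
  zero_mem' := by intro i _ j _; simp
  smul_mem' := by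
    intro c x hx i hi j hj
    rw [map_smul, map_smul, hx i hi j hj]

theorem mem_eqDir {A : Set ι} {y : Fin n → ℝ} :
    y ∈ f.eqDir A ↔ ∀ i ∈ A, ∀ j ∈ A, f.lin i y = f.lin j y := Iff.rfl

theorem val_add_smul (i : ι) (x y : Fin n → ℝ) (t : ℝ) :
    f.val i (x + t • y) = f.val i x + t * f.lin i y := by
  simp [val]; ring

theorem val_sub_const (i : ι) (x y : Fin n → ℝ) :
    f.lin i (x - y) = f.val i x - f.val i y := by
  simp [val]

theorem val_continuous (i : ι) : Continuous (f.val i) := by unfold val; fun_prop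

theorem mem_maxSet_eq {x : Fin n → ℝ} {i j : ι} (hi : i ∈ f.maxSet x) (hj : j ∈ f.maxSet x) :
    f.val i x = f.val j x := le_antisymm (hj i) (hi j)

theorem mem_maxSet_of_eq {x : Fin n → ℝ} {i j : ι} (hi : i ∈ f.maxSet x)
    (h : f.val j x = f.val i x) : j ∈ f.maxSet x := fun l => h ▸ hi l

theorem mem_cell_maxSet (x : Fin n → ℝ) : x ∈ f.cell (f.maxSet x) :=
  Set.Subset.refl _

theorem isRationalPolyhedron_of_fintype {κ : Type*} [Fintype κ] (a : κ → Fin n → ℤ) (b : κ → ℝ) :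
    IsRationalPolyhedron {x : Fin n → ℝ | ∀ i, ∑ j, (a i j : ℝ) * x j ≤ b i} := by
  refine ⟨Fintype.card κ, fun r => a ((Fintype.equivFin κ).symm r),
    fun r => b ((Fintype.equivFin κ).symm r), ?_⟩
  ext x
  exact ⟨fun h r => h _, fun h i => by simpa using h (Fintype.equivFin κ i)⟩

theorem isRationalPolyhedron_cell [Fintype ι] (A : Set ι) : IsRationalPolyhedron (f.cell A) := by
  classical
  have := isRationalPolyhedron_of_fintype (n := n) (κ := {i // i ∈ A} × ι)
    (fun p => f.slope p.2 - f.slope p.1) (fun p => f.const p.1 - f.const p.2)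
  convert this using 1
  ext x
  have key : ∀ i j, f.val j x ≤ f.val i x ↔
      ∑ l, ((f.slope j - f.slope i) l : ℝ) * x l ≤ f.const i - f.const j := by
    intro i j
    simp only [val, lin_apply, Pi.sub_apply, Int.cast_sub, sub_mul, Finset.sum_sub_distrib]
    constructor <;> intro h <;> linarith
  constructor
  · intro h p
    have := (key p.1 p.2).1 (h p.1.2 p.2)
    simpa using this
  · intro h i hi j
    refine (key i j).2 ?_
    simpa using h (⟨i, hi⟩, j)

theorem convex_cell (A : Set ι) : Convex ℝ (f.cell A) := by
  intro x hx y hy s t hs ht hst i hi j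
  have h1 := mul_le_mul_of_nonneg_left (hx hi j) hs
  have h2 := mul_le_mul_of_nonneg_left (hy hi j) ht
  have h3 : ∀ l, f.val l (s • x + t • y) = s * f.val l x + t * f.val l y := by
    intro l
    simp only [val, map_add, map_smul, smul_eq_mul]
    linear_combination (-f.const l) * hst
  rw [h3, h3]; linarith

/-- Affine values average, and an average of two numbers bounded by the two maxima reaches the
average of the maxima only if both reach it. A member maximal at both ends is needed to know that
the maximum itself averages; `A` provides it. -/
theorem maxSet_midpoint {A : Set ι} (hA : A.Nonempty) {x y : Fin n → ℝ} (hx : x ∈ f.cell A)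
    (hy : y ∈ f.cell A) :
    f.maxSet ((1 / 2 : ℝ) • x + (1 / 2 : ℝ) • y) = f.maxSet x ∩ f.maxSet y := by
  obtain ⟨i₀, hi₀⟩ := hA
  have h3 : ∀ l, f.val l ((1 / 2 : ℝ) • x + (1 / 2 : ℝ) • y) = (f.val l x + f.val l y) / 2 := by
    intro l
    simp only [val, map_add, map_smul, smul_eq_mul]
    ring
  ext i
  constructor
  · intro hi
    have h := hi i₀
    rw [h3, h3] at h
    have h1 := hx hi₀ i
    have h2 := hy hi₀ i
    exact ⟨f.mem_maxSet_of_eq (hx hi₀) (by linarith), f.mem_maxSet_of_eq (hy hi₀) (by linarith)⟩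
  · rintro ⟨h1, h2⟩ j
    rw [h3, h3]
    linarith [h1 j, h2 j]

/-- Near `x`, along `D`, the maximal members are those among the ones maximal at `x` that grow
fastest. -/
theorem eventually_maxSet_add_smul [Finite ι] (x D : Fin n → ℝ) :
    ∀ᶠ ε in 𝓝[>] (0 : ℝ), f.maxSet (x + ε • D) =
      {i | i ∈ f.maxSet x ∧ ∀ j ∈ f.maxSet x, f.lin j D ≤ f.lin i D} := by
  rcases isEmpty_or_nonempty ι with h | h
  · exact Filter.Eventually.of_forall fun ε => by ext i; exact h.elim i
  obtain ⟨i₀, hi₀⟩ : ∃ i, i ∈ f.maxSet x := Finite.exists_max (fun i => f.val i x)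
  have hev : ∀ᶠ ε in 𝓝[>] (0 : ℝ), ∀ i j, i ∈ f.maxSet x → j ∉ f.maxSet x →
      f.val j (x + ε • D) < f.val i (x + ε • D) := by
    rw [Filter.eventually_all]; intro i
    rw [Filter.eventually_all]; intro j
    by_cases hi : i ∈ f.maxSet x
    · by_cases hj : j ∈ f.maxSet x
      · exact Filter.Eventually.of_forall fun ε _ h => absurd hj h
      · have hlt : f.val j x < f.val i x :=
          lt_of_le_of_ne (hi j) fun h => hj (f.mem_maxSet_of_eq hi h)
        have hc : ∀ l, Filter.Tendsto (fun ε : ℝ => f.val l (x + ε • D)) (𝓝[>] 0) (𝓝 (f.val l x)) := by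
          intro l
          have : Continuous fun ε : ℝ => f.val l (x + ε • D) :=
            (f.val_continuous l).comp (by fun_prop)
          have h := this.tendsto 0
          simp only [zero_smul, add_zero] at h
          exact h.mono_left nhdsWithin_le_nhds
        filter_upwards [(hc j).eventually_lt (hc i) hlt] with ε h _ _ using h
    · exact Filter.Eventually.of_forall fun ε h => absurd h hi
  filter_upwards [hev, self_mem_nhdsWithin] with ε hε hpos
  ext i
  constructor
  · intro hi
    have him : i ∈ f.maxSet x := by
      by_contra hn
      exact absurd (hi i₀) (not_le.2 (hε i₀ i hi₀ hn))
    refine ⟨him, fun j hj => ?_⟩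
    have h := hi j
    rw [val_add_smul, val_add_smul, f.mem_maxSet_eq hj him] at h
    exact le_of_mul_le_mul_left (by linarith) hpos
  · rintro ⟨hi, hD⟩ j
    by_cases hj : j ∈ f.maxSet x
    · rw [val_add_smul, val_add_smul, f.mem_maxSet_eq hj hi]
      linarith [mul_le_mul_of_nonneg_left (hD j hj) hpos.le]
    · exact (hε i j hi hj).le

theorem eventually_maxSet_subset [Finite ι] (x : Fin n → ℝ) :
    ∀ᶠ y in 𝓝 x, f.maxSet y ⊆ f.maxSet x := by
  rcases isEmpty_or_nonempty ι with h | h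
  · exact Filter.Eventually.of_forall fun ε i => h.elim i
  obtain ⟨i₀, hi₀⟩ : ∃ i, i ∈ f.maxSet x := Finite.exists_max (fun i => f.val i x)
  have hev : ∀ᶠ y in 𝓝 x, ∀ j, j ∉ f.maxSet x → f.val j y < f.val i₀ y := by
    rw [Filter.eventually_all]; intro j
    by_cases hj : j ∈ f.maxSet x
    · exact Filter.Eventually.of_forall fun ε h => absurd hj h
    · have hlt : f.val j x < f.val i₀ x :=
        lt_of_le_of_ne (hi₀ j) fun h => hj (f.mem_maxSet_of_eq hi₀ h)
      filter_upwards [(f.val_continuous j).continuousAt.eventually_lt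
        (f.val_continuous i₀).continuousAt hlt] with y h _ using h
  filter_upwards [hev] with y hy i hi
  by_contra hn
  exact absurd (hi i₀) (not_le.2 (hy i hn))

/-- A member of `cell (maxSet x)` can be reflected slightly through `x`. -/
theorem exists_reflect_mem [Finite ι] {A : Set ι} {x y : Fin n → ℝ} (hA : A ⊆ f.maxSet x)
    (hy : y ∈ f.eqDir (f.maxSet x)) : ∃ ε : ℝ, 0 < ε ∧ x + ε • y ∈ f.cell A := by
  have h := f.eventually_maxSet_add_smul x y
  obtain ⟨ε, hε, hpos⟩ := (h.and self_mem_nhdsWithin).exists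
  refine ⟨ε, hpos, fun i hi => ?_⟩
  rw [hε]
  exact ⟨hA hi, fun j hj => (hy j hj i (hA hi)).le⟩

theorem sub_mem_eqDir {A : Set ι} {x y : Fin n → ℝ} (hx : x ∈ f.cell A) (hy : y ∈ f.cell A) :
    y - x ∈ f.eqDir A := by
  intro i hi j hj
  rw [val_sub_const, val_sub_const, f.mem_maxSet_eq (hx hi) (hx hj),
    f.mem_maxSet_eq (hy hi) (hy hj)]

/-- Every nonempty exposed face of a cell is the cell of the maximal set of one of its points. -/
theorem exists_face_eq_cell [Finite ι] {A : Set ι} (hA : A.Nonempty) {τ : Set (Fin n → ℝ)}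
    (hτ : τ.Nonempty) (hexp : IsExposed ℝ (f.cell A) τ) :
    ∃ x ∈ τ, τ = f.cell (f.maxSet x) := by
  have hconv : Convex ℝ τ := hexp.convex (f.convex_cell A)
  have hsub := hexp.subset
  obtain ⟨l, hl⟩ := hexp hτ
  -- A point with the fewest maximal members is a relative interior point of the face: by the
  -- midpoint formula no other point of `τ` can lose one of them.
  obtain ⟨x, hx, hmin⟩ : ∃ x ∈ τ, ∀ y ∈ τ, (f.maxSet x).ncard ≤ (f.maxSet y).ncard := by
    obtain ⟨x, hx, h⟩ := (measure (fun x => (f.maxSet x).ncard)).wf.has_min τ hτ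
    exact ⟨x, hx, fun y hy => not_lt.1 (h y hy)⟩
  refine ⟨x, hx, Set.Subset.antisymm (fun y hy => ?_) (fun y hy => ?_)⟩
  · have hz : (1 / 2 : ℝ) • x + (1 / 2 : ℝ) • y ∈ τ :=
      hconv hx hy (by norm_num) (by norm_num) (by norm_num)
    have h1 := hmin _ hz
    rw [f.maxSet_midpoint hA (hsub hx) (hsub hy)] at h1
    have h2 : f.maxSet x ∩ f.maxSet y = f.maxSet x :=
      Set.eq_of_subset_of_ncard_le Set.inter_subset_left h1
    exact Set.inter_eq_left.1 h2
  · have hAx : A ⊆ f.maxSet x := hsub hx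
    -- The segment from `y` can be prolonged beyond `x` inside the cell. The exposing functional is
    -- largest at `x`, so it cannot be smaller at `y`.
    have hd : x - y ∈ f.eqDir (f.maxSet x) := f.sub_mem_eqDir hy (f.mem_cell_maxSet x)
    obtain ⟨ε, hε, hmem⟩ := f.exists_reflect_mem hAx hd
    have hxm : ∀ z ∈ f.cell A, l z ≤ l x := by rw [hl] at hx; exact hx.2
    have h1 := hxm _ hmem
    rw [map_add, map_smul, map_sub, smul_eq_mul] at h1
    have h2 : l x ≤ l y := by
      by_contra hcon
      push Not at hcon
      have := mul_pos hε (sub_pos.2 hcon)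
      linarith
    rw [hl]
    exact ⟨hAx.trans hy, fun z hz => (hxm z hz).trans h2⟩

/-- A cell is an exposed face of itself. This is why every cell may be indexed by the maximal set of
one of its own points. -/
theorem exists_relint [Finite ι] {A : Set ι} (hA : A.Nonempty) (h : (f.cell A).Nonempty) :
    ∃ x ∈ f.cell A, f.cell A = f.cell (f.maxSet x) :=
  f.exists_face_eq_cell hA h (IsExposed.refl _)

/-- A point is relatively interior to the cell of its own maximal set, so a small step in any
direction along which the maximal members agree stays in the cell. -/
theorem vectorSpan_cell [Finite ι] (x : Fin n → ℝ) :
    vectorSpan ℝ (f.cell (f.maxSet x)) = f.eqDir (f.maxSet x) := by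
  apply le_antisymm
  · rw [vectorSpan_def, Submodule.span_le]
    rintro _ ⟨y, hy, z, hz, rfl⟩
    exact f.sub_mem_eqDir hz hy
  · intro y hy
    obtain ⟨ε, hε, hmem⟩ := f.exists_reflect_mem subset_rfl hy
    have h := vsub_mem_vectorSpan ℝ hmem (f.mem_cell_maxSet x)
    have h2 : (x + ε • y) -ᵥ x = ε • y := by simp
    rw [h2] at h
    exact (Submodule.smul_mem_iff _ hε.ne').1 h

/-- Fix `i₀` in `A`. On the cell of `A` the differences of values against `i₀` are nonpositive, and
those with index in `B` vanish together exactly on the cell of `B`. The sum of their linear parts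
therefore exposes the intersection, which is nonempty by the definition of exposed. -/
theorem cell_inter_isExposed [Finite ι] {A : Set ι} (hA : A.Nonempty) (B : Set ι) :
    IsExposed ℝ (f.cell A) (f.cell A ∩ f.cell B) := by
  classical
  rintro ⟨x, hxA, hxB⟩
  obtain ⟨i₀, hi₀⟩ := hA
  have := Fintype.ofFinite ι
  refine ⟨∑ i ∈ Finset.univ.filter (· ∈ B), (f.lin i - f.lin i₀), ?_⟩
  have hval : ∀ y, (∑ i ∈ Finset.univ.filter (· ∈ B), (f.lin i - f.lin i₀)) y =
      ∑ i ∈ Finset.univ.filter (· ∈ B), (f.val i y - f.val i₀ y) -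
        ∑ i ∈ Finset.univ.filter (· ∈ B), (f.const i - f.const i₀) := by
    intro y
    rw [← Finset.sum_sub_distrib, sum_apply]
    refine Finset.sum_congr rfl fun i _ => ?_
    simp only [sub_apply, val]; ring
  have hzero : ∑ i ∈ Finset.univ.filter (· ∈ B), (f.val i x - f.val i₀ x) = 0 :=
    Finset.sum_eq_zero fun i hi => sub_eq_zero.2
      (f.mem_maxSet_eq (hxB (by simpa using hi)) (hxA hi₀))
  have hnonpos : ∀ y ∈ f.cell A, ∀ i ∈ Finset.univ.filter (· ∈ B), f.val i y - f.val i₀ y ≤ 0 :=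
    fun y hy i _ => sub_nonpos.2 (hy hi₀ i)
  ext y
  constructor
  · rintro ⟨hyA, hyB⟩
    refine ⟨hyA, fun z hz => ?_⟩
    rw [hval, hval]
    have h0 : ∑ i ∈ Finset.univ.filter (· ∈ B), (f.val i y - f.val i₀ y) = 0 :=
      Finset.sum_eq_zero fun i hi => sub_eq_zero.2
        (f.mem_maxSet_eq (hyB (by simpa using hi)) (hyA hi₀))
    have := Finset.sum_nonpos (hnonpos z hz)
    linarith
  · rintro ⟨hyA, hy⟩
    refine ⟨hyA, fun i hi => ?_⟩
    have h := hy x hxA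
    rw [hval, hval, hzero] at h
    have h0 : ∑ i ∈ Finset.univ.filter (· ∈ B), (f.val i y - f.val i₀ y) = 0 :=
      le_antisymm (Finset.sum_nonpos (hnonpos y hyA)) (by linarith)
    have h1 := (Finset.sum_eq_zero_iff_of_nonpos (hnonpos y hyA)).1 h0 i (by simpa using hi)
    exact f.mem_maxSet_of_eq (hyA hi₀) (by linarith)

/-- The complex of the nonempty cells indexed by an upward closed family of nonempty sets. -/
def complex [Fintype ι] (𝓐 : Set (Set ι)) (hne : ∀ A ∈ 𝓐, A.Nonempty)
    (hup : ∀ A ∈ 𝓐, ∀ B, A ⊆ B → B ∈ 𝓐) : PolyhedralComplex n where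
  cells := ((Set.toFinite {A : Set ι | A ∈ 𝓐 ∧ (f.cell A).Nonempty}).image f.cell).toFinset
  nonempty := by
    intro σ hσ
    obtain ⟨A, ⟨-, h⟩, rfl⟩ := (Set.Finite.mem_toFinset _).1 hσ
    exact h
  polyhedron := by
    intro σ hσ
    obtain ⟨A, -, rfl⟩ := (Set.Finite.mem_toFinset _).1 hσ
    exact f.isRationalPolyhedron_cell A
  face_mem := by
    intro σ hσ τ hτ hexp
    obtain ⟨A, ⟨hA, -⟩, rfl⟩ := (Set.Finite.mem_toFinset _).1 hσ
    obtain ⟨x, hx, hxτ⟩ := f.exists_face_eq_cell (hne A hA) hτ hexp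
    rw [Set.Finite.mem_toFinset]
    exact ⟨f.maxSet x, ⟨hup A hA _ (hexp.subset hx), hxτ ▸ hτ⟩, hxτ.symm⟩
  inter_face := by
    intro σ hσ τ hτ _
    obtain ⟨A, ⟨hA, -⟩, rfl⟩ := (Set.Finite.mem_toFinset _).1 hσ
    obtain ⟨B, -, rfl⟩ := (Set.Finite.mem_toFinset _).1 hτ
    exact f.cell_inter_isExposed (hne A hA) B

theorem mem_complex_cells [Fintype ι] {𝓐 : Set (Set ι)} {hne : ∀ A ∈ 𝓐, A.Nonempty}
    {hup : ∀ A ∈ 𝓐, ∀ B, A ⊆ B → B ∈ 𝓐} {σ : Set (Fin n → ℝ)} :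
    σ ∈ (f.complex 𝓐 hne hup).cells ↔ ∃ x, f.maxSet x ∈ 𝓐 ∧ σ = f.cell (f.maxSet x) := by
  change σ ∈ ((Set.toFinite _).image f.cell).toFinset ↔ _
  rw [Set.Finite.mem_toFinset]
  constructor
  · rintro ⟨A, ⟨hA, h⟩, rfl⟩
    obtain ⟨x, hx, hxA⟩ := f.exists_relint (hne A hA) h
    exact ⟨x, hup A hA _ hx, hxA⟩
  · rintro ⟨x, hx, rfl⟩
    exact ⟨_, ⟨hx, x, f.mem_cell_maxSet x⟩, rfl⟩

end AffineFamily

end TropGeo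

namespace TropGeo

/-! ### Bases of a matroid of rank three without loops -/

section Bases

variable {E : Type*} [DecidableEq E]

/-- Replace the element `x` of `B` by `y`. -/
def swap (B : Finset E) (x y : E) : Finset E := insert y (B.erase x)

theorem mem_swap {B : Finset E} {x y e : E} : e ∈ swap B x y ↔ e = y ∨ (e ≠ x ∧ e ∈ B) := by
  simp [swap]

theorem card_swap {B : Finset E} {x y : E} (hx : x ∈ B) (hy : y ∉ B) :
    (swap B x y).card = B.card := by
  have : 0 < B.card := Finset.card_pos.2 ⟨x, hx⟩
  rw [swap, Finset.card_insert_of_notMem (by simp [hy]), Finset.card_erase_of_mem hx]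
  omega

theorem swap_self {B : Finset E} {x : E} (hx : x ∈ B) : swap B x x = B := by
  simp [swap, Finset.insert_erase hx]

theorem sum_swap {M : Type*} [AddCommGroup M] {B : Finset E} {x y : E} (hx : x ∈ B) (hy : y ∉ B)
    (Y : E → M) : ∑ e ∈ swap B x y, Y e = ∑ e ∈ B, Y e - Y x + Y y := by
  rw [swap, Finset.sum_insert (by simp [hy]), ← Finset.add_sum_erase B Y hx]
  abel

theorem sum_swap_eq {M : Type*} [AddCommGroup M] {B : Finset E} {x y : E} (hx : x ∈ B) {Y : E → M}
    (hy : y ∉ B ∨ y = x) (h : ∑ e ∈ swap B x y, Y e = ∑ e ∈ B, Y e) : Y y = Y x := by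
  rcases hy with hy | rfl
  · rw [sum_swap hx hy] at h
    have : Y y - Y x = 0 := by grind
    exact sub_eq_zero.1 this
  · rfl

theorem card_swap_sdiff_lt {B J : Finset E} {x y : E} (hx : x ∈ B) (hxJ : x ∉ J) (hy : y ∈ J) :
    (swap B x y \ J).card < (B \ J).card := by
  apply Finset.card_lt_card
  refine ⟨fun e he => ?_, fun h => ?_⟩
  · rw [Finset.mem_sdiff, mem_swap] at he
    grind
  · have := h (Finset.mem_sdiff.2 ⟨hx, hxJ⟩)
    rw [Finset.mem_sdiff, mem_swap] at this
    grind

/-- The symmetric exchange property of a function on `3`-subsets: a valuated matroid of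
rank three. -/
def IsValuated (p : Finset E → ℝ) : Prop :=
  ∀ B B' : Finset E, B.card = 3 → B'.card = 3 → ∀ x ∈ B, x ∉ B' →
    ∃ y ∈ B', y ∉ B ∧ p B + p B' ≤ p (swap B x y) + p (swap B' y x)

theorem IsValuated.sub_sum {p : Finset E → ℝ} (hp : IsValuated p) (Y : E → ℝ) :
    IsValuated fun B => p B - ∑ e ∈ B, Y e := by
  intro B B' hB hB' x hx hx'
  obtain ⟨y, hy, hy', h⟩ := hp B B' hB hB' x hx hx'
  refine ⟨y, hy, hy', ?_⟩
  simp only [sum_swap hx hy', sum_swap hy hx']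
  linarith

/-- Local optimality implies global optimality. -/
theorem IsValuated.le_of_swap_le {p : Finset E → ℝ} (hp : IsValuated p) {J : Finset E}
    (hJ : J.card = 3) (h : ∀ j ∈ J, ∀ e ∉ J, p (swap J j e) ≤ p J) :
    ∀ B : Finset E, B.card = 3 → p B ≤ p J := by
  suffices ∀ m, ∀ B : Finset E, B.card = 3 → (B \ J).card = m → p B ≤ p J from
    fun B hB => this _ B hB rfl
  intro m
  induction m using Nat.strong_induction_on with
  | _ m ih =>
    intro B hB hm
    by_cases hBJ : B ⊆ J
    · rw [Finset.eq_of_subset_of_card_le hBJ (by omega)]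
    · obtain ⟨x, hx, hxJ⟩ := Finset.not_subset.1 hBJ
      -- The exchange inequality trades `p B + p J` for a neighbour of `J`, which is at most `p J`
      -- by local optimality, and a set one step closer to `J`, which is at most `p J` by induction.
      obtain ⟨y, hy, hyB, hle⟩ := hp B J hB hJ x hx hxJ
      have h1 := h y hy x hxJ
      have h2 := ih _ (hm ▸ card_swap_sdiff_lt hx hxJ hy) (swap B x y)
        (by rw [card_swap hx hyB, hB]) rfl
      linarith

/-- The bases of a matroid of rank three without loops. -/
structure IsBases (M : Set (Finset E)) : Prop where
  card : ∀ B ∈ M, B.card = 3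
  exch : ∀ B ∈ M, ∀ B' ∈ M, ∀ x ∈ B, x ∉ B' → ∃ y ∈ B', y ∉ B ∧ swap B x y ∈ M ∧ swap B' y x ∈ M
  cover : ∀ e, ∃ B ∈ M, e ∈ B

namespace IsBases

variable {M : Set (Finset E)} (hM : IsBases M)
include hM

/-- Each symmetric exchange moves `B` one element closer to `J`. The induction step also receives
the partner basis `swap J y x`, which ties the incoming element to the outgoing one through `J`
alone. -/
theorem exchange_induction {J : Finset E} (hJ : J ∈ M) {P : Finset E → Prop} (hPJ : P J)
    (step : ∀ B ∈ M, ∀ x ∈ B, x ∉ J → ∀ y ∈ J, y ∉ B → swap B x y ∈ M → swap J y x ∈ M →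
      P (swap B x y) → P B) : ∀ B ∈ M, P B := by
  suffices ∀ m, ∀ B ∈ M, (B \ J).card = m → P B from fun B hB => this _ B hB rfl
  intro m
  induction m using Nat.strong_induction_on with
  | _ m ih =>
    intro B hB hm
    by_cases hBJ : B ⊆ J
    · rwa [Finset.eq_of_subset_of_card_le hBJ (by rw [hM.card B hB, hM.card J hJ])]
    · obtain ⟨x, hx, hxJ⟩ := Finset.not_subset.1 hBJ
      obtain ⟨y, hy, hyB, h1, h2⟩ := hM.exch B hB J hJ x hx hxJ
      exact step B hB x hx hxJ y hy hyB h1 h2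
        (ih _ (hm ▸ card_swap_sdiff_lt hx hxJ hy) _ h1 rfl)

/-- The absence of loops enters here: `e` lies in some basis, and exchanging it out of that basis
against `J` puts it into `J`. -/
theorem exists_swap_mem {J : Finset E} (hJ : J ∈ M) (e : E) : ∃ j ∈ J, swap J j e ∈ M := by
  by_cases he : e ∈ J
  · exact ⟨e, he, by rwa [swap_self he]⟩
  · obtain ⟨B, hB, heB⟩ := hM.cover e
    obtain ⟨y, hy, -, -, h⟩ := hM.exch B hB J hJ e heB he
    exact ⟨y, hy, h⟩

theorem eq_of_swap_mem {J : Finset E} (hJ : J ∈ M) {e j : E} (he : e ∈ J) (hj : j ∈ J)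
    (h : swap J j e ∈ M) : j = e := by
  by_contra hne
  have h1 : swap J j e = J.erase j := by
    rw [swap, Finset.insert_eq_self.2]
    exact Finset.mem_erase.2 ⟨fun h => hne h.symm, he⟩
  have h2 := hM.card _ h
  rw [h1, Finset.card_erase_of_mem hj, hM.card J hJ] at h2
  omega

end IsBases

/-- The bases in `M` are transversals of a partition into three classes; the class of `e` is
represented by `c e ∈ S`. -/
structure IsSplit (M : Set (Finset E)) (S : Finset E) (c : E → E) : Prop where
  card : S.card = 3
  mem : ∀ e, c e ∈ S
  self : ∀ s ∈ S, c s = s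
  swap_mem : ∀ e, swap S (c e) e ∈ M
  sum_eq : ∀ B ∈ M, ∀ Y : E → ℝ, (∀ e, Y e = Y (c e)) → ∑ e ∈ B, Y e = ∑ e ∈ S, Y e

theorem IsSplit.base_mem {M : Set (Finset E)} {S : Finset E} {c : E → E} (h : IsSplit M S c) :
    S ∈ M := by
  obtain ⟨s, hs⟩ : S.Nonempty := Finset.card_pos.1 (by rw [h.card]; norm_num)
  have := h.swap_mem s
  rwa [h.self s hs, swap_self hs] at this

/-- The left side describes the directions parallel to the cell. For a split matroid they are the
functions constant on three classes, which makes the cell two-dimensional. -/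
theorem IsSplit.const_iff {M : Set (Finset E)} {S : Finset E} {c : E → E} (h : IsSplit M S c)
    (Y : E → ℝ) :
    (∀ B ∈ M, ∀ B' ∈ M, ∑ e ∈ B, Y e = ∑ e ∈ B', Y e) ↔ ∀ e, Y e = Y (c e) := by
  constructor
  · intro hY e
    refine sum_swap_eq (h.mem e) ?_ (hY _ (h.swap_mem e) _ h.base_mem)
    by_cases he : e ∈ S
    · exact Or.inr (h.self e he).symm
    · exact Or.inl he
  · intro hY B hB B' hB'
    rw [h.sum_eq B hB Y hY, h.sum_eq B' hB' Y hY]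

/-- The class representatives are determined by single exchanges. -/
theorem IsBases.isSplit_of_unique {M : Set (Finset E)} (hM : IsBases M) {S : Finset E} (hS : S ∈ M)
    {c : E → E} (hc : ∀ e, c e ∈ S) (hcM : ∀ e, swap S (c e) e ∈ M)
    (huniq : ∀ e, ∀ s ∈ S, swap S s e ∈ M → s = c e) : IsSplit M S c where
  card := hM.card S hS
  mem := hc
  self := fun s hs => (huniq s s hs (by rwa [swap_self hs])).symm
  swap_mem := hcM
  sum_eq := by
    intro B hB Y hY
    refine hM.exchange_induction hS (P := fun B => ∑ e ∈ B, Y e = ∑ e ∈ S, Y e) rfl ?_ B hB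
    -- Since `swap S y x` is a basis, uniqueness gives `y = c x`. The exchange replaces an element
    -- by its class representative and does not change the sum.
    intro B _ x hx hxS y hy hyB _ h2 ih
    rw [sum_swap hx hyB] at ih
    grind

/-- Three elements no two of which can be exchanged for each other split the matroid. -/
theorem IsBases.exists_isSplit {M : Set (Finset E)} (hM : IsBases M) {S : Finset E}
    (hS : 3 ≤ S.card) (hexch : ∀ s ∈ S, ∀ s' ∈ S, ∀ B ∈ M, s ∈ B → s' ∉ B → swap B s s' ∉ M) :
    ∃ c, IsSplit M S c := by
  have hSM : S ∈ M := by
    obtain ⟨s₀, hs₀⟩ : S.Nonempty := Finset.card_pos.1 (by omega)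
    obtain ⟨B₀, hB₀, -⟩ := hM.cover s₀
    -- A basis containing as much of `S` as possible contains all of it: a missing element can be
    -- exchanged in, and by hypothesis the element that leaves is not in `S`.
    obtain ⟨B, hB, hmax⟩ : ∃ B ∈ M, ∀ B' ∈ M, (S \ B).card ≤ (S \ B').card := by
      obtain ⟨x, hx, h⟩ := (measure (fun B => (S \ B).card)).wf.has_min M ⟨B₀, hB₀⟩
      exact ⟨x, hx, fun y hy => not_lt.1 (h y hy)⟩
    have hsub : S ⊆ B := by
      by_contra hns
      obtain ⟨s, hs, hsB⟩ := Finset.not_subset.1 hns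
      obtain ⟨y, hy, h⟩ := hM.exists_swap_mem hB s
      by_cases hyS : y ∈ S
      · exact hexch y hyS s hs B hB hy hsB h
      · have h1 := hmax _ h
        have h2 : (S \ swap B y s).card < (S \ B).card := by
          apply Finset.card_lt_card
          refine ⟨fun e he => ?_, fun h => ?_⟩
          · rw [Finset.mem_sdiff, mem_swap] at he
            grind
          · have := h (Finset.mem_sdiff.2 ⟨hs, hsB⟩)
            rw [Finset.mem_sdiff, mem_swap] at this
            exact this.2 (Or.inl rfl)
        omega
    rwa [Finset.eq_of_subset_of_card_le hsub (by rw [hM.card B hB]; exact hS)]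
  choose c hc hcM using fun e => hM.exists_swap_mem hSM e
  refine ⟨c, hM.isSplit_of_unique hSM hc hcM fun e s hs h => ?_⟩
  by_cases he : e ∈ S
  · rw [hM.eq_of_swap_mem hSM he hs h, hM.eq_of_swap_mem hSM he (hc e) (hcM e)]
  by_contra hne
  -- If `e` could replace both `s` and `c e`, the two resulting bases would differ by exchanging `c
  -- e` for `s`, which is excluded.
  refine hexch (c e) (hc e) s hs (swap S s e) h ?_ ?_ ?_
  · exact mem_swap.2 (Or.inr ⟨fun h => hne h.symm, hc e⟩)
  · rw [mem_swap]
    grind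
  · convert hcM e using 1
    ext z
    simp only [mem_swap]
    grind

end Bases

end TropGeo

namespace TropGeo

/-! ### Homogeneous coordinates -/

section Homogeneous

variable {n : ℕ}

/-- The coordinates of a point of `ℝⁿ`, together with the coordinate `0` indexed by `none`. -/
def hom (x : Fin n → ℝ) : Option (Fin n) → ℝ := fun e => e.elim 0 x

@[simp] theorem hom_none (x : Fin n → ℝ) : hom x none = 0 := rfl
@[simp] theorem hom_some (x : Fin n → ℝ) (i : Fin n) : hom x (some i) = x i := rfl

theorem hom_add (x y : Fin n → ℝ) (e : Option (Fin n)) : hom (x + y) e = hom x e + hom y e := by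
  cases e <;> simp
theorem hom_sub (x y : Fin n → ℝ) (e : Option (Fin n)) : hom (x - y) e = hom x e - hom y e := by
  cases e <;> simp
theorem hom_smul (c : ℝ) (y : Fin n → ℝ) (e : Option (Fin n)) : hom (c • y) e = c * hom y e := by
  cases e <;> simp
theorem hom_sum {ι : Type*} (s : Finset ι) (y : ι → Fin n → ℝ) (e : Option (Fin n)) :
    hom (∑ i ∈ s, y i) e = ∑ i ∈ s, hom (y i) e := by
  cases e <;> simp

theorem hom_injective : Function.Injective (hom (n := n)) := fun x y h => by
  ext i; exact congrFun h (some i)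

/-- The point of `ℝⁿ` with given homogeneous coordinates. -/
def dehom (D : Option (Fin n) → ℝ) : Fin n → ℝ := fun i => D (some i) - D none

theorem hom_dehom (D : Option (Fin n) → ℝ) (e : Option (Fin n)) :
    hom (dehom D) e = D e - D none := by
  cases e <;> simp [dehom]

/-- Up to a common additive constant, every standard direction lowers one homogeneous coordinate by
1; the vector (1, …, 1) is the one that lowers `none`. This makes all indices play the same role
below. -/
theorem hom_stdDir (i e : Option (Fin n)) :
    hom (toReal (stdDir n i)) e = (if i = none then 1 else 0) - if e = i then 1 else 0 := by
  cases i <;> cases e <;> simp [toReal, stdDir, Pi.single_apply]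

theorem toReal_add (u v : Fin n → ℤ) : toReal (u + v) = toReal u + toReal v := by
  ext i; simp [toReal]
theorem toReal_sub (u v : Fin n → ℤ) : toReal (u - v) = toReal u - toReal v := by
  ext i; simp [toReal]
theorem toReal_smul (c : ℤ) (v : Fin n → ℤ) : toReal (c • v) = (c : ℝ) • toReal v := by
  ext i; simp [toReal]
theorem toReal_sum {ι : Type*} (s : Finset ι) (u : ι → Fin n → ℤ) :
    toReal (∑ i ∈ s, u i) = ∑ i ∈ s, toReal (u i) := by
  ext i; simp [toReal]
theorem toReal_injective : Function.Injective (toReal (n := n)) := fun u v h => by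
  ext i; have := congrFun h i; simpa [toReal] using this

theorem hom_sum_stdDir (s : Finset (Option (Fin n))) (e : Option (Fin n)) :
    hom (toReal (∑ i ∈ s, stdDir n i)) e =
      (if none ∈ s then 1 else 0) - if e ∈ s then 1 else 0 := by
  rw [toReal_sum, hom_sum]
  simp only [hom_stdDir, Finset.sum_sub_distrib]
  congr 1 <;> simp [Finset.sum_ite_eq', Finset.sum_ite_eq]

theorem exists_int_hom (w : Fin n → ℤ) (e : Option (Fin n)) : ∃ m : ℤ, hom (toReal w) e = m := by
  cases e
  · exact ⟨0, by simp⟩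
  · exact ⟨_, rfl⟩

end Homogeneous

/-! ### Tropical planes from valuated matroids of rank three -/

section Plane

variable {n : ℕ}

/-- The index set of bases. -/
abbrev Triple (n : ℕ) := {B : Finset (Option (Fin n)) // B.card = 3}

open Classical in
/-- The affine functions `p(B) - ∑_{e ∈ B} x_e`. -/
def planeFamily (p : Finset (Option (Fin n)) → ℝ) : AffineFamily n (Triple n) where
  slope B j := -if some j ∈ B.1 then 1 else 0
  const B := p B.1

variable (p : Finset (Option (Fin n)) → ℝ)

theorem planeFamily_lin (B : Triple n) (y : Fin n → ℝ) :
    (planeFamily p).lin B y = -∑ e ∈ B.1, hom y e := by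
  rw [AffineFamily.lin_apply]
  have h : ∑ e ∈ B.1, hom y e = ∑ e, if e ∈ B.1 then hom y e else 0 := by
    rw [Finset.sum_ite_mem]; simp
  rw [h, Fintype.sum_option, hom_none, ite_self, zero_add, ← Finset.sum_neg_distrib]
  refine Finset.sum_congr rfl fun j _ => ?_
  simp only [planeFamily, hom_some]
  split_ifs <;> simp

theorem planeFamily_val (B : Triple n) (y : Fin n → ℝ) :
    (planeFamily p).val B y = p B.1 - ∑ e ∈ B.1, hom y e := by
  rw [AffineFamily.val, planeFamily_lin]
  simp only [planeFamily]; ring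

/-- The bases of the initial matroid at `x`. -/
def bases (x : Fin n → ℝ) : Set (Finset (Option (Fin n))) :=
  Subtype.val '' (planeFamily p).maxSet x

theorem mem_bases {x : Fin n → ℝ} {B : Finset (Option (Fin n))} :
    B ∈ bases p x ↔ B.card = 3 ∧ ∀ B' : Finset (Option (Fin n)), B'.card = 3 →
      p B' - ∑ e ∈ B', hom x e ≤ p B - ∑ e ∈ B, hom x e := by
  constructor
  · rintro ⟨⟨B, hB⟩, h, rfl⟩
    refine ⟨hB, fun B' hB' => ?_⟩
    simpa only [planeFamily_val] using h ⟨B', hB'⟩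
  · rintro ⟨hB, h⟩
    refine ⟨⟨B, hB⟩, fun B' => ?_, rfl⟩
    rw [planeFamily_val, planeFamily_val]
    exact h _ B'.2

theorem mem_bases_of_eq {x : Fin n → ℝ} {B B' : Finset (Option (Fin n))} (h : B ∈ bases p x)
    (hB' : B'.card = 3) (hle : p B - ∑ e ∈ B, hom x e ≤ p B' - ∑ e ∈ B', hom x e) :
    B' ∈ bases p x := by
  rw [mem_bases] at h ⊢
  exact ⟨hB', fun B'' hB'' => (h.2 B'' hB'').trans hle⟩

theorem bases_subset_iff {x y : Fin n → ℝ} :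
    bases p x ⊆ bases p y ↔ (planeFamily p).maxSet x ⊆ (planeFamily p).maxSet y :=
  Set.image_subset_image_iff Subtype.val_injective

theorem bases_eq_iff {x y : Fin n → ℝ} :
    bases p x = bases p y ↔ (planeFamily p).maxSet x = (planeFamily p).maxSet y :=
  Set.image_eq_image Subtype.val_injective

/-- The index sets of the cells of the plane. -/
def IsCover (A : Set (Triple n)) : Prop := ∀ e, ∃ B ∈ A, e ∈ B.1

/-- The polyhedral complex of the plane. -/
def planeComplex : PolyhedralComplex n :=
  (planeFamily p).complex {A | IsCover A}
    (fun _ hA => (hA none).imp fun _ h => h.1)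
    (fun _ hA _ hB e => (hA e).imp fun _ h => ⟨hB h.1, h.2⟩)

/-- The cell with `x` in its relative interior. -/
def planeCell (x : Fin n → ℝ) : Set (Fin n → ℝ) := (planeFamily p).cell ((planeFamily p).maxSet x)

theorem mem_planeCell {x y : Fin n → ℝ} : y ∈ planeCell p x ↔ bases p x ⊆ bases p y :=
  (bases_subset_iff p).symm

theorem self_mem_planeCell (x : Fin n → ℝ) : x ∈ planeCell p x := (mem_planeCell p).2 subset_rfl

theorem planeCell_eq_iff {x y : Fin n → ℝ} : planeCell p x = planeCell p y ↔ bases p x = bases p y := by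
  constructor
  · intro h
    apply Set.Subset.antisymm
    · exact (mem_planeCell p).1 (h ▸ self_mem_planeCell p y)
    · exact (mem_planeCell p).1 (h ▸ self_mem_planeCell p x)
  · intro h
    rw [planeCell, planeCell, (bases_eq_iff p).1 h]

/-- `x` lies on the plane. -/
def OnPlane (x : Fin n → ℝ) : Prop := ∀ e, ∃ B ∈ bases p x, e ∈ B

theorem onPlane_iff {x : Fin n → ℝ} : OnPlane p x ↔ IsCover ((planeFamily p).maxSet x) := by
  simp [OnPlane, IsCover, bases]

theorem mem_planeComplex_cells {σ : Set (Fin n → ℝ)} :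
    σ ∈ (planeComplex p).cells ↔ ∃ x, OnPlane p x ∧ σ = planeCell p x := by
  simp only [onPlane_iff]
  exact (planeFamily p).mem_complex_cells

theorem mem_support_planeComplex {x : Fin n → ℝ} :
    (∃ σ ∈ (planeComplex p).cells, x ∈ σ) ↔ OnPlane p x := by
  constructor
  · rintro ⟨σ, hσ, hx⟩
    obtain ⟨y, hy, rfl⟩ := (mem_planeComplex_cells p).1 hσ
    exact fun e => (hy e).imp fun B h => ⟨(mem_planeCell p).1 hx h.1, h.2⟩
  · intro h
    exact ⟨_, (mem_planeComplex_cells p).2 ⟨x, h, rfl⟩, self_mem_planeCell p x⟩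

/-- The coordinates enter with a minus sign, so among the bases at `x` those of least `D`-weight
survive a small move along `D`. -/
theorem bases_add_smul (x D : Fin n → ℝ) : ∀ᶠ ε in 𝓝[>] (0 : ℝ), bases p (x + ε • D) =
    {B | B ∈ bases p x ∧ ∀ B' ∈ bases p x, ∑ e ∈ B, hom D e ≤ ∑ e ∈ B', hom D e} := by
  filter_upwards [(planeFamily p).eventually_maxSet_add_smul x D] with ε h
  ext B
  rw [bases, h]
  constructor
  · rintro ⟨B, ⟨h1, h2⟩, rfl⟩
    refine ⟨⟨B, h1, rfl⟩, ?_⟩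
    rintro _ ⟨B', hB', rfl⟩
    have := h2 B' hB'
    rw [planeFamily_lin, planeFamily_lin] at this
    linarith
  · rintro ⟨⟨B, h1, rfl⟩, h2⟩
    refine ⟨B, ⟨h1, fun B' hB' => ?_⟩, rfl⟩
    rw [planeFamily_lin, planeFamily_lin]
    linarith [h2 B'.1 ⟨B', hB', rfl⟩]

theorem eventually_bases_subset (x : Fin n → ℝ) : ∀ᶠ y in 𝓝 x, bases p y ⊆ bases p x := by
  filter_upwards [(planeFamily p).eventually_maxSet_subset x] with y h
  exact (bases_subset_iff p).2 h

theorem mem_vectorSpan_planeCell {x y : Fin n → ℝ} : y ∈ vectorSpan ℝ (planeCell p x) ↔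
    ∀ B ∈ bases p x, ∀ B' ∈ bases p x, ∑ e ∈ B, hom y e = ∑ e ∈ B', hom y e := by
  rw [planeCell, AffineFamily.vectorSpan_cell, AffineFamily.mem_eqDir]
  constructor
  · rintro h _ ⟨B, hB, rfl⟩ _ ⟨B', hB', rfl⟩
    have := h B hB B' hB'
    rwa [planeFamily_lin, planeFamily_lin, neg_inj] at this
  · intro h B hB B' hB'
    rw [planeFamily_lin, planeFamily_lin, neg_inj]
    exact h _ ⟨B, hB, rfl⟩ _ ⟨B', hB', rfl⟩

variable {p}

/-- Subtracting a linear function keeps the exchange inequality. When both sets on its left are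
maximal, both on its right must be maximal as well. -/
theorem isBases_of_onPlane (hp : IsValuated p) {x : Fin n → ℝ} (hx : OnPlane p x) :
    IsBases (bases p x) where
  card := fun B hB => ((mem_bases p).1 hB).1
  cover := hx
  exch := by
    intro B hB B' hB' x hx hx'
    have h1 := (mem_bases p).1 hB
    have h2 := (mem_bases p).1 hB'
    obtain ⟨y, hy, hy', h⟩ := hp.sub_sum (hom _) B B' h1.1 h2.1 x hx hx'
    have c1 := (card_swap hx hy').trans h1.1
    have c2 := (card_swap hy hx').trans h2.1
    have h4 := h2.2 _ c2
    have h5 := h2.2 _ c1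
    have h6 := h1.2 _ h2.1
    exact ⟨y, hy, hy', mem_bases_of_eq p hB c1 (by linarith),
      mem_bases_of_eq p hB' c2 (by linarith)⟩

section Split

variable {x : Fin n → ℝ} {S : Finset (Option (Fin n))} {c : Option (Fin n) → Option (Fin n)}

theorem IsSplit.mem_vectorSpan (h : IsSplit (bases p x) S c) {y : Fin n → ℝ} :
    y ∈ vectorSpan ℝ (planeCell p x) ↔ ∀ e, hom y e = hom y (c e) := by
  rw [mem_vectorSpan_planeCell, h.const_iff]

/-- A direction of the cell has three values, one for each class, and the class of `none` has value
0; the remaining two are free. -/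
theorem IsSplit.cellDim_eq (h : IsSplit (bases p x) S c) : cellDim (planeCell p x) = 2 := by
  set s₀ := c none with hs₀
  have hcard : (S.erase s₀).card = 2 := by rw [Finset.card_erase_of_mem (h.mem _), h.card]
  let φ : vectorSpan ℝ (planeCell p x) →ₗ[ℝ] ({s // s ∈ S.erase s₀} → ℝ) :=
    { toFun := fun y s => hom y.1 s.1
      map_add' := by intro y z; ext s; simp [hom_add]
      map_smul' := by intro r y; ext s; simp [hom_smul] }
  have hφ : Function.Bijective φ := by
    constructor
    · rw [← LinearMap.ker_eq_bot, LinearMap.ker_eq_bot']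
      rintro ⟨y, hy⟩ h0
      have hy' := h.mem_vectorSpan.1 hy
      ext i
      change y i = 0
      rw [← hom_some y i, hy']
      by_cases hc : c (some i) = s₀
      · rw [hc, hs₀, ← hy']; rfl
      · exact congrFun h0 ⟨_, Finset.mem_erase.2 ⟨hc, h.mem _⟩⟩
    · intro g
      let D : Option (Fin n) → ℝ := fun e =>
        if he : c e ∈ S.erase s₀ then g ⟨c e, he⟩ else 0
      have hD0 : D none = 0 := by simp [D, hs₀]
      refine ⟨⟨dehom D, h.mem_vectorSpan.2 fun e => ?_⟩, ?_⟩
      · rw [hom_dehom, hom_dehom]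
        have : c (c e) = c e := h.self _ (h.mem e)
        simp [D, this]
      · ext ⟨s, hs⟩
        change hom (dehom D) s = _
        have : c s = s := h.self _ (Finset.mem_of_mem_erase hs)
        rw [hom_dehom, hD0, sub_zero]
        simp only [D, this, hs, dif_pos]
  have := (LinearEquiv.ofBijective φ hφ).finrank_eq
  rw [cellDim, this, Module.finrank_fintype_fun_eq_card, Fintype.card_coe, hcard]

theorem IsSplit.onPlane (h : IsSplit (bases p x) S c) : OnPlane p x := fun e =>
  ⟨_, h.swap_mem e, mem_swap.2 (Or.inl rfl)⟩

end Split

/-- Every point of the plane lies in a cell whose bases split. -/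
theorem exists_isSplit_superset (hp : IsValuated p) {x : Fin n → ℝ} (hx : OnPlane p x) :
    ∃ x' S c, bases p x' ⊆ bases p x ∧ IsSplit (bases p x') S c := by
  classical
  have hM := isBases_of_onPlane hp hx
  obtain ⟨J, hJ, -⟩ := hx none
  -- An injective weight breaks all ties. Each `e` is assigned to the heaviest element of `J` that
  -- it can replace, and `D` is the weight of that element.
  let δ : Option (Fin n) → ℝ := fun e => ((Fintype.equivFin _ e : ℕ) : ℝ)
  have hδ : Function.Injective δ := fun a b h => by
    simpa [δ, Fin.val_inj] using h
  let N : Option (Fin n) → Finset (Option (Fin n)) := fun e => J.filter fun j => swap J j e ∈ bases p x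
  have hN : ∀ e, (N e).Nonempty := fun e => by
    obtain ⟨j, hj, h⟩ := hM.exists_swap_mem hJ e
    exact ⟨j, Finset.mem_filter.2 ⟨hj, h⟩⟩
  choose c hcN hcmax using fun e => (N e).exists_max_image δ (hN e)
  have hcJ : ∀ e, c e ∈ J := fun e => (Finset.mem_filter.1 (hcN e)).1
  have hcM : ∀ e, swap J (c e) e ∈ bases p x := fun e => (Finset.mem_filter.1 (hcN e)).2
  have hself : ∀ s ∈ J, c s = s := fun s hs => hM.eq_of_swap_mem hJ hs (hcJ s) (hcM s)
  let D : Option (Fin n) → ℝ := fun e => δ (c e)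
  have hsum : ∀ B ∈ bases p x, ∑ e ∈ B, hom (dehom D) e = ∑ e ∈ B, D e - 3 * D none := by
    intro B hB
    simp only [hom_dehom, Finset.sum_sub_distrib, Finset.sum_const, hM.card B hB]
    simp
  have hmin : ∀ B ∈ bases p x, ∑ e ∈ J, D e ≤ ∑ e ∈ B, D e := by
    refine hM.exchange_induction hJ (P := fun B => ∑ e ∈ J, D e ≤ ∑ e ∈ B, D e) le_rfl ?_
    -- Here `y` is one of the elements of `J` that `x` can replace, so its weight is at most `D x`.
    -- Hence moving towards `J` never increases the `D`-weight.
    intro B _ x hx hxJ y hy hyB _ h2 ih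
    rw [sum_swap hx hyB] at ih
    have : D y ≤ D x := by grind
    linarith
  -- A small move along `D` keeps exactly the bases of the same `D`-weight as `J`. Then `e` can
  -- replace `s ∈ J` only if `δ s = δ (c e)`, so only if `s = c e`.
  obtain ⟨ε, hε, -⟩ := ((bases_add_smul p x (dehom D)).and self_mem_nhdsWithin).exists
  set x' := x + ε • dehom D
  have hmem : ∀ B, B ∈ bases p x' ↔ B ∈ bases p x ∧ ∑ e ∈ B, D e = ∑ e ∈ J, D e := by grind
  have hswap : ∀ e j, j ∈ J → swap J j e ∈ bases p x → (swap J j e ∈ bases p x' ↔ D e = D j) := by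
    intro e j hj hs
    rw [hmem]
    by_cases he : e ∈ J
    · have := hM.eq_of_swap_mem hJ he hj hs
      subst this
      simp [swap_self hj, hJ]
    · rw [sum_swap hj he]
      grind
  have hcM' : ∀ e, swap J (c e) e ∈ bases p x' := fun e => by grind
  have hsub : bases p x' ⊆ bases p x := fun B hB => ((hmem B).1 hB).1
  have hJ' : J ∈ bases p x' := (hmem J).2 ⟨hJ, rfl⟩
  have hx' : OnPlane p x' := fun e => ⟨_, hcM' e, mem_swap.2 (Or.inl rfl)⟩
  refine ⟨x', J, c, hsub, (isBases_of_onPlane hp hx').isSplit_of_unique hJ' hcJ hcM' ?_⟩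
  intro e s hs h
  have := (hswap e s hs (hsub h)).1 h
  simp only [D, hself s hs] at this
  exact (hδ this).symm

/-- The plane has pure dimension two. -/
theorem planeComplex_pure (hp : IsValuated p) :
    ∀ σ ∈ (planeComplex p).cells, ∃ F ∈ (planeComplex p).cells, σ ⊆ F ∧ cellDim F = 2 := by
  intro σ hσ
  obtain ⟨x, hx, rfl⟩ := (mem_planeComplex_cells p).1 hσ
  obtain ⟨x', S, c, hsub, h⟩ := exists_isSplit_superset hp hx
  refine ⟨_, (mem_planeComplex_cells p).2 ⟨x', h.onPlane, rfl⟩, fun y hy => ?_, h.cellDim_eq⟩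
  rw [mem_planeCell] at hy ⊢
  exact hsub.trans hy

end Plane

end TropGeo

namespace TropGeo

/-! ### Matroids with a rank one part: the combinatorics around cells of codimension one -/

section Balancing

variable {n : ℕ} {p : Finset (Option (Fin n)) → ℝ}

theorem vectorSpan_planeCell_mono {x y : Fin n → ℝ} (h : bases p y ⊆ bases p x) :
    vectorSpan ℝ (planeCell p x) ≤ vectorSpan ℝ (planeCell p y) := by
  intro z hz
  rw [mem_vectorSpan_planeCell] at hz ⊢
  exact fun B hB B' hB' => hz B (h hB) B' (h hB')

/-- A cell of dimension one comes from a matroid with a connected component of rank one. -/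
theorem exists_rank_one_part (hp : IsValuated p) {x : Fin n → ℝ} (hx : OnPlane p x)
    (hdim : cellDim (planeCell p x) = 1) :
    ∃ A : Finset (Option (Fin n)),
      ∀ B ∈ bases p x, ∑ e ∈ B, (if e ∈ A then (1 : ℝ) else 0) = 1 := by
  have hM := isBases_of_onPlane hp hx
  have hpos : 0 < Module.finrank ℝ (vectorSpan ℝ (planeCell p x)) := by rw [cellDim] at hdim; omega
  obtain ⟨⟨y, hy⟩, hy0⟩ := Module.finrank_pos_iff_exists_ne_zero.1 hpos
  have hy0 : y ≠ 0 := fun h => hy0 (Subtype.ext h)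
  rw [mem_vectorSpan_planeCell] at hy
  obtain ⟨J, hJ, -⟩ := hx none
  have hval : ∀ e, ∀ j ∈ J, swap J j e ∈ bases p x → hom y e = hom y j := by
    intro e j hj h
    refine sum_swap_eq hj ?_ (hy _ h _ hJ)
    by_cases he : e ∈ J
    · exact Or.inr (hM.eq_of_swap_mem hJ he hj h).symm
    · exact Or.inl he
  choose c hcJ hcM using fun e => hM.exists_swap_mem hJ e
  have hyc : ∀ e, hom y e = hom y (c e) := fun e => hval e _ (hcJ e) (hcM e)
  -- A nonzero direction `y` of the cell takes only the values it has on `J`. If these were three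
  -- different values, the matroid would split and the cell would have dimension two.
  by_cases hinj : ∀ s ∈ J, ∀ t ∈ J, hom y s = hom y t → s = t
  · have hsplit := hM.isSplit_of_unique hJ hcJ hcM fun e s hs h =>
      hinj s hs _ (hcJ e) (by rw [← hval e s hs h, hyc e])
    have := hsplit.cellDim_eq
    omega
  · push Not at hinj
    obtain ⟨b, hb, b', hb', hbb, hne⟩ := hinj
    obtain ⟨a, ha⟩ : ((J.erase b).erase b').Nonempty := by
      rw [← Finset.card_pos, Finset.card_erase_of_mem (Finset.mem_erase.2 ⟨hne.symm, hb'⟩),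
        Finset.card_erase_of_mem hb, hM.card J hJ]
      norm_num
    have hab' : a ≠ b' := (Finset.mem_erase.1 ha).1
    have hab : a ≠ b := (Finset.mem_erase.1 (Finset.mem_erase.1 ha).2).1
    have haJ : a ∈ J := (Finset.mem_erase.1 (Finset.mem_erase.1 ha).2).2
    have hJeq : J = {a, b, b'} := by
      symm
      apply Finset.eq_of_subset_of_card_le
      · intro e he
        simp only [Finset.mem_insert, Finset.mem_singleton] at he
        rcases he with rfl | rfl | rfl <;> assumption
      · rw [hM.card J hJ, Finset.card_eq_three.2 ⟨a, b, b', hab, hab', hne, rfl⟩]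
    have hJv : ∀ e, hom y e = hom y a ∨ hom y e = hom y b := by
      intro e
      have := hcJ e
      rw [hJeq] at this
      simp only [Finset.mem_insert, Finset.mem_singleton] at this
      grind
    have hne' : hom y a ≠ hom y b := by
      intro h
      apply hy0
      apply hom_injective
      ext e
      have h0 : ∀ e, hom y e = hom y b := fun e => by
        rcases hJv e with h' | h' <;> simp [h', h]
      rw [h0 e, ← h0 none]
      cases e <;> simp
    -- Two elements of `J` share a value and the third, `a`, differs. The indicator of the level set
    -- of `a` is an affine function of `y`, hence has constant sum over bases, and this sum is 1 on
    -- `J`.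
    refine ⟨Finset.univ.filter fun e => hom y e = hom y a, fun B hB => ?_⟩
    have hind : ∀ e, (if e ∈ Finset.univ.filter (fun e => hom y e = hom y a) then (1 : ℝ) else 0) =
        (hom y e - hom y b) / (hom y a - hom y b) := by
      grind
    simp only [hind]
    rw [← Finset.sum_div, Finset.sum_sub_distrib, hy B hB J hJ, Finset.sum_const, hM.card B hB, hJeq,
      Finset.sum_insert (by simp [hab, hab']), Finset.sum_insert (by simp [hne]),
      Finset.sum_singleton, ← hbb, div_eq_one_iff_eq (sub_ne_zero.2 hne')]
    ring

section RankOnePart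

variable {M : Set (Finset (Option (Fin n)))} (hM : IsBases M) {A : Finset (Option (Fin n))}
  (hA : ∀ B ∈ M, ∑ e ∈ B, (if e ∈ A then (1 : ℝ) else 0) = 1)

include hM hA

theorem mem_part_iff_of_swap {B : Finset (Option (Fin n))} (hB : B ∈ M) {j e : Option (Fin n)}
    (hj : j ∈ B) (h : swap B j e ∈ M) : e ∈ A ↔ j ∈ A := by
  have h1 : e ∉ B ∨ e = j := by
    by_cases he : e ∈ B
    · exact Or.inr (hM.eq_of_swap_mem hB he hj h).symm
    · exact Or.inl he
  have h2 := sum_swap_eq hj (Y := fun e => if e ∈ A then (1 : ℝ) else 0) h1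
  by_cases he : e ∈ A <;> by_cases hj : j ∈ A <;> simp_all

/-- A basis has one element in `A` and two outside. -/
theorem exists_eq_triple {B : Finset (Option (Fin n))} (hB : B ∈ M) :
    ∃ a b c, a ∈ A ∧ b ∉ A ∧ c ∉ A ∧ b ≠ c ∧ B = {a, b, c} := by
  have h := hA B hB
  rw [Finset.sum_boole] at h
  have h1 : (B.filter (· ∈ A)).card = 1 := by exact_mod_cast h
  have h2 : (B.filter (¬ · ∈ A)).card = 2 := by
    have := Finset.card_filter_add_card_filter_not (s := B) (· ∈ A)
    rw [hM.card B hB] at this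
    omega
  obtain ⟨a, ha⟩ := Finset.card_eq_one.1 h1
  obtain ⟨b, c, hbc, hbc'⟩ := Finset.card_eq_two.1 h2
  have ha' : a ∈ B.filter (· ∈ A) := ha ▸ Finset.mem_singleton_self a
  have hb' : b ∈ B.filter (¬ · ∈ A) := hbc' ▸ by simp
  have hc' : c ∈ B.filter (¬ · ∈ A) := hbc' ▸ by simp
  grind

theorem eq_triple_of_mem {B : Finset (Option (Fin n))} (hB : B ∈ M) {e : Option (Fin n)}
    (he : e ∈ B) (heA : e ∉ A) : ∃ a g, a ∈ A ∧ g ∉ A ∧ g ≠ e ∧ B = {a, e, g} := by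
  obtain ⟨a, b, c, ha, hb, hc, hbc, rfl⟩ := exists_eq_triple hM hA hB
  grind

omit hM hA in
/-- Two elements outside the rank one part that lie in no common basis. -/
def Parallel (M : Set (Finset (Option (Fin n)))) (e f : Option (Fin n)) : Prop :=
  ∀ B ∈ M, e ∈ B → f ∈ B → e = f

omit hM hA in
theorem Parallel.symm {e f : Option (Fin n)} (h : Parallel M e f) : Parallel M f e :=
  fun B hB he hf => (h B hB hf he).symm

-- Bring `f` into a basis that contains `e` and `g`. At most one of the two is removed, so `f`
-- shares a basis with the other and must be equal to it.
omit hA in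
theorem Parallel.trans' {e f g : Option (Fin n)} (h : Parallel M e f) (h' : Parallel M f g) :
    Parallel M e g := by
  intro B hB he hg
  by_contra hne
  obtain ⟨j, hj, hs⟩ := hM.exists_swap_mem hB f
  have hf : f ∈ swap B j f := mem_swap.2 (Or.inl rfl)
  by_cases hje : e = j
  · have := h' _ hs hf (mem_swap.2 (Or.inr ⟨fun h => hne (hje.trans h.symm), hg⟩))
    subst this
    exact hne (h B hB he hg)
  · have := h _ hs (mem_swap.2 (Or.inr ⟨hje, he⟩)) hf
    subst this
    exact hne (h' B hB he hg)

open Classical in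
omit hM hA in
/-- The parallel class of `e` outside `A`. -/
def parClass (M : Set (Finset (Option (Fin n)))) (A : Finset (Option (Fin n)))
    (e : Option (Fin n)) : Finset (Option (Fin n)) :=
  Finset.univ.filter fun f => f ∉ A ∧ Parallel M e f

omit hM hA in
theorem mem_parClass {e f : Option (Fin n)} : f ∈ parClass M A e ↔ f ∉ A ∧ Parallel M e f := by
  simp [parClass]

omit hM hA in
theorem self_mem_parClass {e : Option (Fin n)} (he : e ∉ A) : e ∈ parClass M A e :=
  mem_parClass.2 ⟨he, fun _ _ _ _ => rfl⟩

omit hA in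
theorem eq_of_mem_parClass {e f g : Option (Fin n)} (hf : f ∈ parClass M A e)
    (hg : g ∈ parClass M A e) {B : Finset (Option (Fin n))} (hB : B ∈ M) (hfB : f ∈ B)
    (hgB : g ∈ B) : f = g :=
  Parallel.trans' hM (mem_parClass.1 hf).2.symm (mem_parClass.1 hg).2 B hB hfB hgB

omit hA in
theorem parClass_eq {e f : Option (Fin n)} (h : f ∈ parClass M A e) :
    parClass M A f = parClass M A e := by
  ext g
  rw [mem_parClass, mem_parClass]
  have := (mem_parClass.1 h).2
  exact ⟨fun hg => ⟨hg.1, Parallel.trans' hM this hg.2⟩,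
    fun hg => ⟨hg.1, Parallel.trans' hM this.symm hg.2⟩⟩

/-- The bases that meet a parallel class split. -/
theorem exists_isSplit_parClass {M' : Set (Finset (Option (Fin n)))} {e : Option (Fin n)}
    (he : e ∉ A) (hM' : ∀ B, B ∈ M' ↔ B ∈ M ∧ ∃ f ∈ B, f ∈ parClass M A e) :
    ∃ a g, a ∈ A ∧ g ∉ A ∧ g ∉ parClass M A e ∧
      IsSplit M' {a, e, g} (fun f => if f ∈ A then a else if f ∈ parClass M A e then e else g) := by
  obtain ⟨B, hB, heB⟩ := hM.cover e
  obtain ⟨a, g, ha, hg, hge, rfl⟩ := eq_triple_of_mem hM hA hB heB he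
  have heP : e ∈ parClass M A e := self_mem_parClass he
  have hgP : g ∉ parClass M A e := fun h =>
    hge (eq_of_mem_parClass hM h heP hB (by simp) (by simp))
  have hae : a ≠ e := fun h => he (h ▸ ha)
  have hag : a ≠ g := fun h => hg (h ▸ ha)
  have hcA : ∀ f ∈ A, (if f ∈ A then a else if f ∈ parClass M A e then e else g) = a :=
    fun f hf => by simp [hf]
  have hcP : ∀ f ∈ parClass M A e,
      (if f ∈ A then a else if f ∈ parClass M A e then e else g) = e :=
    fun f hf => by simp [hf, (mem_parClass.1 hf).1]
  have hcR : ∀ f, f ∉ A → f ∉ parClass M A e →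
      (if f ∈ A then a else if f ∈ parClass M A e then e else g) = g :=
    fun f hf hf' => by simp [hf, hf']
  refine ⟨a, g, ha, hg, hgP, ⟨hM.card _ hB, fun f => ?_, fun s hs => ?_, fun f => ?_, ?_⟩⟩
  · grind
  · grind
  · by_cases hf : f ∈ A
    · rw [hcA f hf, hM']
      obtain ⟨j, hj, hs⟩ := hM.exists_swap_mem hB f
      have := (mem_part_iff_of_swap hM hA hB hj hs).1 hf
      simp only [Finset.mem_insert, Finset.mem_singleton] at hj
      rcases hj with rfl | rfl | rfl
      · exact ⟨hs, e, mem_swap.2 (Or.inr ⟨hae.symm, by simp⟩), heP⟩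
      · exact absurd this he
      · exact absurd this hg
    · by_cases hf' : f ∈ parClass M A e
      · rw [hcP f hf', hM']
        refine ⟨?_, f, mem_swap.2 (Or.inl rfl), hf'⟩
        obtain ⟨j, hj, hs⟩ := hM.exists_swap_mem hB f
        have := (mem_part_iff_of_swap hM hA hB hj hs)
        simp only [Finset.mem_insert, Finset.mem_singleton] at hj
        rcases hj with rfl | rfl | rfl
        · exact absurd (this.2 ha) hf
        · exact hs
        · have h1 := eq_of_mem_parClass hM hf' heP hs (mem_swap.2 (Or.inl rfl))
            (mem_swap.2 (Or.inr ⟨hge.symm, by simp⟩))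
          subst h1
          exact absurd hs (fun hs => hge.symm (hM.eq_of_swap_mem hB (by simp) (by simp) hs).symm)
      · rw [hcR f hf hf', hM']
        have hnp : ¬ Parallel M e f := fun h => hf' (mem_parClass.2 ⟨hf, h⟩)
        simp only [Parallel, not_forall] at hnp
        obtain ⟨B', hB', heB', hfB', hef⟩ := hnp
        refine ⟨?_, e, mem_swap.2 (Or.inr ⟨hge.symm, by simp⟩), heP⟩
        by_cases hfg : f ∈ ({a, e, g} : Finset (Option (Fin n)))
        · simp only [Finset.mem_insert, Finset.mem_singleton] at hfg
          rcases hfg with rfl | rfl | rfl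
          · exact absurd ha hf
          · exact absurd rfl hef
          · rwa [swap_self (by simp)]
        -- The element that makes room for `f` is not `e`, which lies in both bases, and not in `A`,
        -- because a swap preserves membership in `A`. So it is `g`.
        · obtain ⟨y, hy, hyB', -, hs⟩ := hM.exch B' hB' _ hB f hfB' hfg
          have := (mem_part_iff_of_swap hM hA hB hy hs)
          grind
  · intro B' hB' Y hY
    obtain ⟨hB'M, f, hfB', hf⟩ := (hM' B').1 hB'
    obtain ⟨a', g', ha', hg', hgf, rfl⟩ := eq_triple_of_mem hM hA hB'M hfB' (mem_parClass.1 hf).1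
    have hfA := (mem_parClass.1 hf).1
    have hgP' : g' ∉ parClass M A e := fun h =>
      hgf (eq_of_mem_parClass hM h hf hB'M (by simp) (by simp))
    grind

/-- A proper set of bases that is the set of minima of a linear function and covers all elements
consists of the bases that meet a parallel class. -/
theorem exists_parClass_of_min {M' : Set (Finset (Option (Fin n)))} (hM'b : IsBases M')
    (D : Option (Fin n) → ℝ)
    (hM' : ∀ B, B ∈ M' ↔ B ∈ M ∧ ∀ B' ∈ M, ∑ e ∈ B, D e ≤ ∑ e ∈ B', D e)
    (hne : M' ≠ M) : ∃ e, e ∉ A ∧ ∀ B, B ∈ M' ↔ B ∈ M ∧ ∃ f ∈ B, f ∈ parClass M A e := by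
  have hsub : ∀ B ∈ M', B ∈ M := fun B hB => ((hM' B).1 hB).1
  have hA' : ∀ B ∈ M', ∑ e ∈ B, (if e ∈ A then (1 : ℝ) else 0) = 1 := fun B hB => hA B (hsub B hB)
  have hsumeq : ∀ B ∈ M', ∀ B' ∈ M', ∑ e ∈ B, D e = ∑ e ∈ B', D e := fun B hB B' hB' =>
    le_antisymm (((hM' B).1 hB).2 B' (hsub B' hB')) (((hM' B').1 hB').2 B (hsub B hB))
  -- Any two elements of `A` can be exchanged within `M'`, where the `D`-sum is constant.
  have hDA : ∀ a ∈ A, ∀ a' ∈ A, D a = D a' := by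
    intro a ha a' ha'
    obtain ⟨B, hB, haB⟩ := hM'b.cover a'
    obtain ⟨j, hj, hs⟩ := hM'b.exists_swap_mem hB a
    have hjA := (mem_part_iff_of_swap hM'b hA' hB hj hs).1 ha
    have hja : j = a' := by
      obtain ⟨a₁, b, c, ha₁, hb, hc, -, rfl⟩ := exists_eq_triple hM'b hA' hB
      grind
    subst hja
    refine sum_swap_eq hj ?_ (hsumeq _ hs _ hB)
    by_cases h : a ∈ B
    · exact Or.inr (hM'b.eq_of_swap_mem hB h hj hs).symm
    · exact Or.inl h
  obtain ⟨B₁, hB₁, -⟩ := hM'b.cover none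
  obtain ⟨a₁, b₁, c₁, ha₁, hb₁, hc₁, -, rfl⟩ := exists_eq_triple hM'b hA' hB₁
  obtain ⟨e, heA, hemin⟩ := (Finset.univ.filter (· ∉ A)).exists_min_image D ⟨b₁, by simpa using hb₁⟩
  have heA : e ∉ A := by simpa using heA
  have hemin : ∀ f, f ∉ A → D e ≤ D f := fun f hf => hemin f (by simpa using hf)
  have hsum3 : ∀ a ∈ A, ∀ b c, b ∉ A → c ∉ A → b ≠ c →
      ∑ f ∈ ({a, b, c} : Finset _), D f = D a₁ + D b + D c := by
    grind
  obtain ⟨B₀, hB₀, heB₀⟩ := hM'b.cover e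
  obtain ⟨a, g, ha, hg, hge, rfl⟩ := eq_triple_of_mem hM'b hA' hB₀ heB₀ heA
  have hB₀min : ∀ B' ∈ M, D a₁ + D e + D g ≤ ∑ f ∈ B', D f := by
    intro B' hB'
    rw [← hsum3 a ha e g heA hg hge.symm]
    exact ((hM' _).1 hB₀).2 B' hB'
  have hM'sum : ∀ B ∈ M', ∑ f ∈ B, D f = D a₁ + D e + D g := by grind
  -- Every `f` outside `A` lies in a minimal basis. Its companion there has the complementary value,
  -- since the sum of the two is always `D e + D g`.
  have hpartner : ∀ f, f ∉ A → ∃ h, h ∉ A ∧ h ≠ f ∧ D f + D h = D e + D g ∧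
      ∃ B ∈ M', f ∈ B ∧ h ∈ B ∧ ∀ z ∈ B, z ∉ A → z = f ∨ z = h := by
    intro f hf
    obtain ⟨B, hB, hfB⟩ := hM'b.cover f
    obtain ⟨a', h, ha', hh, hhf, rfl⟩ := eq_triple_of_mem hM'b hA' hB hfB hf
    refine ⟨h, hh, hhf, ?_, _, hB, by simp, by simp, ?_⟩
    · grind
    · intro z hz hzA
      simp only [Finset.mem_insert, Finset.mem_singleton] at hz
      grind
  -- Equality would make `D` constant outside `A`; then all bases would be minimal and `M'` would
  -- not be proper.
  have hgt : D e < D g := by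
    refine lt_of_le_of_ne (hemin g hg) fun heq => hne ?_
    have hconst : ∀ f, f ∉ A → D f = D e := by
      intro f hf
      obtain ⟨h, hh, -, hsum, -⟩ := hpartner f hf
      linarith [hemin f hf, hemin h hh]
    refine Set.Subset.antisymm hsub fun B hB => (hM' B).2 ⟨hB, fun B' hB' => ?_⟩
    obtain ⟨a₂, b₂, c₂, ha₂, hb₂, hc₂, hbc₂, rfl⟩ := exists_eq_triple hM hA hB
    grind
  -- If `f` had another value, `f` and its partner would both lie strictly above `D e`. Swapping `e`
  -- for one of them would produce a basis below the minimum.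
  have htwo : ∀ f, f ∉ A → D f = D e ∨ D f = D g := by
    intro f hf
    by_contra hcon
    push Not at hcon
    obtain ⟨h, hh, hhf, hsum, B, hB, hfB, hhB, hBfh⟩ := hpartner f hf
    have h1 : D e < D f := lt_of_le_of_ne (hemin f hf) hcon.1.symm
    have h2 : D e < D h := lt_of_le_of_ne (hemin h hh) fun h => hcon.2 (by linarith)
    obtain ⟨j, hj, hs⟩ := hM.exists_swap_mem (hsub B hB) e
    have hjA := (not_congr (mem_part_iff_of_swap hM hA (hsub B hB) hj hs)).1 heA
    have heB : e ∉ B := by grind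
    have h3 := hB₀min _ hs
    rw [sum_swap hj heB, hM'sum B hB] at h3
    rcases hBfh j hj hjA with rfl | rfl <;> linarith
  -- A basis containing two elements of the least value would undercut the minimal sum `D a₁ + D e +
  -- D g`.
  have hpar : ∀ f f', f ∉ A → f' ∉ A → D f = D e → D f' = D e → Parallel M f f' := by
    intro f f' hf hf' hDf hDf' B hB hfB hf'B
    by_contra hff
    obtain ⟨a', h, ha', hh, hhf, rfl⟩ := eq_triple_of_mem hM hA hB hfB hf
    simp only [Finset.mem_insert, Finset.mem_singleton] at hf'B
    rcases hf'B with rfl | rfl | rfl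
    · exact hf' ha'
    · exact hff rfl
    · grind
  have hPiff : ∀ f, f ∈ parClass M A e ↔ f ∉ A ∧ D f = D e := by
    intro f
    rw [mem_parClass]
    refine ⟨fun ⟨hf, hfe⟩ => ⟨hf, (htwo f hf).resolve_right fun hDf => ?_⟩,
      fun ⟨hf, hDf⟩ => ⟨hf, hpar e f heA hf rfl hDf⟩⟩
    obtain ⟨h, hh, hhf, hsum, B, hB, hfB, hhB, -⟩ := hpartner f hf
    have hDh : D h = D e := by linarith
    have := Parallel.trans' hM (hpar h e hh heA hDh rfl) hfe B (hsub B hB) hhB hfB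
    exact hhf this
  refine ⟨e, heA, fun B => ?_⟩
  constructor
  · intro hB
    refine ⟨hsub B hB, ?_⟩
    have hs := hM'sum B hB
    obtain ⟨a₂, b₂, c₂, ha₂, hb₂, hc₂, hbc₂, rfl⟩ := exists_eq_triple hM'b hA' hB
    rw [hsum3 a₂ ha₂ b₂ c₂ hb₂ hc₂ hbc₂] at hs
    rcases htwo b₂ hb₂ with h | h
    · exact ⟨b₂, by simp, (hPiff _).2 ⟨hb₂, h⟩⟩
    · exact ⟨c₂, by simp, (hPiff _).2 ⟨hc₂, by linarith⟩⟩
  · rintro ⟨hB, f, hfB, hf⟩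
    refine (hM' B).2 ⟨hB, fun B' hB' => ?_⟩
    obtain ⟨hfA, hDf⟩ := (hPiff f).1 hf
    obtain ⟨a', h, ha', hh, hhf, rfl⟩ := eq_triple_of_mem hM hA hB hfB hfA
    grind

end RankOnePart

end Balancing

end TropGeo

namespace TropGeo

/-! ### Facets around a cell of codimension one, their normals, and balancing -/

variable {n : ℕ} {p : Finset (Option (Fin n)) → ℝ}

/-- Equal dimension forces the cell of `x` to span the same directions as the larger cell of `y`.
Then `y - x` is a direction along which the bases at `x` remain tied, so all of them are still
maximal at `y`. -/
theorem planeCell_eq_of_mem_of_cellDim {x y : Fin n → ℝ} (hx : x ∈ planeCell p y)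
    (hy : OnPlane p y) (hdim : cellDim (planeCell p x) = cellDim (planeCell p y)) :
    planeCell p y = planeCell p x := by
  have hsub := (mem_planeCell p).1 hx
  have hspan : vectorSpan ℝ (planeCell p x) = vectorSpan ℝ (planeCell p y) :=
    Submodule.eq_of_le_of_finrank_eq (vectorSpan_planeCell_mono hsub) hdim
  refine (planeCell_eq_iff p).2 (Set.Subset.antisymm hsub fun B hB => ?_)
  obtain ⟨B₀, hB₀, -⟩ := hy none
  have hd : y - x ∈ vectorSpan ℝ (planeCell p y) :=
    vsub_mem_vectorSpan ℝ (self_mem_planeCell p y) hx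
  rw [← hspan, mem_vectorSpan_planeCell] at hd
  have h1 := hd B hB B₀ (hsub hB₀)
  simp only [hom_sub, Finset.sum_sub_distrib] at h1
  have h2 := ((mem_bases p).1 hB)
  have h3 := ((mem_bases p).1 (hsub hB₀))
  have h4 := h2.2 _ h3.1
  exact mem_bases_of_eq p hB₀ h2.1 (by linarith)

/-- The facets around a cell of codimension one correspond to the parallel classes. -/
theorem exists_parClass_of_facet (hp : IsValuated p) {x y : Fin n → ℝ} (hx : OnPlane p x)
    (hy : OnPlane p y) {A : Finset (Option (Fin n))}
    (hA : ∀ B ∈ bases p x, ∑ e ∈ B, (if e ∈ A then (1 : ℝ) else 0) = 1)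
    (hsub : bases p y ⊆ bases p x) (hne : bases p y ≠ bases p x) :
    ∃ e, e ∉ A ∧ ∀ B, B ∈ bases p y ↔ B ∈ bases p x ∧ ∃ f ∈ B, f ∈ parClass (bases p x) A e := by
  refine exists_parClass_of_min (isBases_of_onPlane hp hx) hA (isBases_of_onPlane hp hy)
    (hom (y - x)) (fun B => ?_) hne
  obtain ⟨B₀, hB₀, -⟩ := hy none
  -- All bases at `x` tie there, so those that survive at `y` are the ones minimizing the weight `y
  -- - x`, which is the situation of `exists_parClass_of_min`.
  have hval : ∀ B ∈ bases p x, ∀ B' ∈ bases p x,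
      p B - ∑ e ∈ B, hom x e = p B' - ∑ e ∈ B', hom x e := fun B hB B' hB' => by
    rw [mem_bases] at hB hB'
    exact le_antisymm (hB'.2 _ hB.1) (hB.2 _ hB'.1)
  simp only [hom_sub, Finset.sum_sub_distrib]
  constructor
  · intro hB
    refine ⟨hsub hB, fun B' hB' => ?_⟩
    have h1 := ((mem_bases p).1 hB).2 B' ((mem_bases p).1 hB').1
    have h2 := hval B (hsub hB) B' hB'
    linarith
  · rintro ⟨hB, h⟩
    have h1 := h B₀ (hsub hB₀)
    have h2 := hval B hB B₀ (hsub hB₀)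
    exact mem_bases_of_eq p hB₀ ((mem_bases p).1 hB).1 (by linarith)

theorem sum_hom_sum_stdDir {B P : Finset (Option (Fin n))} (hB : B.card = 3) :
    ∑ e ∈ B, hom (toReal (∑ i ∈ P, stdDir n i)) e =
      3 * (if none ∈ P then 1 else 0) - ((B.filter (· ∈ P)).card : ℝ) := by
  simp only [hom_sum_stdDir, Finset.sum_sub_distrib, Finset.sum_const, hB, Finset.sum_boole]
  simp

/-- The facet around `x` in the direction of a parallel class. -/
theorem exists_facet_of_parClass (hp : IsValuated p) {x : Fin n → ℝ} (hx : OnPlane p x)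
    {A : Finset (Option (Fin n))} {e : Option (Fin n)}
    (he : e ∉ A) : ∃ ε : ℝ, 0 < ε ∧
      ∀ B, B ∈ bases p (x + ε • toReal (∑ i ∈ parClass (bases p x) A e, stdDir n i)) ↔
        B ∈ bases p x ∧ ∃ f ∈ B, f ∈ parClass (bases p x) A e := by
  have hM := isBases_of_onPlane hp hx
  obtain ⟨ε, hε, hpos⟩ := ((bases_add_smul p x
    (toReal (∑ i ∈ parClass (bases p x) A e, stdDir n i))).and self_mem_nhdsWithin).exists
  refine ⟨ε, hpos, fun B => ?_⟩
  rw [hε]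
  -- A basis contains at most one element of a parallel class. Moving along the class vector lowers
  -- exactly the coordinates of the class, up to a common constant, so the bases that meet the class
  -- win.
  have hle : ∀ B ∈ bases p x, (B.filter (· ∈ parClass (bases p x) A e)).card ≤ 1 := by
    intro B hB
    refine Finset.card_le_one.2 fun f hf g hg => ?_
    rw [Finset.mem_filter] at hf hg
    exact eq_of_mem_parClass hM hf.2 hg.2 hB hf.1 hg.1
  constructor
  · rintro ⟨hB, h⟩
    refine ⟨hB, ?_⟩
    obtain ⟨B', hB', heB'⟩ := hM.cover e
    have h1 := h B' hB'
    rw [sum_hom_sum_stdDir (hM.card B hB), sum_hom_sum_stdDir (hM.card B' hB')] at h1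
    have h2 : 0 < (B'.filter (· ∈ parClass (bases p x) A e)).card :=
      Finset.card_pos.2 ⟨e, Finset.mem_filter.2 ⟨heB', self_mem_parClass he⟩⟩
    have h3 : ((B'.filter (· ∈ parClass (bases p x) A e)).card : ℝ) ≤
      (B.filter (· ∈ parClass (bases p x) A e)).card := by linarith
    have h4 : 0 < (B.filter (· ∈ parClass (bases p x) A e)).card :=
      lt_of_lt_of_le h2 (by exact_mod_cast h3)
    obtain ⟨f, hf⟩ := Finset.card_pos.1 h4
    exact ⟨f, Finset.mem_filter.1 hf⟩
  · rintro ⟨hB, f, hfB, hf⟩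
    refine ⟨hB, fun B' hB' => ?_⟩
    rw [sum_hom_sum_stdDir (hM.card B hB), sum_hom_sum_stdDir (hM.card B' hB')]
    have h1 : 1 ≤ (B.filter (· ∈ parClass (bases p x) A e)).card :=
      Finset.card_pos.2 ⟨f, Finset.mem_filter.2 ⟨hfB, hf⟩⟩
    have h2 : ((B'.filter (· ∈ parClass (bases p x) A e)).card : ℝ) ≤
      (B.filter (· ∈ parClass (bases p x) A e)).card := by
      exact_mod_cast (hle B' hB').trans h1
    linarith

theorem mem_cellLattice {σ : Set (Fin n → ℝ)} {w : Fin n → ℤ} :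
    w ∈ cellLattice σ ↔ toReal w ∈ vectorSpan ℝ σ := Iff.rfl

/-- If the classes were different, any element outside `A` and the class of `e` would share a basis
with `e`; this basis meets the class of `e'`, so the element lies in that class. A basis missing the
class of `e` would then meet that of `e'`, a contradiction. -/
theorem parClass_eq_of_bases_iff (hp : IsValuated p) {x : Fin n → ℝ} (hx : OnPlane p x)
    {A : Finset (Option (Fin n))}
    (hA : ∀ B ∈ bases p x, ∑ e ∈ B, (if e ∈ A then (1 : ℝ) else 0) = 1) {e e' : Option (Fin n)}
    (he : e ∉ A)
    (hne : ∃ B ∈ bases p x, ¬ ∃ f ∈ B, f ∈ parClass (bases p x) A e)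
    (h : ∀ B ∈ bases p x, (∃ f ∈ B, f ∈ parClass (bases p x) A e) ↔
      ∃ f ∈ B, f ∈ parClass (bases p x) A e') :
    parClass (bases p x) A e = parClass (bases p x) A e' := by
  have hM := isBases_of_onPlane hp hx
  by_contra hcon
  have hdisj : ∀ f, f ∈ parClass (bases p x) A e → f ∉ parClass (bases p x) A e' := by
    intro f hf hf'
    exact hcon ((parClass_eq hM hf).symm.trans (parClass_eq hM hf'))
  obtain ⟨B, hB, hBe⟩ := hne
  obtain ⟨a, b, c, ha, hb, hc, hbc, rfl⟩ := exists_eq_triple hM hA hB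
  have key : ∀ f, f ∉ A → f ∉ parClass (bases p x) A e → f ∈ parClass (bases p x) A e' := by
    intro f hf hfe
    have hnp : ¬ Parallel (bases p x) e f := fun h => hfe (mem_parClass.2 ⟨hf, h⟩)
    simp only [Parallel, not_forall] at hnp
    obtain ⟨B', hB', heB', hfB', hef⟩ := hnp
    obtain ⟨z, hz, hzP⟩ := (h B' hB').1 ⟨e, heB', self_mem_parClass he⟩
    obtain ⟨a', g, ha', hg, hge, rfl⟩ := eq_triple_of_mem hM hA hB' heB' he
    have hfg : f = g := by grind
    subst hfg
    simp only [Finset.mem_insert, Finset.mem_singleton] at hz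
    rcases hz with rfl | rfl | rfl
    · exact absurd ha' (mem_parClass.1 hzP).1
    · exact absurd hzP (hdisj _ (self_mem_parClass he))
    · exact hzP
  have hbP := key b hb fun hbP => hBe ⟨b, by simp, hbP⟩
  exact hBe ((h _ hB).2 ⟨b, by simp, hbP⟩)

/-- The vector of a parallel class is a primitive normal of the facet. -/
theorem isPrimitiveNormal_parClass (hp : IsValuated p) {x : Fin n → ℝ} (hx : OnPlane p x)
    {A : Finset (Option (Fin n))}
    (hA : ∀ B ∈ bases p x, ∑ e ∈ B, (if e ∈ A then (1 : ℝ) else 0) = 1) {e : Option (Fin n)}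
    (he : e ∉ A) {ε : ℝ} (hε : 0 < ε)
    (h : ∀ B, B ∈ bases p (x + ε • toReal (∑ i ∈ parClass (bases p x) A e, stdDir n i)) ↔
      B ∈ bases p x ∧ ∃ f ∈ B, f ∈ parClass (bases p x) A e) :
    IsPrimitiveNormal (planeCell p x)
      (planeCell p (x + ε • toReal (∑ i ∈ parClass (bases p x) A e, stdDir n i)))
      (∑ i ∈ parClass (bases p x) A e, stdDir n i) := by
  have hM := isBases_of_onPlane hp hx
  obtain ⟨a, g, ha, hg, hgP, hs⟩ := exists_isSplit_parClass hM hA he h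
  set u := ∑ i ∈ parClass (bases p x) A e, stdDir n i with hu
  have hdisj : ∀ f ∈ parClass (bases p x) A e, f ∉ A := fun f hf => (mem_parClass.1 hf).1
  refine ⟨le_antisymm (fun w hw => ?_) (sup_le (fun w hw => ?_) ?_), x, self_mem_planeCell p x, ε,
    hε, self_mem_planeCell p _⟩
  · obtain ⟨me, hme⟩ := exists_int_hom w e
    obtain ⟨mg, hmg⟩ := exists_int_hom w g
    have hw' := hs.mem_vectorSpan.1 (mem_cellLattice.1 hw)
    -- On the facet `w` has one value on `A`, one on the parallel class and one on the rest. Adding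
    -- `me - mg` times the class vector makes the last two agree, which leaves a direction of the
    -- smaller cell.
    have hsplit : w = (w + (me - mg) • u) + (-(me - mg)) • u := by
      rw [neg_smul, add_neg_cancel_right]
    rw [hsplit]
    refine Submodule.add_mem_sup ?_ (Submodule.smul_mem _ _ (Submodule.mem_span_singleton_self u))
    rw [mem_cellLattice, mem_vectorSpan_planeCell]
    have key : ∀ B ∈ bases p x, ∑ f ∈ B, hom (toReal (w + (me - mg) • u)) f =
        3 * (mg + (me - mg) * (if none ∈ parClass (bases p x) A e then 1 else 0))
          + (hom (toReal w) a - mg) := by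
      intro B hB
      have : ∀ f, hom (toReal (w + (me - mg) • u)) f =
          (mg + (me - mg) * (if none ∈ parClass (bases p x) A e then (1 : ℝ) else 0)) +
            (hom (toReal w) a - mg) * (if f ∈ A then 1 else 0) := by
        intro f
        rw [toReal_add, toReal_smul, hom_add, hom_smul, hu, hom_sum_stdDir, hw' f]
        grind
      simp only [this, Finset.sum_add_distrib, ← Finset.mul_sum, hA B hB, Finset.sum_const,
        hM.card B hB]
      ring
    exact fun B hB B' hB' => (key B hB).trans (key B' hB').symm
  · exact vectorSpan_planeCell_mono (fun B hB => ((h B).1 hB).1) hw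
  · rw [Submodule.span_singleton_le_iff_mem, mem_cellLattice, hs.mem_vectorSpan]
    intro f
    rw [hu, hom_sum_stdDir, hom_sum_stdDir]
    have haP : a ∉ parClass (bases p x) A e := fun h => hdisj a h ha
    by_cases hfA : f ∈ A
    · grind
    · by_cases hfP : f ∈ parClass (bases p x) A e
      · simp [hfA, hfP, self_mem_parClass he]
      · simp [hfA, hfP, hgP]

/-- Up to a constant this vector is the indicator of `A`, which has the same sum over all bases. It
is the total of the normals in the balancing condition. -/
theorem sum_stdDir_mem_vectorSpan (hp : IsValuated p) {x : Fin n → ℝ} (hx : OnPlane p x)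
    {A : Finset (Option (Fin n))}
    (hA : ∀ B ∈ bases p x, ∑ e ∈ B, (if e ∈ A then (1 : ℝ) else 0) = 1) :
    toReal (∑ e with e ∉ A, stdDir n e) ∈ vectorSpan ℝ (planeCell p x) := by
  have hM := isBases_of_onPlane hp hx
  rw [mem_vectorSpan_planeCell]
  have key : ∀ B ∈ bases p x, ∑ f ∈ B, hom (toReal (∑ e with e ∉ A, stdDir n e)) f =
      3 * ((if none ∈ Finset.univ.filter (· ∉ A) then 1 else 0) - 1) + 1 := by
    intro B hB
    have : ∀ f, hom (toReal (∑ e with e ∉ A, stdDir n e)) f =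
        ((if none ∈ Finset.univ.filter (· ∉ A) then 1 else 0) - 1) + if f ∈ A then 1 else 0 := by
      intro f
      rw [hom_sum_stdDir]
      by_cases hf : f ∈ A <;> simp [hf]
    simp only [this, Finset.sum_add_distrib, hA B hB, Finset.sum_const, hM.card B hB]
    simp
  exact fun B hB B' hB' => (key B hB).trans (key B' hB').symm

-- The parallel classes partition the complement of `A` and correspond bijectively to the facets
-- around `τ`. Hence the normals add up to the sum of all standard directions outside `A`, which is
-- parallel to `τ`.
open Classical in
theorem planeComplex_balanced (hp : IsValuated p) (τ : Set (Fin n → ℝ))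
    (hτ : τ ∈ (planeComplex p).cells) (hdim : cellDim τ + 1 = 2) :
    ∃ u : Set (Fin n → ℝ) → (Fin n → ℤ),
      (∀ F ∈ (planeComplex p).cells, cellDim F = 2 → τ ⊆ F → IsPrimitiveNormal τ F (u F)) ∧
      ∑ F ∈ (planeComplex p).cells.filter (fun F => cellDim F = 2 ∧ τ ⊆ F),
        ((1 : ℕ) : ℝ) • toReal (u F) ∈ vectorSpan ℝ τ := by
  obtain ⟨x, hx, rfl⟩ := (mem_planeComplex_cells p).1 hτ
  have hM := isBases_of_onPlane hp hx
  have hdim : cellDim (planeCell p x) = 1 := by omega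
  obtain ⟨A, hA⟩ := exists_rank_one_part hp hx hdim
  have hfac : ∀ e, ∃ ε : ℝ, e ∉ A → 0 < ε ∧
      ∀ B, B ∈ bases p (x + ε • toReal (∑ i ∈ parClass (bases p x) A e, stdDir n i)) ↔
        B ∈ bases p x ∧ ∃ f ∈ B, f ∈ parClass (bases p x) A e := by
    intro e
    by_cases he : e ∈ A
    · exact ⟨0, fun h => absurd he h⟩
    · obtain ⟨ε, hε, h⟩ := exists_facet_of_parClass hp hx he
      exact ⟨ε, fun _ => ⟨hε, h⟩⟩
  choose ε hε using hfac
  set y : Option (Fin n) → Fin n → ℝ := fun e =>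
    x + ε e • toReal (∑ i ∈ parClass (bases p x) A e, stdDir n i) with hy
  have hyB : ∀ e, e ∉ A → ∀ B, B ∈ bases p (y e) ↔
      B ∈ bases p x ∧ ∃ f ∈ B, f ∈ parClass (bases p x) A e := fun e he => (hε e he).2
  have hplane : ∀ e, e ∉ A → OnPlane p (y e) ∧ cellDim (planeCell p (y e)) = 2 := fun e he => by
    obtain ⟨a, g, -, -, -, hs⟩ := exists_isSplit_parClass hM hA he (hyB e he)
    exact ⟨hs.onPlane, hs.cellDim_eq⟩
  have hsub : ∀ e, e ∉ A → planeCell p x ⊆ planeCell p (y e) := fun e he z hz => by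
    rw [mem_planeCell] at hz ⊢
    exact fun B hB => hz ((hyB e he B).1 hB).1
  have hne : ∀ e, e ∉ A → ∃ B ∈ bases p x, ¬ ∃ f ∈ B, f ∈ parClass (bases p x) A e := by
    intro e he
    by_contra! hcon
    have : bases p (y e) = bases p x := by grind
    have h2 := (hplane e he).2
    rw [(planeCell_eq_iff p).2 this] at h2
    omega
  have hclass : ∀ e e', e ∉ A → e' ∉ A → planeCell p (y e) = planeCell p (y e') →
      parClass (bases p x) A e = parClass (bases p x) A e' := by
    intro e e' he he' h
    rw [planeCell_eq_iff] at h
    refine parClass_eq_of_bases_iff hp hx hA he (hne e he) fun B hB => ?_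
    have h1 := hyB e he B
    grind
  have hclass' : ∀ e e', e ∉ A → e' ∈ parClass (bases p x) A e →
      planeCell p (y e') = planeCell p (y e) := by
    intro e e' he he'
    have he'A := (mem_parClass.1 he').1
    rw [planeCell_eq_iff]
    ext B
    rw [hyB e he, hyB e' he'A, parClass_eq hM he']
  have hex : ∀ F ∈ (planeComplex p).cells, cellDim F = 2 → planeCell p x ⊆ F →
      ∃ e, e ∉ A ∧ F = planeCell p (y e) := by
    intro F hF hF2 hxF
    obtain ⟨z, hz, rfl⟩ := (mem_planeComplex_cells p).1 hF
    have hzx := (mem_planeCell p).1 (hxF (self_mem_planeCell p x))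
    obtain ⟨e, he, h⟩ := exists_parClass_of_facet hp hx hz hA hzx fun h => by
      rw [(planeCell_eq_iff p).2 h] at hF2
      omega
    refine ⟨e, he, (planeCell_eq_iff p).2 ?_⟩
    ext B
    rw [h, hyB e he]
  have hfiber : ∀ e, e ∉ A → Finset.univ.filter (fun e' => e' ∉ A ∧ planeCell p (y e') =
      planeCell p (y e)) = parClass (bases p x) A e := by
    intro e he
    ext f
    simp only [Finset.mem_filter, Finset.mem_univ, true_and]
    refine ⟨fun h => ?_, fun h => ⟨(mem_parClass.1 h).1, hclass' e f he h⟩⟩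
    rw [← hclass f e h.1 he h.2]
    exact self_mem_parClass h.1
  -- Defining the normal of `F` as a sum over the whole fibre of `F` avoids a choice of class
  -- representatives and turns balancing into a sum over fibres.
  refine ⟨fun F => ∑ e with e ∉ A ∧ planeCell p (y e) = F, stdDir n e, ?_, ?_⟩
  · intro F hF hF2 hxF
    obtain ⟨e, he, rfl⟩ := hex F hF hF2 hxF
    simp only [hfiber e he]
    exact isPrimitiveNormal_parClass hp hx hA he (hε e he).1 (hyB e he)
  · have hmaps : ∀ e ∈ Finset.univ.filter (· ∉ A), planeCell p (y e) ∈
        (planeComplex p).cells.filter (fun F => cellDim F = 2 ∧ planeCell p x ⊆ F) := by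
      intro e he
      have he := (Finset.mem_filter.1 he).2
      exact Finset.mem_filter.2 ⟨(mem_planeComplex_cells p).2 ⟨_, (hplane e he).1, rfl⟩,
        (hplane e he).2, hsub e he⟩
    have h1 := Finset.sum_fiberwise_of_maps_to hmaps (stdDir n)
    simp only [Finset.filter_filter] at h1
    simp only [Nat.cast_one, one_smul]
    rw [← toReal_sum, h1]
    convert sum_stdDir_mem_vectorSpan hp hx hA

end TropGeo

namespace TropGeo

/-! ### The plane has degree one -/

variable {n : ℕ} {p : Finset (Option (Fin n)) → ℝ}

theorem eq_of_hom_add_const {x y : Fin n → ℝ} {m : ℝ} (h : ∀ e, hom x e = hom y e + m) : x = y := by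
  have h0 := h none
  simp only [hom_none, zero_add] at h0
  exact hom_injective (funext fun e => by rw [h e, ← h0, add_zero])

/-- In homogeneous coordinates the cone consists of the points obtained from the apex by lowering
the coordinates in `I`, modulo a common constant `m`. -/
theorem mem_stdCone_iff {v x : Fin n → ℝ} {I : Finset (Option (Fin n))} :
    x ∈ stdCone v I ↔ ∃ (m : ℝ) (c : Option (Fin n) → ℝ), (∀ i ∈ I, 0 ≤ c i) ∧
      ∀ e, hom x e = hom v e + m - if e ∈ I then c e else 0 := by
  have key : ∀ (c : Option (Fin n) → ℝ) (e : Option (Fin n)),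
      hom (v + ∑ i ∈ I, c i • toReal (stdDir n i)) e =
        hom v e + (if none ∈ I then c none else 0) - if e ∈ I then c e else 0 := by
    intro c e
    rw [hom_add, hom_sum]
    simp only [hom_smul, hom_stdDir, mul_sub, Finset.sum_sub_distrib]
    simp [Finset.sum_ite_eq, add_sub_assoc]
  constructor
  · rintro ⟨c, hc, rfl⟩
    exact ⟨_, c, hc, key c⟩
  · rintro ⟨m, c, hc, h⟩
    refine ⟨c, hc, eq_of_hom_add_const (m := m - if none ∈ I then c none else 0) fun e => ?_⟩
    rw [h, key]
    ring

/-- The apices in general position with respect to the plane. -/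
def genericApex (p : Finset (Option (Fin n)) → ℝ) : Set (Fin n → ℝ) :=
  {v | ∀ B B' : Triple n, B ≠ B' → (planeFamily p).val B v ≠ (planeFamily p).val B' v}

theorem genericApex_eq : genericApex p =
    ⋂ q : {q : Triple n × Triple n // q.1 ≠ q.2},
      {v | (planeFamily p).val q.1.1 v ≠ (planeFamily p).val q.1.2 v} := by
  ext v
  rw [Set.mem_iInter]
  exact ⟨fun h q => h _ _ q.2, fun h B B' hB => h ⟨(B, B'), hB⟩⟩

theorem isOpen_val_ne (B B' : Triple n) :
    IsOpen {v | (planeFamily p).val B v ≠ (planeFamily p).val B' v} :=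
  isOpen_ne_fun ((planeFamily p).val_continuous B) ((planeFamily p).val_continuous B')

theorem dense_val_ne {B B' : Triple n} (h : B ≠ B') :
    Dense {v | (planeFamily p).val B v ≠ (planeFamily p).val B' v} := by
  intro v
  obtain ⟨e, heB, heB'⟩ : ∃ e ∈ B.1, e ∉ B'.1 := by
    by_contra! hcon
    exact h (Subtype.ext (Finset.eq_of_subset_of_card_le hcon (by rw [B.2, B'.2])))
  by_cases hv : (planeFamily p).val B v ≠ (planeFamily p).val B' v
  · exact subset_closure hv
  push Not at hv
  have hlin : (planeFamily p).lin B (toReal (stdDir n e)) ≠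
      (planeFamily p).lin B' (toReal (stdDir n e)) := by
    simp only [planeFamily_lin, hom_stdDir, Finset.sum_sub_distrib, Finset.sum_const, B.2, B'.2]
    simp [heB, heB']
  have hlim : Filter.Tendsto (fun t : ℝ => v + t • toReal (stdDir n e)) (𝓝[≠] 0) (𝓝 v) := by
    have : Filter.Tendsto (fun t : ℝ => v + t • toReal (stdDir n e)) (𝓝 0)
        (𝓝 (v + (0 : ℝ) • toReal (stdDir n e))) :=
      (continuous_const.add (continuous_id.smul continuous_const)).tendsto 0
    rw [zero_smul, add_zero] at this
    exact this.mono_left nhdsWithin_le_nhds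
  refine mem_closure_of_tendsto hlim ?_
  filter_upwards [self_mem_nhdsWithin] with t ht
  rw [AffineFamily.val_add_smul, AffineFamily.val_add_smul, hv]
  intro hcon
  exact hlin (mul_left_cancel₀ ht (add_left_cancel hcon))

theorem isOpen_genericApex : IsOpen (genericApex p) := by
  rw [genericApex_eq]
  exact isOpen_iInter_of_finite fun q => isOpen_val_ne _ _

theorem dense_genericApex : Dense (genericApex p) := by
  rw [genericApex_eq]
  exact dense_iInter_of_isOpen (fun q => isOpen_val_ne _ _) fun q => dense_val_ne q.2

theorem ne_of_genericApex {v : Fin n → ℝ} (hv : v ∈ genericApex p) {B B' : Finset (Option (Fin n))}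
    (hB : B.card = 3) (hB' : B'.card = 3) (h : B ≠ B') :
    p B - ∑ e ∈ B, hom v e ≠ p B' - ∑ e ∈ B', hom v e := by
  have := hv ⟨B, hB⟩ ⟨B', hB'⟩ fun hc => h (congrArg Subtype.val hc)
  simpa only [planeFamily_val] using this

section Meet

variable (hp : IsValuated p) (hn : 2 ≤ n) {v x : Fin n → ℝ} (hv : v ∈ genericApex p)
  {I : Finset (Option (Fin n))}

include hp hn hv

/-- Outside `I` the points `x` and `v` agree up to a constant. A swap between two elements of the
complement would give two different triples with the same value at `v`, contrary to genericity, so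
the complement splits the matroid at `x`. -/
theorem exists_isSplit_compl (hx : OnPlane p x) (hxI : x ∈ stdCone v I) (hI : I.card ≤ n - 2) :
    ∃ c, IsSplit (bases p x) Iᶜ c := by
  have hM := isBases_of_onPlane hp hx
  obtain ⟨m, c, -, h⟩ := mem_stdCone_iff.1 hxI
  refine hM.exists_isSplit ?_ fun s hs s' hs' B hB hsB hsB' hswap => ?_
  · rw [Finset.card_compl, Fintype.card_option, Fintype.card_fin]
    omega
  · rw [Finset.mem_compl] at hs hs'
    have h1 := ((mem_bases p).1 hB).2 _ ((mem_bases p).1 hswap).1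
    have h2 := ((mem_bases p).1 hswap).2 _ ((mem_bases p).1 hB).1
    refine ne_of_genericApex hv (hM.card _ hB) (hM.card _ hswap) (fun hc => hsB' ?_) ?_
    · rw [hc]
      exact mem_swap.2 (Or.inl rfl)
    · rw [sum_swap hsB hsB'] at h1 h2 ⊢
      rw [h s, h s', if_neg hs, if_neg hs'] at h1 h2
      linarith

-- The correction replaces each coordinate in `I` by that of its class representative, up to a
-- common constant. Its coefficients are integers when `z` is integral, so the facet and the cone
-- generate the full lattice and the index is one.
omit hp hn hv in
theorem IsSplit.sub_sum_mem {c : Option (Fin n) → Option (Fin n)} (h : IsSplit (bases p x) Iᶜ c)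
    (z : Fin n → ℝ) : z - ∑ i ∈ I, (hom z (c i) - hom z i) • toReal (stdDir n i) ∈
      vectorSpan ℝ (planeCell p x) := by
  rw [h.mem_vectorSpan]
  have key : ∀ e, hom (z - ∑ i ∈ I, (hom z (c i) - hom z i) • toReal (stdDir n i)) e =
      hom z (c e) - if none ∈ I then hom z (c none) - hom z none else 0 := by
    intro e
    rw [hom_sub, hom_sum]
    simp only [hom_smul, hom_stdDir, mul_sub, Finset.sum_sub_distrib]
    by_cases he : e ∈ I
    · simp [Finset.sum_ite_eq, he]
      split_ifs <;> ring
    · simp [Finset.sum_ite_eq, he, h.self e (Finset.mem_compl.2 he)]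
  intro e
  rw [key, key, h.self _ (h.mem e)]

omit hp hn hv in
theorem IsSplit.cellLattice_sup_eq_top {c : Option (Fin n) → Option (Fin n)}
    (h : IsSplit (bases p x) Iᶜ c) :
    cellLattice (planeCell p x) ⊔
      Submodule.span ℤ (stdDir n '' (I : Set (Option (Fin n)))) = ⊤ := by
  refine eq_top_iff.2 fun w _ => ?_
  choose W hW using exists_int_hom w
  have : w = (w - ∑ i ∈ I, (W (c i) - W i) • stdDir n i) +
      ∑ i ∈ I, (W (c i) - W i) • stdDir n i := by abel
  rw [this]
  refine Submodule.add_mem_sup ?_ (Submodule.sum_mem _ fun i hi => Submodule.smul_mem _ _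
    (Submodule.subset_span ⟨i, hi, rfl⟩))
  rw [mem_cellLattice, toReal_sub, toReal_sum]
  simp only [toReal_smul]
  have := h.sub_sum_mem (toReal w)
  simpa only [hW, Int.cast_sub] using this

omit hp hn hv in
theorem IsSplit.vectorSpan_sup_eq_top {c : Option (Fin n) → Option (Fin n)}
    (h : IsSplit (bases p x) Iᶜ c) :
    vectorSpan ℝ (planeCell p x) ⊔ Submodule.span ℝ
      ((fun i => toReal (stdDir n i)) '' (I : Set (Option (Fin n)))) = ⊤ := by
  refine eq_top_iff.2 fun z _ => ?_
  have : z = (z - ∑ i ∈ I, (hom z (c i) - hom z i) • toReal (stdDir n i)) +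
      ∑ i ∈ I, (hom z (c i) - hom z i) • toReal (stdDir n i) := by abel
  rw [this]
  exact Submodule.add_mem_sup (h.sub_sum_mem z) (Submodule.sum_mem _ fun i hi =>
    Submodule.smul_mem _ _ (Submodule.subset_span ⟨i, hi, rfl⟩))

/-- Passing from `x` back to `v` raises the coordinates in `I` relative to the others, which
penalizes every swap into `I`. So the complement of `I` is locally optimal at `v`, hence globally,
and strictly by genericity. -/
theorem lt_of_mem_stdCone (hx : OnPlane p x) (hxI : x ∈ stdCone v I) (hI : I.card ≤ n - 2)
    {B : Finset (Option (Fin n))} (hB : B.card = 3) (hne : B ≠ Iᶜ) :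
    p B - ∑ e ∈ B, hom v e < p Iᶜ - ∑ e ∈ Iᶜ, hom v e := by
  obtain ⟨c, hs⟩ := exists_isSplit_compl hp hn hv hx hxI hI
  obtain ⟨m, b, hb, h⟩ := mem_stdCone_iff.1 hxI
  refine lt_of_le_of_ne ((hp.sub_sum (hom v)).le_of_swap_le hs.card (fun j hj e he => ?_) B hB)
    (ne_of_genericApex hv hB hs.card hne)
  have h1 := ((mem_bases p).1 hs.base_mem).2 (swap Iᶜ j e) (by rw [card_swap hj he, hs.card])
  rw [sum_swap hj he] at h1 ⊢
  have heI : e ∈ I := by simpa using he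
  have hjI : j ∉ I := by simpa using hj
  grind

/-- The coordinate of a common point at `e ∈ I` is determined by the best exchange of `e` into the
complement of `I`. Testing the exchange realized at one point against optimality at the other gives
both inequalities. -/
theorem eq_of_mem_stdCone (hx : OnPlane p x) (hxI : x ∈ stdCone v I) {y : Fin n → ℝ}
    (hy : OnPlane p y) (hyI : y ∈ stdCone v I) (hI : I.card ≤ n - 2) : x = y := by
  obtain ⟨c, hs⟩ := exists_isSplit_compl hp hn hv hx hxI hI
  obtain ⟨c', hs'⟩ := exists_isSplit_compl hp hn hv hy hyI hI
  obtain ⟨m, b, hb, h⟩ := mem_stdCone_iff.1 hxI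
  obtain ⟨m', b', hb', h'⟩ := mem_stdCone_iff.1 hyI
  have key : ∀ {x y : Fin n → ℝ} {c : Option (Fin n) → Option (Fin n)} {m m' : ℝ},
      IsSplit (bases p x) Iᶜ c → Iᶜ ∈ bases p y → (∀ e ∉ I, hom x e = hom v e + m) →
      (∀ e ∉ I, hom y e = hom v e + m') → ∀ e ∈ I, hom x e - m ≤ hom y e - m' := by
    intro x y c m m' hs hy h h' e he
    have hc : c e ∉ I := Finset.mem_compl.1 (hs.mem e)
    have heS : e ∉ Iᶜ := by simpa using he
    have h1 := ((mem_bases p).1 (hs.swap_mem e)).2 _ hs.card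
    have h2 := ((mem_bases p).1 hy).2 _ ((mem_bases p).1 (hs.swap_mem e)).1
    rw [sum_swap (hs.mem e) heS] at h1 h2
    grind
  have hx1 : ∀ e ∉ I, hom x e = hom v e + m := fun e he => by rw [h, if_neg he, sub_zero]
  have hy1 : ∀ e ∉ I, hom y e = hom v e + m' := fun e he => by rw [h', if_neg he, sub_zero]
  refine eq_of_hom_add_const (m := m - m') fun e => ?_
  by_cases he : e ∈ I
  · have h1 := key hs hs'.base_mem hx1 hy1 e he
    have h2 := key hs' hs.base_mem hy1 hx1 e he
    linarith
  · grind

-- Take a triple `J` that is optimal at `v` and keep its coordinates. Lower every other coordinate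
-- `e` until the best exchange of `e` into `J` ties with `J`; the amount is nonnegative because `J`
-- is optimal.
omit hv in
theorem exists_mem_stdCone :
    ∃ I x, I.card = n - 2 ∧ OnPlane p x ∧ x ∈ stdCone v I := by
  obtain ⟨J₀, hJ₀⟩ : ∃ J₀ : Finset (Option (Fin n)), J₀.card = 3 := by
    obtain ⟨J₀, -, h⟩ := Finset.exists_subset_card_eq
      (s := (Finset.univ : Finset (Option (Fin n)))) (n := 3)
      (by rw [Finset.card_univ, Fintype.card_option, Fintype.card_fin]; omega)
    exact ⟨J₀, h⟩
  obtain ⟨J, hJ, hmax⟩ := (Finset.univ.filter fun B : Finset (Option (Fin n)) => B.card = 3)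
    |>.exists_max_image (fun B => p B - ∑ e ∈ B, hom v e) ⟨J₀, by simpa using hJ₀⟩
  have hJ : J.card = 3 := (Finset.mem_filter.1 hJ).2
  have hmax : ∀ B : Finset (Option (Fin n)), B.card = 3 →
      p B - ∑ e ∈ B, hom v e ≤ p J - ∑ e ∈ J, hom v e := fun B hB => hmax B (by simpa using hB)
  have hJne : J.Nonempty := Finset.card_pos.1 (by omega)
  choose j hjJ hj using fun e => J.exists_max_image (fun j => p (swap J j e) + hom v j) hJne
  set D : Option (Fin n) → ℝ := fun e =>
    if e ∈ J then hom v e else p (swap J (j e) e) - p J + hom v (j e) with hD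
  have hD1 : ∀ e ∈ J, D e = hom v e := fun e he => by simp [hD, he]
  have hD2 : ∀ e ∉ J, D e = p (swap J (j e) e) - p J + hom v (j e) := fun e he => by simp [hD, he]
  have hJb : J ∈ bases p (dehom D) := by
    refine (mem_bases p).2 ⟨hJ, fun B hB => (hp.sub_sum (hom (dehom D))).le_of_swap_le hJ
      (fun i hi e he => ?_) B hB⟩
    rw [sum_swap hi he, hom_dehom, hom_dehom, hD1 i hi, hD2 e he]
    have := hj e i hi
    linarith
  refine ⟨Jᶜ, dehom D, ?_, fun e => ?_, mem_stdCone_iff.2 ⟨-D none, fun e => hom v e - D e, ?_, ?_⟩⟩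
  · rw [Finset.card_compl, hJ, Fintype.card_option, Fintype.card_fin]
    omega
  · by_cases he : e ∈ J
    · exact ⟨J, hJb, he⟩
    · refine ⟨swap J (j e) e, mem_bases_of_eq p hJb (by rw [card_swap (hjJ e) he, hJ]) ?_,
        mem_swap.2 (Or.inl rfl)⟩
      rw [sum_swap (hjJ e) he, hom_dehom, hom_dehom, hD1 _ (hjJ e), hD2 e he]
      linarith
  · intro e he
    have he : e ∉ J := Finset.mem_compl.1 he
    have := hmax (swap J (j e) e) (by rw [card_swap (hjJ e) he, hJ])
    rw [sum_swap (hjJ e) he] at this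
    simp only [hD2 e he]
    linarith
  · intro e
    rw [hom_dehom]
    by_cases he : e ∈ J
    · simp [he, hD1 e he, sub_eq_add_neg]
    · simp [he]
      ring

end Meet

/-- The tropical plane of a valuated matroid of rank three, with all weights equal to one. -/
def planeVariety (hp : IsValuated p) : TropicalVariety n 2 where
  toPolyhedralComplex := planeComplex p
  pure := planeComplex_pure hp
  weight := fun _ => 1
  weight_pos := fun _ _ _ => one_pos
  balanced := planeComplex_balanced hp

/-- The index set is forced because its complement is the strict optimum at `v`; then the point and
the facet are forced too. The single intersection has weight one and index one. -/
theorem isTropicalPlane_planeVariety (hp : IsValuated p) (hn : 2 ≤ n) :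
    IsTropicalPlane (planeVariety hp) := by
  refine ⟨genericApex p, isOpen_genericApex, dense_genericApex, fun v hv => ⟨?_, ?_⟩⟩
  · rintro σ hσ I hI ⟨x, hxσ, hxI⟩
    obtain ⟨y, hy, rfl⟩ := (mem_planeComplex_cells p).1 hσ
    have hsub := (mem_planeCell p).1 hxσ
    have hx : OnPlane p x := fun e => let ⟨B, hB, he⟩ := hy e; ⟨B, hsub hB, he⟩
    obtain ⟨c, hs⟩ := exists_isSplit_compl hp hn hv hx hxI hI
    refine eq_top_iff.2 ?_
    rw [← hs.vectorSpan_sup_eq_top]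
    exact sup_le_sup_right (vectorSpan_planeCell_mono hsub) _
  · obtain ⟨I₀, x₀, hI₀, hx₀, hxI₀⟩ := exists_mem_stdCone hp hn (v := v)
    obtain ⟨c, hs⟩ := exists_isSplit_compl hp hn hv hx₀ hxI₀ hI₀.le
    have huniq : ∀ F ∈ (planeComplex p).cells, cellDim F = 2 → ∀ I : Finset (Option (Fin n)),
        I.card = n - 2 → (F ∩ stdCone v I).Nonempty → F = planeCell p x₀ ∧ I = I₀ := by
      rintro F hF hF2 I hI ⟨x, hxF, hxI⟩
      obtain ⟨y, hy, rfl⟩ := (mem_planeComplex_cells p).1 hF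
      have hsub := (mem_planeCell p).1 hxF
      have hx : OnPlane p x := fun e => let ⟨B, hB, he⟩ := hy e; ⟨B, hsub hB, he⟩
      obtain ⟨c', hs'⟩ := exists_isSplit_compl hp hn hv hx hxI hI.le
      have hII : I = I₀ := by
        by_contra hne
        have hne' : Iᶜ ≠ I₀ᶜ := fun h => hne (compl_injective h)
        exact lt_asymm (lt_of_mem_stdCone hp hn hv hx₀ hxI₀ hI₀.le hs'.card hne')
          (lt_of_mem_stdCone hp hn hv hx hxI hI.le hs.card hne'.symm)
      subst hII
      have hxx := eq_of_mem_stdCone hp hn hv hx hxI hx₀ hxI₀ hI.le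
      subst hxx
      exact ⟨planeCell_eq_of_mem_of_cellDim hxF hy (hs.cellDim_eq.trans hF2.symm), rfl⟩
    have hmem : planeCell p x₀ ∈ (planeComplex p).cells :=
      (mem_planeComplex_cells p).2 ⟨x₀, hx₀, rfl⟩
    unfold TropicalVariety.intersectionNumber
    rw [Finset.sum_eq_single (planeCell p x₀), Finset.sum_eq_single I₀, if_pos]
    · change 1 * _ = 1
      rw [hs.cellLattice_sup_eq_top]
      simp
    · exact ⟨x₀, self_mem_planeCell p x₀, hxI₀⟩
    · intro I hI hne
      rw [Finset.mem_filter] at hI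
      exact if_neg fun h => hne (huniq _ hmem hs.cellDim_eq I hI.2 h).2
    · grind
    · intro F hF hne
      rw [Finset.mem_filter] at hF
      refine Finset.sum_eq_zero fun I hI => if_neg fun h => hne ?_
      exact (huniq F hF.1 hF.2 I (Finset.mem_filter.1 hI).2 h).1
    · intro h
      exact absurd (Finset.mem_filter.2 ⟨hmem, hs.cellDim_eq⟩) h

end TropGeo

namespace TropGeo

/-! ### The plane near an interior point of a facet -/

section LocallyFlat

variable {n : ℕ} {p : Finset (Option (Fin n)) → ℝ}

theorem mem_support_planeVariety (hp : IsValuated p) {x : Fin n → ℝ} :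
    x ∈ (planeVariety hp).support ↔ OnPlane p x := mem_support_planeComplex p

/-- In the interior of a facet the plane is locally an affine plane. -/
theorem IsSplit.eventually_onPlane_iff (hp : IsValuated p) {x : Fin n → ℝ}
    {S : Finset (Option (Fin n))} {c : Option (Fin n) → Option (Fin n)}
    (h : IsSplit (bases p x) S c) :
    ∀ᶠ y in 𝓝 x, OnPlane p y ↔ y - x ∈ vectorSpan ℝ (planeCell p x) := by
  filter_upwards [eventually_bases_subset p x] with y hy
  constructor
  · intro hyp
    obtain ⟨F, hF, hsub, hF2⟩ := planeComplex_pure hp _ ((mem_planeComplex_cells p).2 ⟨y, hyp, rfl⟩)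
    obtain ⟨z, hz, rfl⟩ := (mem_planeComplex_cells p).1 hF
    have h1 := (mem_planeCell p).1 (hsub (self_mem_planeCell p y))
    have h2 : x ∈ planeCell p z := (mem_planeCell p).2 (h1.trans hy)
    have h3 := planeCell_eq_of_mem_of_cellDim h2 hz (h.cellDim_eq.trans hF2.symm)
    rw [planeCell_eq_iff] at h3
    exact vsub_mem_vectorSpan ℝ ((mem_planeCell p).2 (h3 ▸ h1)) (self_mem_planeCell p x)
  · intro hyx
    rw [mem_vectorSpan_planeCell] at hyx
    -- A triple that is optimal at a nearby `y` is already a basis at `x`. Along the directions of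
    -- the facet all bases at `x` stay tied with it, so they cover the indices at `y` as well.
    obtain ⟨B₀, hB₀, hmax⟩ := (Finset.univ.filter fun B : Finset (Option (Fin n)) => B.card = 3)
      |>.exists_max_image (fun B => p B - ∑ e ∈ B, hom y e)
        ⟨S, Finset.mem_filter.2 ⟨Finset.mem_univ _, h.card⟩⟩
    have hB₀ := (Finset.mem_filter.1 hB₀).2
    have hB₀ : B₀ ∈ bases p y := (mem_bases p).2 ⟨hB₀, fun B hB => hmax B (by simpa using hB)⟩
    refine fun e => ⟨_, mem_bases_of_eq p hB₀ ((mem_bases p).1 (h.swap_mem e)).1 ?_,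
      mem_swap.2 (Or.inl rfl)⟩
    have h1 := hyx _ (h.swap_mem e) _ (hy hB₀)
    simp only [hom_sub, Finset.sum_sub_distrib] at h1
    have h2 := (mem_bases p).1 (h.swap_mem e)
    grind

end LocallyFlat

/-- This is the exchange inequality for the triples `{x, b, b'}` and `{c₁, c₂, c₃}` in terms of
positions; the three cases are the possible partners of `x`. Writing `max (N - ·)` instead of a
minimum keeps everything in natural numbers. -/
theorem exists_exchange_max_min {N x b b' c₁ c₂ c₃ : ℕ} (hx : x ≤ N) (hb : b < b') (hb' : b' ≤ N)
    (h₁ : c₁ < c₂) (h₂ : c₂ < c₃) (h₃ : c₃ ≤ N) :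
    ((c₁ ≠ b ∧ c₁ ≠ b') ∧ max x b' + max (N - x) (N - b) + (c₃ + (N - c₁)) ≤
        max c₁ b' + max (N - c₁) (N - b) + (max x c₃ + max (N - x) (N - c₂))) ∨
    ((c₂ ≠ b ∧ c₂ ≠ b') ∧ max x b' + max (N - x) (N - b) + (c₃ + (N - c₁)) ≤
        max c₂ b' + max (N - c₂) (N - b) + (max x c₃ + max (N - x) (N - c₁))) ∨
    ((c₃ ≠ b ∧ c₃ ≠ b') ∧ max x b' + max (N - x) (N - b) + (c₃ + (N - c₁)) ≤
        max c₃ b' + max (N - c₃) (N - b) + (max x c₂ + max (N - x) (N - c₁))) := by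
  omega

/-! ### The valuated matroid given by the spread of a triple -/

section Spread

variable {n : ℕ}

/-- The position of an index in the chain `none < some 0 < some 1 < ⋯`. -/
def lab (e : Option (Fin n)) : ℕ := e.elim 0 fun i => i + 1

@[simp] theorem lab_none : lab (none : Option (Fin n)) = 0 := rfl
@[simp] theorem lab_some (i : Fin n) : lab (some i) = i + 1 := rfl

theorem lab_le (e : Option (Fin n)) : lab e ≤ n := by
  cases e with
  | none => simp
  | some i => simp [i.2]

theorem lab_injective : Function.Injective (lab (n := n)) := by
  rintro (_ | i) (_ | j) h <;> simp [lab, Fin.val_inj] at h ⊢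
  exact h

/-- The distance between the extreme elements of a set of indices, up to a constant. -/
def spread (B : Finset (Option (Fin n))) : ℝ := ((B.sup lab + B.sup fun e => n - lab e : ℕ) : ℝ)

theorem exists_sorted {B : Finset (Option (Fin n))} (hB : B.card = 3) :
    ∃ a b c, lab a < lab b ∧ lab b < lab c ∧ B = {a, b, c} := by
  obtain ⟨x, y, z, hxy, hxz, hyz, rfl⟩ := Finset.card_eq_three.1 hB
  have h1 := lab_injective.ne hxy
  have h2 := lab_injective.ne hxz
  have h3 := lab_injective.ne hyz
  rcases lt_or_gt_of_ne h1 with h1 | h1 <;> rcases lt_or_gt_of_ne h2 with h2 | h2 <;>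
    rcases lt_or_gt_of_ne h3 with h3 | h3
  · exact ⟨x, y, z, h1, h3, rfl⟩
  · exact ⟨x, z, y, h2, h3, by grind⟩
  · omega
  · exact ⟨z, x, y, h2, h1, by grind⟩
  · exact ⟨y, x, z, h1, h2, by grind⟩
  · omega
  · exact ⟨y, z, x, h3, h2, by grind⟩
  · exact ⟨z, y, x, h3, h1, by grind⟩

theorem spread_triple (a b c : Option (Fin n)) :
    spread {a, b, c} = ((max (lab a) (max (lab b) (lab c)) +
      max (n - lab a) (max (n - lab b) (n - lab c)) : ℕ) : ℝ) := by
  simp [spread, Finset.sup_insert]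

theorem spread_of_lt (x : Option (Fin n)) {b b' : Option (Fin n)} (h : lab b < lab b') :
    spread {x, b, b'} =
      ((max (lab x) (lab b') + max (n - lab x) (n - lab b) : ℕ) : ℝ) := by
  rw [spread_triple, max_eq_right h.le, max_eq_left (Nat.sub_le_sub_left h.le n)]

theorem spread_sorted {a b c : Option (Fin n)} (hab : lab a < lab b) (hbc : lab b < lab c) :
    spread {a, b, c} = ((lab c + (n - lab a) : ℕ) : ℝ) := by
  rw [spread_of_lt _ hbc, max_eq_right (hab.trans hbc).le,
    max_eq_left (Nat.sub_le_sub_left hab.le n)]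

/-- Sorting the triple `B'` and the two elements of `B` other than `x` reduces the claim to
`exists_exchange_max_min`; what remains is to identify the exchanged triples. -/
theorem isValuated_spread : IsValuated (spread (n := n)) := by
  intro B B' hB hB' x hx hx'
  obtain ⟨c₁, c₂, c₃, h₁, h₂, rfl⟩ := exists_sorted hB'
  obtain ⟨b, b', hbb, hBe⟩ : ∃ b b', lab b < lab b' ∧ B.erase x = {b, b'} := by
    obtain ⟨b, b', hbb, h⟩ := Finset.card_eq_two.1
      (show (B.erase x).card = 2 by rw [Finset.card_erase_of_mem hx, hB])
    rcases lt_or_gt_of_ne (lab_injective.ne hbb) with h1 | h1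
    · exact ⟨b, b', h1, h⟩
    · exact ⟨b', b, h1, by rw [h, Finset.pair_comm]⟩
  have hB : B = {x, b, b'} := by rw [← hBe, Finset.insert_erase hx]
  simp only [Finset.mem_insert, Finset.mem_singleton, not_or] at hx'
  obtain ⟨hx₁, hx₂, hx₃⟩ := hx'
  have hsw : ∀ y, swap B x y = {y, b, b'} := fun y => by rw [swap, hBe]
  have h12 : c₁ ≠ c₂ := fun h => by simp [h] at h₁
  have h23 : c₂ ≠ c₃ := fun h => by simp [h] at h₂
  have h13 : c₁ ≠ c₃ := fun h => by rw [h] at h₁; omega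
  have hw₁ : swap {c₁, c₂, c₃} c₁ x = {x, c₂, c₃} := by
    rw [swap, Finset.erase_insert (by simp [h12, h13])]
  have hw₂ : swap {c₁, c₂, c₃} c₂ x = {x, c₁, c₃} := by
    rw [swap, Finset.insert_comm, Finset.erase_insert (by simp [h12.symm, h23])]
  have hw₃ : swap {c₁, c₂, c₃} c₃ x = {x, c₁, c₂} := by
    rw [swap, Finset.pair_comm, Finset.insert_comm, Finset.erase_insert
      (by simp [h13.symm, h23.symm])]
  have hmemB : ∀ y, y ≠ x → lab y ≠ lab b → lab y ≠ lab b' → y ∉ B := by grind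
  rcases exists_exchange_max_min (lab_le x) hbb (lab_le b') h₁ h₂ (lab_le c₃)
      with ⟨⟨h3, h4⟩, h5⟩ | ⟨⟨h3, h4⟩, h5⟩ | ⟨⟨h3, h4⟩, h5⟩
  · refine ⟨c₁, by simp, hmemB _ (Ne.symm hx₁) h3 h4, ?_⟩
    rw [hsw, hw₁, hB]
    rw [spread_sorted h₁ h₂, spread_of_lt _ hbb, spread_of_lt _ hbb, spread_of_lt _ h₂]
    exact_mod_cast h5
  · refine ⟨c₂, by simp, hmemB _ (Ne.symm hx₂) h3 h4, ?_⟩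
    rw [hsw, hw₂, hB]
    rw [spread_sorted h₁ h₂, spread_of_lt _ hbb, spread_of_lt _ hbb, spread_of_lt _ (h₁.trans h₂)]
    exact_mod_cast h5
  · refine ⟨c₃, by simp, hmemB _ (Ne.symm hx₃) h3 h4, ?_⟩
    rw [hsw, hw₃, hB]
    rw [spread_sorted h₁ h₂, spread_of_lt _ hbb, spread_of_lt _ hbb, spread_of_lt _ h₁]
    exact_mod_cast h5

end Spread

/-! ### Charts of the plane -/

section Chart

variable {k : ℕ}

/-- The linear part of the chart with index `j`. -/
def chartLin (k j : ℕ) : (ℝ × ℝ) →ₗ[ℝ] (Fin (k + 1) → ℝ) where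
  toFun z := fun i => -(if j ≤ (i : ℕ) then z.1 else 0) + if j < (i : ℕ) then z.2 else 0
  map_add' z w := by
    ext i
    simp only [Prod.fst_add, Prod.snd_add, Pi.add_apply]
    split_ifs <;> ring
  map_smul' c z := by
    ext i
    simp only [Prod.smul_fst, Prod.smul_snd, Pi.smul_apply, smul_eq_mul, RingHom.id_apply]
    split_ifs <;> ring

/-- The chart with index `j`. -/
def chart (k j : ℕ) (z : ℝ × ℝ) : Fin (k + 1) → ℝ :=
  (fun i : Fin (k + 1) => |((i : ℕ) : ℝ) - j| - j - 1) + chartLin k j z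

/-- The region of the plane on which the chart with index `j` is used. -/
def chartDomain (k j : ℕ) : Set (ℝ × ℝ) :=
  {z | (0 < j → -1 ≤ z.1 ∧ -1 ≤ z.1 - z.2) ∧ (j + 1 < k → -1 ≤ z.2 ∧ z.1 - z.2 ≤ 1)}

/-- The interior of `chartDomain k j`. -/
def chartInterior (k j : ℕ) : Set (ℝ × ℝ) :=
  {z | (0 < j → -1 < z.1 ∧ -1 < z.1 - z.2) ∧ (j + 1 < k → -1 < z.2 ∧ z.1 - z.2 < 1)}

/-- The homogeneous coordinates of a point of the chart as a function of the position. -/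
def chartHom (j : ℕ) (z : ℝ × ℝ) (l : ℕ) : ℝ :=
  |(l : ℝ) - (j + 1)| - (j + 1) - (if j + 1 ≤ l then z.1 else 0) + if j + 1 < l then z.2 else 0

theorem hom_chart (j : ℕ) (z : ℝ × ℝ) (e : Option (Fin (k + 1))) :
    hom (chart k j z) e = chartHom j z (lab e) := by
  cases e with
  | none =>
    rw [hom_none, lab_none, chartHom, if_neg (by omega), if_neg (by omega), Nat.cast_zero,
      zero_sub, abs_neg, abs_of_nonneg (by positivity)]
    ring
  | some i =>
    simp only [hom_some, lab_some, chartHom, chart, chartLin, LinearMap.coe_mk, AddHom.coe_mk,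
      Pi.add_apply, Nat.cast_add, Nat.cast_one, add_sub_add_right_eq_sub, add_le_add_iff_right,
      add_lt_add_iff_right]
    ring

theorem chartHom_of_lt {j l : ℕ} (z : ℝ × ℝ) (h : l < j + 1) : chartHom j z l = -l := by
  have : (l : ℝ) + 1 ≤ j + 1 := by exact_mod_cast h
  rw [chartHom, if_neg (by omega), if_neg (by omega), abs_of_nonpos (by linarith)]
  ring

theorem chartHom_self (j : ℕ) (z : ℝ × ℝ) : chartHom j z (j + 1) = -(j + 1) - z.1 := by
  rw [chartHom, if_pos le_rfl, if_neg (by omega)]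
  simp

theorem chartHom_of_gt {j l : ℕ} (z : ℝ × ℝ) (h : j + 1 < l) :
    chartHom j z l = l - 2 * (j + 1) - z.1 + z.2 := by
  have : (j : ℝ) + 1 + 1 ≤ l := by exact_mod_cast h
  rw [chartHom, if_pos (by omega), if_pos h, abs_of_nonneg (by linarith)]
  ring

theorem spread_sub_sum_chart {j : ℕ} (z : ℝ × ℝ) {a b c : Option (Fin (k + 1))}
    (hab : lab a < lab b) (hbc : lab b < lab c) :
    spread {a, b, c} - ∑ e ∈ {a, b, c}, hom (chart k j z) e =
      (lab c + (k + 1) - lab a : ℝ) - (chartHom j z (lab a) + chartHom j z (lab b) +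
        chartHom j z (lab c)) := by
  have hab' : a ≠ b := fun h => by simp [h] at hab
  have hbc' : b ≠ c := fun h => by simp [h] at hbc
  have hac' : a ≠ c := fun h => by rw [h] at hab; omega
  have h1 : lab c + (k + 1 - lab a) + lab a = lab c + (k + 1) := by
    have := lab_le a
    omega
  have h2 : ((lab c + (k + 1 - lab a) : ℕ) : ℝ) + lab a = lab c + (k + 1) := by exact_mod_cast h1
  rw [spread_sorted hab hbc, Finset.sum_insert (by simp [hab', hac']), Finset.sum_pair hbc']
  simp only [hom_chart]
  linarith

/-- The value does not depend on `a` and `c`: below position `j + 1` the chart coordinate is `-l`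
and above it is `l` plus a constant, which cancels the spread. So all triples with middle position
`j + 1` tie. -/
theorem chart_val_eq {j : ℕ} (z : ℝ × ℝ) {a b c : ℕ} (hab : a < j + 1) (hb : b = j + 1)
    (hbc : j + 1 < c) :
    (c + (k + 1) - a : ℝ) - (chartHom j z a + chartHom j z b + chartHom j z c) =
      k + 1 + 3 * (j + 1) + 2 * z.1 - z.2 := by
  subst hb
  rw [chartHom_of_lt z hab, chartHom_self, chartHom_of_gt z hbc]
  ring

/-- The inequalities of the domain are the comparisons with triples whose middle element is next to
`j + 1`. A middle element below requires `-1 ≤ z.1` and `-1 ≤ z.1 - z.2`, and such a triple exists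
only for `j > 0`; a middle element above gives the other two bounds. -/
theorem chart_val_le {j : ℕ} {z : ℝ × ℝ} (hz : z ∈ chartDomain k j) {a b c : ℕ}
    (hab : a < b) (hbc : b < c) (hc : c ≤ k + 1) :
    (c + (k + 1) - a : ℝ) - (chartHom j z a + chartHom j z b + chartHom j z c) ≤
        k + 1 + 3 * (j + 1) + 2 * z.1 - z.2 := by
  rcases lt_trichotomy b (j + 1) with hb | hb | hb
  · have hb1 : (b : ℝ) + 1 ≤ j + 1 := by exact_mod_cast hb
    obtain ⟨h1, h2⟩ := hz.1 (by omega)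
    rw [chartHom_of_lt z (hab.trans hb), chartHom_of_lt z hb]
    rcases lt_trichotomy c (j + 1) with hc | hc | hc
    · have hc1 : (c : ℝ) + 1 ≤ j + 1 := by exact_mod_cast hc
      rw [chartHom_of_lt z hc]
      linarith
    · subst hc
      rw [chartHom_self]
      push_cast
      linarith
    · rw [chartHom_of_gt z hc]
      linarith
  · by_cases hc : a < j + 1
    · rw [chart_val_eq z hc hb (by omega)]
    · omega
  · have hb1 : (j : ℝ) + 1 + 1 ≤ b := by exact_mod_cast hb
    obtain ⟨h1, h2⟩ := hz.2 (by omega)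
    rw [chartHom_of_gt z hb, chartHom_of_gt z (hb.trans hbc)]
    rcases lt_trichotomy a (j + 1) with ha | ha | ha
    · rw [chartHom_of_lt z ha]
      linarith
    · subst ha
      rw [chartHom_self]
      push_cast
      linarith
    · have ha1 : (j : ℝ) + 1 + 1 ≤ a := by exact_mod_cast ha
      rw [chartHom_of_gt z ha]
      linarith

theorem chart_val_lt {j : ℕ} {z : ℝ × ℝ} (hz : z ∈ chartInterior k j) {a b c : ℕ}
    (hab : a < b) (hbc : b < c) (hc : c ≤ k + 1) (hb : b ≠ j + 1) :
    (c + (k + 1) - a : ℝ) - (chartHom j z a + chartHom j z b + chartHom j z c) <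
        k + 1 + 3 * (j + 1) + 2 * z.1 - z.2 := by
  rcases lt_or_gt_of_ne hb with hb | hb
  · have hb1 : (b : ℝ) + 1 ≤ j + 1 := by exact_mod_cast hb
    obtain ⟨h1, h2⟩ := hz.1 (by omega)
    rw [chartHom_of_lt z (hab.trans hb), chartHom_of_lt z hb]
    rcases lt_trichotomy c (j + 1) with hc | hc | hc
    · have hc1 : (c : ℝ) + 1 ≤ j + 1 := by exact_mod_cast hc
      rw [chartHom_of_lt z hc]
      linarith
    · subst hc
      rw [chartHom_self]
      push_cast
      linarith
    · rw [chartHom_of_gt z hc]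
      linarith
  · have hb1 : (j : ℝ) + 1 + 1 ≤ b := by exact_mod_cast hb
    obtain ⟨h1, h2⟩ := hz.2 (by omega)
    rw [chartHom_of_gt z hb, chartHom_of_gt z (hb.trans hbc)]
    rcases lt_trichotomy a (j + 1) with ha | ha | ha
    · rw [chartHom_of_lt z ha]
      linarith
    · subst ha
      rw [chartHom_self]
      push_cast
      linarith
    · have ha1 : (j : ℝ) + 1 + 1 ≤ a := by exact_mod_cast ha
      rw [chartHom_of_gt z ha]
      linarith

theorem chartInterior_subset (k j : ℕ) : chartInterior k j ⊆ chartDomain k j := fun _ hz =>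
  ⟨fun h => ⟨(hz.1 h).1.le, (hz.1 h).2.le⟩, fun h => ⟨(hz.2 h).1.le, (hz.2 h).2.le⟩⟩

theorem triple_mem_bases_chart {j : ℕ} {z : ℝ × ℝ} (hz : z ∈ chartDomain k j)
    {a b c : Option (Fin (k + 1))} (ha : lab a < j + 1) (hb : lab b = j + 1) (hc : j + 1 < lab c) :
    {a, b, c} ∈ bases spread (chart k j z) := by
  have hab : a ≠ b := fun h => by rw [h] at ha; omega
  have hac : a ≠ c := fun h => by rw [h] at ha; omega
  have hbc : b ≠ c := fun h => by rw [← h] at hc; omega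
  refine (mem_bases _).2 ⟨Finset.card_eq_three.2 ⟨a, b, c, hab, hac, hbc, rfl⟩, fun B hB => ?_⟩
  obtain ⟨a', b', c', h1, h2, rfl⟩ := exists_sorted hB
  rw [spread_sub_sum_chart z h1 h2, spread_sub_sum_chart z (by omega) (by omega),
    chart_val_eq z ha hb hc]
  exact chart_val_le hz h1 h2 (lab_le c')

theorem exists_of_mem_bases_chart {j : ℕ} (hj : j < k) {z : ℝ × ℝ} (hz : z ∈ chartInterior k j)
    {B : Finset (Option (Fin (k + 1)))} (hB : B ∈ bases spread (chart k j z)) :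
    ∃ a b c, lab a < j + 1 ∧ lab b = j + 1 ∧ j + 1 < lab c ∧ B = {a, b, c} := by
  obtain ⟨a, b, c, h1, h2, rfl⟩ := exists_sorted ((mem_bases _).1 hB).1
  have hb : lab b = j + 1 := by
    by_contra hb
    have h3 := triple_mem_bases_chart (chartInterior_subset k j hz) (a := none)
      (b := some ⟨j, by omega⟩) (c := some ⟨k, by omega⟩) (by simp) (by simp) (by simpa using hj)
    have h4 := ((mem_bases _).1 hB).2 _ ((mem_bases _).1 h3).1
    rw [spread_sub_sum_chart z h1 h2, spread_sub_sum_chart z (by simp) (by simpa using hj),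
      chart_val_eq z (by simp) (by simp) (by simpa using hj)] at h4
    exact absurd (chart_val_lt hz h1 h2 (lab_le c) hb) (not_lt.2 h4)
  exact ⟨a, b, c, by omega, hb, by omega, rfl⟩

theorem onPlane_chart {j : ℕ} (hj : j < k) {z : ℝ × ℝ} (hz : z ∈ chartDomain k j) :
    OnPlane spread (chart k j z) := by
  intro e
  rcases lt_trichotomy (lab e) (j + 1) with he | he | he
  · exact ⟨_, triple_mem_bases_chart hz (a := e) (b := some ⟨j, by omega⟩)
      (c := some ⟨k, by omega⟩) he (by simp) (by simpa using hj), by simp⟩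
  · exact ⟨_, triple_mem_bases_chart hz (a := none) (b := e) (c := some ⟨k, by omega⟩) (by simp) he
      (by simpa using hj), by simp⟩
  · exact ⟨_, triple_mem_bases_chart hz (a := none) (b := some ⟨j, by omega⟩) (c := e) (by simp)
      (by simp) he, by simp⟩

/-- The three classes of indices of the facet parametrized by the chart with index `j`. -/
def chartClass (k j : ℕ) (e : Option (Fin (k + 1))) : Option (Fin (k + 1)) :=
  if lab e < j + 1 then none else if lab e = j + 1 then e else some (Fin.last k)

theorem chartClass_of_lt {j : ℕ} {e : Option (Fin (k + 1))} (h : lab e < j + 1) :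
    chartClass k j e = none := by simp [chartClass, h]
theorem chartClass_of_eq {j : ℕ} {e : Option (Fin (k + 1))} (h : lab e = j + 1) :
    chartClass k j e = e := by simp [chartClass, h]
theorem chartClass_of_gt {j : ℕ} {e : Option (Fin (k + 1))} (h : j + 1 < lab e) :
    chartClass k j e = some (Fin.last k) := by simp [chartClass, h.ne', h.not_gt]

/-- In the interior of its domain the chart parametrizes a facet. -/
theorem isSplit_chart {j : ℕ} (hj : j < k) {z : ℝ × ℝ} (hz : z ∈ chartInterior k j) :
    IsSplit (bases spread (chart k j z)) {none, some ⟨j, by omega⟩, some (Fin.last k)}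
      (chartClass k j) := by
  have hm : lab (some (⟨j, by omega⟩ : Fin (k + 1))) = j + 1 := lab_some _
  have hl : j + 1 < lab (some (Fin.last k)) := by simpa using hj
  have h0 : lab (none : Option (Fin (k + 1))) < j + 1 := by simp
  generalize some (⟨j, by omega⟩ : Fin (k + 1)) = m at *
  have hcl : ∀ e, lab e = j + 1 → e = m := fun e he => lab_injective (he.trans hm.symm)
  have hne1 : none ≠ m := fun h => by rw [h] at h0; omega
  have hne2 : (none : Option (Fin (k + 1))) ≠ some (Fin.last k) := by simp
  have hne3 : m ≠ some (Fin.last k) := fun h => by rw [← h] at hl; omega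
  refine ⟨Finset.card_eq_three.2 ⟨_, _, _, hne1, hne2, hne3, rfl⟩, fun e => ?_, fun s hs => ?_,
    fun e => ?_, fun B hB Y hY => ?_⟩
  · rcases lt_trichotomy (lab e) (j + 1) with he | he | he
    · simp [chartClass_of_lt he]
    · simp [chartClass_of_eq he, hcl e he, chartClass_of_eq hm]
    · simp [chartClass_of_gt he]
  · simp only [Finset.mem_insert, Finset.mem_singleton] at hs
    rcases hs with rfl | rfl | rfl
    · exact chartClass_of_lt h0
    · exact chartClass_of_eq hm
    · exact chartClass_of_gt hl
  · have hz := chartInterior_subset k j hz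
    rcases lt_trichotomy (lab e) (j + 1) with he | he | he
    · rw [chartClass_of_lt he, swap, Finset.erase_insert (by simp [hne1])]
      exact triple_mem_bases_chart hz he hm hl
    · rw [chartClass_of_eq he, hcl e he, swap_self (by simp)]
      exact triple_mem_bases_chart hz h0 hm hl
    · rw [chartClass_of_gt he, swap, Finset.pair_comm m, Finset.insert_comm none,
        Finset.erase_insert (by simp [hne3.symm]), Finset.insert_comm, Finset.pair_comm]
      exact triple_mem_bases_chart hz h0 hm he
  · obtain ⟨a, b, c, ha, hb, hc, rfl⟩ := exists_of_mem_bases_chart hj hz hB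
    have hab : a ≠ b := fun h => by rw [h] at ha; omega
    have hac : a ≠ c := fun h => by rw [h] at ha; omega
    have hbc : b ≠ c := fun h => by rw [← h] at hc; omega
    have h1 := hY a
    have h2 := hY c
    rw [chartClass_of_lt ha] at h1
    rw [chartClass_of_gt hc] at h2
    rw [Finset.sum_insert (by simp [hab, hac]), Finset.sum_pair hbc,
      Finset.sum_insert (by simp [hne1]), Finset.sum_pair hne3, h1, h2, hcl b hb]

theorem chartLin_of_lt {j : ℕ} (w : ℝ × ℝ) {i : Fin (k + 1)} (h : (i : ℕ) < j) :
    chartLin k j w i = 0 := by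
  simp [chartLin, h.not_ge, h.not_gt]
theorem chartLin_of_eq {j : ℕ} (w : ℝ × ℝ) {i : Fin (k + 1)} (h : (i : ℕ) = j) :
    chartLin k j w i = -w.1 := by
  simp [chartLin, h]
theorem chartLin_of_gt {j : ℕ} (w : ℝ × ℝ) {i : Fin (k + 1)} (h : j < (i : ℕ)) :
    chartLin k j w i = -w.1 + w.2 := by
  simp [chartLin, h, h.le]

theorem mem_vectorSpan_chart {j : ℕ} (hj : j < k) {z : ℝ × ℝ} (hz : z ∈ chartInterior k j)
    {y : Fin (k + 1) → ℝ} :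
    y ∈ vectorSpan ℝ (planeCell spread (chart k j z)) ↔ ∃ w, y = chartLin k j w := by
  rw [(isSplit_chart hj hz).mem_vectorSpan]
  have hl : j < (Fin.last k : ℕ) := by simpa using hj
  constructor
  · intro h
    refine ⟨(-y ⟨j, by omega⟩, y (Fin.last k) - y ⟨j, by omega⟩), ?_⟩
    ext i
    rw [← hom_some y, h]
    rcases lt_trichotomy (i : ℕ) j with h1 | h1 | h1
    · rw [chartLin_of_lt _ h1, chartClass_of_lt (by simpa using h1), hom_none]
    · rw [chartLin_of_eq _ h1, chartClass_of_eq (by simpa using h1), hom_some,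
        show i = ⟨j, by omega⟩ from Fin.ext h1]
      simp
    · rw [chartLin_of_gt _ h1, chartClass_of_gt (by simpa using h1), hom_some]
      simp
  · rintro ⟨w, rfl⟩ e
    rcases lt_trichotomy (lab e) (j + 1) with he | he | he
    · rw [chartClass_of_lt he]
      cases e with
      | none => rfl
      | some i => exact chartLin_of_lt w (by simpa using he)
    · rw [chartClass_of_eq he]
    · rw [chartClass_of_gt he]
      cases e with
      | none => simp at he
      | some i => rw [hom_some, hom_some, chartLin_of_gt _ (by simpa using he), chartLin_of_gt _ hl]

/-- Different charts overlap at most in one point. -/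
theorem chart_eq_chart {j j' : ℕ} (hj : j < j') (hj' : j' < k) {z z' : ℝ × ℝ}
    (hz : z ∈ chartDomain k j) (hz' : z' ∈ chartDomain k j') (h : chart k j z = chart k j' z') :
    j' = j + 1 ∧ z = (0, -1) ∧ z' = (-1, 0) := by
  obtain ⟨h1, h2⟩ := hz.2 (by omega)
  obtain ⟨h3, h4⟩ := hz'.1 (by omega)
  have e : ∀ i : Fin (k + 1), chartHom j z (i + 1) = chartHom j' z' (i + 1) := fun i => by
    have := hom_chart j z (some i)
    rw [h, hom_chart, lab_some] at this
    exact this.symm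
  have e1 := e ⟨j, by omega⟩
  have e2 := e ⟨j', by omega⟩
  have e3 := e ⟨k, by omega⟩
  rw [chartHom_self, chartHom_of_lt _ (by simpa using hj)] at e1
  rw [chartHom_self, chartHom_of_gt _ (by simpa using hj)] at e2
  rw [chartHom_of_gt _ (by simp; omega), chartHom_of_gt _ (by simpa using hj')] at e3
  -- The coordinate at position `j + 1` gives `z.1 = 0`; the one at `j' + 1` gives `2 (j' - j) =
  -- -z.2 - z'.1`, which is at most 2 on the two domains. Equality throughout pins down both points.
  have hle : (j' : ℝ) ≤ j + 1 := by linarith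
  have hjj : j' = j + 1 := by
    have : j' ≤ j + 1 := by exact_mod_cast hle
    omega
  subst hjj
  grind

theorem chart_injective {j : ℕ} (hj : j < k) : Function.Injective (chart k j) := by
  intro z w h
  have e : ∀ i : Fin (k + 1), chartHom j z (i + 1) = chartHom j w (i + 1) := fun i => by
    have := hom_chart j z (some i)
    rw [h, hom_chart, lab_some] at this
    exact this.symm
  have e1 := e ⟨j, by omega⟩
  have e2 := e ⟨k, by omega⟩
  rw [chartHom_self, chartHom_self] at e1
  rw [chartHom_of_gt _ (by simpa using hj), chartHom_of_gt _ (by simpa using hj)] at e2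
  exact Prod.ext (by linarith) (by linarith)

end Chart

end TropGeo

namespace TropGeo

/-! ### Segments and rays with rational directions -/

section Line

variable {n : ℕ}

theorem IsPrimitiveVector.ne_zero {u : Fin n → ℤ} (hu : IsPrimitiveVector u) : u ≠ 0 := by
  rintro rfl
  have : Finset.univ.gcd (0 : Fin n → ℤ) = 0 := Finset.gcd_eq_zero_iff.2 (by simp)
  rw [IsPrimitiveVector, this] at hu
  exact zero_ne_one hu

theorem toReal_ne_zero {u : Fin n → ℤ} (hu : u ≠ 0) : toReal u ≠ 0 := fun h => hu <| by
  ext i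
  have := congrFun h i
  simpa [toReal] using this

theorem toReal_neg (u : Fin n → ℤ) : toReal (-u) = -toReal u := by ext i; simp [toReal]

/-- Integer multiples of a primitive vector. -/
theorem IsPrimitiveVector.exists_eq_smul {u : Fin n → ℤ} (hu : IsPrimitiveVector u)
    {w : Fin n → ℤ} {c : ℝ} (h : toReal w = c • toReal u) : ∃ m : ℤ, c = m ∧ w = m • u := by
  -- Bézout coefficients of the primitive vector express the real factor `c` as an integer.
  obtain ⟨f, hf⟩ := Finset.gcd_eq_sum_mul Finset.univ u
  rw [hu] at hf
  have hc : c = ((∑ i, w i * f i : ℤ) : ℝ) := by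
    have h1 : (1 : ℝ) = ∑ i, (u i : ℝ) * (f i : ℝ) := by exact_mod_cast hf
    push_cast
    calc c = c * 1 := (mul_one c).symm
      _ = ∑ i, (w i : ℝ) * (f i : ℝ) := by
        rw [h1, Finset.mul_sum]
        refine Finset.sum_congr rfl fun i _ => ?_
        have := congrFun h i
        simp only [toReal, Pi.smul_apply, smul_eq_mul] at this
        rw [this]
        ring
  refine ⟨_, hc, toReal_injective ?_⟩
  rw [h, toReal_smul, hc]

variable {a : Fin n → ℝ} {u : Fin n → ℤ}

/-- The parametrized line through `a` in direction `u`. -/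
def along (a : Fin n → ℝ) (u : Fin n → ℤ) (t : ℝ) : Fin n → ℝ := a + t • toReal u

theorem along_injective (hu : u ≠ 0) : Function.Injective (along a u) := fun s t h =>
  smul_left_injective ℝ (toReal_ne_zero hu) (add_left_cancel h)

theorem along_sub (s t : ℝ) : along a u s - along a u t = (s - t) • toReal u := by
  rw [along, along, add_sub_add_left_eq_sub, sub_smul]

theorem along_eq_sum (s t r q : ℝ) (h : r + q = 1) :
    r • along a u s + q • along a u t = along a u (r * s + q * t) := by
  have : r • a + q • a = a := by rw [← add_smul, h, one_smul]
  simp only [along, smul_add, smul_smul, add_smul]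
  nth_rw 3 [← this]
  abel

/-- The coordinate along the line as a functional. -/
theorem exists_functional (hu : u ≠ 0) : ∃ l : (Fin n → ℝ) →L[ℝ] ℝ, 0 < l (toReal u) := by
  obtain ⟨i, hi⟩ := Function.ne_iff.1 hu
  refine ⟨(u i : ℝ) • ContinuousLinearMap.proj i, ?_⟩
  have : (u i : ℝ) ≠ 0 := by exact_mod_cast hi
  exact mul_self_pos.2 this

theorem map_along (l : (Fin n → ℝ) →L[ℝ] ℝ) (t : ℝ) :
    l (along a u t) = l a + t * l (toReal u) := by
  simp [along]

theorem isExposed_min (hu : u ≠ 0) {I : Set ℝ} {t : ℝ} (ht : IsLeast I t) :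
    IsExposed ℝ (along a u '' I) {along a u t} := by
  obtain ⟨l, hl⟩ := exists_functional hu
  refine fun _ => ⟨-l, ?_⟩
  ext x
  simp only [Set.mem_singleton_iff, Set.mem_ofPred_eq, Set.forall_mem_image, neg_apply,
    neg_le_neg_iff, map_along]
  constructor
  · rintro rfl
    refine ⟨⟨t, ht.1, rfl⟩, fun s hs => ?_⟩
    rw [map_along]
    have := ht.2 hs
    gcongr
  · rintro ⟨⟨s, hs, rfl⟩, h⟩
    have := h ht.1
    rw [map_along, add_le_add_iff_left, mul_le_mul_iff_left₀ hl] at this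
    rw [le_antisymm this (ht.2 hs)]

/-- The faces of a segment or ray. -/
theorem face_along {I : Set ℝ} {τ : Set (Fin n → ℝ)} (hne : τ.Nonempty)
    (h : IsExposed ℝ (along a u '' I) τ) :
    τ = along a u '' I ∨ (∃ t, IsLeast I t ∧ τ = {along a u t}) ∨
      ∃ t, IsGreatest I t ∧ τ = {along a u t} := by
  obtain ⟨l, hl⟩ := h hne
  have hmem : ∀ x, x ∈ τ ↔ ∃ s ∈ I, x = along a u s ∧ ∀ t ∈ I, t * l (toReal u) ≤ s * l (toReal u) := by
    intro x
    rw [hl]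
    simp only [Set.mem_ofPred_eq, Set.forall_mem_image, map_along]
    constructor
    · rintro ⟨⟨s, hs, rfl⟩, h⟩
      refine ⟨s, hs, rfl, fun t ht => ?_⟩
      have := h ht
      rw [map_along] at this
      linarith
    · rintro ⟨s, hs, rfl, h⟩
      refine ⟨⟨s, hs, rfl⟩, fun t ht => ?_⟩
      rw [map_along]
      linarith [h t ht]
  obtain ⟨x, hx⟩ := hne
  obtain ⟨s, hs, rfl, hmax⟩ := (hmem x).1 hx
  rcases lt_trichotomy (l (toReal u)) 0 with h0 | h0 | h0
  · refine Or.inr (Or.inl ⟨s, ⟨hs, fun t ht => ?_⟩, ?_⟩)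
    · have := hmax t ht
      nlinarith
    · ext y
      rw [hmem, Set.mem_singleton_iff]
      refine ⟨?_, fun h => ⟨s, hs, h, hmax⟩⟩
      rintro ⟨t, ht, rfl, ht'⟩
      rw [mul_right_cancel₀ h0.ne (le_antisymm (hmax t ht) (ht' s hs))]
  · refine Or.inl ?_
    ext y
    rw [hmem]
    simp only [h0, mul_zero, le_refl, implies_true, and_true]
    exact ⟨fun ⟨t, ht, h⟩ => ⟨t, ht, h.symm⟩, fun ⟨t, ht, h⟩ => ⟨t, ht, h.symm⟩⟩
  · refine Or.inr (Or.inr ⟨s, ⟨hs, fun t ht => ?_⟩, ?_⟩)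
    · have := hmax t ht
      nlinarith
    · ext y
      rw [hmem, Set.mem_singleton_iff]
      refine ⟨?_, fun h => ⟨s, hs, h, hmax⟩⟩
      rintro ⟨t, ht, rfl, ht'⟩
      rw [mul_right_cancel₀ h0.ne' (le_antisymm (hmax t ht) (ht' s hs))]

theorem vectorSpan_along {I : Set ℝ} {s t : ℝ} (hs : s ∈ I) (ht : t ∈ I) (hst : s ≠ t) :
    vectorSpan ℝ (along a u '' I) = Submodule.span ℝ {toReal u} := by
  refine le_antisymm ?_ ?_
  · rw [vectorSpan_def, Submodule.span_le]
    rintro _ ⟨_, ⟨r, -, rfl⟩, _, ⟨q, -, rfl⟩, rfl⟩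
    change along a u r - along a u q ∈ _
    rw [along_sub]
    exact Submodule.smul_mem _ _ (Submodule.mem_span_singleton_self _)
  · rw [Submodule.span_singleton_le_iff_mem]
    have h := vsub_mem_vectorSpan ℝ (Set.mem_image_of_mem (along a u) hs)
      (Set.mem_image_of_mem (along a u) ht)
    rw [vsub_eq_sub, along_sub] at h
    have := Submodule.smul_mem _ (s - t)⁻¹ h
    rwa [smul_smul, inv_mul_cancel₀ (sub_ne_zero.2 hst), one_smul] at this

theorem cellDim_along (hu : u ≠ 0) {I : Set ℝ} {s t : ℝ} (hs : s ∈ I) (ht : t ∈ I) (hst : s ≠ t) :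
    cellDim (along a u '' I) = 1 := by
  rw [cellDim, vectorSpan_along hs ht hst]
  exact finrank_span_singleton (toReal_ne_zero hu)

theorem cellDim_singleton (x : Fin n → ℝ) : cellDim ({x} : Set (Fin n → ℝ)) = 0 := by
  rw [cellDim, vectorSpan_singleton]
  exact finrank_bot ℝ _

theorem isPrimitiveNormal_along (hu : IsPrimitiveVector u) {I : Set ℝ} {t : ℝ} (ht : 0 < t)
    (h0 : (0 : ℝ) ∈ I) (h : t ∈ I) : IsPrimitiveNormal {a} (along a u '' I) u := by
  have hv := vectorSpan_along (a := a) (u := u) h0 h ht.ne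
  refine ⟨le_antisymm (fun w hw => ?_) (sup_le (fun w hw => ?_) ?_), a, rfl, t, ht, ⟨t, h, rfl⟩⟩
  · change toReal w ∈ vectorSpan ℝ _ at hw
    rw [hv, Submodule.mem_span_singleton] at hw
    obtain ⟨c, hc⟩ := hw
    obtain ⟨m, -, rfl⟩ := hu.exists_eq_smul hc.symm
    exact Submodule.mem_sup_right (Submodule.smul_mem _ _ (Submodule.mem_span_singleton_self u))
  · change toReal w ∈ vectorSpan ℝ _ at hw ⊢
    rw [vectorSpan_singleton] at hw
    rw [(Submodule.mem_bot ℝ).1 hw]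
    exact Submodule.zero_mem _
  · rw [Submodule.span_singleton_le_iff_mem]
    change toReal u ∈ vectorSpan ℝ _
    rw [hv]
    exact Submodule.mem_span_singleton_self _

theorem isRationalPolyhedron_singleton (x : Fin n → ℝ) :
    IsRationalPolyhedron ({x} : Set (Fin n → ℝ)) := by
  convert AffineFamily.isRationalPolyhedron_of_fintype (n := n) (κ := Fin n × Bool)
    (fun p => if p.2 then Pi.single p.1 1 else -Pi.single p.1 1)
    (fun p => if p.2 then x p.1 else -x p.1) using 1
  ext y
  simp only [Set.mem_singleton_iff, Set.mem_ofPred_eq, Prod.forall, Bool.forall_bool]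
  constructor
  · rintro rfl i
    simp [Pi.single_apply]
  · intro h
    ext i
    have := h i
    simp [Pi.single_apply] at this
    linarith [this.1, this.2]

theorem mem_along_iff {i : Fin n} (hi : u i ≠ 0) {x : Fin n → ℝ} {t : ℝ} :
    x = along a u t ↔ (x i - a i = t * u i) ∧ ∀ j, (u i : ℝ) * (x j - a j) = u j * (x i - a i) := by
  have hi' : (u i : ℝ) ≠ 0 := by exact_mod_cast hi
  constructor
  · rintro rfl
    simp only [along, toReal, Pi.add_apply, Pi.smul_apply, smul_eq_mul, add_sub_cancel_left]
    exact ⟨trivial, fun j => by ring⟩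
  · rintro ⟨h1, h2⟩
    ext j
    have := h2 j
    rw [h1] at this
    have : x j - a j = t * u j := mul_left_cancel₀ hi' (by rw [this]; ring)
    simp only [along, toReal, Pi.add_apply, Pi.smul_apply, smul_eq_mul]
    linarith

/-- With a nonzero coordinate `u i`, the line is cut out by the minors `u i (x j - a j) = u j (x i -
a i)`, each giving two inequalities, and the ray by the sign of `u i (x i - a i)`. -/
theorem isRationalPolyhedron_ray (hu : u ≠ 0) :
    IsRationalPolyhedron (along a u '' Set.Ici 0) := by
  obtain ⟨i, hi⟩ := Function.ne_iff.1 hu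
  have hi' : (0 : ℝ) < u i * u i := by
    have : (u i : ℝ) ≠ 0 := by exact_mod_cast hi
    exact mul_self_pos.2 this
  convert AffineFamily.isRationalPolyhedron_of_fintype (n := n) (κ := Fin n ⊕ Fin n ⊕ Unit)
    (Sum.elim (fun j => u i • Pi.single j 1 - u j • Pi.single i 1)
      (Sum.elim (fun j => -(u i • Pi.single j 1 - u j • Pi.single i 1))
        (fun _ => -(u i • Pi.single i 1))))
    (Sum.elim (fun j => u i * a j - u j * a i)
      (Sum.elim (fun j => -(u i * a j - u j * a i)) (fun _ => - (u i * a i)))) using 1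
  ext y
  simp only [Set.mem_ofPred_eq, Sum.forall, Sum.elim_inl, Sum.elim_inr]
  have e1 : ∀ j, ∑ x, ((u i • Pi.single j 1 - u j • Pi.single i 1 : Fin n → ℤ) x : ℝ) * y x
      = u i * y j - u j * y i := by
    simp [Pi.single_apply, sub_mul, Finset.sum_sub_distrib]
  have e2 : ∀ j, ∑ x, ((-(u i • Pi.single j 1 - u j • Pi.single i 1) : Fin n → ℤ) x : ℝ) * y x
      = -(u i * y j - u j * y i) := by
    simp [Pi.single_apply, sub_mul, Finset.sum_sub_distrib]
  have e3 : ∑ x, ((-(u i • Pi.single i 1) : Fin n → ℤ) x : ℝ) * y x = -(u i * y i) := by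
    simp [Pi.single_apply]
  simp only [e1, e2, e3]
  constructor
  · rintro ⟨t, ht, rfl⟩
    obtain ⟨h1, h2⟩ := (mem_along_iff (a := a) (t := t) hi).1 rfl
    refine ⟨fun j => ?_, fun j => ?_, fun _ => ?_⟩
    · linarith [h2 j]
    · linarith [h2 j]
    · have : 0 ≤ t * (u i * u i) := mul_nonneg ht hi'.le
      have h3 : (u i : ℝ) * (along a u t i - a i) = t * (u i * u i) := by rw [h1]; ring
      linarith
  · rintro ⟨h1, h2, h3⟩
    have hi0 : (u i : ℝ) ≠ 0 := by exact_mod_cast hi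
    refine ⟨(y i - a i) / u i, ?_, ((mem_along_iff hi).2 ⟨by field_simp, fun j => ?_⟩).symm⟩
    · have h3 := h3 ()
      have : (y i - a i) / u i = (u i * (y i - a i)) / (u i * u i) := by field_simp
      rw [Set.mem_Ici, this]
      exact div_nonneg (by linarith) hi'.le
    · linarith [h1 j, h2 j]

theorem IsRationalPolyhedron.inter {P Q : Set (Fin n → ℝ)} (hP : IsRationalPolyhedron P)
    (hQ : IsRationalPolyhedron Q) : IsRationalPolyhedron (P ∩ Q) := by
  obtain ⟨r, a, b, rfl⟩ := hP
  obtain ⟨s, c, d, rfl⟩ := hQ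
  convert AffineFamily.isRationalPolyhedron_of_fintype (n := n) (κ := Fin r ⊕ Fin s)
    (Sum.elim a c) (Sum.elim b d) using 1
  ext x
  simp [Sum.forall]

end Line

end TropGeo

namespace TropGeo

/-! ### Tropical curves from trivalent graphs -/

/-- A trivalent graph in `ℝⁿ`: each vertex has three half-edges, which are joined in pairs or
unbounded. -/
structure TrivalentGraph (n : ℕ) (V : Type) where
  pos : V → Fin n → ℝ
  dir : V × Fin 3 → Fin n → ℤ
  wt : V × Fin 3 → ℕ
  opp : V × Fin 3 → Option (V × Fin 3)

namespace TrivalentGraph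

variable {n : ℕ} {V : Type} (G : TrivalentGraph n V)

/-- The ray spanned by a half-edge. -/
def ray (h : V × Fin 3) : Set (Fin n → ℝ) := along (G.pos h.1) (G.dir h) '' Set.Ici 0

/-- The ray spanned by a half-edge without its apex. -/
def openRay (h : V × Fin 3) : Set (Fin n → ℝ) := along (G.pos h.1) (G.dir h) '' Set.Ioi 0

/-- The edge of a half-edge. -/
def edge (h : V × Fin 3) : Set (Fin n → ℝ) :=
  {x | x ∈ G.ray h ∧ ∀ h', G.opp h = some h' → x ∈ G.ray h'}

/-- The edge of a half-edge without its vertices. -/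
def openEdge (h : V × Fin 3) : Set (Fin n → ℝ) :=
  {x | x ∈ G.openRay h ∧ ∀ h', G.opp h = some h' → x ∈ G.openRay h'}

/-- The conditions that make a trivalent graph a tropical curve. -/
structure IsTropical : Prop where
  pos_injective : Function.Injective G.pos
  primitive : ∀ h, IsPrimitiveVector (G.dir h)
  wt_pos : ∀ h, 0 < G.wt h
  balance : ∀ v, ∑ s, (G.wt (v, s) : ℤ) • G.dir (v, s) = 0
  opp_symm : ∀ h h', G.opp h = some h' → G.opp h' = some h
  opp_dir : ∀ h h', G.opp h = some h' → G.dir h' = -G.dir h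
  opp_wt : ∀ h h', G.opp h = some h' → G.wt h' = G.wt h
  opp_pos : ∀ h h', G.opp h = some h' →
    ∃ t : ℝ, 0 < t ∧ G.pos h'.1 = along (G.pos h.1) (G.dir h) t
  noncrossing : ∀ h h' x, x ∈ G.openEdge h → x ∈ G.edge h' → h' = h ∨ G.opp h = some h'

variable {G} {h h' : V × Fin 3}

theorem edge_of_none (ho : G.opp h = none) :
    G.edge h = along (G.pos h.1) (G.dir h) '' Set.Ici 0 := by
  ext x
  simp [edge, ray, ho]

theorem openEdge_of_none (ho : G.opp h = none) :
    G.openEdge h = along (G.pos h.1) (G.dir h) '' Set.Ioi 0 := by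
  ext x
  simp [openEdge, openRay, ho]

theorem openEdge_subset : G.openEdge h ⊆ G.edge h := fun _ hx =>
  ⟨Set.image_mono Set.Ioi_subset_Ici_self hx.1,
    fun h' ho => Set.image_mono Set.Ioi_subset_Ici_self (hx.2 h' ho)⟩

namespace IsTropical

variable (hG : G.IsTropical)
include hG

theorem dir_ne_zero (h : V × Fin 3) : G.dir h ≠ 0 := (hG.primitive h).ne_zero

/-- The partner ray is the same line traversed backwards from parameter `l`, so the intersection of
the two rays is parametrized by an interval. -/
theorem exists_length (ho : G.opp h = some h') : ∃ l : ℝ, 0 < l ∧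
    G.pos h'.1 = along (G.pos h.1) (G.dir h) l ∧
    G.edge h = along (G.pos h.1) (G.dir h) '' Set.Icc 0 l ∧
    G.openEdge h = along (G.pos h.1) (G.dir h) '' Set.Ioo 0 l := by
  obtain ⟨l, hl, hpos⟩ := hG.opp_pos h h' ho
  have key : ∀ s, along (G.pos h'.1) (G.dir h') s = along (G.pos h.1) (G.dir h) (l - s) := by
    intro s
    rw [hpos, hG.opp_dir h h' ho, along, along, along, toReal_neg, smul_neg, sub_smul]
    abel
  have hinj := along_injective (a := G.pos h.1) (hG.dir_ne_zero h)
  refine ⟨l, hl, hpos, ?_, ?_⟩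
  · ext x
    simp only [edge, ray, ho, Option.some.injEq, forall_eq', Set.mem_ofPred_eq, Set.mem_image, key]
    constructor
    · grind
    · rintro ⟨t, ⟨h0, h1⟩, rfl⟩
      exact ⟨⟨t, h0, rfl⟩, l - t, sub_nonneg.2 h1, by rw [sub_sub_cancel]⟩
  · ext x
    simp only [openEdge, openRay, ho, Option.some.injEq, forall_eq', Set.mem_ofPred_eq,
      Set.mem_image, key]
    constructor
    · grind
    · rintro ⟨t, ⟨h0, h1⟩, rfl⟩
      exact ⟨⟨t, h0, rfl⟩, l - t, sub_pos.2 h1, by rw [sub_sub_cancel]⟩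

theorem edge_opp (ho : G.opp h = some h') : G.edge h' = G.edge h := by
  ext x
  simp only [edge, ho, hG.opp_symm h h' ho, Option.some.injEq, forall_eq', Set.mem_ofPred_eq]
  exact and_comm

theorem mem_edge_iff {x : Fin n → ℝ} : x ∈ G.edge h ↔
    x = G.pos h.1 ∨ x ∈ G.openEdge h ∨ ∃ h', G.opp h = some h' ∧ x = G.pos h'.1 := by
  have h0 : along (G.pos h.1) (G.dir h) 0 = G.pos h.1 := by simp [along]
  cases ho : G.opp h with
  | none =>
    simp only [edge_of_none ho, openEdge_of_none ho, Set.mem_image, Set.mem_Ici, Set.mem_Ioi,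
      reduceCtorEq, false_and, exists_false, or_false]
    grind
  | some h' =>
    obtain ⟨l, hl, hpos, he, ho'⟩ := hG.exists_length ho
    grind

theorem openEdge_nonempty (h : V × Fin 3) : (G.openEdge h).Nonempty := by
  cases ho : G.opp h with
  | none => rw [openEdge_of_none ho]; exact Set.nonempty_Ioi.image _
  | some h' =>
    obtain ⟨l, hl, -, -, ho'⟩ := hG.exists_length ho
    rw [ho']
    exact (Set.nonempty_Ioo.2 hl).image _

/-- By the noncrossing condition an interior point of an edge knows its half-edge up to pairing, and
open edges are nonempty. -/
theorem edge_eq_iff : G.edge h = G.edge h' ↔ h' = h ∨ G.opp h = some h' := by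
  constructor
  · intro heq
    obtain ⟨x, hx⟩ := hG.openEdge_nonempty h
    exact hG.noncrossing h h' x hx (heq ▸ openEdge_subset hx)
  · rintro (rfl | ho)
    · rfl
    · exact (hG.edge_opp ho).symm

theorem pos_mem_edge (h : V × Fin 3) : G.pos h.1 ∈ G.edge h := hG.mem_edge_iff.2 (Or.inl rfl)

/-- All three half-edges at such a vertex would have to be `h` or its partner, which are only two.
Trivalence is essential here. -/
theorem pos_notMem_openEdge (v : V) (h : V × Fin 3) : G.pos v ∉ G.openEdge h := by
  intro hv
  have h1 := fun s => hG.noncrossing h (v, s) _ hv (hG.pos_mem_edge (v, s))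
  rcases h1 0 with h2 | h2
  · rcases h1 1 with h3 | h3
    · simp [← h2] at h3
    · rcases h1 2 with h4 | h4
      · simp [← h2] at h4
      · simp [h3] at h4
  · rcases h1 1 with h3 | h3
    · rcases h1 2 with h4 | h4
      · simp [← h3] at h4
      · simp [h2] at h4
    · simp [h2] at h3

theorem pos_mem_edge_iff {v : V} : G.pos v ∈ G.edge h ↔ ∃ s, G.edge h = G.edge (v, s) := by
  rw [hG.mem_edge_iff]
  constructor
  · rintro (hv | hv | ⟨h', ho, hv⟩)
    · exact ⟨h.2, by rw [hG.pos_injective hv]⟩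
    · exact absurd hv (hG.pos_notMem_openEdge v h)
    · exact ⟨h'.2, by rw [hG.pos_injective hv, Prod.mk.eta, hG.edge_opp ho]⟩
  · rintro ⟨s, hs⟩
    exact hG.mem_edge_iff.1 (hs ▸ hG.pos_mem_edge (v, s))

theorem edge_star_injective (v : V) : Function.Injective fun s => G.edge (v, s) := by
  intro s s' hs
  rcases hG.edge_eq_iff.1 hs with h1 | h1
  · exact (Prod.mk.inj h1).2.symm
  · obtain ⟨t, ht, hp⟩ := hG.opp_pos _ _ h1
    rw [along, eq_comm, add_eq_left, smul_eq_zero] at hp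
    exact absurd hp (not_or.2 ⟨ht.ne', toReal_ne_zero (hG.dir_ne_zero _)⟩)

theorem exists_along (h : V × Fin 3) : ∃ (I : Set ℝ) (t : ℝ), 0 < t ∧ 0 ∈ I ∧ t ∈ I ∧
    G.edge h = along (G.pos h.1) (G.dir h) '' I := by
  cases ho : G.opp h with
  | none => exact ⟨Set.Ici 0, 1, one_pos, Set.mem_Ici.2 le_rfl, Set.mem_Ici.2 zero_le_one, edge_of_none ho⟩
  | some h' =>
    obtain ⟨l, hl, -, he, -⟩ := hG.exists_length ho
    exact ⟨Set.Icc 0 l, l, hl, ⟨le_rfl, hl.le⟩, ⟨hl.le, le_rfl⟩, he⟩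

theorem cellDim_edge (h : V × Fin 3) : cellDim (G.edge h) = 1 := by
  obtain ⟨I, t, ht, h0, h1, he⟩ := hG.exists_along h
  rw [he]
  exact cellDim_along (hG.dir_ne_zero h) h0 h1 ht.ne

theorem isPrimitiveNormal_edge (h : V × Fin 3) :
    IsPrimitiveNormal {G.pos h.1} (G.edge h) (G.dir h) := by
  obtain ⟨I, t, ht, h0, h1, he⟩ := hG.exists_along h
  rw [he]
  exact isPrimitiveNormal_along (hG.primitive h) ht h0 h1

theorem isRationalPolyhedron_edge (h : V × Fin 3) : IsRationalPolyhedron (G.edge h) := by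
  cases ho : G.opp h with
  | none => rw [edge_of_none ho]; exact isRationalPolyhedron_ray (hG.dir_ne_zero h)
  | some h' =>
    have : G.edge h = G.ray h ∩ G.ray h' := by simp [edge, ho]
    rw [this]
    exact (isRationalPolyhedron_ray (hG.dir_ne_zero h)).inter
      (isRationalPolyhedron_ray (hG.dir_ne_zero h'))

/-- The points of an edge between two others lie in its interior. -/
theorem midpoint_mem_openEdge {x y : Fin n → ℝ} (hx : x ∈ G.edge h) (hy : y ∈ G.edge h)
    (hxy : x ≠ y) : (1 / 2 : ℝ) • x + (1 / 2 : ℝ) • y ∈ G.openEdge h := by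
  cases ho : G.opp h with
  | none =>
    rw [edge_of_none ho] at hx hy
    rw [openEdge_of_none ho]
    obtain ⟨s, hs, rfl⟩ := hx
    obtain ⟨t, ht, rfl⟩ := hy
    rw [along_eq_sum _ _ _ _ (by norm_num)]
    grind
  | some h' =>
    obtain ⟨l, hl, -, he, ho'⟩ := hG.exists_length ho
    rw [he] at hx hy
    rw [ho']
    obtain ⟨s, ⟨hs, hs'⟩, rfl⟩ := hx
    obtain ⟨t, ⟨ht, ht'⟩, rfl⟩ := hy
    rw [along_eq_sum _ _ _ _ (by norm_num)]
    grind

theorem midpoint_mem_edge {x y : Fin n → ℝ} (hx : x ∈ G.edge h) (hy : y ∈ G.edge h)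
    (hxy : x ≠ y) : (1 / 2 : ℝ) • x + (1 / 2 : ℝ) • y ∈ G.edge h :=
  openEdge_subset (hG.midpoint_mem_openEdge hx hy hxy)

theorem isExposed_pos (h : V × Fin 3) : IsExposed ℝ (G.edge h) {G.pos h.1} := by
  have h0 : along (G.pos h.1) (G.dir h) 0 = G.pos h.1 := by simp [along]
  rw [← h0]
  cases ho : G.opp h with
  | none =>
    rw [edge_of_none ho]
    exact isExposed_min (hG.dir_ne_zero h) isLeast_Ici
  | some h' =>
    obtain ⟨l, hl, -, he, ho'⟩ := hG.exists_length ho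
    rw [he]
    exact isExposed_min (hG.dir_ne_zero h) (isLeast_Icc hl.le)

theorem face_edge {τ : Set (Fin n → ℝ)} (hne : τ.Nonempty) (hτ : IsExposed ℝ (G.edge h) τ) :
    τ = G.edge h ∨ ∃ v, τ = {G.pos v} := by
  have h0 : along (G.pos h.1) (G.dir h) 0 = G.pos h.1 := by simp [along]
  cases ho : G.opp h with
  | none =>
    rw [edge_of_none ho] at hτ ⊢
    rcases face_along hne hτ with h1 | ⟨t, ht, h1⟩ | ⟨t, ht, -⟩
    · exact Or.inl h1
    · rw [ht.unique isLeast_Ici, h0] at h1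
      exact Or.inr ⟨_, h1⟩
    · have h2 := ht.2 (Set.mem_Ici.2 (add_nonneg ht.1 zero_le_one) : t + 1 ∈ Set.Ici (0 : ℝ))
      linarith
  | some h' =>
    obtain ⟨l, hl, hpos, he, -⟩ := hG.exists_length ho
    rw [he] at hτ ⊢
    rcases face_along hne hτ with h1 | ⟨t, ht, h1⟩ | ⟨t, ht, h1⟩
    · exact Or.inl h1
    · rw [ht.unique (isLeast_Icc hl.le), h0] at h1
      exact Or.inr ⟨_, h1⟩
    · rw [ht.unique (isGreatest_Icc hl.le), ← hpos] at h1
      exact Or.inr ⟨_, h1⟩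

/-- Distinct edges cannot share an interior point, so a common point is a vertex. Two common points
would have their midpoint in the interior of the first edge and on the second. -/
theorem inter_edge (hne : (G.edge h ∩ G.edge h').Nonempty) :
    G.edge h = G.edge h' ∨ ∃ v s s', G.edge h = G.edge (v, s) ∧ G.edge h' = G.edge (v, s') ∧
      G.edge h ∩ G.edge h' = {G.pos v} := by
  by_cases heq : G.edge h = G.edge h'
  · exact Or.inl heq
  obtain ⟨x, hx, hx'⟩ := hne
  have hno : ∀ y, y ∈ G.openEdge h → y ∉ G.edge h' := fun y hy hy' =>
    heq (hG.edge_eq_iff.2 (hG.noncrossing h h' y hy hy'))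
  obtain ⟨v, rfl⟩ : ∃ v, x = G.pos v := by
    rcases hG.mem_edge_iff.1 hx with h1 | h1 | ⟨h2, -, h1⟩
    · exact ⟨_, h1⟩
    · exact absurd hx' (hno x h1)
    · exact ⟨_, h1⟩
  obtain ⟨s, hs⟩ := hG.pos_mem_edge_iff.1 hx
  obtain ⟨s', hs'⟩ := hG.pos_mem_edge_iff.1 hx'
  refine Or.inr ⟨v, s, s', hs, hs', Set.eq_singleton_iff_unique_mem.2 ⟨⟨hx, hx'⟩, ?_⟩⟩
  rintro y ⟨hy, hy'⟩
  by_contra hne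
  exact hno _ (hG.midpoint_mem_openEdge hy hx hne) (hG.midpoint_mem_edge hy' hx' hne)

omit hG in
open Classical in
variable (G) in
/-- The weight of an edge. -/
def weight (F : Set (Fin n → ℝ)) : ℕ := if hF : ∃ h, F = G.edge h then G.wt hF.choose else 0

theorem weight_edge (h : V × Fin 3) : weight G (G.edge h) = G.wt h := by
  have hF : ∃ h', G.edge h = G.edge h' := ⟨h, rfl⟩
  rw [weight, dif_pos hF]
  rcases hG.edge_eq_iff.1 hF.choose_spec with h1 | h1
  · rw [h1]
  · exact hG.opp_wt _ _ h1

variable [Fintype V]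

omit hG in
open Classical in
variable (G) in
/-- The cells of the tropical curve. -/
def cells : Finset (Set (Fin n → ℝ)) :=
  (Finset.univ.image fun v => {G.pos v}) ∪ Finset.univ.image G.edge

omit hG in
theorem mem_cells {σ : Set (Fin n → ℝ)} :
    σ ∈ cells G ↔ (∃ v, σ = {G.pos v}) ∨ ∃ h, σ = G.edge h := by
  simp [cells, eq_comm]

omit hG in
theorem mem_cells_of_dim {σ : Set (Fin n → ℝ)} (hσ : σ ∈ cells G) (hd : cellDim σ = 1) :
    ∃ h, σ = G.edge h := by
  rcases mem_cells.1 hσ with ⟨v, rfl⟩ | h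
  · rw [cellDim_singleton] at hd
    exact absurd hd zero_ne_one
  · exact h

/-- The polyhedral complex of a tropical graph. -/
def complex : PolyhedralComplex n where
  cells := cells G
  nonempty σ hσ := by
    rcases mem_cells.1 hσ with ⟨v, rfl⟩ | ⟨h, rfl⟩
    · exact Set.singleton_nonempty _
    · exact ⟨_, hG.pos_mem_edge h⟩
  polyhedron σ hσ := by
    rcases mem_cells.1 hσ with ⟨v, rfl⟩ | ⟨h, rfl⟩
    · exact isRationalPolyhedron_singleton _
    · exact hG.isRationalPolyhedron_edge h
  face_mem σ hσ τ hne hτ := by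
    rw [mem_cells]
    rcases mem_cells.1 hσ with ⟨v, rfl⟩ | ⟨h, rfl⟩
    · refine Or.inl ⟨v, ?_⟩
      rcases Set.subset_singleton_iff_eq.1 hτ.subset with h1 | h1
      · exact absurd h1 hne.ne_empty
      · exact h1
    · rcases hG.face_edge hne hτ with h1 | h1
      · exact Or.inr ⟨h, h1⟩
      · exact Or.inl h1
  inter_face σ hσ τ hτ hne := by
    rcases mem_cells.1 hσ with ⟨v, rfl⟩ | ⟨h, rfl⟩
    · obtain ⟨x, hx, hx'⟩ := hne
      rw [Set.mem_singleton_iff] at hx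
      subst hx
      rw [Set.singleton_inter_of_mem hx']
    · rcases mem_cells.1 hτ with ⟨v, rfl⟩ | ⟨h', rfl⟩
      · obtain ⟨x, hx', hx⟩ := hne
        rw [Set.mem_singleton_iff] at hx
        subst hx
        rw [Set.inter_singleton_of_mem hx']
        obtain ⟨s, hs⟩ := hG.pos_mem_edge_iff.1 hx'
        rw [hs]
        exact hG.isExposed_pos (v, s)
      · rcases hG.inter_edge hne with h1 | ⟨v, s, s', h1, -, h2⟩
        · rw [h1, Set.inter_self]
        · rw [h2, h1]
          exact hG.isExposed_pos (v, s)

open Classical in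
/-- The tropical curve of a tropical graph. -/
def curve : TropicalCurve n where
  toPolyhedralComplex := hG.complex
  pure σ hσ := by
    rcases mem_cells.1 hσ with ⟨v, rfl⟩ | ⟨h, rfl⟩
    · exact ⟨_, mem_cells.2 (Or.inr ⟨(v, 0), rfl⟩),
        Set.singleton_subset_iff.2 (hG.pos_mem_edge (v, 0)), hG.cellDim_edge _⟩
    · exact ⟨_, hσ, subset_rfl, hG.cellDim_edge h⟩
  weight := weight G
  weight_pos F hF hd := by
    obtain ⟨h, rfl⟩ := mem_cells_of_dim hF hd
    rw [hG.weight_edge]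
    exact hG.wt_pos h
  balanced τ hτ hd := by
    rcases mem_cells.1 hτ with ⟨v, rfl⟩ | ⟨h, rfl⟩
    swap
    · rw [hG.cellDim_edge] at hd
      omega
    have hfac : ∀ F ∈ cells G, cellDim F = 1 → {G.pos v} ⊆ F → ∃ s, F = G.edge (v, s) := by
      intro F hF hF1 hv
      obtain ⟨h, rfl⟩ := mem_cells_of_dim hF hF1
      exact hG.pos_mem_edge_iff.1 (Set.singleton_subset_iff.1 hv)
    -- The normal of an edge at `v` is the direction of the half-edge at `v` that spans it; this
    -- half-edge is unique by `edge_star_injective`.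
    let u : Set (Fin n → ℝ) → (Fin n → ℤ) := fun F =>
      if hF : ∃ s, F = G.edge (v, s) then G.dir (v, hF.choose) else 0
    have hu : ∀ s, u (G.edge (v, s)) = G.dir (v, s) := by
      intro s
      have hF : ∃ s', G.edge (v, s) = G.edge (v, s') := ⟨s, rfl⟩
      simp only [u]
      rw [dif_pos hF, ← hG.edge_star_injective v hF.choose_spec]
    refine ⟨u, fun F hF hF1 hv => ?_, ?_⟩
    · obtain ⟨s, rfl⟩ := hfac F hF hF1 hv
      rw [hu]
      exact hG.isPrimitiveNormal_edge (v, s)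
    · have himg : (cells G).filter (fun F => cellDim F = 1 ∧ {G.pos v} ⊆ F) =
          Finset.univ.image fun s => G.edge (v, s) := by
        ext F
        simp only [Finset.mem_filter, Finset.mem_image, Finset.mem_univ, true_and]
        constructor
        · rintro ⟨hF, hF1, hv⟩
          obtain ⟨s, hs⟩ := hfac F hF hF1 hv
          exact ⟨s, hs.symm⟩
        · rintro ⟨s, rfl⟩
          exact ⟨mem_cells.2 (Or.inr ⟨_, rfl⟩), hG.cellDim_edge _,
            Set.singleton_subset_iff.2 (hG.pos_mem_edge (v, s))⟩
      change ∑ F ∈ (cells G).filter (fun F => cellDim F = 1 ∧ {G.pos v} ⊆ F), _ ∈ _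
      rw [himg, Finset.sum_image fun s _ s' _ h => hG.edge_star_injective v h]
      have hb := congrArg toReal (hG.balance v)
      rw [toReal_sum] at hb
      have : ∑ s, (weight G (G.edge (v, s)) : ℝ) • toReal (u (G.edge (v, s))) = 0 := by
        rw [show (0 : Fin n → ℝ) = toReal 0 by ext i; simp [toReal], ← hb]
        refine Finset.sum_congr rfl fun s _ => ?_
        rw [hu, hG.weight_edge, toReal_smul, Int.cast_natCast]
      rw [this]
      exact Submodule.zero_mem _

theorem curve_weight (h : V × Fin 3) : hG.curve.weight (G.edge h) = G.wt h := hG.weight_edge h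

theorem mem_support {x : Fin n → ℝ} : x ∈ hG.curve.support ↔ ∃ h, x ∈ G.edge h := by
  constructor
  · rintro ⟨σ, hσ, hx⟩
    rcases mem_cells.1 hσ with ⟨v, rfl⟩ | ⟨h, rfl⟩
    · rw [Set.mem_singleton_iff.1 hx]
      exact ⟨(v, 0), hG.pos_mem_edge (v, 0)⟩
    · exact ⟨h, hx⟩
  · rintro ⟨h, hx⟩
    exact ⟨_, mem_cells.2 (Or.inr ⟨h, rfl⟩), hx⟩

end IsTropical

end TrivalentGraph

end TropGeo

namespace TropGeo

/-! ### Ends, recession fan and local structure of the curve of a trivalent graph -/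

theorem IsRationalPolyhedron.isClosed {n : ℕ} {P : Set (Fin n → ℝ)} (hP : IsRationalPolyhedron P) :
    IsClosed P := by
  obtain ⟨r, a, b, rfl⟩ := hP
  simp only [Set.ofPred_forall]
  exact isClosed_iInter fun i => isClosed_le (by fun_prop) continuous_const

theorem segment_eq_along {n : ℕ} {a : Fin n → ℝ} {u : Fin n → ℤ} {l : ℝ} (hl : 0 < l) :
    segment ℝ a (along a u l) = along a u '' Set.Icc 0 l := by
  rw [segment_eq_image']
  ext x
  simp only [along, add_sub_cancel_left, Set.mem_image, smul_smul]
  constructor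
  · rintro ⟨θ, ⟨h0, h1⟩, rfl⟩
    exact ⟨θ * l, ⟨by positivity, by nlinarith⟩, rfl⟩
  · rintro ⟨t, ⟨h0, h1⟩, rfl⟩
    exact ⟨t / l, ⟨by positivity, (div_le_one hl).2 h1⟩, by rw [div_mul_cancel₀ _ hl.ne']⟩

theorem stdDir_injective {n : ℕ} : Function.Injective (stdDir n) := by
  rintro (_ | i) (_ | j) h
  · rfl
  · have := congrFun h j
    simp [stdDir] at this
  · have := congrFun h i
    simp [stdDir] at this
  · have := congrFun h i
    by_contra hne
    have hne : i ≠ j := fun h => hne (by rw [h])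
    simp [stdDir, hne] at this

theorem sup_stdDir {n : ℕ} (hn : 0 < n) (i : Option (Fin n)) :
    Finset.univ.sup (fun j => (stdDir n i j).toNat) = if i = none then 1 else 0 := by
  cases i with
  | none =>
    have : Nonempty (Fin n) := ⟨⟨0, hn⟩⟩
    simp [stdDir, Finset.sup_const Finset.univ_nonempty]
  | some i =>
    refine Nat.le_zero.1 (Finset.sup_le fun j _ => ?_)
    simp only [stdDir, Pi.neg_apply, Pi.single_apply]
    split_ifs <;> simp

namespace TrivalentGraph.IsTropical

variable {n : ℕ} {V : Type} {G : TrivalentGraph n V} {h h' : V × Fin 3} (hG : G.IsTropical)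
include hG

theorem edge_eq_segment (ho : G.opp h = some h') :
    G.edge h = segment ℝ (G.pos h.1) (G.pos h'.1) := by
  obtain ⟨l, hl, hpos, he, -⟩ := hG.exists_length ho
  rw [hpos, he, segment_eq_along hl]

theorem pos_ne_of_opp (ho : G.opp h = some h') : G.pos h.1 ≠ G.pos h'.1 := by
  obtain ⟨t, ht, hp⟩ := hG.opp_pos _ _ ho
  intro heq
  rw [← heq, along, eq_comm, add_eq_left, smul_eq_zero] at hp
  exact absurd hp (not_or.2 ⟨ht.ne', toReal_ne_zero (hG.dir_ne_zero _)⟩)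

theorem exists_openEdge_along (h : V × Fin 3) : ∃ J : Set ℝ, IsOpen J ∧
    G.openEdge h = along (G.pos h.1) (G.dir h) '' J := by
  cases ho : G.opp h with
  | none => exact ⟨_, isOpen_Ioi, openEdge_of_none ho⟩
  | some h' =>
    obtain ⟨l, -, -, -, he⟩ := hG.exists_length ho
    exact ⟨_, isOpen_Ioo, he⟩

section Finite

variable [Fintype V]

/-- On an unpaired half-edge, the end direction and the half-edge direction are nonnegative integer
multiples of each other, hence equal. A paired half-edge spans a segment, which contains no ray. -/
theorem isEnd_iff {e : Set (Fin n → ℝ)} {u : Fin n → ℤ} :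
    hG.curve.IsEnd e u ↔ ∃ h, G.opp h = none ∧ e = G.edge h ∧ u = G.dir h := by
  constructor
  · rintro ⟨he, hd, hu, hray⟩
    obtain ⟨h, rfl⟩ := mem_cells_of_dim he hd
    have hinj := along_injective (a := G.pos h.1) (hG.dir_ne_zero h)
    have hmem : ∀ t : ℝ, 0 ≤ t → G.pos h.1 + t • toReal u ∈ G.edge h :=
      hray _ (hG.pos_mem_edge h)
    obtain ⟨s, hs, hs'⟩ := (hmem 1 zero_le_one).1
    rw [one_smul, along, add_right_inj] at hs'
    obtain ⟨m, rfl, hm⟩ := (hG.primitive h).exists_eq_smul hs'.symm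
    cases ho : G.opp h with
    | none =>
      refine ⟨h, ho, rfl, ?_⟩
      have hm0 : m ≠ 0 := by
        rintro rfl
        rw [zero_smul] at hm
        exact hu.ne_zero hm
      have hm1 : (0 : ℝ) ≤ m := hs
      have hm2 : 0 ≤ m := by exact_mod_cast hm1
      have hm3 : toReal (G.dir h) = ((m : ℝ)⁻¹) • toReal u := by
        rw [← hs', smul_smul, inv_mul_cancel₀ (by exact_mod_cast hm0), one_smul]
      obtain ⟨m', hm', -⟩ := hu.exists_eq_smul hm3
      have : m * m' = 1 := by
        have : (m : ℝ) * m' = 1 := by rw [← hm', mul_inv_cancel₀ (by exact_mod_cast hm0)]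
        exact_mod_cast this
      rw [hm, Int.eq_one_of_mul_eq_one_right hm2 this, one_smul]
    | some h' =>
      obtain ⟨l, hl, -, he, -⟩ := hG.exists_length ho
      obtain ⟨t, ⟨-, ht⟩, hlt⟩ := he ▸ hmem (l + 1) (by linarith)
      have h1 : along (G.pos h.1) (G.dir h) t = along (G.pos h.1) (G.dir h) ((l + 1) * m) := by
        rw [hlt, ← hs', along, smul_smul]
      have h2 := hinj h1
      have hm0 : m ≠ 0 := by
        rintro rfl
        rw [zero_smul] at hm
        exact hu.ne_zero hm
      have hm1 : (0 : ℝ) ≤ m := hs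
      have hm2 : 0 ≤ m := by exact_mod_cast hm1
      have hm3 : (1 : ℝ) ≤ m := by exact_mod_cast (show 1 ≤ m by omega)
      nlinarith
  · rintro ⟨h, ho, rfl, rfl⟩
    refine ⟨mem_cells.2 (Or.inr ⟨h, rfl⟩), hG.cellDim_edge h, hG.primitive h, ?_⟩
    rw [edge_of_none ho]
    rintro _ ⟨s, hs, rfl⟩ t ht
    exact ⟨s + t, add_nonneg hs ht, by rw [along, along, add_smul, add_assoc]⟩

omit [Fintype V] in
theorem edge_injOn_rays (ho : G.opp h = none) (heq : G.edge h = G.edge h') : h = h' := by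
  rcases hG.edge_eq_iff.1 heq with h1 | h1
  · exact h1.symm
  · grind

open Classical in
theorem recessionFan_apply (u : Fin n → ℤ) :
    hG.curve.recessionFan u = ∑ h with G.opp h = none ∧ G.dir h = u, G.wt h := by
  have himg : hG.curve.cells.filter (fun e => hG.curve.IsEnd e u) =
      (Finset.univ.filter fun h => G.opp h = none ∧ G.dir h = u).image G.edge := by
    ext e
    simp only [Finset.mem_filter, hG.isEnd_iff, Finset.mem_image, Finset.mem_univ, true_and]
    constructor
    · grind
    · rintro ⟨h, ⟨ho, rfl⟩, rfl⟩
      exact ⟨mem_cells.2 (Or.inr ⟨h, rfl⟩), h, ho, rfl, rfl⟩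
  unfold TropicalVariety.recessionFan
  rw [himg, Finset.sum_image]
  · exact Finset.sum_congr rfl fun h _ => hG.curve_weight h
  · intro h hh h' _ heq
    simp only [Finset.coe_filter, Finset.mem_univ, true_and, Set.mem_ofPred_eq] at hh
    exact hG.edge_injOn_rays hh.1 heq

open Classical in
theorem curveDegree_eq_sum :
    hG.curve.curveDegree =
      ∑ h with G.opp h = none, G.wt h * Finset.univ.sup (fun j => (G.dir h j).toNat) := by
  have himg : {q : Set (Fin n → ℝ) × (Fin n → ℤ) | hG.curve.IsEnd q.1 q.2} =
      ((Finset.univ.filter fun h => G.opp h = none).image fun h => (G.edge h, G.dir h) :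
        Finset (Set (Fin n → ℝ) × (Fin n → ℤ))) := by
    ext ⟨e, u⟩
    simp only [Set.mem_ofPred_eq, hG.isEnd_iff, Finset.coe_image, Finset.coe_filter,
      Finset.mem_univ, true_and, Set.mem_image, Prod.mk.injEq]
    grind
  unfold TropicalVariety.curveDegree
  rw [himg, finsum_mem_coe_finset, Finset.sum_image]
  · exact Finset.sum_congr rfl fun h _ => by rw [hG.curve_weight h]
  · intro h hh h' _ heq
    simp only [Finset.coe_filter, Finset.mem_univ, true_and, Set.mem_ofPred_eq] at hh
    exact hG.edge_injOn_rays hh (Prod.mk.inj heq).1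

/-- If all ends have standard directions, the degree is the weight of the recession fan in
direction `(1, …, 1)`. -/
theorem curveDegree_eq (hn : 0 < n) (hstd : ∀ h, G.opp h = none → ∃ i, G.dir h = stdDir n i) :
    hG.curve.curveDegree = hG.curve.recessionFan (stdDir n none) := by
  rw [hG.curveDegree_eq_sum, hG.recessionFan_apply, ← Finset.filter_filter, Finset.sum_filter (G.dir · = _)]
  refine Finset.sum_congr rfl fun h hh => ?_
  obtain ⟨i, hi⟩ := hstd h (Finset.mem_filter.1 hh).2
  rw [hi, sup_stdDir hn]
  by_cases h0 : i = none
  · simp [h0]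
  · rw [if_neg h0, if_neg fun hc => h0 (stdDir_injective hc), mul_zero]

/-- The local structure at an interior point of an edge. -/
theorem eventually_mem_support {x : Fin n → ℝ} (hx : x ∈ G.openEdge h) :
    ∀ᶠ y in 𝓝 x, y ∈ hG.curve.support ↔ y - x ∈ Submodule.span ℝ {toReal (G.dir h)} := by
  obtain ⟨J, hJ, he⟩ := hG.exists_openEdge_along h
  obtain ⟨l, hl⟩ := exists_functional (hG.dir_ne_zero h)
  rw [he] at hx
  obtain ⟨t, ht, rfl⟩ := hx
  have hxo : along (G.pos h.1) (G.dir h) t ∈ G.openEdge h := he ▸ ⟨t, ht, rfl⟩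
  have h1 : ∀ᶠ y in 𝓝 (along (G.pos h.1) (G.dir h) t),
      t + l (y - along (G.pos h.1) (G.dir h) t) / l (toReal (G.dir h)) ∈ J := by
    have hc : Continuous fun y : Fin n → ℝ =>
        t + l (y - along (G.pos h.1) (G.dir h) t) / l (toReal (G.dir h)) := by fun_prop
    refine hc.continuousAt.eventually_mem (hJ.mem_nhds ?_)
    simpa using ht
  -- There are finitely many edges and they are closed, so those avoiding `x` avoid a neighbourhood
  -- of it.
  have h2 : ∀ᶠ y in 𝓝 (along (G.pos h.1) (G.dir h) t), ∀ h', G.edge h' ≠ G.edge h →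
      y ∉ G.edge h' := by
    rw [Filter.eventually_all]
    intro h'
    by_cases heq : G.edge h' = G.edge h
    · exact Filter.Eventually.of_forall fun y hy => absurd heq hy
    · have hcl : IsClosed (G.edge h') := (hG.isRationalPolyhedron_edge h').isClosed
      have hnot : along (G.pos h.1) (G.dir h) t ∉ G.edge h' := fun hmem =>
        heq (hG.edge_eq_iff.2 (hG.noncrossing h h' _ hxo hmem)).symm
      filter_upwards [hcl.isOpen_compl.mem_nhds hnot] with y hy _ using hy
  filter_upwards [h1, h2] with y hy1 hy2
  rw [hG.mem_support, Submodule.mem_span_singleton]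
  constructor
  · rintro ⟨h', hy⟩
    have hy' : y ∈ G.edge h := by grind
    obtain ⟨s, -, rfl⟩ := hy'.1
    exact ⟨s - t, (along_sub s t).symm⟩
  · rintro ⟨c, hc⟩
    refine ⟨h, openEdge_subset ?_⟩
    rw [he]
    refine ⟨_, hy1, ?_⟩
    rw [← hc, map_smul, smul_eq_mul, mul_div_cancel_right₀ _ hl.ne', along, add_smul, hc, ← add_assoc]
    change along (G.pos h.1) (G.dir h) t + (y - along (G.pos h.1) (G.dir h) t) = y
    abel

theorem weight_eq_of_mem_openEdge {x : Fin n → ℝ} (hx : x ∈ G.openEdge h) {e : Set (Fin n → ℝ)}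
    (he : e ∈ hG.curve.cells) (hd : cellDim e = 1) (hxe : x ∈ e) :
    hG.curve.weight e = G.wt h := by
  obtain ⟨h', rfl⟩ := mem_cells_of_dim he hd
  rw [hG.curve_weight]
  rcases hG.noncrossing h h' x hx hxe with rfl | ho
  · rfl
  · exact hG.opp_wt _ _ ho

end Finite

end TrivalentGraph.IsTropical

/-! ### The genus -/

section Genus

variable {n : ℕ} (C : TropicalCurve n)

theorem TropicalVariety.Adj.symm {C : TropicalCurve n} {v w : C.Vertex} (h : C.Adj v w) :
    C.Adj w v := ⟨h.1.symm, by rw [segment_symm]; exact h.2⟩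

open Classical in
/-- The number of oriented bounded edges. -/
theorem two_mul_finrank_chainsOne (K : Type*) [Field K] :
    2 * Module.finrank K (C.chainsOne K) =
      Fintype.card {q : C.Vertex × C.Vertex // C.Adj q.1 q.2} := by
  -- An arbitrary linear order on the vertices orients every edge, and a chain is determined by its
  -- values on the edges oriented upwards.
  let o := Fintype.equivFin C.Vertex
  let φ : C.chainsOne K →ₗ[K] ({q : C.Vertex × C.Vertex // C.Adj q.1 q.2 ∧ o q.1 < o q.2} → K) :=
    { toFun := fun f q => f.1 q.1.1 q.1.2
      map_add' := fun f g => rfl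
      map_smul' := fun c f => rfl }
  have hφ : Function.Bijective φ := by
    constructor
    · rw [← LinearMap.ker_eq_bot, LinearMap.ker_eq_bot']
      intro f hf
      ext v w
      change f.1 v w = 0
      by_cases hvw : C.Adj v w
      · rcases lt_or_gt_of_ne (o.injective.ne hvw.1) with h1 | h1
        · exact congrFun hf ⟨(v, w), hvw, h1⟩
        · rw [f.2.1 w v, neg_eq_zero]
          exact congrFun hf ⟨(w, v), hvw.symm, h1⟩
      · exact f.2.2 v w hvw
    · intro g
      let f : C.Vertex → C.Vertex → K := fun v w =>
        if h : C.Adj v w ∧ o v < o w then g ⟨(v, w), h⟩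
        else if h : C.Adj w v ∧ o w < o v then -g ⟨(w, v), h⟩ else 0
      refine ⟨⟨f, fun v w => ?_, fun v w hvw => ?_⟩, ?_⟩
      · grind
      · simp only [f]
        rw [dif_neg (fun h => hvw h.1), dif_neg (fun h => hvw h.1.symm)]
      · ext ⟨⟨v, w⟩, hq⟩
        change f v w = _
        simp only [f]
        rw [dif_pos hq]
  rw [(LinearEquiv.ofBijective φ hφ).finrank_eq, Module.finrank_fintype_fun_eq_card]
  have e : {q : C.Vertex × C.Vertex // C.Adj q.1 q.2} ≃
      {q : C.Vertex × C.Vertex // C.Adj q.1 q.2 ∧ o q.1 < o q.2} ⊕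
        {q : C.Vertex × C.Vertex // C.Adj q.1 q.2 ∧ o q.1 < o q.2} :=
    { toFun := fun q => if h : o q.1.1 < o q.1.2 then Sum.inl ⟨q.1, q.2, h⟩
        else Sum.inr ⟨q.1.swap, q.2.symm, lt_of_le_of_ne (not_lt.1 h) (o.injective.ne q.2.1.symm)⟩
      invFun := Sum.elim (fun q => ⟨q.1, q.2.1⟩) (fun q => ⟨q.1.swap, q.2.1.symm⟩)
      left_inv := by grind
      right_inv := by
        rintro (⟨q, hq⟩ | ⟨q, hq⟩)
        · simp [hq.2]
        · simp [hq.2.not_gt] }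
  rw [Fintype.card_congr e, Fintype.card_sum, two_mul]

theorem sum_boundary (K : Type*) [Field K] (f : C.chainsOne K) : ∑ v, C.boundary K f v = 0 := by
  change ∑ v, ∑ w, f.1 w v = 0
  rw [← Finset.sum_product']
  refine Finset.sum_involution (fun q _ => q.swap) (fun q _ => ?_) (fun q _ hq heq => ?_)
    (fun q _ => Finset.mem_univ _) (fun q _ => q.swap_swap)
  · change f.1 q.2 q.1 + f.1 q.1 q.2 = 0
    rw [f.2.1 q.2 q.1]
    ring
  -- Pairs `(v, v)` fixed by the involution contribute zero because no vertex is adjacent to itself;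
  -- antisymmetry alone would not give this in characteristic two.
  · refine hq (f.2.2 _ _ fun h => h.1 ?_)
    exact congrArg Prod.fst heq

/-- The genus of a connected tropical curve. -/
theorem genus_add_card_vertex (K : Type*) [Field K]
    (hconn : ∀ v w : C.Vertex, Relation.ReflTransGen C.Adj v w) [Nonempty C.Vertex] :
    C.genus K + Fintype.card C.Vertex = Module.finrank K (C.chainsOne K) + 1 := by
  classical
  let σ : (C.Vertex → K) →ₗ[K] K := ∑ v, LinearMap.proj v
  have hσ : ∀ g, σ g = ∑ v, g v := fun g => by simp [σ]
  have hstep : ∀ v w, C.Adj v w →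
      (Pi.single w 1 - Pi.single v 1 : C.Vertex → K) ∈ LinearMap.range (C.boundary K) := by
    intro v w hvw
    refine ⟨⟨fun a b => (if a = v ∧ b = w then 1 else 0) - if a = w ∧ b = v then 1 else 0,
      fun a b => ?_, fun a b hab => ?_⟩, ?_⟩
    · grind
    · have h1 : ¬ (a = v ∧ b = w) := by rintro ⟨rfl, rfl⟩; exact hab hvw
      have h2 : ¬ (a = w ∧ b = v) := by rintro ⟨rfl, rfl⟩; exact hab hvw.symm
      simp only [h1, h2, if_false, sub_zero]
    · ext x
      change ∑ a, ((if a = v ∧ x = w then (1 : K) else 0) - if a = w ∧ x = v then 1 else 0) = _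
      simp only [Finset.sum_sub_distrib, ite_and, Finset.sum_ite_eq', Finset.mem_univ, if_true,
        Pi.sub_apply, Pi.single_apply]
  have hall : ∀ v w, (Pi.single w 1 - Pi.single v 1 : C.Vertex → K) ∈
      LinearMap.range (C.boundary K) := by
    intro v w
    induction hconn v w with
    | refl => rw [sub_self]; exact Submodule.zero_mem _
    | tail _ h ih =>
      have := Submodule.add_mem _ ih (hstep _ _ h)
      rwa [add_comm, sub_add_sub_cancel] at this
  -- In a connected graph the boundaries are exactly the zero-chains of sum 0, because a path from
  -- `v₀` to `w` has boundary `w - v₀`. The rank formula then gives the Euler characteristic.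
  have hrange : LinearMap.range (C.boundary K) = LinearMap.ker σ := by
    refine le_antisymm ?_ fun g hg => ?_
    · rintro _ ⟨f, rfl⟩
      rw [LinearMap.mem_ker, hσ, sum_boundary]
    · rw [LinearMap.mem_ker, hσ] at hg
      obtain ⟨v₀⟩ := ‹Nonempty C.Vertex›
      have : g = ∑ w, g w • (Pi.single w 1 - Pi.single v₀ 1 : C.Vertex → K) := by
        simp only [smul_sub, Finset.sum_sub_distrib, ← Finset.sum_smul, hg, zero_smul, sub_zero]
        ext x
        simp [Finset.sum_apply, Pi.single_apply]
      rw [this]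
      exact Submodule.sum_mem _ fun w _ => Submodule.smul_mem _ _ (hall v₀ w)
  have hker : Module.finrank K (LinearMap.ker σ) + 1 = Fintype.card C.Vertex := by
    have hsurj : LinearMap.range σ = ⊤ := by
      rw [LinearMap.range_eq_top]
      intro c
      obtain ⟨v₀⟩ := ‹Nonempty C.Vertex›
      exact ⟨Pi.single v₀ c, by rw [hσ]; simp⟩
    have := LinearMap.finrank_range_add_finrank_ker σ
    rw [hsurj, finrank_top, Module.finrank_self, Module.finrank_fintype_fun_eq_card] at this
    omega
  have h1 := LinearMap.finrank_range_add_finrank_ker (C.boundary K)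
  rw [hrange] at h1
  have h2 : C.genus K = Module.finrank K (LinearMap.ker (C.boundary K)) := rfl
  omega

end Genus

namespace TrivalentGraph

variable {n : ℕ} {V : Type} {G : TrivalentGraph n V}

variable (G) in
/-- Two vertices joined by an edge. -/
def Joined (v w : V) : Prop := ∃ s h', G.opp (v, s) = some h' ∧ h'.1 = w

namespace IsTropical

variable (hG : G.IsTropical) [Fintype V]
include hG

/-- The vertices of the graph are the vertices of the curve. -/
def vertexEquiv : V ≃ hG.curve.Vertex :=
  Equiv.ofBijective (fun v => ⟨G.pos v, mem_cells.2 (Or.inl ⟨v, rfl⟩)⟩) (by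
    constructor
    · intro v w h
      exact hG.pos_injective (congrArg Subtype.val h)
    · rintro ⟨x, hx⟩
      rcases mem_cells.1 hx with ⟨v, hv⟩ | ⟨h, hh⟩
      · exact ⟨v, Subtype.ext (Set.singleton_injective hv).symm⟩
      · have h1 := hG.cellDim_edge h
        rw [← hh, cellDim_singleton] at h1
        exact absurd h1 zero_ne_one)

theorem vertexEquiv_val (v : V) : (hG.vertexEquiv v).1 = G.pos v := rfl

theorem adj_iff {v w : V} : hG.curve.Adj (hG.vertexEquiv v) (hG.vertexEquiv w) ↔ G.Joined v w := by
  constructor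
  · rintro ⟨hne, hseg⟩
    have hne : v ≠ w := fun h => hne (by rw [h])
    have hpne := hG.pos_injective.ne hne
    rw [vertexEquiv_val, vertexEquiv_val] at hseg
    obtain ⟨h, hh⟩ : ∃ h, segment ℝ (G.pos v) (G.pos w) = G.edge h := by
      rcases mem_cells.1 hseg with ⟨z, hz⟩ | hh
      · have h1 := left_mem_segment ℝ (G.pos v) (G.pos w)
        have h2 := right_mem_segment ℝ (G.pos v) (G.pos w)
        rw [hz, Set.mem_singleton_iff] at h1 h2
        exact absurd (h1.trans h2.symm) hpne
      · exact hh
    have h1 := left_mem_segment ℝ (G.pos v) (G.pos w)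
    have h2 := right_mem_segment ℝ (G.pos v) (G.pos w)
    rw [hh] at h1 h2
    obtain ⟨s, hs⟩ := hG.pos_mem_edge_iff.1 h1
    obtain ⟨s', hs'⟩ := hG.pos_mem_edge_iff.1 h2
    rcases hG.edge_eq_iff.1 (hs.symm.trans hs') with h3 | h3
    · exact absurd (Prod.mk.inj h3).1.symm hne
    · exact ⟨s, _, h3, rfl⟩
  · rintro ⟨s, h', ho, rfl⟩
    refine ⟨fun heq => hG.pos_ne_of_opp ho (congrArg Subtype.val heq), ?_⟩
    exact mem_cells.2 (Or.inr ⟨_, (hG.edge_eq_segment ho).symm⟩)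

-- Edges are straight segments, so two bounded edges with the same ends coincide; an oriented
-- bounded edge is therefore the same as a paired half-edge.
open Classical in
theorem card_adj : Fintype.card {q : hG.curve.Vertex × hG.curve.Vertex // hG.curve.Adj q.1 q.2} =
    Fintype.card {h : V × Fin 3 // (G.opp h).isSome} := by
  symm
  refine Fintype.card_congr (Equiv.ofBijective (fun h => ⟨(hG.vertexEquiv h.1.1,
    hG.vertexEquiv ((G.opp h.1).get h.2).1), hG.adj_iff.2 ⟨h.1.2, _, by simp, rfl⟩⟩) ⟨?_, ?_⟩)
  · rintro ⟨h, hh⟩ ⟨h', hh'⟩ heq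
    simp only [Subtype.mk.injEq, Prod.mk.injEq, EmbeddingLike.apply_eq_iff_eq] at heq
    obtain ⟨g, hg⟩ := Option.isSome_iff_exists.1 hh
    obtain ⟨g', hg'⟩ := Option.isSome_iff_exists.1 hh'
    simp only [hg, hg', Option.get_some] at heq
    have h1 : G.edge h = G.edge h' := by
      rw [hG.edge_eq_segment hg, hG.edge_eq_segment hg', heq.1, heq.2]
    rcases hG.edge_eq_iff.1 h1 with h2 | h2
    · exact Subtype.ext h2.symm
    · rw [hg, Option.some.injEq] at h2
      subst h2
      exact absurd (by rw [heq.1]) (hG.pos_ne_of_opp hg)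
  · rintro ⟨⟨v, w⟩, hvw⟩
    obtain ⟨v, rfl⟩ := hG.vertexEquiv.surjective v
    obtain ⟨w, rfl⟩ := hG.vertexEquiv.surjective w
    obtain ⟨s, h', ho, rfl⟩ := hG.adj_iff.1 hvw
    refine ⟨⟨(v, s), by simp [ho]⟩, ?_⟩
    simp [ho]

/-- The genus of the curve of a connected trivalent graph. -/
theorem two_mul_genus (K : Type*) [Field K] [Nonempty V]
    (hconn : ∀ v w, Relation.ReflTransGen G.Joined v w) :
    2 * (hG.curve.genus K : ℤ) = Fintype.card V - Nat.card {h : V × Fin 3 // G.opp h = none} + 2 := by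
  have : Nonempty hG.curve.Vertex := ⟨hG.vertexEquiv (Classical.arbitrary V)⟩
  have h1 := genus_add_card_vertex hG.curve K (fun v w => by
    obtain ⟨v, rfl⟩ := hG.vertexEquiv.surjective v
    obtain ⟨w, rfl⟩ := hG.vertexEquiv.surjective w
    exact (hconn v w).lift hG.vertexEquiv fun _ _ => hG.adj_iff.2)
  have h2 := two_mul_finrank_chainsOne hG.curve K
  have h3 := hG.card_adj
  -- Of the `3 |V|` half-edges, those that are paired count every bounded edge twice. Together with
  -- `|V| - |E| = 1 - g` this gives the formula.
  have h4 : Fintype.card {h : V × Fin 3 // (G.opp h).isSome} +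
      Nat.card {h : V × Fin 3 // G.opp h = none} = 3 * Fintype.card V := by
    rw [Nat.card_eq_fintype_card]
    have h5 := Fintype.card_subtype_compl fun h : V × Fin 3 => G.opp h = none
    have h6 := Fintype.card_subtype_le fun h : V × Fin 3 => G.opp h = none
    have h7 : Fintype.card {h : V × Fin 3 // (G.opp h).isSome} =
        Fintype.card {h : V × Fin 3 // ¬ G.opp h = none} :=
      Fintype.card_congr (Equiv.subtypeEquivRight fun h => by
        rw [Option.isSome_iff_ne_none])
    rw [Fintype.card_prod, Fintype.card_fin] at h5 h6
    omega
  rw [← Fintype.card_congr hG.vertexEquiv] at h1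
  omega

end IsTropical

end TrivalentGraph

end TropGeo

namespace TropGeo

/-! ### Planar curves dual to labelled triangles -/

/-- The oriented area spanned by two labels. -/
def area (a b : ℤ × ℤ) : ℤ := a.1 * b.2 - a.2 * b.1

theorem fin_three_cases (s s' : Fin 3) : s' = s ∨ s' = s + 1 ∨ s' = s + 2 := by revert s s'; decide

theorem fin_three_succ_succ_ne (s : Fin 3) : s + 1 + 1 ≠ s ∧ s ≠ s + 1 := by revert s; decide

/-- Vertices in the plane that are dual to triangles of labels. -/
structure LabelledGraph (V : Type) where
  pos : V → Fin 2 → ℝ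
  labels : Set (ℤ × ℤ)
  height : ℤ × ℤ → ℝ
  tri : V → Fin 3 → ℤ × ℤ

namespace LabelledGraph

variable {V : Type} (G : LabelledGraph V)

/-- The affine function of a label. -/
def val (l : ℤ × ℤ) (x : Fin 2 → ℝ) : ℝ := l.1 * x 0 + l.2 * x 1 - G.height l

/-- Two half-edges are joined if they are dual to the same side with opposite orientations. -/
def Partner (h h' : V × Fin 3) : Prop :=
  G.tri h'.1 h'.2 = G.tri h.1 (h.2 + 1) ∧ G.tri h'.1 (h'.2 + 1) = G.tri h.1 h.2

/-- The integer length of the side dual to a half-edge. -/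
def wt (h : V × Fin 3) : ℕ :=
  Int.gcd (G.tri h.1 (h.2 + 1) - G.tri h.1 h.2).1 (G.tri h.1 (h.2 + 1) - G.tri h.1 h.2).2

/-- The half-edge `s` at a vertex is orthogonal to the side from the label `s` to the label
`s + 1`. -/
def dir (h : V × Fin 3) : Fin 2 → ℤ :=
  ![(G.tri h.1 (h.2 + 1) - G.tri h.1 h.2).2 / G.wt h,
    -((G.tri h.1 (h.2 + 1) - G.tri h.1 h.2).1 / G.wt h)]

open Classical in
/-- The half-edge joined to a half-edge. -/
def opp (h : V × Fin 3) : Option (V × Fin 3) :=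
  if hh : ∃ h', G.Partner h h' then some hh.choose else none

/-- The trivalent graph dual to the triangles. -/
def graph : TrivalentGraph 2 V where
  pos := G.pos
  dir := G.dir
  wt := G.wt
  opp := G.opp

/-- The conditions under which the graph is a tropical curve. -/
structure IsRegular : Prop where
  tri_mem : ∀ v s, G.tri v s ∈ G.labels
  tie : ∀ v s, G.val (G.tri v s) (G.pos v) = G.val (G.tri v 0) (G.pos v)
  dominance : ∀ v, ∀ l ∈ G.labels, (∀ s, G.tri v s ≠ l) →
    G.val l (G.pos v) < G.val (G.tri v 0) (G.pos v)
  area_pos : ∀ v, 0 < area (G.tri v 1 - G.tri v 0) (G.tri v 2 - G.tri v 0)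
  sum_injective : Function.Injective fun v => ∑ s, G.tri v s
  boundary : ∀ v s, (∃ h', G.Partner (v, s) h') ∨ ∀ l ∈ G.labels,
    area (l - G.tri v s) (G.tri v (s + 1) - G.tri v s) ≤ 0

theorem graph_pos : G.graph.pos = G.pos := rfl
theorem graph_dir : G.graph.dir = G.dir := rfl

variable {G}

theorem opp_eq_none {h : V × Fin 3} : G.opp h = none ↔ ¬ ∃ h', G.Partner h h' := by
  rw [opp]
  split_ifs with hh <;> simp [hh]

theorem opp_tri (v : V) (s : Fin 3) (v' : V) (s' : Fin 3) (h : G.opp (v, s) = some (v', s')) :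
    G.tri v' s' = G.tri v (s + 1) ∧ G.tri v' (s' + 1) = G.tri v s := by
  rw [opp] at h
  split_ifs at h with hh
  have h1 := hh.choose_spec
  rw [Option.some.inj h] at h1
  exact h1

namespace IsRegular

variable (hG : G.IsRegular)
include hG

theorem area_pos' (v : V) (s : Fin 3) :
    0 < area (G.tri v (s + 1) - G.tri v s) (G.tri v (s + 2) - G.tri v s) := by
  have h := hG.area_pos v
  simp only [area, Prod.fst_sub, Prod.snd_sub] at h ⊢
  fin_cases s
  · exact h
  · grind
  · grind

theorem tri_injective (v : V) : Function.Injective (G.tri v) := by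
  have key : ∀ s : Fin 3, G.tri v s ≠ G.tri v (s + 1) ∧ G.tri v s ≠ G.tri v (s + 2) := by
    intro s
    have h := hG.area_pos' v s
    constructor <;> intro heq <;> rw [← heq] at h <;> simp [area] at h
  intro s s' h
  by_contra hne
  rcases fin_three_cases s s' with rfl | rfl | rfl
  · exact hne rfl
  · exact (key s).1 h
  · exact (key s).2 h

theorem wt_pos (h : V × Fin 3) : 0 < G.wt h := by
  obtain ⟨v, s⟩ := h
  refine Nat.pos_of_ne_zero fun h0 => (fin_three_succ_succ_ne s).2 (hG.tri_injective v ?_)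
  obtain ⟨h1, h2⟩ := Int.gcd_eq_zero_iff.1 h0
  exact (sub_eq_zero.1 (Prod.ext h1 h2)).symm

omit hG in
theorem dir_zero (v : V) (s : Fin 3) :
    (G.wt (v, s) : ℤ) * G.dir (v, s) 0 = (G.tri v (s + 1) - G.tri v s).2 :=
  Int.mul_ediv_cancel' (Int.gcd_dvd_right _ _)

omit hG in
theorem dir_one (v : V) (s : Fin 3) :
    (G.wt (v, s) : ℤ) * G.dir (v, s) 1 = -(G.tri v (s + 1) - G.tri v s).1 := by
  change _ * -(_ / _) = _
  rw [mul_neg]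
  exact congrArg Neg.neg (Int.mul_ediv_cancel' (Int.gcd_dvd_left _ _))

theorem primitive (h : V × Fin 3) : IsPrimitiveVector (G.dir h) := by
  have h1 : Finset.univ.gcd (fun i => (G.wt h : ℤ) * G.dir h i) ∣ (G.wt h : ℤ) * 1 := by
    rw [mul_one]
    refine Int.dvd_coe_gcd ?_ ?_
    · rw [← dvd_neg]
      exact (Finset.gcd_dvd (Finset.mem_univ (1 : Fin 2))).trans (dir_one h.1 h.2).dvd
    · exact (Finset.gcd_dvd (Finset.mem_univ (0 : Fin 2))).trans (dir_zero h.1 h.2).dvd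
  rw [Finset.gcd_mul_left, Int.normalize_coe_nat,
    mul_dvd_mul_iff_left (by exact_mod_cast (hG.wt_pos h).ne')] at h1
  rw [IsPrimitiveVector, ← Finset.normalize_gcd]
  exact normalize_eq_one.2 (isUnit_of_dvd_one h1)

theorem opp_none (v : V) (s : Fin 3) (h : G.opp (v, s) = none) : ∀ l ∈ G.labels,
    area (l - G.tri v s) (G.tri v (s + 1) - G.tri v s) ≤ 0 :=
  (hG.boundary v s).resolve_left (opp_eq_none.1 h)

theorem tie' (v : V) (s s' : Fin 3) :
    G.val (G.tri v s) (G.pos v) = G.val (G.tri v s') (G.pos v) :=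
  (hG.tie v s).trans (hG.tie v s').symm

theorem val_le (v : V) (s : Fin 3) {l : ℤ × ℤ} (hl : l ∈ G.labels) :
    G.val l (G.pos v) ≤ G.val (G.tri v s) (G.pos v) := by
  by_cases h : ∀ s, G.tri v s ≠ l
  · exact (hG.dominance v l hl h).le.trans_eq (hG.tie v s).symm
  · push Not at h
    obtain ⟨s', rfl⟩ := h
    exact (hG.tie' v s' s).le

omit hG in
theorem val_along (l : ℤ × ℤ) (a : Fin 2 → ℝ) (u : Fin 2 → ℤ) (t : ℝ) :
    G.val l (along a u t) = G.val l a + t * (l.1 * u 0 + l.2 * u 1) := by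
  simp only [val, along, toReal, Pi.add_apply, Pi.smul_apply, smul_eq_mul]
  ring

omit hG in
/-- The slope of a label along a half-edge, relative to the labels of the half-edge. -/
theorem wt_mul_slope (v : V) (s : Fin 3) (l : ℤ × ℤ) :
    (G.wt (v, s) : ℤ) * ((l.1 * G.dir (v, s) 0 + l.2 * G.dir (v, s) 1) -
      ((G.tri v s).1 * G.dir (v, s) 0 + (G.tri v s).2 * G.dir (v, s) 1)) =
      area (l - G.tri v s) (G.tri v (s + 1) - G.tri v s) := by
  have h0 := dir_zero (G := G) v s
  have h1 := dir_one (G := G) v s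
  simp only [area, Prod.fst_sub, Prod.snd_sub] at h0 h1 ⊢
  linear_combination (l.1 - (G.tri v s).1) * h0 + (l.2 - (G.tri v s).2) * h1

theorem slope_le_iff (v : V) (s : Fin 3) (l : ℤ × ℤ) :
    (l.1 : ℝ) * G.dir (v, s) 0 + l.2 * G.dir (v, s) 1 ≤
      (G.tri v s).1 * G.dir (v, s) 0 + (G.tri v s).2 * G.dir (v, s) 1 ↔
    area (l - G.tri v s) (G.tri v (s + 1) - G.tri v s) ≤ 0 := by
  rw [← wt_mul_slope v s l]
  have := hG.wt_pos (v, s)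
  have hw : (0 : ℤ) < G.wt (v, s) := by exact_mod_cast this
  constructor
  · intro h
    have h : l.1 * G.dir (v, s) 0 + l.2 * G.dir (v, s) 1 ≤
      (G.tri v s).1 * G.dir (v, s) 0 + (G.tri v s).2 * G.dir (v, s) 1 := by exact_mod_cast h
    exact mul_nonpos_of_nonneg_of_nonpos hw.le (by linarith)
  · intro h
    have h := nonpos_of_mul_nonpos_right h hw
    have h : l.1 * G.dir (v, s) 0 + l.2 * G.dir (v, s) 1 ≤
      (G.tri v s).1 * G.dir (v, s) 0 + (G.tri v s).2 * G.dir (v, s) 1 := by linarith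
    exact_mod_cast h

theorem slope_succ (v : V) (s : Fin 3) :
    ((G.tri v (s + 1)).1 : ℝ) * G.dir (v, s) 0 + (G.tri v (s + 1)).2 * G.dir (v, s) 1 =
      (G.tri v s).1 * G.dir (v, s) 0 + (G.tri v s).2 * G.dir (v, s) 1 := by
  have h := wt_mul_slope (G := G) v s (G.tri v (s + 1))
  have hw : (G.wt (v, s) : ℤ) ≠ 0 := by exact_mod_cast (hG.wt_pos (v, s)).ne'
  have h0 : area (G.tri v (s + 1) - G.tri v s) (G.tri v (s + 1) - G.tri v s) = 0 := by
    simp only [area]; ring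
  rw [h0] at h
  have h := (mul_eq_zero.1 h).resolve_left hw
  exact_mod_cast sub_eq_zero.1 h

theorem slope_third_lt (v : V) (s : Fin 3) :
    ((G.tri v (s + 2)).1 : ℝ) * G.dir (v, s) 0 + (G.tri v (s + 2)).2 * G.dir (v, s) 1 <
      (G.tri v s).1 * G.dir (v, s) 0 + (G.tri v s).2 * G.dir (v, s) 1 := by
  have h := wt_mul_slope (G := G) v s (G.tri v (s + 2))
  have h0 := hG.area_pos' v s
  have h1 : area (G.tri v (s + 2) - G.tri v s) (G.tri v (s + 1) - G.tri v s) < 0 := by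
    simp only [area] at h0 ⊢; linarith
  rw [← h] at h1
  have h2 := neg_of_mul_neg_right h1 (by positivity)
  have h2 := sub_neg.1 h2
  exact_mod_cast h2

theorem gcd_wt_dir (h : V × Fin 3) : Finset.univ.gcd (fun i => (G.wt h : ℤ) * G.dir h i) = G.wt h := by
  have h1 := hG.primitive h
  rw [Finset.gcd_mul_left, h1, mul_one]
  exact Int.normalize_coe_nat _

theorem wt_dir_opp {h h' : V × Fin 3} (ho : G.opp h = some h') :
    G.wt h' = G.wt h ∧ G.dir h' = -G.dir h := by
  obtain ⟨v, s⟩ := h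
  obtain ⟨v', s'⟩ := h'
  obtain ⟨h1, h2⟩ := opp_tri v s v' s' ho
  have h3 : ∀ i, (G.wt (v', s') : ℤ) * G.dir (v', s') i = -((G.wt (v, s) : ℤ) * G.dir (v, s) i) := by
    intro i
    fin_cases i
    · change _ * G.dir (v', s') 0 = -(_ * G.dir (v, s) 0)
      rw [dir_zero, dir_zero, h1, h2, ← neg_sub]
      rfl
    · change _ * G.dir (v', s') 1 = -(_ * G.dir (v, s) 1)
      rw [dir_one, dir_one, h1, h2, ← neg_sub]
      rfl
  have h5 : G.wt (v', s') = G.wt (v, s) := by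
    refine Nat.dvd_antisymm (Int.natCast_dvd_natCast.1 ?_) (Int.natCast_dvd_natCast.1 ?_)
    · rw [← hG.gcd_wt_dir (v, s)]
      exact Finset.dvd_gcd fun i _ => ⟨-G.dir (v', s') i, by rw [mul_neg, h3, neg_neg]⟩
    · rw [← hG.gcd_wt_dir (v', s')]
      exact Finset.dvd_gcd fun i _ => ⟨-G.dir (v, s) i, by rw [mul_neg, h3]⟩
  have h4 : (G.wt (v', s') : ℤ) = G.wt (v, s) := by rw [h5]
  refine ⟨h5, funext fun i => ?_⟩
  have hw : (G.wt (v, s) : ℤ) ≠ 0 := by exact_mod_cast (hG.wt_pos (v, s)).ne'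
  have h6 := h3 i
  rw [h4, ← mul_neg] at h6
  exact mul_left_cancel₀ hw h6

/-- By strict dominance the labels that are maximal at the position of `v` are exactly its corners.
Equal positions give equal sets of corners, hence equal corner sums. -/
theorem pos_injective : Function.Injective G.pos := by
  intro v w h
  refine hG.sum_injective ?_
  have hsub : ∀ v w, G.pos v = G.pos w → ∀ s, ∃ s', G.tri w s' = G.tri v s := by
    intro v w h s
    by_contra! hcon
    have h1 := hG.dominance w _ (hG.tri_mem v s) hcon
    rw [← h] at h1
    exact absurd (hG.val_le v s (hG.tri_mem w 0)) (not_le.2 h1)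
  have himg : Finset.univ.image (G.tri v) = Finset.univ.image (G.tri w) := by
    ext l
    simp only [Finset.mem_image, Finset.mem_univ, true_and]
    constructor
    · rintro ⟨s, rfl⟩; exact hsub v w h s
    · rintro ⟨s, rfl⟩; exact hsub w v h.symm s
  have h1 : ∑ l ∈ Finset.univ.image (G.tri v), l = ∑ l ∈ Finset.univ.image (G.tri w), l := by
    rw [himg]
  rwa [Finset.sum_image fun a _ b _ hab => hG.tri_injective v hab,
    Finset.sum_image fun a _ b _ hab => hG.tri_injective w hab] at h1

/-- The points where the labels of a half-edge tie lie on a line in the direction of the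
half-edge. -/
theorem exists_along_of_tie {v : V} {s : Fin 3} {x : Fin 2 → ℝ}
    (e1 : G.val (G.tri v (s + 1)) x = G.val (G.tri v s) x) :
    ∃ t : ℝ, x = along (G.pos v) (G.dir (v, s)) t := by
  have e2 := hG.tie' v s (s + 1)
  have d0 : (G.wt (v, s) : ℝ) * G.dir (v, s) 0 = (G.tri v (s + 1)).2 - (G.tri v s).2 := by
    exact_mod_cast dir_zero v s
  have d1 : (G.wt (v, s) : ℝ) * G.dir (v, s) 1 = -((G.tri v (s + 1)).1 - (G.tri v s).1) := by
    exact_mod_cast dir_one v s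
  have hw : (G.wt (v, s) : ℝ) ≠ 0 := by exact_mod_cast (hG.wt_pos (v, s)).ne'
  have e : (G.dir (v, s) 1 : ℝ) * (x 0 - G.pos v 0) = G.dir (v, s) 0 * (x 1 - G.pos v 1) := by
    refine mul_left_cancel₀ hw ?_
    simp only [val] at e1 e2
    linear_combination (x 0 - G.pos v 0) * d1 - (x 1 - G.pos v 1) * d0 - e1 - e2
  obtain ⟨i, hi⟩ := Function.ne_iff.1 (hG.primitive (v, s)).ne_zero
  have hi' : (G.dir (v, s) i : ℝ) ≠ 0 := by exact_mod_cast hi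
  refine ⟨(x i - G.pos v i) / G.dir (v, s) i, (mem_along_iff hi).2 ⟨by field_simp, ?_⟩⟩
  intro j
  fin_cases i <;> fin_cases j
  · rfl
  · exact e.symm
  · exact e
  · rfl

/-- Two vertices with the same pair of labels lie on a line in the direction of the half-edge. -/
theorem exists_along {v v' : V} {s : Fin 3} {s₁ s₂ : Fin 3} (h₁ : G.tri v' s₁ = G.tri v s)
    (h₂ : G.tri v' s₂ = G.tri v (s + 1)) :
    ∃ t : ℝ, G.pos v' = along (G.pos v) (G.dir (v, s)) t :=
  hG.exists_along_of_tie (by rw [← h₁, ← h₂, hG.tie' v' s₁ s₂])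

theorem mem_openRay {v : V} {s : Fin 3} {x : Fin 2 → ℝ}
    (h : G.val (G.tri v (s + 1)) x = G.val (G.tri v s) x)
    (h' : G.val (G.tri v (s + 2)) x < G.val (G.tri v s) x) : x ∈ G.graph.openRay (v, s) := by
  obtain ⟨t, rfl⟩ := hG.exists_along_of_tie h
  refine ⟨t, ?_, rfl⟩
  have h1 := hG.slope_third_lt v s
  rw [val_along, val_along, hG.tie' v (s + 2) s] at h'
  rw [Set.mem_Ioi]
  nlinarith

/-- A corner of `v'` ties with the side at `v'` and is not above it at `v`, so relative to the side
it grows from `v` to `v'`. -/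
theorem third_slope_le {v v' : V} {s : Fin 3} {t : ℝ}
    (ht : G.pos v' = along (G.pos v) (G.dir (v, s)) t) {s₁ s₂ : Fin 3}
    (h : G.tri v' s₁ = G.tri v s) :
    0 ≤ t * (((G.tri v' s₂).1 : ℝ) * G.dir (v, s) 0 + (G.tri v' s₂).2 * G.dir (v, s) 1 -
      ((G.tri v s).1 * G.dir (v, s) 0 + (G.tri v s).2 * G.dir (v, s) 1)) := by
  have h1 := hG.tie' v' s₁ s₂
  rw [h, ht, val_along, val_along] at h1
  have h2 := hG.val_le v s (hG.tri_mem v' s₂)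
  linarith

/-- Counterclockwise triangles with the same oriented side lie on the same side of it; the third
label of either one decreases along the outward half-edge. With opposite orientation, in
`slope_opp`, it increases. -/
theorem slope_congr {v v' : V} {s s' : Fin 3} (h₁ : G.tri v' s' = G.tri v s)
    (h₂ : G.tri v' (s' + 1) = G.tri v (s + 1)) :
    ((G.tri v' (s' + 2)).1 : ℝ) * G.dir (v, s) 0 + (G.tri v' (s' + 2)).2 * G.dir (v, s) 1 <
      (G.tri v s).1 * G.dir (v, s) 0 + (G.tri v s).2 * G.dir (v, s) 1 := by
  rw [← not_le]
  intro hle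
  have h0 := hG.area_pos' v' s'
  rw [h₁, h₂] at h0
  have hz : (G.wt (v, s) : ℤ) * ((G.tri v s).1 * G.dir (v, s) 0 + (G.tri v s).2 * G.dir (v, s) 1 -
      ((G.tri v' (s' + 2)).1 * G.dir (v, s) 0 + (G.tri v' (s' + 2)).2 * G.dir (v, s) 1)) ≤ 0 := by
    refine mul_nonpos_of_nonneg_of_nonpos (by positivity) ?_
    have : (G.tri v s).1 * G.dir (v, s) 0 + (G.tri v s).2 * G.dir (v, s) 1 ≤
      (G.tri v' (s' + 2)).1 * G.dir (v, s) 0 + (G.tri v' (s' + 2)).2 * G.dir (v, s) 1 := by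
      exact_mod_cast hle
    linarith
  have hs := wt_mul_slope (G := G) v s (G.tri v' (s' + 2))
  simp only [area] at h0 hs
  linarith

theorem slope_opp {v v' : V} {s s' : Fin 3} (h₁ : G.tri v' s' = G.tri v (s + 1))
    (h₂ : G.tri v' (s' + 1) = G.tri v s) :
    ((G.tri v s).1 : ℝ) * G.dir (v, s) 0 + (G.tri v s).2 * G.dir (v, s) 1 <
      (G.tri v' (s' + 2)).1 * G.dir (v, s) 0 + (G.tri v' (s' + 2)).2 * G.dir (v, s) 1 := by
  rw [← not_le, hG.slope_le_iff]
  intro hle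
  have h0 := hG.area_pos' v' s'
  rw [h₁, h₂] at h0
  simp only [area, Prod.fst_sub, Prod.snd_sub] at h0 hle
  linarith

/-- Each of the two vertices would lie behind the other along the common outward direction, since
the third labels decrease along it. So the positions coincide, and then the vertices do. -/
theorem eq_of_tri_eq {v v' : V} {s s' : Fin 3} (h₁ : G.tri v' s' = G.tri v s)
    (h₂ : G.tri v' (s' + 1) = G.tri v (s + 1)) : (v', s') = (v, s) := by
  obtain ⟨t, ht⟩ := hG.exists_along h₁ h₂
  obtain ⟨r, hr⟩ := hG.exists_along h₁.symm h₂.symm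
  have h3 := hG.third_slope_le ht (s₂ := s' + 2) h₁
  have h4 := hG.slope_congr h₁ h₂
  have h5 := hG.third_slope_le hr (s₂ := s + 2) h₁.symm
  have h6 := hG.slope_congr h₁.symm h₂.symm
  have hr0 : r ≤ 0 := by
    by_contra hpos
    nlinarith
  have hw' : (0 : ℝ) < G.wt (v', s') := by exact_mod_cast hG.wt_pos (v', s')
  have hd : ∀ i, (G.wt (v', s') : ℝ) * G.dir (v', s') i = G.wt (v, s) * G.dir (v, s) i := by
    intro i
    have : (G.wt (v', s') : ℤ) * G.dir (v', s') i = G.wt (v, s) * G.dir (v, s) i := by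
      fin_cases i
      · exact (dir_zero v' s').trans (by rw [h₁, h₂]; exact (dir_zero v s).symm)
      · exact (dir_one v' s').trans (by rw [h₁, h₂]; exact (dir_one v s).symm)
    exact_mod_cast this
  obtain ⟨i, hi⟩ := Function.ne_iff.1 (hG.primitive (v, s)).ne_zero
  have hi' : (G.dir (v, s) i : ℝ) ≠ 0 := by exact_mod_cast hi
  have e1 := congrFun ht i
  have e2 := congrFun hr i
  simp only [along, toReal, Pi.add_apply, Pi.smul_apply, smul_eq_mul] at e1 e2
  have e3 : t * G.wt (v', s') + r * G.wt (v, s) = 0 := by grind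
  have ht' : t = 0 := by nlinarith
  rw [ht', along, zero_smul, add_zero] at ht
  have hv := hG.pos_injective ht
  subst hv
  rw [hG.tri_injective _ h₁]

theorem opp_eq_some {h h' : V × Fin 3} : G.opp h = some h' ↔ G.Partner h h' := by
  refine ⟨fun ho => opp_tri h.1 h.2 h'.1 h'.2 ho, fun hp => ?_⟩
  cases ho : G.opp h with
  | none => exact absurd ⟨h', hp⟩ (opp_eq_none.1 ho)
  | some g =>
    obtain ⟨h1, h2⟩ := opp_tri h.1 h.2 g.1 g.2 ho
    exact congrArg some (hG.eq_of_tri_eq (h1.trans hp.1.symm) (h2.trans hp.2.symm))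

theorem opp_symm (h h' : V × Fin 3) (ho : G.opp h = some h') : G.opp h' = some h := by
  rw [hG.opp_eq_some] at ho ⊢
  exact ⟨ho.2.symm, ho.1.symm⟩

theorem ne_of_opp {v v' : V} {s s' : Fin 3} (h₁ : G.tri v' s' = G.tri v (s + 1))
    (h₂ : G.tri v' (s' + 1) = G.tri v s) : v' ≠ v := by
  rintro rfl
  have e1 := hG.tri_injective _ h₁
  have e2 := hG.tri_injective _ h₂
  rw [e1] at e2
  exact (fin_three_succ_succ_ne s).1 e2

/-- The labels of a half-edge are maximal along the edge. -/
theorem val_le_of_mem_edge {v : V} {s : Fin 3} {x : Fin 2 → ℝ}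
    (hx : x ∈ G.graph.edge (v, s)) {l : ℤ × ℤ} (hl : l ∈ G.labels) :
    G.val l x ≤ G.val (G.tri v s) x := by
  obtain ⟨⟨t, ht, rfl⟩, hx'⟩ := hx
  rcases le_or_gt ((l.1 : ℝ) * G.dir (v, s) 0 + l.2 * G.dir (v, s) 1)
    ((G.tri v s).1 * G.dir (v, s) 0 + (G.tri v s).2 * G.dir (v, s) 1) with hle | hlt
  · rw [val_along, val_along, graph_pos, graph_dir]
    exact add_le_add (hG.val_le v s hl) (mul_le_mul_of_nonneg_left hle ht)
  -- A label growing faster than the side lies beyond it. If there is no partner, the side is on the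
  -- boundary and no such label exists; otherwise the estimate is made from the other end, where the
  -- slope has the opposite sign.
  · cases ho : G.opp (v, s) with
    | none => exact absurd hlt (not_lt.2 ((hG.slope_le_iff v s l).2 (hG.opp_none v s ho l hl)))
    | some h' =>
      obtain ⟨v', s'⟩ := h'
      obtain ⟨r, hr, hr'⟩ := hx' _ ho
      obtain ⟨h1, h2⟩ := opp_tri v s v' s' ho
      rw [← hr', val_along, val_along, ← h2, graph_pos, graph_dir, (hG.wt_dir_opp ho).2]
      refine add_le_add (hG.val_le v' _ hl) (mul_le_mul_of_nonneg_left ?_ hr)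
      rw [h2]
      simp only [Pi.neg_apply, Int.cast_neg]
      linarith

theorem val_succ_of_mem_edge {v : V} {s : Fin 3} {x : Fin 2 → ℝ}
    (hx : x ∈ G.graph.edge (v, s)) : G.val (G.tri v (s + 1)) x = G.val (G.tri v s) x := by
  obtain ⟨⟨t, -, rfl⟩, -⟩ := hx
  rw [val_along, val_along, graph_pos, graph_dir, hG.tie' v (s + 1) s, hG.slope_succ]

/-- The labels of a half-edge are the only maximal ones in the interior of the edge. -/
theorem val_lt_of_mem_openEdge {v : V} {s : Fin 3} {x : Fin 2 → ℝ}
    (hx : x ∈ G.graph.openEdge (v, s)) {l : ℤ × ℤ} (hl : l ∈ G.labels)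
    (h0 : l ≠ G.tri v s) (h1 : l ≠ G.tri v (s + 1)) : G.val l x < G.val (G.tri v s) x := by
  obtain ⟨⟨t, ht, rfl⟩, hx'⟩ := hx
  rcases lt_trichotomy ((l.1 : ℝ) * G.dir (v, s) 0 + l.2 * G.dir (v, s) 1)
    ((G.tri v s).1 * G.dir (v, s) 0 + (G.tri v s).2 * G.dir (v, s) 1) with hlt | heq | hlt
  · rw [val_along, val_along, graph_pos, graph_dir]
    exact add_lt_add_of_le_of_lt (hG.val_le v s hl) (mul_lt_mul_of_pos_left hlt ht)
  · have h2 : ∀ s', G.tri v s' ≠ l := by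
      intro s' hs'
      rcases fin_three_cases s s' with rfl | rfl | rfl
      · exact h0 hs'.symm
      · exact h1 hs'.symm
      · have := hG.slope_third_lt v s
        rw [hs'] at this
        linarith
    rw [val_along, val_along, graph_pos, graph_dir, heq]
    have := hG.dominance v l hl h2
    rw [← hG.tie v s] at this
    linarith
  · cases ho : G.opp (v, s) with
    | none => exact absurd hlt (not_lt.2 ((hG.slope_le_iff v s l).2 (hG.opp_none v s ho l hl)))
    | some h' =>
      obtain ⟨v', s'⟩ := h'
      obtain ⟨r, hr, hr'⟩ := hx' _ ho
      obtain ⟨h1, h2⟩ := opp_tri v s v' s' ho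
      rw [← hr', val_along, val_along, ← h2, graph_pos, graph_dir, (hG.wt_dir_opp ho).2]
      refine add_lt_add_of_le_of_lt (hG.val_le v' _ hl) (mul_lt_mul_of_pos_left ?_ hr)
      rw [h2]
      simp only [Pi.neg_apply, Int.cast_neg]
      linarith

/-- Balancing says that the sides of a triangle add up to zero. Noncrossing holds because the only
maximal labels in the interior of an edge are its own two, so an edge through such a point is dual
to the same side in one of its two orientations. -/
theorem isTropical : G.graph.IsTropical where
  pos_injective := hG.pos_injective
  primitive := hG.primitive
  wt_pos := hG.wt_pos
  balance v := by
    ext i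
    simp only [Finset.sum_apply, Pi.smul_apply, smul_eq_mul, Pi.zero_apply, Fin.sum_univ_three]
    fin_cases i
    · have h0 := dir_zero (G := G) v 0
      have h1 := dir_zero (G := G) v 1
      have h2 := dir_zero (G := G) v 2
      simp only [Fin.reduceAdd, Prod.snd_sub] at h0 h1 h2
      change (G.wt (v, 0) : ℤ) * G.dir (v, 0) 0 + G.wt (v, 1) * G.dir (v, 1) 0 +
        G.wt (v, 2) * G.dir (v, 2) 0 = 0
      rw [h0, h1, h2]
      ring
    · have h0 := dir_one (G := G) v 0
      have h1 := dir_one (G := G) v 1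
      have h2 := dir_one (G := G) v 2
      simp only [Fin.reduceAdd, Prod.fst_sub] at h0 h1 h2
      change (G.wt (v, 0) : ℤ) * G.dir (v, 0) 1 + G.wt (v, 1) * G.dir (v, 1) 1 +
        G.wt (v, 2) * G.dir (v, 2) 1 = 0
      rw [h0, h1, h2]
      ring
  opp_symm := hG.opp_symm
  opp_dir h h' ho := (hG.wt_dir_opp ho).2
  opp_wt h h' ho := (hG.wt_dir_opp ho).1
  opp_pos := by
    rintro ⟨v, s⟩ ⟨v', s'⟩ ho
    obtain ⟨h1, h2⟩ := opp_tri v s v' s' ho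
    obtain ⟨t, ht⟩ := hG.exists_along h2 h1
    refine ⟨t, lt_of_le_of_ne ?_ ?_, ht⟩
    · have h3 := hG.third_slope_le ht (s₂ := s' + 2) h2
      have h4 := hG.slope_opp h1 h2
      by_contra hneg
      nlinarith
    · rintro rfl
      rw [along, zero_smul, add_zero] at ht
      exact hG.ne_of_opp h1 h2 (hG.pos_injective ht)
  noncrossing := by
    rintro ⟨v, s⟩ ⟨v', s'⟩ x hx hx'
    have key : ∀ l ∈ G.labels, G.val l x = G.val (G.tri v' s') x →
        l = G.tri v s ∨ l = G.tri v (s + 1) := by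
      intro l hl hlx
      by_contra! hcon
      have h1 := hG.val_lt_of_mem_openEdge hx hl hcon.1 hcon.2
      have h2 := hG.val_le_of_mem_edge hx' (hG.tri_mem v s)
      linarith
    have hne : G.tri v' s' ≠ G.tri v' (s' + 1) := fun h =>
      (fin_three_succ_succ_ne s').2 (hG.tri_injective _ h)
    rcases key _ (hG.tri_mem v' s') rfl with h1 | h1 <;>
      rcases key _ (hG.tri_mem v' (s' + 1)) (hG.val_succ_of_mem_edge hx') with h2 | h2
    · exact absurd (h1.trans h2.symm) hne
    · exact Or.inl (hG.eq_of_tri_eq h1 h2)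
    · right
      cases ho : G.opp (v, s) with
      | none =>
        have h3 := (hG.slope_le_iff v s _).2 (hG.opp_none v s ho _ (hG.tri_mem v' (s' + 2)))
        exact absurd (hG.slope_opp h1 h2) (not_lt.2 h3)
      | some g =>
        obtain ⟨w, r⟩ := g
        obtain ⟨h3, h4⟩ := opp_tri v s w r ho
        rw [hG.eq_of_tri_eq (h1.trans h3.symm) (h2.trans h4.symm)]
        exact ho
    · exact absurd (h1.trans h2.symm) hne

end IsRegular

end LabelledGraph

end TropGeo

namespace TropGeo

/-! ### Charts and integer vectors -/

section Emb

variable {k : ℕ}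

/-- The pair of coordinates of a point of the plane. -/
def pair (z : Fin 2 → ℝ) : ℝ × ℝ := (z 0, z 1)

theorem pair_injective : Function.Injective pair := by
  intro z w h
  have h0 := congrArg Prod.fst h
  have h1 := congrArg Prod.snd h
  ext i
  fin_cases i
  · exact h0
  · exact h1

/-- The chart with index `j` on the coordinate plane. -/
def emb (k j : ℕ) (z : Fin 2 → ℝ) : Fin (k + 1) → ℝ := chart k j (pair z)

/-- The linear part of the chart with index `j` on integer vectors. -/
def chartDir (k j : ℕ) : (Fin 2 → ℤ) →ₗ[ℤ] (Fin (k + 1) → ℤ) where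
  toFun u := fun i => -(if j ≤ (i : ℕ) then u 0 else 0) + if j < (i : ℕ) then u 1 else 0
  map_add' u v := by
    ext i
    simp only [Pi.add_apply]
    split_ifs <;> ring
  map_smul' c u := by
    ext i
    simp only [Pi.smul_apply, smul_eq_mul, RingHom.id_apply]
    split_ifs <;> ring

theorem chartDir_of_lt {j : ℕ} (u : Fin 2 → ℤ) {i : Fin (k + 1)} (h : (i : ℕ) < j) :
    chartDir k j u i = 0 := by
  simp [chartDir, h.not_ge, h.not_gt]
theorem chartDir_of_eq {j : ℕ} (u : Fin 2 → ℤ) {i : Fin (k + 1)} (h : (i : ℕ) = j) :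
    chartDir k j u i = -u 0 := by
  simp [chartDir, h]
theorem chartDir_of_gt {j : ℕ} (u : Fin 2 → ℤ) {i : Fin (k + 1)} (h : j < (i : ℕ)) :
    chartDir k j u i = -u 0 + u 1 := by
  simp [chartDir, h, h.le]

theorem toReal_chartDir (j : ℕ) (u : Fin 2 → ℤ) :
    toReal (chartDir k j u) = chartLin k j (pair (toReal u)) := by
  ext i
  simp only [toReal]
  rcases lt_trichotomy (i : ℕ) j with h | h | h
  · rw [chartDir_of_lt u h, chartLin_of_lt _ h, Int.cast_zero]
  · rw [chartDir_of_eq u h, chartLin_of_eq _ h, Int.cast_neg]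
    rfl
  · rw [chartDir_of_gt u h, chartLin_of_gt _ h, Int.cast_add, Int.cast_neg]
    rfl

theorem emb_along (j : ℕ) (a : Fin 2 → ℝ) (u : Fin 2 → ℤ) (t : ℝ) :
    emb k j (along a u t) = along (emb k j a) (chartDir k j u) t := by
  have h : pair (along a u t) = pair a + t • pair (toReal u) := by simp [pair, along]
  rw [emb, emb, chart, chart, h, map_add, map_smul, along, toReal_chartDir, add_assoc]

theorem emb_injective {j : ℕ} (hj : j < k) : Function.Injective (emb k j) :=
  (chart_injective hj).comp pair_injective

theorem chartDir_injective {j : ℕ} (hj : j < k) : Function.Injective (chartDir k j) := by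
  intro u v h
  have h0 := congrFun h ⟨j, by omega⟩
  have h1 := congrFun h (Fin.last k)
  rw [chartDir_of_eq (j := j) _ rfl, chartDir_of_eq (j := j) _ rfl] at h0
  rw [chartDir_of_gt _ (by simpa using hj), chartDir_of_gt _ (by simpa using hj)] at h1
  ext i
  fin_cases i
  · grind
  · grind

theorem IsPrimitiveVector.chartDir {j : ℕ} (hj : j < k) {u : Fin 2 → ℤ} (hu : IsPrimitiveVector u) :
    IsPrimitiveVector (chartDir k j u) := by
  have h0 := (Finset.gcd_dvd (f := TropGeo.chartDir k j u)
    (Finset.mem_univ (⟨j, by omega⟩ : Fin (k + 1))))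
  have h1 := (Finset.gcd_dvd (f := TropGeo.chartDir k j u) (Finset.mem_univ (Fin.last k)))
  rw [chartDir_of_eq (j := j) _ rfl, dvd_neg] at h0
  rw [chartDir_of_gt _ (by simpa using hj), (dvd_add_right (dvd_neg.2 h0))] at h1
  have h2 : Finset.univ.gcd (TropGeo.chartDir k j u) ∣ Finset.univ.gcd u := by
    refine Finset.dvd_gcd fun i _ => ?_
    fin_cases i
    · exact h0
    · exact h1
  rw [hu] at h2
  rw [IsPrimitiveVector, ← Finset.normalize_gcd]
  exact normalize_eq_one.2 (isUnit_of_dvd_one h2)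

theorem chartDir_diag {j : ℕ} (hj : j < k) :
    chartDir k j ![1, 1] = stdDir (k + 1) (some ⟨j, by omega⟩) := by
  ext i
  simp only [stdDir, Pi.neg_apply, Pi.single_apply, Fin.ext_iff]
  rcases lt_trichotomy (i : ℕ) j with h | h | h
  · rw [chartDir_of_lt _ h, if_neg h.ne, neg_zero]
  · rw [chartDir_of_eq _ h, if_pos h]
    rfl
  · rw [chartDir_of_gt _ h, if_neg h.ne']
    rfl

theorem chartDir_left : chartDir k 0 ![-1, 0] = stdDir (k + 1) none := by
  ext i
  rcases Nat.eq_zero_or_pos (i : ℕ) with h | h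
  · rw [chartDir_of_eq _ h]
    rfl
  · rw [chartDir_of_gt _ h]
    rfl

theorem chartDir_down {j : ℕ} (hj : j + 1 = k) :
    chartDir k j ![0, -1] = stdDir (k + 1) (some (Fin.last k)) := by
  ext i
  simp only [stdDir, Pi.neg_apply, Pi.single_apply, Fin.ext_iff, Fin.val_last]
  rcases lt_trichotomy (i : ℕ) j with h | h | h
  · rw [chartDir_of_lt _ h, if_neg (by omega), neg_zero]
  · rw [chartDir_of_eq _ h, if_neg (by omega)]
    rfl
  · rw [chartDir_of_gt _ h, if_pos (by omega)]
    rfl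

theorem chartDir_down_eq_neg (j : ℕ) : chartDir k j ![0, -1] = -chartDir k (j + 1) ![-1, 0] := by
  ext i
  rw [Pi.neg_apply]
  rcases lt_trichotomy (i : ℕ) j with h | h | h
  · rw [chartDir_of_lt _ h, chartDir_of_lt _ (by omega)]; rfl
  · rw [chartDir_of_eq _ h, chartDir_of_lt _ (by omega)]; rfl
  · rcases (Nat.succ_le_of_lt h).eq_or_lt with h' | h'
    · rw [chartDir_of_gt _ h, chartDir_of_eq _ h'.symm]; rfl
    · rw [chartDir_of_gt _ h, chartDir_of_gt _ h']; rfl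

/-- The continuation of a chart into the next one. -/
theorem emb_down (j : ℕ) (r : ℝ) : emb k j ![0, -1 - r] = emb k (j + 1) ![-1 + r, 0] := by
  ext i
  simp only [emb, chart, Pi.add_apply, pair, Matrix.cons_val, Nat.cast_add, Nat.cast_one]
  rcases lt_trichotomy (i : ℕ) j with h | h | h
  · have h' : ((i : ℕ) : ℝ) + 1 ≤ j := by exact_mod_cast h
    rw [chartLin_of_lt _ h, chartLin_of_lt _ (by omega), abs_of_nonpos (by linarith),
      abs_of_nonpos (by linarith)]
    ring
  · have h' : ((i : ℕ) : ℝ) = j := by exact_mod_cast h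
    rw [chartLin_of_eq _ h, chartLin_of_lt _ (by omega), abs_of_nonpos (by linarith),
      abs_of_nonpos (by linarith)]
    ring
  · have h' : (j : ℝ) + 1 ≤ (i : ℕ) := by exact_mod_cast h
    rw [abs_of_nonneg (by linarith), abs_of_nonneg (by linarith), chartLin_of_gt _ h]
    rcases (Nat.succ_le_of_lt h).eq_or_lt with h' | h'
    · rw [chartLin_of_eq _ h'.symm]
      ring
    · rw [chartLin_of_gt _ h']
      ring

end Emb

/-! ### Gluing planar curves along the charts -/

/-- A planar trivalent graph with two marked half-edges. -/
structure Piece (V : Type) extends TrivalentGraph 2 V where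
  left : V × Fin 3
  down : V × Fin 3

/-- The conditions under which a piece lives in the chart with index `j`; its two marked half-edges
leave the domain of the chart and have weight `w`. -/
structure Piece.Fits {V : Type} (P : Piece V) (k j w : ℕ) : Prop where
  isTropical : P.toTrivalentGraph.IsTropical
  pos_mem : ∀ v, pair (P.pos v) ∈ chartInterior k j
  left_opp : 0 < j → P.opp P.left = none
  left_dir : 0 < j → P.dir P.left = ![-1, 0]
  left_wt : 0 < j → P.wt P.left = w
  left_pos : 0 < j → P.pos P.left.1 1 = 0
  down_opp : j + 1 < k → P.opp P.down = none
  down_dir : j + 1 < k → P.dir P.down = ![0, -1]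
  down_wt : j + 1 < k → P.wt P.down = w
  down_pos : j + 1 < k → P.pos P.down.1 0 = 0
  ray_left : ∀ h, P.opp h = none → 0 < j → h ≠ P.left → (j + 1 < k → h ≠ P.down) →
    0 ≤ P.dir h 0 ∧ 0 ≤ P.dir h 0 - P.dir h 1
  ray_down : ∀ h, P.opp h = none → j + 1 < k → h ≠ P.down → (0 < j → h ≠ P.left) →
    0 ≤ P.dir h 1 ∧ P.dir h 0 - P.dir h 1 ≤ 0

/-- The set underlying a trivalent graph. -/
def TrivalentGraph.carrier {n : ℕ} {V : Type} (G : TrivalentGraph n V) : Set (Fin n → ℝ) :=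
  {x | ∃ h, x ∈ G.edge h}

namespace Piece

section Fits

variable {V : Type} {P : Piece V} {k j w : ℕ} (hP : P.Fits k j w)
include hP

theorem Fits.neg_one_lt_left (hj : 0 < j) : -1 < P.pos P.left.1 0 :=
  ((hP.pos_mem P.left.1).1 hj).1

theorem Fits.neg_one_lt_down (hj : j + 1 < k) : -1 < P.pos P.down.1 1 :=
  ((hP.pos_mem P.down.1).2 hj).1

theorem Fits.left_ne_down (h0 : 0 < j) (h1 : j + 1 < k) : P.left ≠ P.down := by
  intro h
  have h2 := hP.left_dir h0
  rw [h, hP.down_dir h1] at h2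
  have h3 := congrFun h2 0
  simp at h3

theorem Fits.along_left (hj : 0 < j) (t : ℝ) :
    along (P.pos P.left.1) (P.dir P.left) t = ![P.pos P.left.1 0 - t, 0] := by
  rw [hP.left_dir hj]
  ext i
  fin_cases i
  · simp [along, toReal, sub_eq_add_neg]
  · simpa [along, toReal] using hP.left_pos hj

theorem Fits.along_down (hj : j + 1 < k) (t : ℝ) :
    along (P.pos P.down.1) (P.dir P.down) t = ![0, P.pos P.down.1 1 - t] := by
  rw [hP.down_dir hj]
  ext i
  fin_cases i
  · simpa [along, toReal] using hP.down_pos hj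
  · simp [along, toReal, sub_eq_add_neg]

theorem Fits.mem_edge_left (hj : 0 < j) {z : Fin 2 → ℝ} :
    z ∈ P.edge P.left ↔ ∃ t ≤ P.pos P.left.1 0, z = ![t, 0] := by
  rw [TrivalentGraph.edge_of_none (hP.left_opp hj)]
  simp only [Set.mem_image, Set.mem_Ici, hP.along_left hj]
  constructor
  · grind
  · rintro ⟨t, ht, rfl⟩
    exact ⟨P.pos P.left.1 0 - t, by linarith, by rw [sub_sub_cancel]⟩

theorem Fits.mem_openEdge_left (hj : 0 < j) {z : Fin 2 → ℝ} :
    z ∈ P.openEdge P.left ↔ ∃ t < P.pos P.left.1 0, z = ![t, 0] := by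
  rw [TrivalentGraph.openEdge_of_none (hP.left_opp hj)]
  simp only [Set.mem_image, Set.mem_Ioi, hP.along_left hj]
  constructor
  · grind
  · rintro ⟨t, ht, rfl⟩
    exact ⟨P.pos P.left.1 0 - t, by linarith, by rw [sub_sub_cancel]⟩

theorem Fits.mem_edge_down (hj : j + 1 < k) {z : Fin 2 → ℝ} :
    z ∈ P.edge P.down ↔ ∃ t ≤ P.pos P.down.1 1, z = ![0, t] := by
  rw [TrivalentGraph.edge_of_none (hP.down_opp hj)]
  simp only [Set.mem_image, Set.mem_Ici, hP.along_down hj]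
  constructor
  · grind
  · rintro ⟨t, ht, rfl⟩
    exact ⟨P.pos P.down.1 1 - t, by linarith, by rw [sub_sub_cancel]⟩

theorem Fits.mem_openEdge_down (hj : j + 1 < k) {z : Fin 2 → ℝ} :
    z ∈ P.openEdge P.down ↔ ∃ t < P.pos P.down.1 1, z = ![0, t] := by
  rw [TrivalentGraph.openEdge_of_none (hP.down_opp hj)]
  simp only [Set.mem_image, Set.mem_Ioi, hP.along_down hj]
  constructor
  · grind
  · rintro ⟨t, ht, rfl⟩
    exact ⟨P.pos P.down.1 1 - t, by linarith, by rw [sub_sub_cancel]⟩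

/-- Apart from the two marked half-edges, the piece stays in the domain of the chart. -/
theorem Fits.edge_subset {h : V × Fin 3} (hl : 0 < j → h ≠ P.left) (hd : j + 1 < k → h ≠ P.down)
    {z : Fin 2 → ℝ} (hz : z ∈ P.edge h) : pair z ∈ chartInterior k j := by
  cases ho : P.opp h with
  | some h' =>
    rw [hP.isTropical.edge_eq_segment ho] at hz
    -- Bounded edges stay in the interior of the domain by convexity. For rays, the conditions on
    -- the directions say that the defining functionals do not move towards their bounds.
    obtain ⟨a, b, ha, hb, hab, rfl⟩ := hz
    have h1 := hP.pos_mem h.1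
    have h2 := hP.pos_mem h'.1
    simp only [chartInterior, pair, Set.mem_ofPred_eq, Pi.add_apply, Pi.smul_apply, smul_eq_mul]
      at h1 h2 ⊢
    refine ⟨fun hj => ?_, fun hj => ?_⟩
    · obtain ⟨h3, h4⟩ := h1.1 hj
      obtain ⟨h5, h6⟩ := h2.1 hj
      constructor
      · rcases ha.eq_or_lt with h | h
        · nlinarith
        · nlinarith
      · rcases ha.eq_or_lt with h | h
        · nlinarith
        · nlinarith
    · obtain ⟨h3, h4⟩ := h1.2 hj
      obtain ⟨h5, h6⟩ := h2.2 hj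
      constructor
      · rcases ha.eq_or_lt with h | h
        · nlinarith
        · nlinarith
      · rcases ha.eq_or_lt with h | h
        · nlinarith
        · nlinarith
  | none =>
    rw [TrivalentGraph.edge_of_none ho] at hz
    obtain ⟨t, ht, rfl⟩ := hz
    rw [Set.mem_Ici] at ht
    have h1 := hP.pos_mem h.1
    simp only [chartInterior, pair, Set.mem_ofPred_eq, along, toReal, Pi.add_apply, Pi.smul_apply,
      smul_eq_mul] at h1 ⊢
    refine ⟨fun hj => ?_, fun hj => ?_⟩
    · obtain ⟨h3, h4⟩ := h1.1 hj
      obtain ⟨h5, h6⟩ := hP.ray_left h ho hj (hl hj) hd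
      have h5 : (0 : ℝ) ≤ P.dir h 0 := by exact_mod_cast h5
      have h6 : (0 : ℝ) ≤ P.dir h 0 - P.dir h 1 := by exact_mod_cast h6
      exact ⟨by nlinarith, by nlinarith⟩
    · obtain ⟨h3, h4⟩ := h1.2 hj
      obtain ⟨h5, h6⟩ := hP.ray_down h ho hj (hd hj) hl
      have h5 : (0 : ℝ) ≤ P.dir h 1 := by exact_mod_cast h5
      have h6 : (P.dir h 0 - P.dir h 1 : ℝ) ≤ 0 := by exact_mod_cast h6
      exact ⟨by nlinarith, by nlinarith⟩

end Fits

end Piece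

end TropGeo

namespace TropGeo

/-! ### The glued graph is a tropical curve -/

section Glue

variable {k : ℕ} {V : Fin k → Type}

/-- The half-edge of a glued graph that comes from a half-edge of one of the pieces. -/
def inj (j : Fin k) (h : V j × Fin 3) : (Σ j, V j) × Fin 3 := (⟨j, h.1⟩, h.2)

theorem inj_injective (j : Fin k) : Function.Injective (inj (V := V) j) := by
  rintro ⟨v, s⟩ ⟨v', s'⟩ h
  simp only [inj, Prod.mk.injEq, Sigma.mk.injEq, heq_eq_eq, true_and] at h
  exact Prod.ext h.1 h.2

theorem exists_eq_inj (H : (Σ j, V j) × Fin 3) : ∃ j h, H = inj j h :=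
  ⟨H.1.1, (H.1.2, H.2), rfl⟩

theorem index_eq_of_inj_eq {j j' : Fin k} {h : V j × Fin 3} {h' : V j' × Fin 3}
    (e : inj j h = inj j' h') : j = j' := congrArg (fun H => H.1.1) e

variable (P : ∀ j, Piece (V j))

/-- The left half-edge of the piece with index `i`. -/
def portLeft (i : ℕ) : Option ((Σ j, V j) × Fin 3) :=
  if h : i < k then some (inj ⟨i, h⟩ (P ⟨i, h⟩).left) else none

/-- The lower half-edge of the piece with index `i`. -/
def portDown (i : ℕ) : Option ((Σ j, V j) × Fin 3) :=
  if h : i < k then some (inj ⟨i, h⟩ (P ⟨i, h⟩).down) else none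

open Classical in
/-- The curve in space obtained from planar pieces by joining the lower half-edge of each piece to
the left half-edge of the next one. -/
def glue : TrivalentGraph (k + 1) (Σ j, V j) where
  pos v := emb k v.1 ((P v.1).pos v.2)
  dir H := chartDir k H.1.1 ((P H.1.1).dir (H.1.2, H.2))
  wt H := (P H.1.1).wt (H.1.2, H.2)
  opp H := match (P H.1.1).opp (H.1.2, H.2) with
    | some h' => some (inj H.1.1 h')
    | none =>
      if (H.1.1 : ℕ) + 1 < k ∧ (H.1.2, H.2) = (P H.1.1).down then portLeft P (H.1.1 + 1)
      else if 0 < (H.1.1 : ℕ) ∧ (H.1.2, H.2) = (P H.1.1).left then portDown P (H.1.1 - 1)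
      else none

theorem glue_pos_inj (j : Fin k) (h : V j × Fin 3) :
    (glue P).pos (inj j h).1 = emb k j ((P j).pos h.1) := rfl
theorem glue_dir_inj (j : Fin k) (h : V j × Fin 3) :
    (glue P).dir (inj j h) = chartDir k j ((P j).dir h) := rfl
theorem glue_wt_inj (j : Fin k) (h : V j × Fin 3) : (glue P).wt (inj j h) = (P j).wt h := rfl

variable {P}

theorem glue_opp_of_some {j : Fin k} {h h' : V j × Fin 3} (ho : (P j).opp h = some h') :
    (glue P).opp (inj j h) = some (inj j h') := by
  simp only [glue, inj, ho]

theorem glue_opp_of_none {j : Fin k} {h : V j × Fin 3} (ho : (P j).opp h = none)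
    (hl : 0 < (j : ℕ) → h ≠ (P j).left) (hd : (j : ℕ) + 1 < k → h ≠ (P j).down) :
    (glue P).opp (inj j h) = none := by
  simp only [glue, inj, ho]
  rw [if_neg fun hh => hd hh.1 hh.2, if_neg fun hh => hl hh.1 hh.2]

variable {w : ℕ} (hP : ∀ j : Fin k, (P j).Fits k j w)
include hP

theorem glue_opp_down {i : ℕ} (hi : i + 1 < k) :
    (glue P).opp (inj ⟨i, by omega⟩ (P ⟨i, by omega⟩).down) =
      some (inj ⟨i + 1, hi⟩ (P ⟨i + 1, hi⟩).left) := by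
  have h := (hP ⟨i, by omega⟩).down_opp hi
  simp only [glue, inj, h]
  rw [if_pos ⟨hi, trivial⟩, portLeft, dif_pos hi]
  rfl

theorem glue_opp_left {i : ℕ} (hi : i + 1 < k) :
    (glue P).opp (inj ⟨i + 1, hi⟩ (P ⟨i + 1, hi⟩).left) =
      some (inj ⟨i, by omega⟩ (P ⟨i, by omega⟩).down) := by
  have h := (hP ⟨i + 1, hi⟩).left_opp (Nat.succ_pos i)
  simp only [glue, inj, h]
  rw [if_neg fun hh => (hP ⟨i + 1, hi⟩).left_ne_down (Nat.succ_pos i) hh.1 hh.2,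
    if_pos ⟨Nat.succ_pos i, trivial⟩, Nat.add_sub_cancel, portDown, dif_pos (by omega)]
  rfl

/-- The ways in which a half-edge can be joined. -/
theorem glue_opp_cases (H : (Σ j, V j) × Fin 3) :
    (∃ j h h', (P j).opp h = some h' ∧ H = inj j h ∧ (glue P).opp H = some (inj j h')) ∨
    (∃ i, ∃ hi : i + 1 < k, H = inj ⟨i, by omega⟩ (P ⟨i, by omega⟩).down ∧
      (glue P).opp H = some (inj ⟨i + 1, hi⟩ (P ⟨i + 1, hi⟩).left)) ∨
    (∃ i, ∃ hi : i + 1 < k, H = inj ⟨i + 1, hi⟩ (P ⟨i + 1, hi⟩).left ∧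
      (glue P).opp H = some (inj ⟨i, by omega⟩ (P ⟨i, by omega⟩).down)) ∨
    (∃ j h, (P j).opp h = none ∧ (0 < (j : ℕ) → h ≠ (P j).left) ∧
      ((j : ℕ) + 1 < k → h ≠ (P j).down) ∧ H = inj j h ∧ (glue P).opp H = none) := by
  obtain ⟨j, h, rfl⟩ := exists_eq_inj H
  cases ho : (P j).opp h with
  | some h' => exact Or.inl ⟨j, h, h', ho, rfl, glue_opp_of_some ho⟩
  | none =>
    right
    by_cases hd : (j : ℕ) + 1 < k ∧ h = (P j).down
    · obtain ⟨hd, rfl⟩ := hd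
      exact Or.inl ⟨j, hd, rfl, glue_opp_down hP hd⟩
    · right
      by_cases hl : 0 < (j : ℕ) ∧ h = (P j).left
      · obtain ⟨hl, rfl⟩ := hl
        obtain ⟨_ | i, hi⟩ := j
        · exact absurd hl (lt_irrefl 0)
        · exact Or.inl ⟨i, hi, rfl, glue_opp_left hP hi⟩
      · push Not at hd hl
        exact Or.inr ⟨j, h, ho, hl, hd, rfl, glue_opp_of_none ho hl hd⟩

theorem glue_opp_symm (H H' : (Σ j, V j) × Fin 3) (h : (glue P).opp H = some H') :
    (glue P).opp H' = some H := by
  rcases glue_opp_cases hP H with ⟨j, g, g', ho, rfl, h'⟩ | ⟨i, hi, rfl, h'⟩ | ⟨i, hi, rfl, h'⟩ |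
    ⟨j, g, -, -, -, rfl, h'⟩ <;> rw [h'] at h
  · cases h
    exact glue_opp_of_some ((hP j).isTropical.opp_symm _ _ ho)
  · cases h
    exact glue_opp_left hP hi
  · cases h
    exact glue_opp_down hP hi
  · cases h

theorem glue_along_down {i : ℕ} (hi : i + 1 < k) (t : ℝ) :
    along ((glue P).pos (inj ⟨i, by omega⟩ (P ⟨i, by omega⟩).down).1)
      ((glue P).dir (inj ⟨i, by omega⟩ (P ⟨i, by omega⟩).down)) t =
    emb k i ![0, (P ⟨i, by omega⟩).pos (P ⟨i, by omega⟩).down.1 1 - t] := by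
  rw [glue_pos_inj, glue_dir_inj, ← emb_along, (hP ⟨i, by omega⟩).along_down hi]

theorem glue_along_left {i : ℕ} (hi : i + 1 < k) (t : ℝ) :
    along ((glue P).pos (inj ⟨i + 1, hi⟩ (P ⟨i + 1, hi⟩).left).1)
      ((glue P).dir (inj ⟨i + 1, hi⟩ (P ⟨i + 1, hi⟩).left)) t =
    emb k (i + 1) ![(P ⟨i + 1, hi⟩).pos (P ⟨i + 1, hi⟩).left.1 0 - t, 0] := by
  rw [glue_pos_inj, glue_dir_inj, ← emb_along, (hP ⟨i + 1, hi⟩).along_left (Nat.succ_pos i)]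

omit hP in
theorem glue_ray_inj (j : Fin k) (h : V j × Fin 3) :
    (glue P).ray (inj j h) = emb k j '' (P j).ray h := by
  rw [TrivalentGraph.ray, TrivalentGraph.ray, Set.image_image]
  simp only [emb_along]
  rfl

omit hP in
theorem glue_openRay_inj (j : Fin k) (h : V j × Fin 3) :
    (glue P).openRay (inj j h) = emb k j '' (P j).openRay h := by
  rw [TrivalentGraph.openRay, TrivalentGraph.openRay, Set.image_image]
  simp only [emb_along]
  rfl

/-- By `emb_down`, a point `(0, t)` of the lower line of one chart has coordinates `(-2 - t, 0)` in
the next. For `t ≥ -1` this is to the left of the next piece's vertex, whose first coordinate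
exceeds -1. -/
theorem glue_openRay_left {i : ℕ} (hi : i + 1 < k) {t : ℝ} (ht : -1 ≤ t) :
    emb k i ![0, t] ∈ (glue P).openRay (inj ⟨i + 1, hi⟩ (P ⟨i + 1, hi⟩).left) := by
  have h1 := (hP ⟨i + 1, hi⟩).neg_one_lt_left (Nat.succ_pos i)
  refine ⟨(P ⟨i + 1, hi⟩).pos (P ⟨i + 1, hi⟩).left.1 0 + 2 + t, by rw [Set.mem_Ioi]; linarith, ?_⟩
  rw [glue_along_left hP hi, show t = -1 - (-1 - t) by ring, emb_down]
  ring

theorem glue_openRay_down {i : ℕ} (hi : i + 1 < k) {t : ℝ} (ht : -1 ≤ t) :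
    emb k (i + 1) ![t, 0] ∈
      (glue P).openRay (inj ⟨i, by omega⟩ (P ⟨i, by omega⟩).down) := by
  have h1 := (hP ⟨i, by omega⟩).neg_one_lt_down hi
  refine ⟨(P ⟨i, by omega⟩).pos (P ⟨i, by omega⟩).down.1 1 + 2 + t,
    by rw [Set.mem_Ioi]; linarith, ?_⟩
  rw [glue_along_down hP hi, show t = -1 + (t + 1) by ring, ← emb_down]
  ring

omit hP in
theorem openRay_subset_ray {n : ℕ} {V : Type} {G : TrivalentGraph n V} {h : V × Fin 3} :
    G.openRay h ⊆ G.ray h := Set.image_mono Set.Ioi_subset_Ici_self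

/-- An edge of a piece within the domain of the chart belongs to an edge of the glued graph. -/
theorem mem_glue_edge {j : Fin k} {h : V j × Fin 3} {z : Fin 2 → ℝ} (hz : z ∈ (P j).edge h)
    (hz' : pair z ∈ chartDomain k j) : emb k j z ∈ (glue P).edge (inj j h) := by
  refine ⟨by rw [glue_ray_inj]; exact ⟨z, hz.1, rfl⟩, fun H' hH' => ?_⟩
  rcases glue_opp_cases hP (inj j h) with ⟨j', g, g', ho, e, h'⟩ | ⟨i, hi, e, h'⟩ |
    ⟨i, hi, e, h'⟩ | ⟨j', g, -, -, -, e, h'⟩ <;> rw [h'] at hH' <;>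
    obtain rfl := index_eq_of_inj_eq e <;> obtain rfl := inj_injective _ e
  · cases hH'
    rw [glue_ray_inj]
    exact ⟨z, hz.2 _ ho, rfl⟩
  · cases hH'
    obtain ⟨t, ht, rfl⟩ := ((hP _).mem_edge_down hi).1 hz
    exact openRay_subset_ray (glue_openRay_left hP hi (hz'.2 hi).1)
  · cases hH'
    obtain ⟨t, ht, rfl⟩ := ((hP _).mem_edge_left (Nat.succ_pos i)).1 hz
    exact openRay_subset_ray (glue_openRay_down hP hi (hz'.1 (Nat.succ_pos i)).1)
  · cases hH'

theorem mem_glue_openEdge {j : Fin k} {h : V j × Fin 3} {z : Fin 2 → ℝ}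
    (hz : z ∈ (P j).openEdge h) (hz' : pair z ∈ chartDomain k j) :
    emb k j z ∈ (glue P).openEdge (inj j h) := by
  refine ⟨by rw [glue_openRay_inj]; exact ⟨z, hz.1, rfl⟩, fun H' hH' => ?_⟩
  rcases glue_opp_cases hP (inj j h) with ⟨j', g, g', ho, e, h'⟩ | ⟨i, hi, e, h'⟩ |
    ⟨i, hi, e, h'⟩ | ⟨j', g, -, -, -, e, h'⟩ <;> rw [h'] at hH' <;>
    obtain rfl := index_eq_of_inj_eq e <;> obtain rfl := inj_injective _ e
  · cases hH'
    rw [glue_openRay_inj]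
    exact ⟨z, hz.2 _ ho, rfl⟩
  · cases hH'
    obtain ⟨t, ht, rfl⟩ := ((hP _).mem_openEdge_down hi).1 hz
    exact glue_openRay_left hP hi (hz'.2 hi).1
  · cases hH'
    obtain ⟨t, ht, rfl⟩ := ((hP _).mem_openEdge_left (Nat.succ_pos i)).1 hz
    exact glue_openRay_down hP hi (hz'.1 (Nat.succ_pos i)).1
  · cases hH'

/-- The joining edge passes from one chart to the next at the point `(0, -1)`, which is `(-1, 0)` in
the next chart: points up to it lie in the first domain, those beyond it in the second. -/
theorem exists_of_mem_glue_edge_port {i : ℕ} (hi : i + 1 < k) {x : Fin (k + 1) → ℝ}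
    (h1 : x ∈ (glue P).ray (inj ⟨i, by omega⟩ (P ⟨i, by omega⟩).down))
    (h2 : x ∈ (glue P).ray (inj ⟨i + 1, hi⟩ (P ⟨i + 1, hi⟩).left)) :
    (∃ z ∈ (P ⟨i, by omega⟩).edge (P ⟨i, by omega⟩).down, pair z ∈ chartDomain k i ∧
      x = emb k i z) ∨
    ∃ z ∈ (P ⟨i + 1, hi⟩).edge (P ⟨i + 1, hi⟩).left, pair z ∈ chartDomain k (i + 1) ∧
      x = emb k (i + 1) z := by
  obtain ⟨t, ht, rfl⟩ := h1
  obtain ⟨s, hs, hst⟩ := h2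
  rw [Set.mem_Ici] at ht hs
  rw [glue_along_down hP hi] at hst ⊢
  rw [glue_along_left hP hi] at hst
  set y := (P ⟨i, by omega⟩).pos (P ⟨i, by omega⟩).down.1 1
  set x' := (P ⟨i + 1, hi⟩).pos (P ⟨i + 1, hi⟩).left.1 0
  have hm := ((hP ⟨i, by omega⟩).pos_mem (P ⟨i, by omega⟩).down.1).1
  have hm' := ((hP ⟨i + 1, hi⟩).pos_mem (P ⟨i + 1, hi⟩).left.1).2
  have hp1 := (hP ⟨i, by omega⟩).down_pos hi
  have hp2 := (hP ⟨i + 1, hi⟩).left_pos (Nat.succ_pos i)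
  simp only [pair] at hm hm'
  rw [hp1] at hm
  rw [hp2] at hm'
  rcases le_or_gt (-1) (y - t) with h | h
  · refine Or.inl ⟨_, ((hP ⟨i, by omega⟩).mem_edge_down hi).2 ⟨y - t, by linarith, rfl⟩,
      ⟨fun h0 => ⟨?_, ?_⟩, fun h0 => ⟨?_, ?_⟩⟩, rfl⟩
    · simp [pair]
    · have := (hm h0).2
      simp only [pair, Matrix.cons_val]
      linarith
    · simpa [pair] using h
    · simp only [pair, Matrix.cons_val]
      linarith
  · rw [show y - t = -1 - (t - y - 1) by ring, emb_down, show -1 + (t - y - 1) = t - y - 2 by ring]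
      at hst ⊢
    have h3 := congrFun (emb_injective (k := k) hi hst) 0
    simp only [Matrix.cons_val] at h3
    refine Or.inr ⟨_, ((hP ⟨i + 1, hi⟩).mem_edge_left (Nat.succ_pos i)).2
      ⟨t - y - 2, by linarith, rfl⟩, ⟨fun h0 => ⟨?_, ?_⟩, fun h0 => ⟨?_, ?_⟩⟩, rfl⟩
    · simp only [pair, Matrix.cons_val]
      linarith
    · simp only [pair, Matrix.cons_val]
      linarith
    · simp [pair]
    · have := (hm' h0).2
      simp only [pair, Matrix.cons_val]
      linarith

/-- Every point of the glued graph is seen in a chart as a point of the planar piece, on the given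
half-edge or its partner. Questions about the space curve become planar through this. -/
theorem exists_of_mem_glue_edge {H : (Σ j, V j) × Fin 3} {x : Fin (k + 1) → ℝ}
    (hx : x ∈ (glue P).edge H) : ∃ j h, (inj j h = H ∨ (glue P).opp H = some (inj j h)) ∧
      ∃ z ∈ (P j).edge h, pair z ∈ chartDomain k j ∧ x = emb k j z := by
  rcases glue_opp_cases hP H with ⟨j, g, g', ho, rfl, h'⟩ | ⟨i, hi, rfl, h'⟩ |
    ⟨i, hi, rfl, h'⟩ | ⟨j, g, ho, hl, hd, rfl, h'⟩
  · have h1 := hx.1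
    have h2 := hx.2 _ h'
    rw [glue_ray_inj] at h1 h2
    obtain ⟨z, hz, rfl⟩ := h1
    obtain ⟨z', hz', e⟩ := h2
    obtain rfl := emb_injective j.2 e
    have hz : z' ∈ (P j).edge g := ⟨hz, fun g₁ hg₁ => by rw [ho] at hg₁; cases hg₁; exact hz'⟩
    refine ⟨j, g, Or.inl rfl, z', hz, chartInterior_subset _ _ ((hP j).edge_subset ?_ ?_ hz), rfl⟩
    · rintro h0 rfl
      rw [(hP j).left_opp h0] at ho
      cases ho
    · rintro h0 rfl
      rw [(hP j).down_opp h0] at ho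
      cases ho
  · rcases exists_of_mem_glue_edge_port hP hi hx.1 (hx.2 _ h') with h | h
    · exact ⟨_, _, Or.inl rfl, h⟩
    · exact ⟨_, _, Or.inr h', h⟩
  · rcases exists_of_mem_glue_edge_port hP hi (hx.2 _ h') hx.1 with h | h
    · exact ⟨_, _, Or.inr h', h⟩
    · exact ⟨_, _, Or.inl rfl, h⟩
  · have h1 := hx.1
    rw [glue_ray_inj] at h1
    obtain ⟨z, hz, rfl⟩ := h1
    have hz : z ∈ (P j).edge g := ⟨hz, fun g₁ hg₁ => by rw [ho] at hg₁; cases hg₁⟩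
    exact ⟨j, g, Or.inl rfl, z, hz, chartInterior_subset _ _ ((hP j).edge_subset hl hd hz), rfl⟩

omit hP in
theorem mem_openEdge_of_mem_glue {j : Fin k} {h : V j × Fin 3} {z : Fin 2 → ℝ}
    (hz : emb k j z ∈ (glue P).openEdge (inj j h)) : z ∈ (P j).openEdge h := by
  have key : ∀ h, emb k j z ∈ (glue P).openRay (inj j h) → z ∈ (P j).openRay h := by
    intro h hh
    rw [glue_openRay_inj] at hh
    obtain ⟨z', hz', e⟩ := hh
    rwa [← emb_injective j.2 e]
  exact ⟨key h hz.1, fun h' ho => key h' (hz.2 _ (glue_opp_of_some ho))⟩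

/-- The only overlap of two chart domains is the gluing point, and it is interior to both marked
half-edges because the vertices of the pieces have coordinates larger than -1. -/
theorem eq_down_left {j j' : Fin k} (hj : (j : ℕ) < j') {z z' : Fin 2 → ℝ}
    (hz : pair z ∈ chartDomain k j) (hz' : pair z' ∈ chartDomain k j')
    (e : emb k j z = emb k j' z') :
    (j' : ℕ) = j + 1 ∧ z ∈ (P j).openEdge (P j).down ∧ z' ∈ (P j').openEdge (P j').left := by
  obtain ⟨h1, h2, h3⟩ := chart_eq_chart hj j'.2 hz hz' e
  have hj1 : (j : ℕ) + 1 < k := h1 ▸ j'.2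
  have hj0 : 0 < (j' : ℕ) := by omega
  refine ⟨h1, ((hP j).mem_openEdge_down hj1).2 ⟨-1, (hP j).neg_one_lt_down hj1, ?_⟩,
    ((hP j').mem_openEdge_left hj0).2 ⟨-1, (hP j').neg_one_lt_left hj0, ?_⟩⟩
  · exact pair_injective (by rw [h2]; simp [pair])
  · exact pair_injective (by rw [h3]; simp [pair])

theorem glue_opp_of_emb_eq {j j' : Fin k} (hj : (j : ℕ) < j') {z z' : Fin 2 → ℝ}
    (hz : pair z ∈ chartDomain k j) (hz' : pair z' ∈ chartDomain k j')
    (e : emb k j z = emb k j' z') {h : V j × Fin 3} {h' : V j' × Fin 3} (hh : z ∈ (P j).edge h)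
    (hh' : z' ∈ (P j').edge h') : (glue P).opp (inj j h) = some (inj j' h') := by
  obtain ⟨h1, h2, h3⟩ := eq_down_left hP hj hz hz' e
  have hj1 : (j : ℕ) + 1 < k := h1 ▸ j'.2
  obtain rfl : h = (P j).down := ((hP j).isTropical.noncrossing _ _ _ h2 hh).resolve_right
    (by rw [(hP j).down_opp hj1]; simp)
  obtain rfl : h' = (P j').left := ((hP j').isTropical.noncrossing _ _ _ h3 hh').resolve_right
    (by rw [(hP j').left_opp (by omega)]; simp)
  obtain ⟨i', hi'⟩ := j'
  obtain rfl : i' = j + 1 := h1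
  exact glue_opp_down hP hi'

theorem glue_isTropical : (glue P).IsTropical where
  pos_injective := by
    have key : ∀ v w : Σ j, V j, (v.1 : ℕ) < w.1 → (glue P).pos v ≠ (glue P).pos w := by
      intro v w hlt e
      have h1 := (hP v.1).pos_mem v.2
      obtain ⟨h3, h4, h5⟩ := chart_eq_chart hlt w.1.2 (chartInterior_subset _ _ h1)
        (chartInterior_subset _ _ ((hP w.1).pos_mem w.2)) e
      rw [h4] at h1
      exact absurd (h1.2 (h3 ▸ w.1.2)).1 (lt_irrefl _)
    intro v w e
    rcases lt_trichotomy (v.1 : ℕ) w.1 with h | h | h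
    · exact absurd e (key v w h)
    · obtain ⟨j, v⟩ := v
      obtain ⟨j', w⟩ := w
      obtain rfl : j = j' := Fin.ext h
      have hvw : v = w := (hP j).isTropical.pos_injective (emb_injective j.2 e)
      rw [hvw]
    · exact absurd e.symm (key w v h)
  primitive H := ((hP _).isTropical.primitive _).chartDir H.1.1.2
  wt_pos H := (hP _).isTropical.wt_pos _
  balance v := by
    have h := (hP v.1).isTropical.balance v.2
    have h' := congrArg (chartDir k v.1) h
    rw [map_sum, map_zero] at h'
    exact (Finset.sum_congr rfl fun s _ => (map_smul _ _ _).symm).trans h'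
  opp_symm := glue_opp_symm hP
  opp_dir H H' hH := by
    rcases glue_opp_cases hP H with ⟨j, g, g', ho, rfl, h'⟩ | ⟨i, hi, rfl, h'⟩ |
      ⟨i, hi, rfl, h'⟩ | ⟨j, g, -, -, -, rfl, h'⟩ <;> rw [h'] at hH <;> cases hH
    · rw [glue_dir_inj, glue_dir_inj, (hP j).isTropical.opp_dir _ _ ho, map_neg]
    · rw [glue_dir_inj, glue_dir_inj, (hP _).left_dir (Nat.succ_pos i), (hP _).down_dir hi,
        chartDir_down_eq_neg, neg_neg]
    · rw [glue_dir_inj, glue_dir_inj, (hP _).left_dir (Nat.succ_pos i), (hP _).down_dir hi,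
        chartDir_down_eq_neg]
  opp_wt H H' hH := by
    rcases glue_opp_cases hP H with ⟨j, g, g', ho, rfl, h'⟩ | ⟨i, hi, rfl, h'⟩ |
      ⟨i, hi, rfl, h'⟩ | ⟨j, g, -, -, -, rfl, h'⟩ <;> rw [h'] at hH <;> cases hH
    · exact (hP j).isTropical.opp_wt _ _ ho
    · rw [glue_wt_inj, glue_wt_inj, (hP _).left_wt (Nat.succ_pos i), (hP _).down_wt hi]
    · rw [glue_wt_inj, glue_wt_inj, (hP _).left_wt (Nat.succ_pos i), (hP _).down_wt hi]
  opp_pos H H' hH := by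
    rcases glue_opp_cases hP H with ⟨j, g, g', ho, rfl, h'⟩ | ⟨i, hi, rfl, h'⟩ |
      ⟨i, hi, rfl, h'⟩ | ⟨j, g, -, -, -, rfl, h'⟩ <;> rw [h'] at hH <;> cases hH
    · obtain ⟨t, ht, e⟩ := (hP j).isTropical.opp_pos _ _ ho
      exact ⟨t, ht, by rw [glue_pos_inj, glue_pos_inj, glue_dir_inj, ← emb_along, ← e]⟩
    · obtain ⟨t, ht, e⟩ := glue_openRay_down hP hi ((hP ⟨i + 1, hi⟩).neg_one_lt_left
        (Nat.succ_pos i)).le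
      refine ⟨t, ht, ?_⟩
      rw [e, ← sub_zero ((P ⟨i + 1, hi⟩).pos _ _), ← glue_along_left hP hi, along, zero_smul,
        add_zero]
    · obtain ⟨t, ht, e⟩ := glue_openRay_left hP hi ((hP ⟨i, by omega⟩).neg_one_lt_down hi).le
      refine ⟨t, ht, ?_⟩
      rw [e, ← sub_zero ((P ⟨i, _⟩).pos _ _), ← glue_along_down hP hi, along, zero_smul,
        add_zero]
  -- Half-edges are compared up to pairing, which is an equivalence relation. Seen in one chart, two
  -- edges through the point are handled by the planar noncrossing condition; seen in two charts,
  -- the point is a gluing point and both half-edges are the joined ones.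
  noncrossing := by
    have htrans : ∀ H₁ H₂ H₃ : (Σ j, V j) × Fin 3, (H₂ = H₁ ∨ (glue P).opp H₁ = some H₂) →
        (H₃ = H₂ ∨ (glue P).opp H₂ = some H₃) → (H₃ = H₁ ∨ (glue P).opp H₁ = some H₃) := by
      rintro H₁ H₂ H₃ (rfl | h1) (rfl | h2)
      · exact Or.inl rfl
      · exact Or.inr h2
      · exact Or.inr h1
      · rw [glue_opp_symm hP _ _ h1] at h2
        cases h2
        exact Or.inl rfl
    have hsymm : ∀ H₁ H₂ : (Σ j, V j) × Fin 3, (H₂ = H₁ ∨ (glue P).opp H₁ = some H₂) →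
        (H₁ = H₂ ∨ (glue P).opp H₂ = some H₁) := by
      rintro H₁ H₂ (rfl | h1)
      · exact Or.inl rfl
      · exact Or.inr (glue_opp_symm hP _ _ h1)
    intro H H' x hx hx'
    obtain ⟨j, h, hH, z, hz, hzd, rfl⟩ := exists_of_mem_glue_edge hP
      (TrivalentGraph.openEdge_subset hx)
    obtain ⟨j', h', hH', z', hz', hzd', e⟩ := exists_of_mem_glue_edge hP hx'
    refine htrans _ _ _ hH (htrans _ _ _ ?_ (hsymm _ _ hH'))
    rcases lt_trichotomy (j : ℕ) j' with hj | hj | hj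
    · exact Or.inr (glue_opp_of_emb_eq hP hj hzd hzd' e hz hz')
    · obtain rfl : j = j' := Fin.ext hj
      obtain rfl := emb_injective j.2 e
      have hzo : z ∈ (P j).openEdge h := by
        refine mem_openEdge_of_mem_glue ?_
        rcases hH with rfl | hH
        · exact hx
        · exact ⟨hx.2 _ hH, fun H₁ hH₁ => by
            rw [glue_opp_symm hP _ _ hH] at hH₁
            cases hH₁
            exact hx.1⟩
      rcases (hP j).isTropical.noncrossing _ _ _ hzo hz' with rfl | ho
      · exact Or.inl rfl
      · exact Or.inr (glue_opp_of_some ho)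
    · exact Or.inr (glue_opp_symm hP _ _ (glue_opp_of_emb_eq hP hj hzd' hzd e.symm hz' hz))

theorem mem_glue_carrier {x : Fin (k + 1) → ℝ} : x ∈ (glue P).carrier ↔
    ∃ j, ∃ z ∈ (P j).carrier, pair z ∈ chartDomain k j ∧ x = emb k j z := by
  constructor
  · rintro ⟨H, hx⟩
    obtain ⟨j, h, -, z, hz, hzd, e⟩ := exists_of_mem_glue_edge hP hx
    exact ⟨j, z, ⟨h, hz⟩, hzd, e⟩
  · rintro ⟨j, z, ⟨h, hz⟩, hzd, rfl⟩
    exact ⟨_, mem_glue_edge hP hz hzd⟩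

theorem mem_support_glue [Fintype (Σ j, V j)] {x : Fin (k + 1) → ℝ} :
    x ∈ (glue_isTropical hP).curve.support ↔
      ∃ j, ∃ z ∈ (P j).carrier, pair z ∈ chartDomain k j ∧ x = emb k j z :=
  (glue_isTropical hP).mem_support.trans (mem_glue_carrier hP)

end Glue

end TropGeo

namespace TropGeo

/-! ### Transverse intersections, recession and genus of glued curves -/

/-- Cramer's rule with an invertible determinant. -/
theorem exists_smul_add_of_area {u v : Fin 2 → ℤ} (h : IsUnit (u 0 * v 1 - u 1 * v 0))
    (a : Fin 2 → ℤ) : ∃ α β : ℤ, a = α • u + β • v := by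
  obtain ⟨ε, hε⟩ := h.exists_right_inv
  refine ⟨ε * (a 0 * v 1 - a 1 * v 0), ε * (u 0 * a 1 - u 1 * a 0), ?_⟩
  ext i
  fin_cases i
  · simp only [Fin.zero_eta, Fin.isValue, Pi.add_apply, Pi.smul_apply, smul_eq_mul]
    linear_combination (-a 0) * hε
  · simp only [Fin.mk_one, Fin.isValue, Pi.add_apply, Pi.smul_apply, smul_eq_mul]
    linear_combination (-a 1) * hε

section Chart

variable {k j : ℕ}

theorem chartLin_injective (hj : j < k) : Function.Injective (chartLin k j) := by
  intro z w h
  refine chart_injective hj ?_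
  rw [chart, chart, h]

theorem pair_smul_add (s t : ℝ) (u v : Fin 2 → ℝ) : pair (s • u + t • v) = s • pair u + t • pair v := by
  simp [pair]

theorem smul_toReal_chartDir_add (s t : ℝ) (u v : Fin 2 → ℤ) :
    s • toReal (chartDir k j u) + t • toReal (chartDir k j v) =
      chartLin k j (pair (s • toReal u + t • toReal v)) := by
  rw [toReal_chartDir, toReal_chartDir, pair_smul_add, map_add, map_smul, map_smul]

theorem mem_span_chartDir (u v : Fin 2 → ℤ) (h : IsUnit (u 0 * v 1 - u 1 * v 0))
    {y : Fin (k + 1) → ℝ} :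
    y ∈ Submodule.span ℝ {toReal (chartDir k j u), toReal (chartDir k j v)} ↔
      ∃ w, y = chartLin k j w := by
  rw [Submodule.mem_span_pair]
  simp only [smul_toReal_chartDir_add]
  constructor
  · grind
  · rintro ⟨w, rfl⟩
    obtain ⟨ε, hε⟩ := h.exists_right_inv
    have hε : ((u 0 : ℝ) * v 1 - u 1 * v 0) * ε = 1 := by exact_mod_cast hε
    refine ⟨ε * (w.1 * v 1 - w.2 * v 0), ε * (u 0 * w.2 - u 1 * w.1), ?_⟩
    congr 1
    refine Prod.ext ?_ ?_ <;> simp only [pair, toReal, Pi.add_apply, Pi.smul_apply, smul_eq_mul]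
    · linear_combination w.1 * hε
    · linear_combination w.2 * hε

theorem linearIndependent_chartDir (hj : j < k) (u v : Fin 2 → ℤ)
    (h : IsUnit (u 0 * v 1 - u 1 * v 0)) :
    LinearIndependent ℝ ![toReal (chartDir k j u), toReal (chartDir k j v)] := by
  rw [LinearIndependent.pair_iff]
  intro s t hst
  rw [smul_toReal_chartDir_add, ← (chartLin k j).map_zero] at hst
  have h1 := chartLin_injective hj hst
  have h2 := congrArg Prod.fst h1
  have h3 := congrArg Prod.snd h1
  simp only [pair, toReal, Pi.add_apply, Pi.smul_apply, smul_eq_mul, Prod.fst_zero,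
    Prod.snd_zero] at h2 h3
  obtain ⟨ε, hε⟩ := h.exists_right_inv
  have hε : ((u 0 : ℝ) * v 1 - u 1 * v 0) * ε = 1 := by exact_mod_cast hε
  grind

theorem exists_eq_chartDir (hj : j < k) {y : Fin (k + 1) → ℤ} {w : ℝ × ℝ}
    (h : toReal y = chartLin k j w) : ∃ a, y = chartDir k j a := by
  refine ⟨![-y ⟨j, by omega⟩, y (Fin.last k) - y ⟨j, by omega⟩], toReal_injective ?_⟩
  rw [toReal_chartDir, h]
  have h0 := congrFun h ⟨j, by omega⟩
  have h1 := congrFun h (Fin.last k)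
  rw [chartLin_of_eq (j := j) _ rfl] at h0
  rw [chartLin_of_gt _ (by simpa using hj)] at h1
  simp only [toReal] at h0 h1
  congr 1
  refine Prod.ext ?_ ?_ <;> simp only [pair, toReal, Matrix.cons_val, Int.cast_neg, Int.cast_sub]
  · linarith
  · linarith

end Chart

section Glue

variable {k : ℕ} {V V' : Fin k → Type} [∀ j, Fintype (V j)] [∀ j, Fintype (V' j)]
  {P : ∀ j, Piece (V j)} {P' : ∀ j, Piece (V' j)} {w w' : ℕ}
  (hP : ∀ j : Fin k, (P j).Fits k j w) (hP' : ∀ j : Fin k, (P' j).Fits k j w')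
include hP

theorem support_glue_subset :
    (glue_isTropical hP).curve.support ⊆ (planeVariety (isValuated_spread (n := k + 1))).support := by
  intro x hx
  obtain ⟨j, z, -, hz, rfl⟩ := (mem_support_glue hP).1 hx
  rw [mem_support_planeVariety]
  exact onPlane_chart j.2 hz

-- The linear part of the chart identifies ℤ² with the lattice of the facet, so a planar crossing
-- with determinant ±1 is transverse in the plane. The crossing has to be in the interior of the
-- chart domain, where the plane is locally flat.
include hP' in
theorem isTransverseAt_glue {j : Fin k} {h : V j × Fin 3} {h' : V' j × Fin 3} {z : Fin 2 → ℝ}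
    (hz : z ∈ (P j).openEdge h) (hz' : z ∈ (P' j).openEdge h') (hzi : pair z ∈ chartInterior k j)
    (hw : (P j).wt h = 1) (hw' : (P' j).wt h' = 1)
    (hdet : IsUnit ((P j).dir h 0 * (P' j).dir h' 1 - (P j).dir h 1 * (P' j).dir h' 0)) :
    IsTransverseAt (planeVariety (isValuated_spread (n := k + 1))) (glue_isTropical hP).curve
      (glue_isTropical hP').curve (emb k j z) := by
  have hzd := chartInterior_subset _ _ hzi
  have he := mem_glue_openEdge hP hz hzd
  have he' := mem_glue_openEdge hP' hz' hzd
  have hC := (glue_isTropical hP).eventually_mem_support he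
  have hD := (glue_isTropical hP').eventually_mem_support he'
  refine ⟨chartDir k j ((P j).dir h), chartDir k j ((P' j).dir h'),
    linearIndependent_chartDir j.2 _ _ hdet, ?_, ?_, hC, hD, ?_, ?_⟩
  · intro y hy
    obtain ⟨b, hb⟩ := (mem_span_chartDir _ _ hdet).1 hy
    obtain ⟨a, rfl⟩ := exists_eq_chartDir j.2 hb
    obtain ⟨α, β, rfl⟩ := exists_smul_add_of_area hdet a
    rw [map_add, map_smul, map_smul, Submodule.mem_span_pair]
    exact ⟨α, β, rfl⟩
  · filter_upwards [(isSplit_chart j.2 hzi).eventually_onPlane_iff isValuated_spread] with y hy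
    rw [mem_support_planeVariety, mem_span_chartDir _ _ hdet]
    exact hy.trans (mem_vectorSpan_chart j.2 hzi)
  · intro e hc hd hpe
    rw [(glue_isTropical hP).weight_eq_of_mem_openEdge he hc hd hpe]
    exact hw
  · intro e hc hd hpe
    rw [(glue_isTropical hP').weight_eq_of_mem_openEdge he' hc hd hpe]
    exact hw'

include hP' in
/-- The intersection of two glued curves is computed in the charts. -/
theorem mem_support_glue_inter {x : Fin (k + 1) → ℝ} :
    x ∈ (glue_isTropical hP).curve.support ∩ (glue_isTropical hP').curve.support ↔
      ∃ j, ∃ z ∈ (P j).carrier ∩ (P' j).carrier, pair z ∈ chartDomain k j ∧ x = emb k j z := by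
  rw [Set.mem_inter_iff, mem_support_glue hP, mem_support_glue hP']
  constructor
  · rintro ⟨⟨j, z, hz, hzd, rfl⟩, j', z', hz', hzd', e⟩
    -- If the two curves see the point in different charts, it is a gluing point. Both curves pass
    -- through it in either chart.
    rcases lt_trichotomy (j : ℕ) j' with hj | hj | hj
    · exact ⟨j, z, ⟨hz, _, TrivalentGraph.openEdge_subset (eq_down_left hP' hj hzd hzd' e).2.1⟩,
        hzd, rfl⟩
    · obtain rfl : j = j' := Fin.ext hj
      obtain rfl := emb_injective j.2 e
      exact ⟨j, z, ⟨hz, hz'⟩, hzd, rfl⟩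
    · exact ⟨j', z', ⟨⟨_, TrivalentGraph.openEdge_subset (eq_down_left hP hj hzd' hzd e.symm).2.1⟩,
        hz'⟩, hzd', e⟩
  · grind

omit [∀ j, Fintype (V j)] in
/-- A glued curve of connected pieces is connected. -/
theorem glue_connected (hc : ∀ j, ∀ a b, Relation.ReflTransGen (P j).Joined a b) (hk : 0 < k)
    (a b : Σ j, V j) : Relation.ReflTransGen (glue P).Joined a b := by
  have hsymm : ∀ a b, (glue P).Joined a b → (glue P).Joined b a := by
    rintro a b ⟨s, ⟨b', s'⟩, h, rfl⟩
    exact ⟨s', _, glue_opp_symm hP _ _ h, rfl⟩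
  have hloc : ∀ j, ∀ a b : V j, Relation.ReflTransGen (glue P).Joined ⟨j, a⟩ ⟨j, b⟩ := by
    intro j a b
    refine (hc j a b).lift (fun v => (⟨j, v⟩ : Σ j, V j)) ?_
    rintro a b ⟨s, h', ho, rfl⟩
    exact ⟨s, _, glue_opp_of_some ho, rfl⟩
  have hbase : ∀ i (hi : i < k) (a : V ⟨i, hi⟩), Relation.ReflTransGen (glue P).Joined
      ⟨⟨i, hi⟩, a⟩ ⟨⟨0, hk⟩, (P ⟨0, hk⟩).down.1⟩ := by
    intro i
    induction i with
    | zero => exact fun hi a => hloc _ a _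
    | succ i ih =>
      intro hi a
      refine ((hloc _ a (P ⟨i + 1, hi⟩).left.1).tail ?_).trans (ih (by omega) (P ⟨i, by omega⟩).down.1)
      exact ⟨(P ⟨i + 1, hi⟩).left.2, _, glue_opp_left hP hi, rfl⟩
  refine (hbase _ a.1.2 a.2).trans ?_
  have := hbase _ b.1.2 b.2
  rw [← Relation.reflTransGen_swap] at this
  exact Relation.ReflTransGen.mono (fun x y h => hsymm y x h) _ _ this

/-- The unbounded edges of a piece that stay unbounded after gluing: there are `d` of them in each of
the admissible directions. -/
structure _root_.TropGeo.Piece.HasRays {V : Type} (P : Piece V) (k j d : ℕ) : Prop where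
  ray : ∀ h, P.opp h = none → (0 < j → h ≠ P.left) → (j + 1 < k → h ≠ P.down) →
    P.wt h = 1 ∧ (P.dir h = ![1, 1] ∨ (j = 0 ∧ P.dir h = ![-1, 0]) ∨ (j + 1 = k ∧ P.dir h = ![0, -1]))
  diag : Nat.card {h // P.opp h = none ∧ P.dir h = ![1, 1]} = d
  left : j = 0 → Nat.card {h // P.opp h = none ∧ P.dir h = ![-1, 0]} = d
  down : j + 1 = k → Nat.card {h // P.opp h = none ∧ P.dir h = ![0, -1]} = d

variable {d : ℕ} (hR : ∀ j : Fin k, (P j).HasRays k j d)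
include hR

omit [∀ j, Fintype (V j)] in
theorem glue_ray_cases {H : (Σ j, V j) × Fin 3} (hH : (glue P).opp H = none) :
    ∃ j h, H = inj j h ∧ (P j).opp h = none ∧ (P j).wt h = 1 ∧ ((P j).dir h = ![1, 1] ∨
      ((j : ℕ) = 0 ∧ (P j).dir h = ![-1, 0]) ∨ ((j : ℕ) + 1 = k ∧ (P j).dir h = ![0, -1])) := by
  rcases glue_opp_cases hP H with ⟨j, g, g', ho, rfl, h'⟩ | ⟨i, hi, rfl, h'⟩ | ⟨i, hi, rfl, h'⟩ |
    ⟨j, g, ho, hl, hd, rfl, h'⟩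
  · rw [h'] at hH; cases hH
  · rw [h'] at hH; cases hH
  · rw [h'] at hH; cases hH
  · exact ⟨j, g, rfl, ho, (hR j).ray g ho hl hd⟩

omit [∀ j, Fintype (V j)] in
theorem glue_ray_standard {H : (Σ j, V j) × Fin 3} (hH : (glue P).opp H = none) :
    ∃ i, (glue P).dir H = stdDir (k + 1) i := by
  obtain ⟨j, h, rfl, -, -, e | ⟨h0, e⟩ | ⟨h0, e⟩⟩ := glue_ray_cases hP hR hH <;>
    rw [glue_dir_inj, e]
  · exact ⟨_, chartDir_diag j.2⟩
  · exact ⟨_, by rw [h0]; exact chartDir_left⟩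
  · exact ⟨_, chartDir_down h0⟩

omit [∀ j, Fintype (V j)] in
/-- The rays of the glued curve in a given direction come from one piece. -/
theorem card_glue_rays {j : Fin k} {a : Fin 2 → ℤ}
    (ha : a = ![1, 1] ∨ ((j : ℕ) = 0 ∧ a = ![-1, 0]) ∨ ((j : ℕ) + 1 = k ∧ a = ![0, -1])) :
    Nat.card {H // (glue P).opp H = none ∧ (glue P).dir H = chartDir k j a} = d := by
  have hpiece : Nat.card {h // (P j).opp h = none ∧ (P j).dir h = a} = d := by
    rcases ha with rfl | ⟨h0, rfl⟩ | ⟨h0, rfl⟩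
    · exact (hR j).diag
    · exact (hR j).left h0
    · exact (hR j).down h0
  rw [← hpiece]
  have hmem : ∀ h : {h // (P j).opp h = none ∧ (P j).dir h = a},
      (glue P).opp (inj j h.1) = none ∧ (glue P).dir (inj j h.1) = chartDir k j a := by
    intro h
    refine ⟨?_, by rw [glue_dir_inj, h.2.2]⟩
    refine glue_opp_of_none h.2.1 (fun h0 e => ?_) (fun h0 e => ?_)
    · have := (hP j).left_dir h0
      rw [← e, h.2.2] at this
      rcases ha with rfl | ⟨h1, rfl⟩ | ⟨h1, rfl⟩
      · have := congrFun this 0; simp at this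
      · omega
      · have := congrFun this 0; simp at this
    · have := (hP j).down_dir h0
      rw [← e, h.2.2] at this
      rcases ha with rfl | ⟨h1, rfl⟩ | ⟨h1, rfl⟩
      · have := congrFun this 0; simp at this
      · have := congrFun this 0; simp at this
      · omega
  refine (Nat.card_congr (Equiv.ofBijective (fun h => ⟨inj j h.1, hmem h⟩) ⟨?_, ?_⟩)).symm
  · intro h h' e
    exact Subtype.ext (inj_injective j (congrArg Subtype.val e))
  · rintro ⟨H, hH, hdir⟩
    obtain ⟨j', h, rfl, ho, -, hcase⟩ := glue_ray_cases hP hR hH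
    have hj : j' = j := by
      rw [glue_dir_inj] at hdir
      rcases hcase with e | ⟨h0, e⟩ | ⟨h0, e⟩ <;> rcases ha with rfl | ⟨h1, rfl⟩ | ⟨h1, rfl⟩ <;>
        rw [e] at hdir
      · rw [chartDir_diag j.2, chartDir_diag j'.2] at hdir
        have := stdDir_injective hdir
        simp only [Option.some.injEq, Fin.mk.injEq] at this
        exact Fin.ext this
      · rw [chartDir_diag j'.2, h1, chartDir_left] at hdir
        cases stdDir_injective hdir
      · rw [chartDir_diag j'.2, chartDir_down h1] at hdir
        have := stdDir_injective hdir
        simp only [Option.some.injEq, Fin.ext_iff, Fin.val_last] at this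
        omega
      · rw [chartDir_diag j.2, h0, chartDir_left] at hdir
        cases stdDir_injective hdir
      · exact Fin.ext (by omega)
      · rw [chartDir_down h1, h0, chartDir_left] at hdir
        cases stdDir_injective hdir
      · rw [chartDir_diag j.2, chartDir_down h0] at hdir
        have := stdDir_injective hdir
        simp only [Option.some.injEq, Fin.ext_iff, Fin.val_last] at this
        omega
      · rw [chartDir_down h0, h1, chartDir_left] at hdir
        cases stdDir_injective hdir
      · exact Fin.ext (by omega)
    subst hj
    exact ⟨⟨h, ho, chartDir_injective j'.2 hdir⟩, rfl⟩

omit [∀ j, Fintype (V j)] in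
theorem card_glue_rays_stdDir (hk : 0 < k) (i : Option (Fin (k + 1))) :
    Nat.card {H // (glue P).opp H = none ∧ (glue P).dir H = stdDir (k + 1) i} = d := by
  cases i with
  | none =>
    rw [← card_glue_rays hP hR (j := ⟨0, hk⟩) (Or.inr (Or.inl ⟨rfl, rfl⟩)), ← chartDir_left]
  | some i =>
    rcases Nat.lt_or_ge i k with h | h
    · rw [← card_glue_rays hP hR (j := ⟨i, h⟩) (Or.inl rfl), chartDir_diag h]
    · obtain rfl : i = Fin.last k := Fin.ext (by rw [Fin.val_last]; omega)
      have hk' : k - 1 + 1 = k := by omega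
      rw [← card_glue_rays hP hR (j := ⟨k - 1, by omega⟩) (Or.inr (Or.inr ⟨hk', rfl⟩)),
        ← chartDir_down hk']

/-- The direction (1,1) of chart `j` becomes the negative of the basis vector with index `j`. The
left direction of the first chart becomes (1, …, 1), the lower direction of the last chart the
negative of the last basis vector. So every standard direction arises in exactly one piece. -/
theorem recessionFan_glue (hk : 0 < k) :
    (glue_isTropical hP).curve.recessionFan = d • fanLine (k + 1) := by
  funext u
  have hwt : (glue_isTropical hP).curve.recessionFan u =
      Nat.card {H // (glue P).opp H = none ∧ (glue P).dir H = u} := by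
    rw [(glue_isTropical hP).recessionFan_apply, Nat.card_eq_fintype_card, Fintype.card_subtype,
      Finset.card_eq_sum_ones]
    refine Finset.sum_congr rfl fun H hH => ?_
    obtain ⟨j, h, rfl, -, hw, -⟩ := glue_ray_cases hP hR (Finset.mem_filter.1 hH).2.1
    exact hw
  rw [hwt, Pi.smul_apply, fanLine]
  by_cases hu : ∃ i, u = stdDir (k + 1) i
  · obtain ⟨i, rfl⟩ := hu
    rw [card_glue_rays_stdDir hP hR hk, if_pos ⟨i, rfl⟩, smul_eq_mul, mul_one]
  · rw [if_neg hu, smul_zero, Nat.card_eq_zero]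
    refine Or.inl ⟨fun H => hu ?_⟩
    obtain ⟨i, hi⟩ := glue_ray_standard hP hR H.2.1
    exact ⟨i, H.2.2.symm.trans hi⟩

theorem curveDegree_glue (hk : 0 < k) : (glue_isTropical hP).curve.curveDegree = d := by
  rw [(glue_isTropical hP).curveDegree_eq (Nat.succ_pos k)
    (fun H hH => glue_ray_standard hP hR hH), recessionFan_glue hP hR hk, Pi.smul_apply, fanLine,
    if_pos ⟨none, rfl⟩, smul_eq_mul, mul_one]

theorem card_glue_rays_all (hk : 0 < k) :
    Nat.card {H // (glue P).opp H = none} = (k + 2) * d := by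
  have h1 := Finset.card_eq_sum_card_fiberwise (f := (glue P).dir)
    (s := Finset.univ.filter fun H => (glue P).opp H = none)
    (t := Finset.univ.image (stdDir (k + 1))) (by
      intro H hH
      obtain ⟨i, hi⟩ := glue_ray_standard hP hR (Finset.mem_filter.1 hH).2
      exact Finset.mem_image.2 ⟨i, Finset.mem_univ _, hi.symm⟩)
  rw [Finset.sum_image fun _ _ _ _ h => stdDir_injective h] at h1
  rw [Nat.card_eq_fintype_card, Fintype.card_subtype, h1]
  have h2 : ∀ i ∈ (Finset.univ : Finset (Option (Fin (k + 1)))), ((Finset.univ.filter fun H =>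
      (glue P).opp H = none).filter fun H => (glue P).dir H = stdDir (k + 1) i).card = d := by
    intro i _
    rw [Finset.filter_filter, ← Fintype.card_subtype, ← Nat.card_eq_fintype_card,
      card_glue_rays_stdDir hP hR hk]
  rw [Finset.sum_congr rfl h2]
  simp

omit [∀ j, Fintype (V j)] hP hR in
/-- The number of glued sides, each counted twice. -/
theorem sum_ports (hk : 0 < k) : ∑ j : Fin k, ((if 0 < (j : ℕ) then (1 : ℤ) else 0) +
    if (j : ℕ) + 1 < k then 1 else 0) = 2 * (k - 1) := by
  obtain ⟨m, rfl⟩ : ∃ m, k = m + 1 := ⟨k - 1, by omega⟩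
  rw [Finset.sum_add_distrib, Fin.sum_univ_succ, Fin.sum_univ_castSucc (n := m)]
  simp
  ring

/-- There are `k d² - 2 (k - 1) (d - 1)` vertices, because each of the `k - 1` joints involves two
undivided sides, and `(k + 2) d` rays. -/
theorem genus_glue (K : Type*) [Field K] (hk : 0 < k)
    (hc : ∀ j, ∀ a b, Relation.ReflTransGen (P j).Joined a b)
    (hcard : ∀ j : Fin k, (Fintype.card (V j) : ℤ) =
      d ^ 2 - ((if 0 < (j : ℕ) then 1 else 0) + if (j : ℕ) + 1 < k then 1 else 0) * (d - 1)) :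
    2 * ((glue_isTropical hP).curve.genus K : ℤ) = k * ((d - 1) * (d - 2)) := by
  have : Nonempty (Σ j, V j) := ⟨⟨⟨0, hk⟩, (P ⟨0, hk⟩).down.1⟩⟩
  rw [(glue_isTropical hP).two_mul_genus K (glue_connected hP hc hk), card_glue_rays_all hP hR hk,
    Fintype.card_sigma, Nat.cast_sum, Finset.sum_congr rfl fun j _ => hcard j,
    Finset.sum_sub_distrib, ← Finset.sum_mul, sum_ports hk, Finset.sum_const, Finset.card_univ,
    Fintype.card_fin, nsmul_eq_mul]
  push_cast
  ring

end Glue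

end TropGeo

namespace TropGeo

/-! ### The constants -/

/-- The size of the bounded part of the curve of degree `d`. -/
def scale (d : ℕ) : ℝ := 1 / (1024 * 16 ^ d * d.factorial)

/-- The depth of the frame of the curve of degree `d`. -/
def depth (d : ℕ) : ℝ := 1 / 2 - 1 / (4 * 2 ^ d)

theorem scale_pos (d : ℕ) : 0 < scale d := by
  unfold scale
  positivity

/-- The factor 16 (d + 1) is chosen so that the whole honeycomb of the next curve, whose coordinates
are at most 5 (d + 1) of its units, lies within one unit of the present curve. -/
theorem scale_succ (d : ℕ) : scale d = 16 * (d + 1) * scale (d + 1) := by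
  rw [scale, scale, Nat.factorial_succ]
  push_cast
  field_simp
  ring

theorem cube_le_pow (d : ℕ) : d ^ 3 ≤ 8 ^ d := by
  rw [show (8 : ℕ) = 2 ^ 3 by norm_num, pow_right_comm]
  exact Nat.pow_le_pow_left Nat.lt_two_pow_self.le 3

/-- The frame deviates from its depth by a multiple of `d² · scale d`. The factor `2 ^ d` makes this
negligible against the gaps between consecutive depths. -/
theorem scale_mul_cube_le (d : ℕ) : (d : ℝ) ^ 3 * scale d * 2 ^ d ≤ 1 / 1024 := by
  have h1 : (d : ℝ) ^ 3 ≤ 8 ^ d := by exact_mod_cast cube_le_pow d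
  have h2 : (1 : ℝ) ≤ d.factorial := by exact_mod_cast d.factorial_pos
  have h3 : (16 : ℝ) ^ d = 8 ^ d * 2 ^ d := by rw [← mul_pow]; norm_num
  rw [scale, h3, mul_one_div, div_mul_eq_mul_div, div_le_div_iff₀ (by positivity) (by norm_num)]
  have h4 : (d : ℝ) ^ 3 * 2 ^ d ≤ 8 ^ d * 2 ^ d * d.factorial := by
    calc (d : ℝ) ^ 3 * 2 ^ d ≤ 8 ^ d * 2 ^ d * 1 := by rw [mul_one]; gcongr
      _ ≤ _ := by gcongr
  linarith

theorem depth_bounds {d : ℕ} (hd : 1 ≤ d) : 3 / 8 ≤ depth d ∧ depth d ≤ 1 / 2 := by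
  have h1 : (2 : ℝ) ≤ 2 ^ d := by
    calc (2 : ℝ) = 2 ^ 1 := by norm_num
      _ ≤ 2 ^ d := pow_le_pow_right₀ (by norm_num) hd
  have h2 : 1 / (4 * 2 ^ d : ℝ) ≤ 1 / 8 := one_div_le_one_div_of_le (by norm_num) (by linarith)
  have h3 : 0 < 1 / (4 * 2 ^ d : ℝ) := by positivity
  rw [depth]
  constructor <;> linarith

/-- The size of the bounded part in units that absorb the degree. -/
def small (d : ℕ) : ℝ := (d : ℝ) ^ 3 * scale d

theorem small_bounds {d : ℕ} (hd : 1 ≤ d) : 0 < small d ∧ small d ≤ 1 / 2048 ∧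
    scale d ≤ small d ∧ d * scale d ≤ small d ∧ d ^ 2 * scale d ≤ small d := by
  have h0 := scale_pos d
  have h1 : (1 : ℝ) ≤ d := by exact_mod_cast hd
  have h2 : (2 : ℝ) ≤ 2 ^ d := by
    calc (2 : ℝ) = 2 ^ 1 := by norm_num
      _ ≤ 2 ^ d := pow_le_pow_right₀ (by norm_num) hd
  have h3 := scale_mul_cube_le d
  have h4 : 0 < (d : ℝ) ^ 3 * scale d := by positivity
  have h5 : (d : ℝ) ≤ d ^ 3 := le_self_pow₀ h1 (by norm_num)
  have h6 : (d : ℝ) ^ 2 ≤ d ^ 3 := pow_le_pow_right₀ h1 (by norm_num)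
  rw [small]
  refine ⟨h4, by nlinarith, ?_, by gcongr, by gcongr⟩
  calc scale d = 1 * scale d := (one_mul _).symm
    _ ≤ _ := by gcongr; linarith

theorem small_le_depth_sub {d : ℕ} : 256 * small d ≤ 1 / (4 * 2 ^ d) := by
  have h := scale_mul_cube_le d
  rw [le_div_iff₀ (by positivity), small]
  linarith

/-- The gap `1 / (8 * 2 ^ d)` is at least 128 times `small d`, by `small_le_depth_sub`. -/
theorem depth_succ (d : ℕ) : depth (d + 1) = depth d + 1 / (8 * 2 ^ d) := by
  rw [depth, depth, pow_succ]
  ring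

/-! ### A dual subdivision of a triangle -/

/-- The triangles of the subdivision. -/
inductive Triangle
  | P (i j : ℤ)
  | Q (i j : ℤ)
  | A (j : ℤ)
  | B (i : ℤ)

namespace Triangle

variable (d : ℕ) (l m : ℤ)

/-- The triangles that occur. The parameters `l` and `m` tell whether there is a left, respectively
lower, edge that is not subdivided. -/
def Valid : Triangle → Prop
  | P i j => l ≤ i ∧ m ≤ j ∧ i + j + 1 ≤ d
  | Q i j => l ≤ i ∧ m ≤ j ∧ i + j + 2 ≤ d
  -- Triangles `A` and `B` fan out from the origin to the column, respectively row, next to an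
  -- undivided side. With both sides undivided the left fan starts at `j = 1`, except in degree one,
  -- where the whole triangle is recorded as `A 0`.
  | A j => l = 1 ∧ 0 ≤ j ∧ j + 1 ≤ d ∧ (m ≤ j ∨ d = 1)
  | B i => m = 1 ∧ l ≤ i ∧ i + 1 ≤ d

/-- The vertices of a triangle in counterclockwise order. -/
def corner : Triangle → Fin 3 → ℤ × ℤ
  | P i j => ![(i, j), (i + 1, j), (i, j + 1)]
  | Q i j => ![(i + 1, j), (i + 1, j + 1), (i, j + 1)]
  | A j => ![(0, 0), (1, j), if j + 1 = d then (0, (d : ℤ)) else (1, j + 1)]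
  | B i => ![(0, 0), if i + 1 = d then ((d : ℤ), 0) else (i + 1, 1), (i, 1)]

/-- The lattice points of the subdivision. -/
def labels : Set (ℤ × ℤ) :=
  {p | 0 ≤ p.1 ∧ 0 ≤ p.2 ∧ p.1 + p.2 ≤ d ∧ (p.1 < l → p.2 = 0 ∨ p.2 = d) ∧
    (p.2 < m → p.1 = 0 ∨ p.1 = d)}

/-- The height of a lattice point, which determines the lengths of the edges of the curve. -/
def height (p : ℤ × ℤ) : ℝ :=
  if p.1 < l ∨ p.2 < m then 0 else
    -- The quadratic form `a² + ab + b²` induces the honeycomb triangulation. The linear terms move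
    -- all its vertices to negative coordinates with negative difference, and the constant lifts the
    -- inner labels above those of the frame by `depth d`.
    scale d * (p.1 ^ 2 + p.1 * p.2 + p.2 ^ 2 - (4 * d + 2) * p.1 - (2 * d + 2) * p.2) - depth d

/-- The vertex of the curve dual to a triangle. -/
def dualPos : Triangle → Fin 2 → ℝ
  | P i j => ![scale d * (2 * i + j - 4 * d - 1), scale d * (i + 2 * j - 2 * d - 1)]
  | Q i j => ![scale d * (2 * i + j - 4 * d), scale d * (i + 2 * j - 2 * d)]
  -- The corners of a frame triangle all have value 0 here, since the label (0,0) has height 0. For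
  -- the last triangle the third corner (0, d) forces the second coordinate to vanish.
  | A j => ![height d l m (1, j) - j * (if j + 1 = d then 0 else scale d * (2 * j - 2 * d)),
      if j + 1 = d then 0 else scale d * (2 * j - 2 * d)]
  | B i => ![if i + 1 = d then 0 else scale d * (2 * i - 4 * d),
      height d l m (i, 1) - i * (if i + 1 = d then 0 else scale d * (2 * i - 4 * d))]

end Triangle

/-- The vertices of the planar curve of degree `d`. -/
abbrev PlanarVertex (d : ℕ) (l m : ℤ) := {T : Triangle // T.Valid d l m}

/-- The planar curve of degree `d` as a labelled graph. -/
def planar (d : ℕ) (l m : ℤ) : LabelledGraph (PlanarVertex d l m) where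
  pos v := v.1.dualPos d l m
  labels := Triangle.labels d l m
  height := Triangle.height d l m
  tri v := v.1.corner d

section Planar

open Triangle

variable {d : ℕ} {l m : ℤ}

theorem val_inner {a b : ℤ} (ha : l ≤ a) (hb : m ≤ b) (x : Fin 2 → ℝ) :
    (planar d l m).val (a, b) x = a * x 0 + b * x 1 -
      scale d * (a ^ 2 + a * b + b ^ 2 - (4 * d + 2) * a - (2 * d + 2) * b) + depth d := by
  simp only [LabelledGraph.val, planar, height, not_lt.2 ha, not_lt.2 hb, or_self, if_false]
  ring

theorem val_frame {a b : ℤ} (h : a < l ∨ b < m) (x : Fin 2 → ℝ) :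
    (planar d l m).val (a, b) x = a * x 0 + b * x 1 := by
  simp only [LabelledGraph.val, planar, height, h, if_true, sub_zero]

theorem val_origin (h : 0 < l ∨ 0 < m) (x : Fin 2 → ℝ) : (planar d l m).val (0, 0) x = 0 := by
  simp [val_frame h]

/-- The basic quadratic form on lattice points. -/
theorem one_le_quad {α β : ℤ} (h0 : ¬ (α = 0 ∧ β = 0)) (h1 : ¬ (α = 1 ∧ β = 0))
    (h2 : ¬ (α = 0 ∧ β = 1)) : 1 ≤ α ^ 2 + α * β + β ^ 2 - α - β := by
  by_contra hcon
  have h3 : (α + β - 1) ^ 2 + α ^ 2 + β ^ 2 ≤ 1 := by linarith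
  have h4 : -1 ≤ α ∧ α ≤ 1 := ⟨by nlinarith [sq_nonneg (α + β - 1)], by nlinarith [sq_nonneg (α + β - 1)]⟩
  have h5 : -1 ≤ β ∧ β ≤ 1 := ⟨by nlinarith [sq_nonneg (α + β - 1)], by nlinarith [sq_nonneg (α + β - 1)]⟩
  obtain ⟨h6, h7⟩ := h4
  obtain ⟨h8, h9⟩ := h5
  interval_cases α <;> interval_cases β <;> simp at h0 h1 h2 h3

/-- The position of a vertex of the frame. -/
theorem frame_bounds (hd : 1 ≤ d) {p q : ℝ} (hp : 2 * d + 2 ≤ p) (hp' : p ≤ 6 * d)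
    (hq : 2 * d + 2 ≤ q) (hq' : q ≤ 6 * d) {j : ℤ} (hj : 0 ≤ j) (hjd : j + 1 ≤ d) {x y : ℝ}
    (hy : y = 0 ∨ y = scale d * (2 * j + 2 - q))
    (hx : x = scale d * (1 + j + j ^ 2 - p - q * j) - depth d - j * y) :
    -6 * small d ≤ y ∧ y ≤ 0 ∧ -depth d - 12 * small d ≤ x ∧ x ≤ -depth d + 6 * (d ^ 2 * scale d) := by
  have hs := scale_pos d
  obtain ⟨e0, e1, e2, e3, e4⟩ := small_bounds hd
  have hj : (0 : ℝ) ≤ j := by exact_mod_cast hj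
  have hjd : (j : ℝ) + 1 ≤ d := by exact_mod_cast hjd
  have hy' : -(6 * d) * scale d ≤ y ∧ y ≤ 0 := by
    rcases hy with rfl | rfl
    · exact ⟨by nlinarith, le_rfl⟩
    · exact ⟨by nlinarith, by nlinarith⟩
  have h3 : 1 + j + j ^ 2 - p - q * j ≤ 0 := by nlinarith
  have h4 : -(12 * d ^ 2) ≤ 1 + j + j ^ 2 - p - q * j := by nlinarith
  exact ⟨by nlinarith, hy'.2, by nlinarith, by nlinarith⟩

/-- The coefficients `p`, `q` allow for both frames: `(4d + 2, 2d + 2)` on the left, exchanged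
below. In the row `a = 1` the value factors as `(b - j) (y - scale d (b + j + 1 - q))`, which is
negative by convexity. In a row `a ≥ 2` the term `a x` costs about twice the depth, while only one
depth is gained. -/
theorem frame_dominance (hd : 1 ≤ d) {p q : ℝ} (hp : 2 * d + 2 ≤ p) (hp' : p ≤ 6 * d)
    (hq : 2 * d + 2 ≤ q) (hq' : q ≤ 6 * d) {j : ℤ} (hj : 0 ≤ j) (hjd : j + 1 ≤ d) {x y : ℝ}
    (hy : y = if j + 1 = d then 0 else scale d * (2 * j + 2 - q))
    (hx : x = scale d * (1 + j + j ^ 2 - p - q * j) - depth d - j * y) {a b : ℤ} (ha : 1 ≤ a)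
    (hb : 0 ≤ b) (hab : a + b ≤ d) (h1 : ¬ (a = 1 ∧ b = j)) (h2 : ¬ (a = 1 ∧ b = j + 1 ∧ j + 1 ≠ d)) :
    a * x + b * y - scale d * (a ^ 2 + a * b + b ^ 2 - p * a - q * b) + depth d < 0 := by
  have hs := scale_pos d
  obtain ⟨b1, b2, b3, b4⟩ := frame_bounds hd hp hp' hq hq' hj hjd
    (by split_ifs at hy; exacts [Or.inl hy, Or.inr hy]) hx
  obtain ⟨e0, e1, -, -, -⟩ := small_bounds hd
  obtain ⟨k0, k1⟩ := depth_bounds hd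
  rcases ha.eq_or_lt with rfl | ha
  · have key : (1 : ℤ) * x + b * y - scale d * ((1 : ℤ) ^ 2 + (1 : ℤ) * b + b ^ 2 - p * (1 : ℤ) - q * b)
        + depth d = (b - j) * (y - scale d * (b + j + 1 - q)) := by
      grind
    rw [key]
    split_ifs at hy with hjd'
    · have hbj : (b : ℝ) + 1 ≤ j := by exact_mod_cast (show b + 1 ≤ j by omega)
      have hjd : (j : ℝ) + 1 ≤ d := by exact_mod_cast hjd
      rw [hy]
      exact mul_neg_of_neg_of_pos (by linarith)
        (by rw [zero_sub, ← mul_neg]; exact mul_pos hs (by linarith))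
    · have h3 : 1 ≤ (b - j) * (b - j - 1) := by
        rcases lt_or_ge b j with h | h
        · nlinarith
        · nlinarith [show j + 2 ≤ b by omega]
      have h4 : (1 : ℝ) ≤ (b - j) * (b - j - 1) := by exact_mod_cast h3
      rw [hy]
      nlinarith
  · have ha' : (2 : ℝ) ≤ a := by exact_mod_cast ha
    have hb' : (0 : ℝ) ≤ b := by exact_mod_cast hb
    have hab' : (a : ℝ) + b ≤ d := by exact_mod_cast hab
    have c3 : -(a ^ 2 + a * b + b ^ 2 - p * a - q * b) ≤ 6 * (d : ℝ) ^ 2 := by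
      nlinarith [mul_nonneg (show (0 : ℝ) ≤ a by linarith) hb', sq_nonneg (a : ℝ), sq_nonneg (b : ℝ)]
    have c5 := (small_bounds hd).2.2.2.2
    nlinarith

end Planar

end TropGeo

namespace TropGeo

/-! ### Positions, orientation and ties for the planar subdivision -/

section Planar

open Triangle

variable {d : ℕ} {l m : ℤ}

/-- The inner points of a piece. -/
theorem inner_val_pos (hd : 1 ≤ d) {a b : ℤ} (ha : 0 ≤ a) (hb : 0 ≤ b) (hab : a + b ≤ d) {x y : ℝ}
    (hx : -(6 * d) * scale d ≤ x) (hy : -(6 * d) * scale d ≤ y) :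
    0 < a * x + b * y - scale d * (a ^ 2 + a * b + b ^ 2 - (4 * d + 2) * a - (2 * d + 2) * b) +
      depth d := by
  have hs := scale_pos d
  obtain ⟨e0, e1, e2, e3, e4⟩ := small_bounds hd
  obtain ⟨k0, k1⟩ := depth_bounds hd
  have ha : (0 : ℝ) ≤ a := by exact_mod_cast ha
  have hb : (0 : ℝ) ≤ b := by exact_mod_cast hb
  have hab : (a : ℝ) + b ≤ d := by exact_mod_cast hab
  have h1 : a * (-(6 * d) * scale d) ≤ a * x := mul_le_mul_of_nonneg_left hx ha
  have h2 : b * (-(6 * d) * scale d) ≤ b * y := mul_le_mul_of_nonneg_left hy hb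
  have h3 : (a : ℝ) ^ 2 + a * b + b ^ 2 - (4 * d + 2) * a - (2 * d + 2) * b ≤ 0 := by nlinarith
  have h4 := mul_nonpos_of_nonneg_of_nonpos hs.le h3
  have h5 : (a + b) * (6 * (d * scale d)) ≤ d * (6 * (d * scale d)) := by
    have : (0 : ℝ) ≤ d := by linarith
    gcongr
  nlinarith

theorem pos_P {i j : ℤ} (h : (P i j).Valid d l m) :
    (planar d l m).pos ⟨P i j, h⟩ =
      ![scale d * (2 * i + j - 4 * d - 1), scale d * (i + 2 * j - 2 * d - 1)] := rfl
theorem pos_Q {i j : ℤ} (h : (Q i j).Valid d l m) :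
    (planar d l m).pos ⟨Q i j, h⟩ =
      ![scale d * (2 * i + j - 4 * d), scale d * (i + 2 * j - 2 * d)] := rfl
theorem pos_A {j : ℤ} (h : (A j).Valid d l m) :
    (planar d l m).pos ⟨A j, h⟩ =
      ![height d l m (1, j) - j * (if j + 1 = d then 0 else scale d * (2 * j - 2 * d)),
      if j + 1 = d then 0 else scale d * (2 * j - 2 * d)] := rfl
theorem pos_B {i : ℤ} (h : (B i).Valid d l m) :
    (planar d l m).pos ⟨B i, h⟩ =
      ![if i + 1 = d then 0 else scale d * (2 * i - 4 * d),
      height d l m (i, 1) - i * (if i + 1 = d then 0 else scale d * (2 * i - 4 * d))] := rfl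

theorem height_inner {a b : ℤ} (ha : l ≤ a) (hb : m ≤ b) : height d l m (a, b) =
    scale d * (a ^ 2 + a * b + b ^ 2 - (4 * d + 2) * a - (2 * d + 2) * b) - depth d := by
  simp only [height, not_lt.2 ha, not_lt.2 hb, or_self, if_false]

variable (hd : 1 ≤ d) (hl : l = 0 ∨ l = 1) (hm : m = 0 ∨ m = 1)

include hd hl hm in
/-- The vertices of the cluster are close to the origin. -/
theorem cluster_bounds (v : PlanarVertex d l m) (hv : ∃ i j, v.1 = P i j ∨ v.1 = Q i j) :
    -(5 * d) * scale d ≤ (planar d l m).pos v 0 ∧ (planar d l m).pos v 0 < 0 ∧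
    -(3 * d) * scale d ≤ (planar d l m).pos v 1 ∧ (planar d l m).pos v 1 < 0 := by
  have hs := scale_pos d
  have hd' : (1 : ℝ) ≤ d := by exact_mod_cast hd
  obtain ⟨v, hv'⟩ := v
  obtain ⟨i, j, rfl | rfl⟩ := hv
  all_goals
    obtain ⟨h1, h2, h3⟩ := id hv'
    have h1 : (0 : ℝ) ≤ i := by exact_mod_cast (show 0 ≤ i by omega)
    have h2 : (0 : ℝ) ≤ j := by exact_mod_cast (show 0 ≤ j by omega)
  · have h3 : (i : ℝ) + j + 1 ≤ d := by exact_mod_cast h3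
    simp only [pos_P, Matrix.cons_val]
    refine ⟨by nlinarith, mul_neg_of_pos_of_neg hs (by linarith), by nlinarith,
      mul_neg_of_pos_of_neg hs (by linarith)⟩
  · have h3 : (i : ℝ) + j + 2 ≤ d := by exact_mod_cast h3
    simp only [pos_Q, Matrix.cons_val]
    refine ⟨by nlinarith, mul_neg_of_pos_of_neg hs (by linarith), by nlinarith,
      mul_neg_of_pos_of_neg hs (by linarith)⟩

include hd hm in
theorem pos_A_bounds {j : ℤ} (h : (A j).Valid d l m) :
    ((planar d l m).pos ⟨A j, h⟩ 0 = 0 ∧ (planar d l m).pos ⟨A j, h⟩ 1 = 0 ∧ d = 1 ∧ m = 1) ∨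
    (m ≤ j ∧ (planar d l m).pos ⟨A j, h⟩ 0 = scale d * (1 + j + j ^ 2 - (4 * d + 2) - (2 * d + 2) * j) -
      depth d - j * (planar d l m).pos ⟨A j, h⟩ 1) := by
  obtain ⟨h1, h2, h3, h4⟩ := id h
  by_cases hmj : m ≤ j
  · right
    refine ⟨hmj, ?_⟩
    simp only [pos_A, Matrix.cons_val,
      height_inner h1.le hmj]
    push_cast
    ring
  · left
    obtain rfl : j = 0 := by omega
    obtain rfl : m = 1 := by omega
    obtain rfl : d = 1 := by omega
    simp [pos_A, height]

theorem pos_B_eq {i : ℤ} (h : (B i).Valid d l m) :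
    (planar d l m).pos ⟨B i, h⟩ 1 = scale d * (1 + i + i ^ 2 - (2 * d + 2) - (4 * d + 2) * i) -
      depth d - i * (planar d l m).pos ⟨B i, h⟩ 0 := by
  obtain ⟨h1, h2, h3⟩ := id h
  simp only [pos_B, Matrix.cons_val,
    height_inner h2 h1.le]
  push_cast
  ring

include hd hl hm in
/-- All vertices are in a small square. -/
theorem planar_pos_bounds (v : PlanarVertex d l m) :
    -(3 / 4) < (planar d l m).pos v 0 ∧ (planar d l m).pos v 0 ≤ 0 ∧
    -(3 / 4) < (planar d l m).pos v 1 ∧ (planar d l m).pos v 1 ≤ 0 := by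
  obtain ⟨e0, e1, e2, e3, e4⟩ := small_bounds hd
  obtain ⟨k0, k1⟩ := depth_bounds hd
  have hd' : (1 : ℝ) ≤ d := by exact_mod_cast hd
  obtain ⟨v | v | j | i, hv⟩ := v
  · obtain ⟨h1, h2, h3, h4⟩ := cluster_bounds hd hl hm ⟨_, hv⟩ ⟨_, _, Or.inl rfl⟩
    exact ⟨by linarith, h2.le, by linarith, h4.le⟩
  · obtain ⟨h1, h2, h3, h4⟩ := cluster_bounds hd hl hm ⟨_, hv⟩ ⟨_, _, Or.inr rfl⟩
    exact ⟨by linarith, h2.le, by linarith, h4.le⟩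
  · rcases pos_A_bounds hd hm hv with ⟨h1, h2, -⟩ | ⟨hmj, h⟩
    · rw [h1, h2]; norm_num
    · obtain ⟨h1, h2, h3, h4⟩ := frame_bounds hd (p := 4 * d + 2) (q := 2 * d + 2) (by linarith)
        (by linarith) (by linarith) (by linarith) hv.2.1 hv.2.2.1 (by
          simp only [pos_A, Matrix.cons_val]
          split_ifs
          · exact Or.inl rfl
          · right; ring) h
      exact ⟨by linarith, by linarith, by linarith, h2⟩
  · obtain ⟨h1, h2, h3, h4⟩ := frame_bounds hd (p := 2 * d + 2) (q := 4 * d + 2) (by linarith)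
      (by linarith) (by linarith) (by linarith) (show 0 ≤ i by have := hv.2.1; omega) hv.2.2 (by
        simp only [pos_B, Matrix.cons_val]
        split_ifs
        · exact Or.inl rfl
        · right; ring) (pos_B_eq hv)
    exact ⟨by linarith, h2, by linarith, by linarith⟩

include hd hl hm in
theorem planar_tri_mem (v : PlanarVertex d l m) (s : Fin 3) :
    (planar d l m).tri v s ∈ (planar d l m).labels := by
  obtain ⟨T, hT⟩ := v
  change T.corner d s ∈ labels d l m
  cases T <;> fin_cases s <;> simp [corner, labels, Valid] at hT ⊢ <;> (try split_ifs) <;>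
    (try simp) <;> omega

include hd in
theorem planar_area_pos (v : PlanarVertex d l m) : 0 < area ((planar d l m).tri v 1 - (planar d l m).tri v 0)
    ((planar d l m).tri v 2 - (planar d l m).tri v 0) := by
  obtain ⟨T, hT⟩ := v
  change 0 < area (T.corner d 1 - T.corner d 0) (T.corner d 2 - T.corner d 0)
  cases T <;> simp [corner, area, Valid] at hT ⊢ <;> (try split_ifs) <;> simp <;> omega

/-- Corner sums of upright and inverted triangles differ modulo 3. Those of `A` have first
coordinate at most 2 and those of `B` have second coordinate at most 2, values not reached by the
other triangles present when the corresponding side is undivided. -/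
theorem planar_sum_injective : Function.Injective fun v : PlanarVertex d l m => ∑ s, (planar d l m).tri v s := by
  have key : ∀ T : Triangle, T.Valid d l m → ∑ s, T.corner d s = match T with
    | P i j => (3 * i + 1, 3 * j + 1)
    | Q i j => (3 * i + 2, 3 * j + 2)
    | A j => if j + 1 = d then (1, 2 * d - 1) else (2, 2 * j + 1)
    | B i => if i + 1 = d then (2 * d - 1, 1) else (2 * i + 1, 2) := by
    intro T hT
    cases T <;> simp [corner, Fin.sum_univ_three, Prod.ext_iff]
    · omega
    · omega
    · split_ifs <;> simp <;> omega
    · split_ifs <;> simp <;> omega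
  rintro ⟨T, hT⟩ ⟨T', hT'⟩ h
  change ∑ s, T.corner d s = ∑ s, T'.corner d s at h
  rw [key T hT, key T' hT'] at h
  refine Subtype.ext ?_
  cases T <;> cases T' <;> simp only [Valid] at hT hT' h <;> (try split_ifs at h) <;>
    simp only [Prod.mk.injEq] at h <;> (try simp only [P.injEq, Q.injEq, A.injEq, B.injEq]) <;> omega

theorem planar_tie (v : PlanarVertex d l m) (s : Fin 3) :
    (planar d l m).val ((planar d l m).tri v s) ((planar d l m).pos v) =
      (planar d l m).val ((planar d l m).tri v 0) ((planar d l m).pos v) := by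
  obtain ⟨T, hT⟩ := v
  cases T with
  | P i j =>
    obtain ⟨h1, h2, h3⟩ := id hT
    change (planar d l m).val ((P i j).corner d s) _ = (planar d l m).val (i, j) _
    rw [val_inner h1 h2, pos_P]
    fin_cases s
    · exact val_inner h1 h2 _
    · refine (val_inner (a := i + 1) (by omega) h2 _).trans ?_
      simp only [Matrix.cons_val]
      push_cast
      ring
    · refine (val_inner (b := j + 1) h1 (by omega) _).trans ?_
      simp only [Matrix.cons_val]
      push_cast
      ring
  | Q i j =>
    obtain ⟨h1, h2, h3⟩ := id hT
    change (planar d l m).val ((Q i j).corner d s) _ = (planar d l m).val (i + 1, j) _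
    rw [val_inner (by omega) h2, pos_Q]
    fin_cases s
    · exact val_inner (by omega) h2 _
    · refine (val_inner (a := i + 1) (b := j + 1) (by omega) (by omega) _).trans ?_
      simp only [Matrix.cons_val]
      push_cast
      ring
    · refine (val_inner (a := i) (b := j + 1) h1 (by omega) _).trans ?_
      simp only [Matrix.cons_val]
      push_cast
      ring
  | A j =>
    obtain ⟨h1, h2, h3, h4⟩ := id hT
    change (planar d l m).val ((A j).corner d s) _ = (planar d l m).val (0, 0) _
    rw [val_origin (by omega), pos_A]
    fin_cases s
    · exact val_origin (by omega) _
    · change (planar d l m).val (1, j) _ = 0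
      simp only [LabelledGraph.val, Matrix.cons_val]
      rw [show (planar d l m).height = height d l m from rfl]
      push_cast
      ring
    · change (planar d l m).val (if j + 1 = d then (0, (d : ℤ)) else (1, j + 1)) _ = 0
      by_cases hj : j + 1 = d
      · rw [if_pos hj, val_frame (by omega), if_pos hj]
        simp
      · rw [if_neg hj, val_inner h1.le (by omega), if_neg hj, height_inner h1.le (by omega)]
        simp only [Matrix.cons_val]
        push_cast
        ring
  | B i =>
    obtain ⟨h1, h2, h3⟩ := id hT
    change (planar d l m).val ((B i).corner d s) _ = (planar d l m).val (0, 0) _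
    rw [val_origin (by omega), pos_B]
    fin_cases s
    · exact val_origin (by omega) _
    · change (planar d l m).val (if i + 1 = d then ((d : ℤ), 0) else (i + 1, 1)) _ = 0
      by_cases hi : i + 1 = d
      · rw [if_pos hi, val_frame (by omega), if_pos hi]
        simp
      · rw [if_neg hi, val_inner (by omega) h1.le, if_neg hi, height_inner (by omega) h1.le]
        simp only [Matrix.cons_val]
        push_cast
        ring
    · change (planar d l m).val (i, 1) _ = 0
      simp only [LabelledGraph.val, Matrix.cons_val]
      rw [show (planar d l m).height = height d l m from rfl]
      push_cast
      ring

end Planar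

end TropGeo

namespace TropGeo

/-! ### Dominance, boundary sides and regularity of the planar subdivision -/

section Planar

open Triangle

variable {d : ℕ} {l m : ℤ}

theorem mem_planar_labels {p : ℤ × ℤ} : p ∈ (planar d l m).labels ↔ 0 ≤ p.1 ∧ 0 ≤ p.2 ∧
    p.1 + p.2 ≤ d ∧ (p.1 < l → p.2 = 0 ∨ p.2 = d) ∧ (p.2 < m → p.1 = 0 ∨ p.1 = d) := Iff.rfl

/-- The coordinate along the frame. -/
theorem pos_A_one {j : ℤ} (h : (A j).Valid d l m) : (planar d l m).pos ⟨A j, h⟩ 1 =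
    if j + 1 = d then 0 else scale d * (2 * j + 2 - (2 * d + 2)) := by
  simp only [pos_A, Matrix.cons_val]
  split_ifs <;> ring

theorem pos_B_zero {i : ℤ} (h : (B i).Valid d l m) : (planar d l m).pos ⟨B i, h⟩ 0 =
    if i + 1 = d then 0 else scale d * (2 * i + 2 - (4 * d + 2)) := by
  simp only [pos_B, Matrix.cons_val]
  split_ifs <;> ring

variable (hd : 1 ≤ d)

include hd in
theorem pos_A_bounds' {j : ℤ} (h : (A j).Valid d l m) (hmj : m ≤ j) :
    let z := (planar d l m).pos ⟨A j, h⟩;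
    -6 * small d ≤ z 1 ∧ z 1 ≤ 0 ∧ -depth d - 12 * small d ≤ z 0 ∧
      z 0 ≤ -depth d + 6 * (d ^ 2 * scale d) := by
  have hd' : (1 : ℝ) ≤ d := by exact_mod_cast hd
  refine frame_bounds hd (p := 4 * d + 2) (q := 2 * d + 2) (j := j) (by linarith) (by linarith)
    (by linarith) (by linarith) h.2.1 h.2.2.1 ?_ ?_
  · rw [pos_A_one]
    split_ifs
    exacts [Or.inl rfl, Or.inr rfl]
  · simp only [pos_A, Matrix.cons_val,
      height_inner h.1.le hmj]
    push_cast
    ring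

include hd in
theorem pos_B_bounds {i : ℤ} (h : (B i).Valid d l m) (hl : 0 ≤ l) :
    let z := (planar d l m).pos ⟨B i, h⟩;
    -6 * small d ≤ z 0 ∧ z 0 ≤ 0 ∧ -depth d - 12 * small d ≤ z 1 ∧
      z 1 ≤ -depth d + 6 * (d ^ 2 * scale d) := by
  have hd' : (1 : ℝ) ≤ d := by exact_mod_cast hd
  refine frame_bounds hd (p := 2 * d + 2) (q := 4 * d + 2) (j := i) (by linarith) (by linarith)
    (by linarith) (by linarith) (hl.trans h.2.1) h.2.2 ?_ (pos_B_eq h)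
  rw [pos_B_zero]
  split_ifs
  exacts [Or.inl rfl, Or.inr rfl]

variable (hl : l = 0 ∨ l = 1) (hm : m = 0 ∨ m = 1)

-- At a honeycomb vertex every other inner label loses at least one unit of scale by `one_le_quad`,
-- and labels of the frame are nonpositive while inner values are positive. At a frame vertex the
-- maximum is the value 0 of the origin, and `frame_dominance` bounds the inner labels.
include hd hl hm in
theorem planar_dominance (v : PlanarVertex d l m) (p : ℤ × ℤ) (hp : p ∈ (planar d l m).labels)
    (hne : ∀ s, (planar d l m).tri v s ≠ p) : (planar d l m).val p ((planar d l m).pos v) <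
      (planar d l m).val ((planar d l m).tri v 0) ((planar d l m).pos v) := by
  have hd' : (1 : ℝ) ≤ d := by exact_mod_cast hd
  have hs := scale_pos d
  obtain ⟨e0, e1, e2, e3, e4⟩ := small_bounds hd
  obtain ⟨k0, k1⟩ := depth_bounds hd
  obtain ⟨a, b⟩ := p
  obtain ⟨g1, g2, g3, g4, g5⟩ := mem_planar_labels.1 hp
  simp only at g1 g2 g3 g4 g5
  have ha : (0 : ℝ) ≤ a := by exact_mod_cast g1
  have hb : (0 : ℝ) ≤ b := by exact_mod_cast g2
  have hcl : ∀ {i j : ℤ} (v : PlanarVertex d l m), (∃ i j, v.1 = P i j ∨ v.1 = Q i j) → 0 ≤ i →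
      0 ≤ j → i + j ≤ d → l ≤ i → m ≤ j → (a < l ∨ b < m) →
      (planar d l m).val (a, b) ((planar d l m).pos v) <
        (planar d l m).val (i, j) ((planar d l m).pos v) := by
    intro i j v hv hi hj hij hli hmj hab
    obtain ⟨h1, h2, h3, h4⟩ := cluster_bounds hd hl hm v hv
    have h5 := inner_val_pos hd hi hj hij (x := (planar d l m).pos v 0)
      (y := (planar d l m).pos v 1) (by nlinarith) (by nlinarith)
    rw [← val_inner hli hmj] at h5
    refine lt_of_le_of_lt ?_ h5
    rw [val_frame hab]
    nlinarith
  obtain ⟨T, hT⟩ := v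
  cases T with
  | P i j =>
    obtain ⟨h1, h2, h3⟩ := id hT
    have n0 : (i, j) ≠ (a, b) := hne 0
    have n1 : (i + 1, j) ≠ (a, b) := hne 1
    have n2 : (i, j + 1) ≠ (a, b) := hne 2
    simp only [ne_eq, Prod.mk.injEq] at n0 n1 n2
    change _ < (planar d l m).val (i, j) _
    by_cases hab : a < l ∨ b < m
    · exact hcl _ ⟨i, j, Or.inl rfl⟩ (by omega) (by omega) (by omega) h1 h2 hab
    · have hq : 1 ≤ (a - i) ^ 2 + (a - i) * (b - j) + (b - j) ^ 2 - (a - i) - (b - j) :=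
        one_le_quad (by omega) (by omega) (by omega)
      have hq : (1 : ℝ) ≤ (a - i) ^ 2 + (a - i) * (b - j) + (b - j) ^ 2 - (a - i) - (b - j) := by
        exact_mod_cast hq
      have hq := mul_le_mul_of_nonneg_left hq hs.le
      rw [val_inner (by omega) (by omega), val_inner h1 h2, pos_P]
      simp only [Matrix.cons_val]
      linarith
  | Q i j =>
    obtain ⟨h1, h2, h3⟩ := id hT
    have n0 : (i + 1, j) ≠ (a, b) := hne 0
    have n1 : (i + 1, j + 1) ≠ (a, b) := hne 1
    have n2 : (i, j + 1) ≠ (a, b) := hne 2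
    simp only [ne_eq, Prod.mk.injEq] at n0 n1 n2
    change _ < (planar d l m).val (i + 1, j) _
    by_cases hab : a < l ∨ b < m
    · exact hcl _ ⟨i, j, Or.inr rfl⟩ (by omega) (by omega) (by omega) (by omega) h2 hab
    · have hq : 1 ≤ (i + 1 - a) ^ 2 + (i + 1 - a) * (j + 1 - b) + (j + 1 - b) ^ 2 - (i + 1 - a) -
          (j + 1 - b) := one_le_quad (by omega) (by omega) (by omega)
      have hq : (1 : ℝ) ≤ (i + 1 - a) ^ 2 + (i + 1 - a) * (j + 1 - b) + (j + 1 - b) ^ 2 -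
          (i + 1 - a) - (j + 1 - b) := by exact_mod_cast hq
      have hq := mul_le_mul_of_nonneg_left hq hs.le
      rw [val_inner (by omega) (by omega), val_inner (by omega) h2, pos_Q]
      simp only [Matrix.cons_val]
      push_cast
      linarith
  | A j =>
    obtain ⟨h1, h2, h3, h4⟩ := id hT
    have n0 : (0, 0) ≠ (a, b) := hne 0
    have n1 : (1, j) ≠ (a, b) := hne 1
    have n2 : (if j + 1 = d then (0, (d : ℤ)) else (1, j + 1)) ≠ (a, b) := hne 2
    change _ < (planar d l m).val (0, 0) _
    rw [val_origin (by omega)]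
    rcases g1.eq_or_lt with rfl | ha1
    · have hb0 : b ≠ 0 := fun h => n0 (by rw [h])
      obtain rfl : b = d := by omega
      have hj : j + 1 ≠ d := fun h => n2 (if_pos h)
      have hj' : (j : ℝ) + 1 + 1 ≤ d := by exact_mod_cast (show j + 1 + 1 ≤ d by omega)
      rw [val_frame (by omega), pos_A_one, if_neg hj]
      have : scale d * (2 * j + 2 - (2 * d + 2)) < 0 := mul_neg_of_pos_of_neg hs (by linarith)
      push_cast
      nlinarith
    · by_cases hbm : b < m
      · obtain rfl : b = 0 := by omega
        obtain rfl : a = d := by omega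
        have hmj : m ≤ j := by
          by_contra hmj
          exact n1 (by rw [show j = 0 by omega, show (d : ℤ) = 1 by omega])
        obtain ⟨b1, b2, b3, b4⟩ := pos_A_bounds' hd hT hmj
        rw [val_frame (Or.inr hbm)]
        push_cast
        nlinarith
      · have hmj : m ≤ j := by omega
        rw [val_inner (by omega) (by omega)]
        refine frame_dominance hd (p := 4 * d + 2) (q := 2 * d + 2) (j := j) (by linarith)
          (by linarith) (by linarith) (by linarith) h2 h3 (pos_A_one hT) ?_ ha1 g2 g3 ?_ ?_
        · rcases pos_A_bounds hd hm hT with ⟨-, -, h5, h6⟩ | h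
          · omega
          · exact h.2
        · rintro ⟨rfl, rfl⟩
          exact n1 rfl
        · rintro ⟨rfl, rfl, h⟩
          exact n2 (if_neg h)
  | B i =>
    obtain ⟨h1, h2, h3⟩ := id hT
    have n0 : (0, 0) ≠ (a, b) := hne 0
    have n1 : (if i + 1 = d then ((d : ℤ), 0) else (i + 1, 1)) ≠ (a, b) := hne 1
    have n2 : (i, 1) ≠ (a, b) := hne 2
    change _ < (planar d l m).val (0, 0) _
    rw [val_origin (by omega)]
    rcases g2.eq_or_lt with rfl | hb1
    · have ha0 : a ≠ 0 := fun h => n0 (by rw [h])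
      obtain rfl : a = d := by omega
      have hj : i + 1 ≠ d := fun h => n1 (if_pos h)
      have hj' : (i : ℝ) + 1 + 1 ≤ d := by exact_mod_cast (show i + 1 + 1 ≤ d by omega)
      rw [val_frame (by omega), pos_B_zero, if_neg hj]
      have : scale d * (2 * i + 2 - (4 * d + 2)) < 0 := mul_neg_of_pos_of_neg hs (by linarith)
      push_cast
      nlinarith
    · by_cases hal : a < l
      · obtain rfl : a = 0 := by omega
        obtain rfl : b = d := by omega
        obtain ⟨b1, b2, b3, b4⟩ := pos_B_bounds hd hT (by omega)
        rw [val_frame (Or.inl hal)]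
        push_cast
        nlinarith
      · rw [val_inner (by omega) (by omega)]
        have := frame_dominance hd (p := 2 * d + 2) (q := 4 * d + 2) (j := i) (by linarith)
          (by linarith) (by linarith) (by linarith) (by omega) h3 (pos_B_zero hT) (pos_B_eq hT)
          hb1 g1 (by omega) ?_ ?_
        · linarith
        · rintro ⟨rfl, rfl⟩
          exact n2 rfl
        · rintro ⟨rfl, rfl, h⟩
          exact n1 (if_neg h)

/-- The sides of the subdivision on the boundary of the triangle. -/
def BoundarySide (d : ℕ) (l m : ℤ) (p q : ℤ × ℤ) : Prop :=
  (∃ i : ℤ, 0 ≤ i ∧ i < d ∧ p = (i + 1, d - 1 - i) ∧ q = (i, d - i)) ∨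
  (l = 0 ∧ ∃ j : ℤ, 0 ≤ j ∧ j < d ∧ p = (0, j + 1) ∧ q = (0, j)) ∨
  (m = 0 ∧ ∃ i : ℤ, 0 ≤ i ∧ i < d ∧ p = (i, 0) ∧ q = (i + 1, 0)) ∨
  (l = 1 ∧ p = (0, (d : ℤ)) ∧ q = (0, 0)) ∨ (m = 1 ∧ p = (0, 0) ∧ q = ((d : ℤ), 0))

theorem BoundarySide.area_le {p q : ℤ × ℤ} (h : BoundarySide d l m p q) {r : ℤ × ℤ}
    (hr : r ∈ (planar d l m).labels) : area (r - p) (q - p) ≤ 0 := by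
  obtain ⟨g1, g2, g3, -, -⟩ := mem_planar_labels.1 hr
  rcases h with ⟨i, h0, h1, rfl, rfl⟩ | ⟨-, i, h0, h1, rfl, rfl⟩ | ⟨-, i, h0, h1, rfl, rfl⟩ |
    ⟨-, rfl, rfl⟩ | ⟨-, rfl, rfl⟩ <;> simp only [area, Prod.fst_sub, Prod.snd_sub] <;> nlinarith

include hl hm in
/-- Each side of a triangle is a side of another triangle or on the boundary. -/
theorem planar_boundary (v : PlanarVertex d l m) (s : Fin 3) :
    (∃ h', (planar d l m).Partner (v, s) h') ∨
      BoundarySide d l m ((planar d l m).tri v s) ((planar d l m).tri v (s + 1)) := by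
  obtain ⟨T, hT⟩ := v
  have mk : ∀ (T' : Triangle) (s' : Fin 3), T'.Valid d l m → (T'.corner d s' = T.corner d (s + 1) ∧
      T'.corner d (s' + 1) = T.corner d s) → (∃ h', (planar d l m).Partner (⟨T, hT⟩, s) h') :=
    fun T' s' h1 h2 => ⟨(⟨T', h1⟩, s'), h2⟩
  change _ ∨ BoundarySide d l m (T.corner d s) (T.corner d (s + 1))
  cases T with
  | P i j =>
    obtain ⟨h1, h2, h3⟩ := id hT
    fin_cases s
    · rcases h2.eq_or_lt with h | h
      · rcases hm with h0 | h0
        · exact Or.inr (Or.inr (Or.inr (Or.inl ⟨h0, i, by omega, by omega, by simp [corner]; omega,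
            by simp [corner]; omega⟩)))
        · exact Or.inl (mk (B i) 1 ⟨h0, h1, by omega⟩ (by
            simp [corner, show ¬ i + 1 = d by omega]; omega))
      · exact Or.inl (mk (Q i (j - 1)) 1 ⟨h1, by omega, by omega⟩ (by simp [corner]))
    · by_cases h : i + j + 2 ≤ d
      · exact Or.inl (mk (Q i j) 2 ⟨h1, h2, h⟩ (by simp [corner]))
      · exact Or.inr (Or.inl ⟨i, by omega, by omega, by simp [corner]; omega,
          by simp [corner]; omega⟩)
    · rcases h1.eq_or_lt with h | h
      · rcases hl with h0 | h0
        · exact Or.inr (Or.inr (Or.inl ⟨h0, j, by omega, by omega, by simp [corner]; omega,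
            by simp [corner]; omega⟩))
        · exact Or.inl (mk (A j) 1 ⟨h0, by omega, by omega, by omega⟩ (by
            simp [corner, show ¬ j + 1 = d by omega]; omega))
      · exact Or.inl (mk (Q (i - 1) j) 0 ⟨by omega, h2, by omega⟩ (by simp [corner]))
  | Q i j =>
    obtain ⟨h1, h2, h3⟩ := id hT
    fin_cases s
    · exact Or.inl (mk (P (i + 1) j) 2 ⟨by omega, h2, by omega⟩ (by simp [corner]))
    · exact Or.inl (mk (P i (j + 1)) 0 ⟨h1, by omega, by omega⟩ (by simp [corner]))
    · exact Or.inl (mk (P i j) 1 ⟨h1, h2, by omega⟩ (by simp [corner]))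
  | A j =>
    obtain ⟨h1, h2, h3, h4⟩ := id hT
    fin_cases s
    · rcases h2.eq_or_lt with rfl | h
      · rcases hm with h0 | h0
        · exact Or.inr (Or.inr (Or.inr (Or.inl ⟨h0, 0, le_rfl, by omega, by simp [corner],
            by simp [corner]⟩)))
        · obtain rfl : d = 1 := by omega
          exact Or.inr (Or.inr (Or.inr (Or.inr (Or.inr ⟨h0, by simp [corner], by simp [corner]⟩))))
      · by_cases hjm : m ≤ j - 1
        · exact Or.inl (mk (A (j - 1)) 2 ⟨h1, by omega, by omega, Or.inl hjm⟩ (by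
            simp [corner, show ¬ j = d by omega]))
        · exact Or.inl (mk (B 1) 2 ⟨by omega, by omega, by omega⟩ (by
            simp [corner]; omega))
    · by_cases h : j + 1 = d
      · exact Or.inr (Or.inl ⟨0, le_rfl, by omega, by simp [corner]; omega,
          by simp [corner, h]⟩)
      · exact Or.inl (mk (P 1 j) 2 ⟨by omega, by omega, by omega⟩ (by simp [corner, h]))
    · by_cases h : j + 1 = d
      · exact Or.inr (Or.inr (Or.inr (Or.inr (Or.inl ⟨h1, by simp [corner, h], by simp [corner]⟩))))
      · exact Or.inl (mk (A (j + 1)) 0 ⟨h1, by omega, by omega, by omega⟩ (by simp [corner, h]))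
  | B i =>
    obtain ⟨h1, h2, h3⟩ := id hT
    fin_cases s
    · by_cases h : i + 1 = d
      · exact Or.inr (Or.inr (Or.inr (Or.inr (Or.inr ⟨h1, by simp [corner], by simp [corner, h]⟩))))
      · exact Or.inl (mk (B (i + 1)) 2 ⟨h1, by omega, by omega⟩ (by simp [corner, h]))
    · by_cases h : i + 1 = d
      · exact Or.inr (Or.inl ⟨i, by omega, by omega, by simp [corner, h]; omega, by simp [corner]; omega⟩)
      · exact Or.inl (mk (P i 1) 0 ⟨h2, by omega, by omega⟩ (by simp [corner, h]))
    · rcases h2.eq_or_lt with rfl | h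
      · rcases hl with rfl | rfl
        · exact Or.inr (Or.inr (Or.inl ⟨rfl, 0, le_rfl, by omega, by simp [corner],
            by simp [corner]⟩))
        · exact Or.inl (mk (A 1) 0 ⟨rfl, by omega, by omega, by omega⟩ (by simp [corner]))
      · exact Or.inl (mk (B (i - 1)) 0 ⟨h1, by omega, by omega⟩ (by
          simp [corner, show ¬ i = d by omega]))

include hd hl hm in
theorem planar_isRegular : (planar d l m).IsRegular where
  tri_mem := planar_tri_mem hd hl hm
  tie := planar_tie
  dominance := planar_dominance hd hl hm
  area_pos := planar_area_pos hd
  sum_injective := planar_sum_injective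
  boundary v s := (planar_boundary hl hm v s).imp_right fun h _ hr => h.area_le hr

end Planar

end TropGeo

namespace TropGeo

/-! ### Unbounded edges and marked half-edges of the planar curve -/

/-- The parameters of a planar curve. -/
structure Admissible (d : ℕ) (l m : ℤ) : Prop where
  one_le : 1 ≤ d
  left : l = 0 ∨ l = 1
  down : m = 0 ∨ m = 1

section Planar

open Triangle

variable {d : ℕ} {l m : ℤ}

/-- The half-edge `h` is dual to the oriented side from `p` to `q`. -/
def IsSide (h : PlanarVertex d l m × Fin 3) (p q : ℤ × ℤ) : Prop :=
  (planar d l m).tri h.1 h.2 = p ∧ (planar d l m).tri h.1 (h.2 + 1) = q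

variable (ha : Admissible d l m)
include ha

theorem Admissible.isRegular : (planar d l m).IsRegular :=
  planar_isRegular ha.one_le ha.left ha.down

theorem IsSide.eq {h h' : PlanarVertex d l m × Fin 3} {p q : ℤ × ℤ} (h1 : IsSide h p q)
    (h2 : IsSide h' p q) : h = h' :=
  ha.isRegular.eq_of_tri_eq (h1.1.trans h2.1.symm) (h1.2.trans h2.2.symm)

theorem BoundarySide.exists_isSide {p q : ℤ × ℤ} (h : BoundarySide d l m p q) :
    ∃ h : PlanarVertex d l m × Fin 3, IsSide h p q := by
  obtain ⟨hd, hl, hm⟩ := ha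
  have mk : ∀ (T : Triangle) (s : Fin 3), T.Valid d l m → (T.corner d s = p ∧
      T.corner d (s + 1) = q) → ∃ h : PlanarVertex d l m × Fin 3, IsSide h p q :=
    fun T s h1 h2 => ⟨(⟨T, h1⟩, s), h2⟩
  rcases h with ⟨i, h0, h1, rfl, rfl⟩ | ⟨hl0, i, h0, h1, rfl, rfl⟩ | ⟨hm0, i, h0, h1, rfl, rfl⟩ |
    ⟨hl1, rfl, rfl⟩ | ⟨hm1, rfl, rfl⟩
  · by_cases hil : i < l
    · exact mk (A (d - 1)) 1 ⟨by omega, by omega, by omega, by omega⟩ (by simp [corner]; omega)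
    · by_cases hjm : d - 1 - i < m
      · obtain rfl : i = d - 1 := by omega
        exact mk (B (d - 1)) 1 ⟨by omega, by omega, by omega⟩ (by simp [corner])
      · exact mk (P i (d - 1 - i)) 1 ⟨by omega, by omega, by omega⟩ (by simp [corner]; omega)
  · by_cases hjm : i < m
    · exact mk (B 0) 2 ⟨by omega, by omega, by omega⟩ (by simp [corner]; omega)
    · exact mk (P 0 i) 2 ⟨by omega, by omega, by omega⟩ (by simp [corner])
  · by_cases hil : i < l
    · exact mk (A 0) 0 ⟨by omega, by omega, by omega, by omega⟩ (by simp [corner]; omega)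
    · exact mk (P i 0) 0 ⟨by omega, by omega, by omega⟩ (by simp [corner])
  · exact mk (A (d - 1)) 2 ⟨by omega, by omega, by omega, by omega⟩ (by simp [corner])
  · by_cases hdl : l ≤ d - 1
    · exact mk (B (d - 1)) 0 ⟨by omega, by omega, by omega⟩ (by simp [corner])
    · exact mk (A 0) 0 ⟨by omega, by omega, by omega, by omega⟩ (by simp [corner]; omega)

/-- A partner triangle across a boundary side would have its third corner outside the big triangle.
-/
theorem planar_opp_eq_none {h : PlanarVertex d l m × Fin 3} : (planar d l m).opp h = none ↔
    ∃ p q, IsSide h p q ∧ BoundarySide d l m p q := by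
  rw [LabelledGraph.opp_eq_none]
  constructor
  · intro hn
    exact ⟨_, _, ⟨rfl, rfl⟩, (planar_boundary ha.left ha.down h.1 h.2).resolve_left hn⟩
  · rintro ⟨p, q, ⟨rfl, rfl⟩, hb⟩ ⟨h', h1, h2⟩
    have h3 := hb.area_le (ha.isRegular.tri_mem h'.1 (h'.2 + 2))
    have h4 := ha.isRegular.area_pos' h'.1 h'.2
    rw [← h1, ← h2] at h3
    simp only [area, Prod.fst_sub, Prod.snd_sub] at h3 h4
    linarith

omit ha in
theorem IsSide.wt_dir {h : PlanarVertex d l m × Fin 3} {p q : ℤ × ℤ} (hs : IsSide h p q) {g : ℕ}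
    (hg : Int.gcd (q - p).1 (q - p).2 = g) : (planar d l m).wt h = g ∧
      (planar d l m).dir h = ![(q - p).2 / g, -((q - p).1 / g)] := by
  have h1 : (planar d l m).wt h = g := by rw [LabelledGraph.wt, hs.1, hs.2, hg]
  refine ⟨h1, ?_⟩
  rw [LabelledGraph.dir, h1, hs.1, hs.2]

/-- The unbounded edges of the planar curve. -/
theorem planar_ray_cases {h : PlanarVertex d l m × Fin 3} (ho : (planar d l m).opp h = none) :
    ((∃ i : Fin d, IsSide h (i + 1, d - 1 - i) (i, d - i)) ∧ (planar d l m).wt h = 1 ∧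
      (planar d l m).dir h = ![1, 1]) ∨
    (l = 0 ∧ (∃ i : Fin d, IsSide h (0, i + 1) (0, i)) ∧ (planar d l m).wt h = 1 ∧
      (planar d l m).dir h = ![-1, 0]) ∨
    (m = 0 ∧ (∃ i : Fin d, IsSide h (i, 0) (i + 1, 0)) ∧ (planar d l m).wt h = 1 ∧
      (planar d l m).dir h = ![0, -1]) ∨
    (l = 1 ∧ IsSide h (0, (d : ℤ)) (0, 0)) ∨ (m = 1 ∧ IsSide h (0, 0) ((d : ℤ), 0)) := by
  obtain ⟨p, q, hs, hb⟩ := (planar_opp_eq_none ha).1 ho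
  rcases hb with ⟨i, h0, h1, rfl, rfl⟩ | ⟨hl0, i, h0, h1, rfl, rfl⟩ | ⟨hm0, i, h0, h1, rfl, rfl⟩ |
    ⟨hl1, rfl, rfl⟩ | ⟨hm1, rfl, rfl⟩
  · refine Or.inl ⟨⟨⟨i.toNat, by omega⟩, by simpa [h0] using hs⟩, ?_⟩
    have h2 := hs.wt_dir (g := 1) (by
      simp)
    refine ⟨h2.1, h2.2.trans ?_⟩
    simp
  · refine Or.inr (Or.inl ⟨hl0, ⟨⟨i.toNat, by omega⟩, by simpa [h0] using hs⟩, ?_⟩)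
    have h2 := hs.wt_dir (g := 1) (by simp)
    refine ⟨h2.1, h2.2.trans ?_⟩
    simp
  · refine Or.inr (Or.inr (Or.inl ⟨hm0, ⟨⟨i.toNat, by omega⟩, by simpa [h0] using hs⟩, ?_⟩))
    have h2 := hs.wt_dir (g := 1) (by simp)
    refine ⟨h2.1, h2.2.trans ?_⟩
    simp
  · exact Or.inr (Or.inr (Or.inr (Or.inl ⟨hl1, hs⟩)))
  · exact Or.inr (Or.inr (Or.inr (Or.inr ⟨hm1, hs⟩)))

/-- The side from (0, d) to the origin has integer length `d`, hence a single ray of weight `d`.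
Both its labels have height 0, so the tie between them puts the vertex on the axis, as gluing
requires. -/
theorem IsSide.left_port {h : PlanarVertex d l m × Fin 3} (hl : l = 1)
    (hs : IsSide h (0, (d : ℤ)) (0, 0)) : (planar d l m).opp h = none ∧ (planar d l m).wt h = d ∧
      (planar d l m).dir h = ![-1, 0] ∧ (planar d l m).pos h.1 1 = 0 := by
  have hd : (d : ℤ) ≠ 0 := by have := ha.one_le; omega
  have h2 := hs.wt_dir (g := d) (by simp)
  refine ⟨(planar_opp_eq_none ha).2 ⟨_, _, hs, Or.inr (Or.inr (Or.inr (Or.inl ⟨hl, rfl, rfl⟩)))⟩,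
    h2.1, h2.2.trans ?_, ?_⟩
  · simp [Int.neg_ediv_self _ hd]
  · have h3 := ha.isRegular.tie' h.1 h.2 (h.2 + 1)
    rw [hs.1, hs.2, val_frame (by omega), val_frame (by omega)] at h3
    have : (d : ℝ) ≠ 0 := by exact_mod_cast hd
    simpa [this] using h3

theorem IsSide.down_port {h : PlanarVertex d l m × Fin 3} (hm : m = 1)
    (hs : IsSide h (0, 0) ((d : ℤ), 0)) : (planar d l m).opp h = none ∧ (planar d l m).wt h = d ∧
      (planar d l m).dir h = ![0, -1] ∧ (planar d l m).pos h.1 0 = 0 := by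
  have hd : (d : ℤ) ≠ 0 := by have := ha.one_le; omega
  have h2 := hs.wt_dir (g := d) (by simp)
  refine ⟨(planar_opp_eq_none ha).2 ⟨_, _, hs, Or.inr (Or.inr (Or.inr (Or.inr ⟨hm, rfl, rfl⟩)))⟩,
    h2.1, h2.2.trans ?_, ?_⟩
  · simp [Int.ediv_self hd]
  · have h3 := ha.isRegular.tie' h.1 h.2 (h.2 + 1)
    rw [hs.1, hs.2, val_frame (by omega), val_frame (by omega)] at h3
    have : (d : ℝ) ≠ 0 := by exact_mod_cast hd
    simpa [this, eq_comm] using h3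

theorem exists_left_port : ∃ h : PlanarVertex d l m × Fin 3, l = 1 → IsSide h (0, (d : ℤ)) (0, 0) := by
  by_cases hl : l = 1
  · obtain ⟨h, hs⟩ := BoundarySide.exists_isSide ha (Or.inr (Or.inr (Or.inr (Or.inl ⟨hl, rfl, rfl⟩))))
    exact ⟨h, fun _ => hs⟩
  -- When the left side is subdivided the mark is a dummy: any half-edge will do, because the
  -- conditions on it are imposed only for glued sides.
  · obtain ⟨h, -⟩ := BoundarySide.exists_isSide ha
      (Or.inl ⟨0, le_rfl, by have := ha.one_le; omega, rfl, rfl⟩)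
    exact ⟨h, fun h => absurd h hl⟩

theorem exists_down_port : ∃ h : PlanarVertex d l m × Fin 3, m = 1 → IsSide h (0, 0) ((d : ℤ), 0) := by
  by_cases hm : m = 1
  · obtain ⟨h, hs⟩ := BoundarySide.exists_isSide ha (Or.inr (Or.inr (Or.inr (Or.inr ⟨hm, rfl, rfl⟩))))
    exact ⟨h, fun _ => hs⟩
  · obtain ⟨h, -⟩ := BoundarySide.exists_isSide ha
      (Or.inl ⟨0, le_rfl, by have := ha.one_le; omega, rfl, rfl⟩)
    exact ⟨h, fun h => absurd h hm⟩

/-- The planar curve with its two undivided boundary sides as marked half-edges. -/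
def Admissible.piece : Piece (PlanarVertex d l m) where
  toTrivalentGraph := (planar d l m).graph
  left := (exists_left_port ha).choose
  down := (exists_down_port ha).choose

theorem Admissible.isSide_left (hl : l = 1) : IsSide ha.piece.left (0, (d : ℤ)) (0, 0) :=
  (exists_left_port ha).choose_spec hl

theorem Admissible.isSide_down (hm : m = 1) : IsSide ha.piece.down (0, 0) ((d : ℤ), 0) :=
  (exists_down_port ha).choose_spec hm

variable {k j : ℕ} (hl : l = if 0 < j then 1 else 0) (hm : m = if j + 1 < k then 1 else 0)
include hl hm

theorem Admissible.hasRays_aux {h : PlanarVertex d l m × Fin 3} (ho : ha.piece.opp h = none)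
    (h1 : 0 < j → h ≠ ha.piece.left) (h2 : j + 1 < k → h ≠ ha.piece.down) :
    ha.piece.wt h = 1 ∧ (ha.piece.dir h = ![1, 1] ∨ (j = 0 ∧ ha.piece.dir h = ![-1, 0]) ∨
      (¬ j + 1 < k ∧ ha.piece.dir h = ![0, -1])) := by
  rcases planar_ray_cases ha ho with ⟨-, h3⟩ | ⟨h0, -, h3⟩ | ⟨h0, -, h3⟩ | ⟨h0, h3⟩ | ⟨h0, h3⟩
  · exact ⟨h3.1, Or.inl h3.2⟩
  · exact ⟨h3.1, Or.inr (Or.inl ⟨by split_ifs at hl <;> omega, h3.2⟩)⟩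
  · exact ⟨h3.1, Or.inr (Or.inr ⟨by split_ifs at hm <;> omega, h3.2⟩)⟩
  · exact absurd (h3.eq ha (ha.isSide_left h0)) (h1 (by split_ifs at hl <;> omega))
  · exact absurd (h3.eq ha (ha.isSide_down h0)) (h2 (by split_ifs at hm <;> omega))

theorem Admissible.fits : ha.piece.Fits k j d where
  isTropical := ha.isRegular.isTropical
  pos_mem v := by
    obtain ⟨h1, h2, h3, h4⟩ := planar_pos_bounds ha.one_le ha.left ha.down v
    change pair ((planar d l m).pos v) ∈ _
    refine ⟨fun _ => ⟨?_, ?_⟩, fun _ => ⟨?_, ?_⟩⟩ <;> simp only [pair] <;> linarith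
  left_opp hj := (IsSide.left_port ha (by simp [hl, hj]) (ha.isSide_left (by simp [hl, hj]))).1
  left_dir hj := (IsSide.left_port ha (by simp [hl, hj]) (ha.isSide_left (by simp [hl, hj]))).2.2.1
  left_wt hj := (IsSide.left_port ha (by simp [hl, hj]) (ha.isSide_left (by simp [hl, hj]))).2.1
  left_pos hj := (IsSide.left_port ha (by simp [hl, hj]) (ha.isSide_left (by simp [hl, hj]))).2.2.2
  down_opp hj := (IsSide.down_port ha (by simp [hm, hj]) (ha.isSide_down (by simp [hm, hj]))).1
  down_dir hj := (IsSide.down_port ha (by simp [hm, hj]) (ha.isSide_down (by simp [hm, hj]))).2.2.1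
  down_wt hj := (IsSide.down_port ha (by simp [hm, hj]) (ha.isSide_down (by simp [hm, hj]))).2.1
  down_pos hj := (IsSide.down_port ha (by simp [hm, hj]) (ha.isSide_down (by simp [hm, hj]))).2.2.2
  ray_left h ho hj h1 h2 := by
    rcases (ha.hasRays_aux hl hm ho (fun _ => h1) h2).2 with h3 | ⟨h0, h3⟩ | ⟨h0, h3⟩
    · simp [h3]
    · omega
    · simp [h3]
  ray_down h ho hj h1 h2 := by
    rcases (ha.hasRays_aux hl hm ho h2 (fun _ => h1)).2 with h3 | ⟨h0, h3⟩ | ⟨h0, h3⟩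
    · simp [h3]
    · simp [h3]
    · omega

omit hl hm in
theorem Admissible.card_rays {u : Fin 2 → ℤ} {p q : Fin d → ℤ × ℤ} (hq : Function.Injective q)
    (hex : ∀ i, BoundarySide d l m (p i) (q i))
    (hu : ∀ h i, IsSide h (p i) (q i) → (planar d l m).dir h = u)
    (hcases : ∀ h, (planar d l m).opp h = none → (planar d l m).dir h = u →
      ∃ i, IsSide h (p i) (q i)) :
    Nat.card {h // ha.piece.opp h = none ∧ ha.piece.dir h = u} = d := by
  choose f hf using fun i => BoundarySide.exists_isSide ha (hex i)
  have hmem : ∀ i, ha.piece.opp (f i) = none ∧ ha.piece.dir (f i) = u := fun i =>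
    ⟨(planar_opp_eq_none ha).2 ⟨_, _, hf i, hex i⟩, hu _ _ (hf i)⟩
  refine (Nat.card_congr (Equiv.ofBijective (fun i => ⟨f i, hmem i⟩) ⟨?_, ?_⟩)).symm.trans
    (Nat.card_fin d)
  · intro i i' h
    have h1 := (hf i).2
    rw [show f i = f i' from congrArg Subtype.val h] at h1
    exact hq (h1.symm.trans (hf i').2)
  · rintro ⟨h, h1, h2⟩
    obtain ⟨i, hi⟩ := hcases h h1 h2
    exact ⟨i, Subtype.ext ((hf i).eq ha hi)⟩

theorem Admissible.hasRays (hjk : j < k) : ha.piece.HasRays k j d where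
  ray h ho h1 h2 := by
    obtain ⟨h3, h4⟩ := ha.hasRays_aux hl hm ho h1 h2
    exact ⟨h3, h4.imp_right (Or.imp_right fun h => ⟨by omega, h.2⟩)⟩
  diag := by
    have hne : ∀ u : Fin 2 → ℤ, u = ![1, 1] → u ≠ ![-1, 0] ∧ u ≠ ![0, -1] := by rintro _ rfl; decide
    have hex : ∀ i : Fin d, BoundarySide d l m ((i : ℤ) + 1, d - 1 - i) (i, d - i) :=
      fun i => Or.inl ⟨i, by omega, by omega, rfl, rfl⟩
    refine ha.card_rays (p := fun i => (i + 1, d - 1 - i)) (q := fun i => (i, d - i)) ?_ hex ?_ ?_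
    · intro i i' h
      simpa [Fin.ext_iff] using congrArg Prod.fst h
    · intro h i hs
      have := (hs.wt_dir (g := 1) (by
        simp)).2
      rw [this]
      simp
    · intro h ho hdir
      rcases planar_ray_cases ha ho with ⟨h3, -⟩ | ⟨h0, -, h3⟩ | ⟨h0, -, h3⟩ | ⟨h0, h3⟩ | ⟨h0, h3⟩
      · exact h3
      · exact absurd h3.2 (hne _ hdir).1
      · exact absurd h3.2 (hne _ hdir).2
      · exact absurd (h3.left_port ha h0).2.2.1 (hne _ hdir).1
      · exact absurd (h3.down_port ha h0).2.2.1 (hne _ hdir).2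
  left hj := by
    have hl0 : l = 0 := by simp [hl, hj]
    have hne : ∀ u : Fin 2 → ℤ, u = ![-1, 0] → u ≠ ![1, 1] ∧ u ≠ ![0, -1] := by rintro _ rfl; decide
    refine ha.card_rays (p := fun i => (0, i + 1)) (q := fun i => (0, i)) ?_ ?_ ?_ ?_
    · intro i i' h
      simpa [Fin.ext_iff] using congrArg Prod.snd h
    · exact fun i => Or.inr (Or.inl ⟨hl0, i, by omega, by omega, rfl, rfl⟩)
    · intro h i hs
      rw [(hs.wt_dir (g := 1) (by simp)).2]
      simp
    · intro h ho hdir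
      rcases planar_ray_cases ha ho with ⟨-, h3⟩ | ⟨h0, h3, -⟩ | ⟨h0, -, h3⟩ | ⟨h0, h3⟩ | ⟨h0, h3⟩
      · exact absurd h3.2 (hne _ hdir).1
      · exact h3
      · exact absurd h3.2 (hne _ hdir).2
      · omega
      · exact absurd (h3.down_port ha h0).2.2.1 (hne _ hdir).2
  down hj := by
    have hm0 : m = 0 := by rw [hm, if_neg (by omega)]
    have hne : ∀ u : Fin 2 → ℤ, u = ![0, -1] → u ≠ ![1, 1] ∧ u ≠ ![-1, 0] := by rintro _ rfl; decide
    refine ha.card_rays (p := fun i => (i, 0)) (q := fun i => (i + 1, 0)) ?_ ?_ ?_ ?_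
    · intro i i' h
      simpa [Fin.ext_iff] using congrArg Prod.fst h
    · exact fun i => Or.inr (Or.inr (Or.inl ⟨hm0, i, by omega, by omega, rfl, rfl⟩))
    · intro h i hs
      rw [(hs.wt_dir (g := 1) (by simp)).2]
      simp
    · intro h ho hdir
      rcases planar_ray_cases ha ho with ⟨-, h3⟩ | ⟨h0, -, h3⟩ | ⟨h0, h3, -⟩ | ⟨h0, h3⟩ | ⟨h0, h3⟩
      · exact absurd h3.2 (hne _ hdir).1
      · exact absurd h3.2 (hne _ hdir).2
      · exact h3
      · exact absurd (h3.left_port ha h0).2.2.1 (hne _ hdir).2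
      · omega

end Planar

end TropGeo

namespace TropGeo

/-! ### The number of triangles and the connectedness of the planar curve -/

section Planar

open Triangle

variable {d : ℕ} {l m : ℤ} (ha : Admissible d l m)

/-- An enumeration of the triangles of the subdivision. -/
def triangleOf (d : ℕ) (l m : ℤ) (N a b : ℕ) : (Fin N × Fin N) ⊕ Fin a ⊕ Fin b → Triangle
  -- An inner triangle of side `N` has `N²` unit triangles: the half `x + y < N` of the index square
  -- gives the upright ones, the other half, reflected, the inverted ones.
  | .inl (x, y) => if (x : ℕ) + y < N then P (l + x) (m + y) else Q (l + N - 1 - x) (m + N - 1 - y)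
  | .inr (.inl t) => A (d - 1 - t)
  | .inr (.inr t) => B (d - 1 - t)

theorem triangleOf_injective (N a b : ℕ) : Function.Injective (triangleOf d l m N a b) := by
  rintro (⟨⟨x, hx⟩, ⟨y, hy⟩⟩ | ⟨t, ht⟩ | ⟨t, ht⟩) (⟨⟨x', hx'⟩, ⟨y', hy'⟩⟩ | ⟨t', ht'⟩ | ⟨t', ht'⟩) h <;>
    simp only [triangleOf] at h <;> (try split_ifs at h) <;> simp at h ⊢ <;> omega

theorem triangleOf_valid_iff {N a b : ℕ} (hN : (N : ℤ) = d - l - m ∨ (N = 0 ∧ d - l - m ≤ 0))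
    (hl : l = 0 ∨ l = 1) (hm : m = 0 ∨ m = 1) (hd : 1 ≤ d)
    (ha : (a : ℤ) = if l = 1 then (if d = 1 then 1 else d - m) else 0)
    (hb : (b : ℤ) = if m = 1 then d - l else 0) (T : Triangle) :
    T.Valid d l m ↔ ∃ x, triangleOf d l m N a b x = T := by
  constructor
  · intro hT
    cases T with
    | P i j =>
      obtain ⟨h1, h2, h3⟩ := hT
      refine ⟨.inl (⟨(i - l).toNat, by omega⟩, ⟨(j - m).toNat, by omega⟩), ?_⟩
      simp only [triangleOf]
      rw [if_pos (by omega)]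
      congr 1 <;> omega
    | Q i j =>
      obtain ⟨h1, h2, h3⟩ := hT
      refine ⟨.inl (⟨(l + N - 1 - i).toNat, by omega⟩, ⟨(m + N - 1 - j).toNat, by omega⟩), ?_⟩
      simp only [triangleOf]
      rw [if_neg (by omega)]
      congr 1 <;> omega
    | A j =>
      obtain ⟨h1, h2, h3, h4⟩ := hT
      refine ⟨.inr (.inl ⟨(d - 1 - j).toNat, by split_ifs at ha <;> omega⟩), ?_⟩
      simp only [triangleOf]
      congr 1
      omega
    | B i =>
      obtain ⟨h1, h2, h3⟩ := hT
      refine ⟨.inr (.inr ⟨(d - 1 - i).toNat, by omega⟩), ?_⟩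
      simp only [triangleOf]
      congr 1
      omega
  · rintro ⟨⟨⟨x, hx⟩, ⟨y, hy⟩⟩ | ⟨t, ht⟩ | ⟨t, ht⟩, rfl⟩ <;> simp only [triangleOf]
    · split_ifs <;> refine ⟨?_, ?_, ?_⟩ <;> omega
    · split_ifs at ha <;> refine ⟨?_, ?_, ?_, ?_⟩ <;> omega
    · split_ifs at hb <;> refine ⟨?_, ?_, ?_⟩ <;> omega

include ha

/-- The inner triangle has side `d - l - m`; the left frame has `d - m` triangles and the lower one
`d - l`, when present. In degree one with both sides undivided the single triangle `A 0` remains. -/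
theorem Admissible.exists_equiv : ∃ N a b : ℕ,
    Nonempty ((Fin N × Fin N) ⊕ Fin a ⊕ Fin b ≃ PlanarVertex d l m) ∧
      (N * N + (a + b) : ℤ) = d ^ 2 - (l + m) * (d - 1) := by
  obtain ⟨hd, hl, hm⟩ := ha
  let N := (d - l - m : ℤ).toNat
  let a := (if l = 1 then (if d = 1 then 1 else d - m) else 0 : ℤ).toNat
  let b := (if m = 1 then d - l else 0 : ℤ).toNat
  have hN : (N : ℤ) = d - l - m ∨ (N = 0 ∧ d - l - m ≤ 0) := by omega
  have ha : (a : ℤ) = if l = 1 then (if d = 1 then 1 else d - m) else 0 := by omega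
  have hb : (b : ℤ) = if m = 1 then d - l else 0 := by omega
  have hv := triangleOf_valid_iff hN hl hm hd ha hb
  refine ⟨N, a, b, ⟨Equiv.ofBijective (fun x => ⟨_, (hv _).2 ⟨x, rfl⟩⟩) ⟨?_, ?_⟩⟩, ?_⟩
  · intro x y h
    exact triangleOf_injective N a b (congrArg Subtype.val h)
  · rintro ⟨T, hT⟩
    obtain ⟨x, hx⟩ := (hv T).1 hT
    exact ⟨x, Subtype.ext hx⟩
  · grind

theorem Admissible.finite : Finite (PlanarVertex d l m) :=
  let ⟨_, _, _, ⟨e⟩, _⟩ := ha.exists_equiv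
  Finite.of_equiv _ e

theorem Admissible.card [Fintype (PlanarVertex d l m)] :
    (Fintype.card (PlanarVertex d l m) : ℤ) = d ^ 2 - (l + m) * (d - 1) := by
  obtain ⟨N, a, b, ⟨e⟩, h⟩ := ha.exists_equiv
  rw [← Fintype.card_congr e, ← h]
  simp

/-! ### Connectedness -/

theorem Admissible.joined {T T' : Triangle} (h : T.Valid d l m) (h' : T'.Valid d l m) (s s' : Fin 3)
    (h1 : T'.corner d s' = T.corner d (s + 1)) (h2 : T'.corner d (s' + 1) = T.corner d s) :
    Relation.EqvGen ha.piece.Joined ⟨T, h⟩ ⟨T', h'⟩ :=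
  .rel _ _ ⟨s, (⟨T', h'⟩, s'), (ha.isRegular.opp_eq_some).2 ⟨h1, h2⟩, rfl⟩

theorem Admissible.eqvGen_P {i j i' j' : ℤ} (h : (P i j).Valid d l m) (h' : (P i' j').Valid d l m) :
    Relation.EqvGen ha.piece.Joined ⟨P i j, h⟩ ⟨P i' j', h'⟩ := by
  have hrow : ∀ n : ℕ, ∀ i : ℤ, (i - l).toNat = n → ∀ j (h : (P i j).Valid d l m)
      (h' : (P l j).Valid d l m), Relation.EqvGen ha.piece.Joined ⟨P i j, h⟩ ⟨P l j, h'⟩ := by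
    intro n
    induction n with
    | zero =>
      intro i hi j h h'
      obtain rfl : i = l := by have := h.1; omega
      exact .refl _
    | succ n ih =>
      intro i hi j h h'
      have hQ : (Q (i - 1) j).Valid d l m := ⟨by omega, h.2.1, by have := h.2.2; omega⟩
      have hP : (P (i - 1) j).Valid d l m := ⟨by omega, h.2.1, by have := h.2.2; omega⟩
      refine .trans _ _ _ (ha.joined h hQ 2 0 (by simp [corner]) (by simp [corner])) ?_
      refine .trans _ _ _ (ha.joined hQ hP 2 1 (by simp [corner]) (by simp [corner])) ?_
      exact ih (i - 1) (by omega) j hP h'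
  have hcol : ∀ n : ℕ, ∀ j : ℤ, (j - m).toNat = n → ∀ (h : (P l j).Valid d l m)
      (h' : (P l m).Valid d l m), Relation.EqvGen ha.piece.Joined ⟨P l j, h⟩ ⟨P l m, h'⟩ := by
    intro n
    induction n with
    | zero =>
      intro j hj h h'
      obtain rfl : j = m := by have := h.2.1; omega
      exact .refl _
    | succ n ih =>
      intro j hj h h'
      have hQ : (Q l (j - 1)).Valid d l m := ⟨le_rfl, by omega, by have := h.2.2; omega⟩
      have hP : (P l (j - 1)).Valid d l m := ⟨le_rfl, by omega, by have := h.2.2; omega⟩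
      refine .trans _ _ _ (ha.joined h hQ 0 1 (by simp [corner]) (by simp [corner])) ?_
      refine .trans _ _ _ (ha.joined hQ hP 2 1 (by simp [corner]) (by simp [corner])) ?_
      exact ih (j - 1) (by omega) hP h'
  have hbase : ∀ i j (h : (P i j).Valid d l m) (h' : (P l m).Valid d l m),
      Relation.EqvGen ha.piece.Joined ⟨P i j, h⟩ ⟨P l m, h'⟩ := by
    intro i j h h'
    have h'' : (P l j).Valid d l m := ⟨le_rfl, h.2.1, by have := h.1; have := h.2.2; omega⟩
    exact .trans _ _ _ (hrow _ i rfl j h h'') (hcol _ j rfl h'' h')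
  have h0 : (P l m).Valid d l m :=
    ⟨le_rfl, le_rfl, by have := h.1; have := h.2.1; have := h.2.2; omega⟩
  exact .trans _ _ _ (hbase i j h h0) (.symm _ _ (hbase i' j' h' h0))

/-- If there are inner triangles, each triangle is connected to them. -/
theorem Admissible.eqvGen_base (h0 : (P l m).Valid d l m) (v : PlanarVertex d l m) :
    Relation.EqvGen ha.piece.Joined v ⟨P l m, h0⟩ := by
  obtain ⟨h01, h02, h03⟩ := id h0
  obtain ⟨hd, hl, hm⟩ := id ha
  have hA : ∀ j (h : (A j).Valid d l m), j + 1 < d →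
      Relation.EqvGen ha.piece.Joined ⟨A j, h⟩ ⟨P l m, h0⟩ := by
    intro j h hj
    obtain ⟨h1, h2, h3, h4⟩ := id h
    have hP : (P 1 j).Valid d l m := ⟨by omega, by omega, by omega⟩
    refine .trans _ _ _ (ha.joined h hP 1 2 ?_ ?_) (ha.eqvGen_P hP h0) <;>
      simp [corner] <;> omega
  have hB : ∀ i (h : (B i).Valid d l m), i + 1 < d →
      Relation.EqvGen ha.piece.Joined ⟨B i, h⟩ ⟨P l m, h0⟩ := by
    intro i h hi
    obtain ⟨h1, h2, h3⟩ := id h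
    have hP : (P i 1).Valid d l m := ⟨by omega, by omega, by omega⟩
    refine .trans _ _ _ (ha.joined h hP 1 0 ?_ ?_) (ha.eqvGen_P hP h0) <;>
      simp [corner] <;> omega
  obtain ⟨T, hT⟩ := v
  cases T with
  | P i j => exact ha.eqvGen_P hT h0
  | Q i j =>
    have hP : (P i j).Valid d l m := ⟨hT.1, hT.2.1, by have := hT.2.2; omega⟩
    exact .trans _ _ _ (ha.joined hT hP 2 1 (by simp [corner]) (by simp [corner])) (ha.eqvGen_P hP h0)
  | A j =>
    obtain ⟨h1, h2, h3, h4⟩ := id hT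
    rcases h3.lt_or_eq with hj | hj
    · exact hA j hT hj
    · have hA' : (A (j - 1)).Valid d l m := ⟨h1, by omega, by omega, by omega⟩
      refine .trans _ _ _ (ha.joined hT hA' 0 2 ?_ ?_) (hA _ hA' (by omega)) <;>
        simp [corner] <;> omega
  | B i =>
    obtain ⟨h1, h2, h3⟩ := id hT
    rcases h3.lt_or_eq with hi | hi
    · exact hB i hT hi
    · have hB' : (B (i - 1)).Valid d l m := ⟨h1, by omega, by omega⟩
      refine .trans _ _ _ (ha.joined hT hB' 2 0 ?_ ?_) (hB _ hB' (by omega)) <;>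
        simp [corner] <;> omega

theorem Admissible.connected (v w : PlanarVertex d l m) :
    Relation.ReflTransGen ha.piece.Joined v w := by
  have hsymm : ∀ a b, ha.piece.Joined a b → ha.piece.Joined b a := by
    rintro a b ⟨s, ⟨b', s'⟩, h, rfl⟩
    exact ⟨s', _, ha.isRegular.opp_symm _ _ h, rfl⟩
  suffices h : Relation.EqvGen ha.piece.Joined v w by
    induction h with
    | rel _ _ h => exact .single h
    | refl => exact .refl
    | symm _ _ _ ih => exact (@Relation.ReflTransGen.stdSymm _ _ ⟨hsymm⟩).symm _ _ ih
    | trans _ _ _ _ _ ih1 ih2 => exact ih1.trans ih2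
  by_cases h0 : (P l m).Valid d l m
  · exact .trans _ _ _ (ha.eqvGen_base h0 v) (.symm _ _ (ha.eqvGen_base h0 w))
  -- Without inner triangles only the last triangle of each frame can occur; if both do, they share
  -- a side.
  have h0 : d < l + m + 1 := by
    by_contra h
    exact h0 ⟨le_rfl, le_rfl, by omega⟩
  have hv : ∀ v : PlanarVertex d l m, v.1 = A (d - 1) ∨ v.1 = B (d - 1) := by
    rintro ⟨T, hT⟩
    cases T with
    | P i j => obtain ⟨h1, h2, h3⟩ := hT; omega
    | Q i j => obtain ⟨h1, h2, h3⟩ := hT; omega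
    | A j =>
      obtain ⟨h1, h2, h3, h4⟩ := hT
      exact Or.inl (congrArg A (by omega))
    | B i =>
      obtain ⟨h1, h2, h3⟩ := hT
      exact Or.inr (congrArg B (by omega))
  have hAB : ∀ (h : (A (d - 1)).Valid d l m) (h' : (B (d - 1)).Valid d l m),
      Relation.EqvGen ha.piece.Joined ⟨A (d - 1), h⟩ ⟨B (d - 1), h'⟩ := by
    intro h h'
    obtain ⟨h1, h2, h3, h4⟩ := id h
    obtain ⟨h5, h6, h7⟩ := id h'
    refine ha.joined h h' 0 2 ?_ ?_ <;> simp [corner] <;> omega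
  obtain ⟨T, hT⟩ := v
  obtain ⟨T', hT'⟩ := w
  rcases hv ⟨T, hT⟩ with h | h <;> rcases hv ⟨T', hT'⟩ with h' | h' <;> dsimp only at h h' <;>
    subst h <;> subst h'
  · exact .refl _
  · exact hAB _ _
  · exact .symm _ _ (hAB _ _)
  · exact .refl _

end Planar

end TropGeo

namespace TropGeo

/-! ### Points that avoid a planar curve -/

namespace LabelledGraph.IsRegular

variable {V : Type} {G : LabelledGraph V} (hG : G.IsRegular)
include hG

/-- On the curve at least two labels are maximal, so one is left whichever label is excluded. -/
theorem exists_max_ne {z : Fin 2 → ℝ} (hz : z ∈ G.graph.carrier) (r : ℤ × ℤ) :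
    ∃ p ∈ G.labels, p ≠ r ∧ ∀ q ∈ G.labels, G.val q z ≤ G.val p z := by
  obtain ⟨⟨v, s⟩, hz⟩ := hz
  by_cases h : G.tri v s = r
  · refine ⟨_, hG.tri_mem v (s + 1), fun h' => ?_, fun q hq => ?_⟩
    · exact (fin_three_succ_succ_ne s).2 (hG.tri_injective v (h.trans h'.symm))
    · rw [hG.val_succ_of_mem_edge hz]
      exact hG.val_le_of_mem_edge hz hq
  · exact ⟨_, hG.tri_mem v s, h, fun q hq => hG.val_le_of_mem_edge hz hq⟩

/-- This is the test for avoiding the curve: every label other than a single `r` is beaten by some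
label. -/
theorem notMem_carrier {z : Fin 2 → ℝ} {r : ℤ × ℤ} 
    (h : ∀ p ∈ G.labels, p ≠ r → ∃ q ∈ G.labels, G.val p z < G.val q z) : z ∉ G.graph.carrier := by
  intro hz
  obtain ⟨p, hp, hne, hmax⟩ := hG.exists_max_ne hz r
  obtain ⟨q, hq, hlt⟩ := h p hp hne
  exact hlt.not_ge (hmax q hq)

end LabelledGraph.IsRegular

section Planar

open Triangle

variable {e : ℕ} {l m : ℤ} (he : Admissible e l m) {z : Fin 2 → ℝ}
include he

theorem Admissible.inner_mem {a b : ℤ} (ha : l ≤ a) (hb : m ≤ b) (hab : a + b ≤ e) :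
    (a, b) ∈ (planar e l m).labels := by
  obtain ⟨-, hl, hm⟩ := he
  exact mem_planar_labels.2 ⟨by omega, by omega, hab, by omega, by omega⟩

/-- The labels are the inner ones and the corners of the triangle. -/
theorem Admissible.label_cases {p : ℤ × ℤ} (hp : p ∈ (planar e l m).labels) :
    (∃ a b : ℤ, p = (a, b) ∧ l ≤ a ∧ m ≤ b ∧ a + b ≤ e) ∨ (p = (0, 0) ∧ (l = 1 ∨ m = 1)) ∨
      (p = (0, (e : ℤ)) ∧ l = 1) ∨ (p = ((e : ℤ), 0) ∧ m = 1) := by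
  obtain ⟨-, hl, hm⟩ := he
  obtain ⟨a, b⟩ := p
  obtain ⟨h1, h2, h3, h4, h5⟩ := mem_planar_labels.1 hp
  grind

/-- The values of two neighbouring inner labels. -/
theorem Admissible.val_right {a b : ℤ} (ha : l ≤ a) (hb : m ≤ b) :
    (planar e l m).val (a + 1, b) z - (planar e l m).val (a, b) z =
      z 0 - scale e * (2 * a + b - 4 * e - 1) := by
  rw [val_inner (by omega) hb, val_inner ha hb]
  push_cast
  ring

theorem Admissible.val_up {a b : ℤ} (ha : l ≤ a) (hb : m ≤ b) :
    (planar e l m).val (a, b + 1) z - (planar e l m).val (a, b) z =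
      z 1 - scale e * (a + 2 * b - 2 * e - 1) := by
  rw [val_inner ha (by omega), val_inner ha hb]
  push_cast
  ring

theorem Admissible.val_diag {a b : ℤ} (ha : l ≤ a) (hb : m ≤ b) :
    (planar e l m).val (a + 1, b) z - (planar e l m).val (a, b + 1) z =
      z 0 - z 1 - scale e * (a - b - 2 * e) := by
  rw [val_inner (by omega) hb, val_inner ha (by omega)]
  push_cast
  ring

omit he in
theorem scale_mul_le {n : ℤ} (hn : n ≤ -1) : scale e * (n : ℝ) ≤ -scale e := by
  have : (n : ℝ) ≤ -1 := by exact_mod_cast hn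
  nlinarith [scale_pos e]

theorem Admissible.origin_mem : (0, 0) ∈ (planar e l m).labels :=
  mem_planar_labels.2 ⟨le_rfl, le_rfl, by simp, fun _ => Or.inl rfl, fun _ => Or.inl rfl⟩

/-- The region where the last inner label dominates. -/
theorem Admissible.notMem_carrier_corner (hle : l + m ≤ e) (h0 : -scale e < z 0)
    (h1 : -scale e < z 0 - z 1) (h2 : m = 1 → -scale e < z 1 ∧ -scale e < z 1 - z 0) :
    z ∉ he.piece.carrier := by
  have hs := scale_pos e
  have hK := (depth_bounds he.one_le).1
  have h1e : (1 : ℝ) ≤ e := by exact_mod_cast he.one_le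
  refine he.isRegular.notMem_carrier (r := (e - m, m)) fun p hp hne => ?_
  have hmem := he.inner_mem (a := e - m) (b := m) (by omega) le_rfl (by omega)
  have hr : (planar e l m).val (e - m, m) z = _ := val_inner (by omega) le_rfl z
  rcases he.label_cases hp with ⟨a, b, rfl, ha, hb, hab⟩ | ⟨rfl, h⟩ | ⟨rfl, h⟩ | ⟨rfl, h⟩
  · rcases hab.lt_or_eq with hab | hab
    -- An inner label below the hypotenuse is beaten by its right neighbour; one on the hypotenuse,
    -- other than the last, by the next label down the hypotenuse.
    · refine ⟨_, he.inner_mem (a := a + 1) (by omega) hb (by omega), ?_⟩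
      have h3 := he.val_right (z := z) ha hb
      have h4 := scale_mul_le (e := e) (n := 2 * a + b - 4 * e - 1) (by have := he.down; omega)
      push_cast at h4
      linarith
    · obtain ⟨b, rfl⟩ : ∃ b', b = b' + 1 := ⟨b - 1, by ring⟩
      have hbm : m ≠ b + 1 := by grind
      refine ⟨_, he.inner_mem (a := a + 1) (b := b) (by omega) (by omega) (by omega), ?_⟩
      have h3 := he.val_diag (z := z) (b := b) ha (by omega)
      have h4 := scale_mul_le (e := e) (n := a - b - 2 * e) (by have := he.down; have := he.one_le; omega)
      push_cast at h4
      linarith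
  all_goals
    refine ⟨_, hmem, ?_⟩
    rw [hr]
  · obtain ⟨-, hl, rfl | rfl⟩ := id he
    · rw [val_origin (by omega)]
      push_cast
      nlinarith
    · obtain ⟨h9, h10⟩ := h2 rfl
      rw [val_origin (by omega)]
      push_cast
      nlinarith
  · rw [val_frame (by omega)]
    obtain ⟨-, hl, rfl | rfl⟩ := id he
    · push_cast
      nlinarith
    · obtain ⟨h9, h10⟩ := h2 rfl
      push_cast
      nlinarith
  · obtain ⟨h9, h10⟩ := h2 h
    subst h
    rw [val_frame (by omega)]
    push_cast
    nlinarith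

/-- The intersection with a horizontal line slightly below the origin. -/
theorem Admissible.of_mem_horizontal (hz : z ∈ he.piece.carrier) (h0 : z 0 < 0)
    (h1 : -scale e < z 1) (h2 : z 1 < 0) :
    (∃ a, l ≤ a ∧ a + 1 + m ≤ e ∧ z 0 = z 1 + scale e * (2 * a + 1 - 3 * e)) ∨
      (l = 1 ∧ m + 1 ≤ e ∧ (planar e l m).val (1, e - 1) z = 0) := by
  have hs := scale_pos e
  have hK := (depth_bounds he.one_le).1
  have h1e : (1 : ℝ) ≤ e := by exact_mod_cast he.one_le
  have hO := he.origin_mem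
  -- So close below the axis, going up in the triangle always increases the value. Only hypotenuse
  -- labels can be maximal, besides the origin when the left side is undivided.
  have key : ∀ p ∈ (planar e l m).labels, (∀ q ∈ (planar e l m).labels,
      (planar e l m).val q z ≤ (planar e l m).val p z) →
      (∃ a : ℤ, p = (a, e - a) ∧ l ≤ a ∧ a + m ≤ e) ∨ (p = (0, 0) ∧ l = 1) := by
    intro p hp hmax
    by_contra hcon
    push Not at hcon
    rcases he.label_cases hp with ⟨a, b, rfl, ha, hb, hab⟩ | ⟨rfl, h⟩ | ⟨rfl, h⟩ | ⟨rfl, h⟩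
    · have hab : a + b < e := by
        refine lt_of_le_of_ne hab fun h => ?_
        exact absurd (hcon.1 a (by rw [← h]; simp) ha) (by omega)
      have h3 := he.val_up (z := z) ha hb
      have h4 := scale_mul_le (e := e) (n := a + 2 * b - 2 * e - 1)
        (by have := he.left; have := he.down; omega)
      have h5 := hmax _ (he.inner_mem (b := b + 1) ha (by omega) (by omega))
      push_cast at h4
      linarith
    · obtain ⟨-, rfl | rfl, hm⟩ := id he
      · have h3 := hmax _ (he.inner_mem (a := 0) (b := e) le_rfl (by have := he.one_le; omega) (by omega))
        rw [val_origin (by omega), val_inner le_rfl (by have := he.one_le; omega)] at h3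
        push_cast at h3
        nlinarith
      · exact hcon.2 rfl rfl
    · have h3 := hmax _ hO
      rw [val_origin (by omega), val_frame (by omega)] at h3
      push_cast at h3
      nlinarith
    · have h3 := hmax _ hO
      rw [val_origin (by omega), val_frame (by omega)] at h3
      push_cast at h3
      nlinarith
  have hlow : ∀ a : ℤ, l ≤ a → a + m ≤ e → (∀ q ∈ (planar e l m).labels,
      (planar e l m).val q z ≤ (planar e l m).val (a, e - a) z) →
      (a + 1 + m ≤ e → z 0 - z 1 ≤ scale e * (2 * a + 1 - 3 * e)) ∧
      (l + 1 ≤ a → scale e * (2 * a - 1 - 3 * e) ≤ z 0 - z 1) := by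
    intro a ha ham hmax
    constructor
    · intro h
      have h3 := hmax _ (he.inner_mem (a := a + 1) (b := e - a - 1) (by omega) (by omega) (by omega))
      have h4 := he.val_diag (z := z) (b := e - a - 1) ha (by omega)
      rw [sub_add_cancel] at h4
      push_cast at h4
      linarith
    · intro h
      have h3 := hmax _ (he.inner_mem (a := a - 1) (b := e - a + 1) (by omega) (by omega) (by omega))
      have h4 := he.val_diag (z := z) (a := a - 1) (b := e - a) (by omega) (by omega)
      rw [sub_add_cancel] at h4
      push_cast at h4
      linarith
  have hpair : ∀ a a' : ℤ, a < a' → l ≤ a → a' + m ≤ e → (∀ q ∈ (planar e l m).labels,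
      (planar e l m).val q z ≤ (planar e l m).val (a, e - a) z) →
      (∀ q ∈ (planar e l m).labels,
      (planar e l m).val q z ≤ (planar e l m).val (a', e - a') z) →
      z 0 = z 1 + scale e * (2 * a + 1 - 3 * e) := by
    intro a a' haa ha ham h3 h4
    have h5 := (hlow a ha (by omega) h3).1 (by omega)
    have h6 := (hlow a' (by omega) (by omega) h4).2 (by omega)
    have h7 : (a' : ℝ) ≥ a + 1 := by exact_mod_cast haa
    have h8 : scale e * (2 * a + 1 - 3 * e) ≤ scale e * (2 * a' - 1 - 3 * e) := by
      gcongr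
      linarith
    linarith
  obtain ⟨p, hp, hpne, hpmax⟩ := he.isRegular.exists_max_ne hz (0, 0)
  obtain ⟨a, rfl, ha, ham⟩ := (key p hp hpmax).resolve_right fun h => hpne h.1
  obtain ⟨q, hq, hqne, hqmax⟩ := he.isRegular.exists_max_ne hz (a, e - a)
  rcases key q hq hqmax with ⟨a', rfl, ha', ham'⟩ | ⟨rfl, hl⟩
  · left
    rcases lt_trichotomy a a' with h | h | h
    · exact ⟨a, ha, by omega, hpair a a' h ha ham' hpmax hqmax⟩
    · exact absurd (by rw [h]) hqne
    · exact ⟨a', ha', by omega, hpair a' a h ha' ham hqmax hpmax⟩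
  · right
    have h3 : (planar e l m).val (a, e - a) z = 0 := by
      rw [← val_origin (d := e) (l := l) (m := m) (by omega) z]
      exact le_antisymm (hqmax _ hp) (hpmax _ hq)
    -- For `a ≥ 2` to be maximal the point has to be near the honeycomb, where inner values are
    -- positive and cannot tie with the origin.
    obtain rfl : a = 1 := by
      by_contra hne
      have h4 := (hlow a ha ham hpmax).2 (by omega)
      have h5 : (2 : ℝ) ≤ a := by exact_mod_cast (show 2 ≤ a by omega)
      have h6 := inner_val_pos he.one_le (show 0 ≤ a by omega)
        (show 0 ≤ e - a by have := he.down; omega) (by omega) (x := z 0) (y := z 1)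
        (by nlinarith) (by nlinarith)
      rw [val_inner ha (by omega)] at h3
      linarith
    exact ⟨hl, by omega, h3⟩

/-- The intersection with a vertical line slightly to the left of the origin. -/
theorem Admissible.of_mem_vertical (hm : m = 1) (hz : z ∈ he.piece.carrier) (h0 : -scale e < z 0)
    (h1 : z 0 < 0) (h2 : z 1 < 0) : l + 1 ≤ e ∧ (planar e l m).val (e - 1, 1) z = 0 := by
  have h1e : (1 : ℝ) ≤ e := by exact_mod_cast he.one_le
  have hO := he.origin_mem
  have key : ∀ p ∈ (planar e l m).labels, (∀ q ∈ (planar e l m).labels,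
      (planar e l m).val q z ≤ (planar e l m).val p z) →
      p = (0, 0) ∨ (p = ((e : ℤ) - 1, 1) ∧ l + 1 ≤ e) := by
    intro p hp hmax
    by_contra hcon
    push Not at hcon
    rcases he.label_cases hp with ⟨a, b, rfl, ha, hb, hab⟩ | ⟨rfl, h⟩ | ⟨rfl, h⟩ | ⟨rfl, h⟩
    · rcases eq_or_ne b 1 with rfl | hb1
      · rcases hab.lt_or_eq with hab | hab
        · have h3 := he.val_right (z := z) ha hb
          have h4 := scale_mul_le (e := e) (n := 2 * a + 1 - 4 * e - 1) (by omega)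
          have h5 := hmax _ (he.inner_mem (a := a + 1) (b := 1) (by omega) hb (by omega))
          push_cast at h3 h4
          linarith
        · exact absurd (hcon.2 (by rw [← hab]; simp)) (by omega)
      · obtain ⟨b, rfl⟩ : ∃ b', b = b' + 1 := ⟨b - 1, by ring⟩
        have h3 := he.val_diag (z := z) (b := b) ha (by omega)
        have h4 := scale_mul_le (e := e) (n := a - b - 2 * e) (by have := he.one_le; omega)
        have h5 := hmax _ (he.inner_mem (a := a + 1) (b := b) (by omega) (by omega) (by omega))
        push_cast at h4
        linarith
    · exact hcon.1 rfl
    · have h3 := hmax _ hO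
      rw [val_origin (by omega), val_frame (by omega)] at h3
      push_cast at h3
      nlinarith
    · have h3 := hmax _ hO
      rw [val_origin (by omega), val_frame (by omega)] at h3
      push_cast at h3
      nlinarith
  obtain ⟨p, hp, hpne, hpmax⟩ := he.isRegular.exists_max_ne hz (0, 0)
  obtain ⟨rfl, hle⟩ := (key p hp hpmax).resolve_left hpne
  obtain ⟨q, hq, hqne, hqmax⟩ := he.isRegular.exists_max_ne hz ((e : ℤ) - 1, 1)
  obtain rfl := (key q hq hqmax).resolve_right fun h => hqne h.1
  refine ⟨hle, ?_⟩
  rw [← val_origin (d := e) (l := l) (m := m) (by omega) z]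
  exact le_antisymm (hqmax _ hp) (hpmax _ hq)

/-- The quadratic part of the height contributes at most 6 units of `small e`; the seventh makes the
inequality strict. -/
theorem Admissible.inner_val_neg {a b : ℤ} (ha : l ≤ a) (hb : m ≤ b) (hab : a + b ≤ e)
    (h : a * z 0 + b * z 1 ≤ -depth e - 7 * small e) : (planar e l m).val (a, b) z < 0 := by
  have hs := scale_pos e
  obtain ⟨e0, -, -, -, e4⟩ := small_bounds he.one_le
  have h1e : (1 : ℝ) ≤ e := by exact_mod_cast he.one_le
  rw [val_inner ha hb]
  have h1 : (0 : ℝ) ≤ a := by exact_mod_cast (show 0 ≤ a by have := he.left; omega)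
  have h2 : (0 : ℝ) ≤ b := by exact_mod_cast (show 0 ≤ b by have := he.down; omega)
  have h3 : (a : ℝ) + b ≤ e := by exact_mod_cast hab
  have h4 : -(a ^ 2 + a * b + b ^ 2 - (4 * e + 2) * a - (2 * e + 2) * b) ≤ 6 * (e : ℝ) ^ 2 := by
    nlinarith [mul_nonneg h1 h2, sq_nonneg (a : ℝ), sq_nonneg (b : ℝ)]
  nlinarith

/-- The values far to the left, where the origin dominates. -/
theorem Admissible.val_neg_left (hl : l = 1) (h0 : z 0 ≤ -depth e - 7 * small e) (h1 : z 1 ≤ 0)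
    {p : ℤ × ℤ} (hp : p ∈ (planar e l m).labels) (hO : p ≠ (0, 0)) (hE : p ≠ (0, (e : ℤ))) :
    (planar e l m).val p z < 0 := by
  have hK := (depth_bounds he.one_le).1
  have e0 := (small_bounds he.one_le).1
  have h1e : (1 : ℝ) ≤ e := by exact_mod_cast he.one_le
  rcases he.label_cases hp with ⟨a, b, rfl, ha, hb, hab⟩ | ⟨rfl, h⟩ | ⟨rfl, h⟩ | ⟨rfl, h⟩
  · have h2 : (1 : ℝ) ≤ a := by exact_mod_cast (show 1 ≤ a by omega)
    have h3 : (0 : ℝ) ≤ b := by exact_mod_cast (show 0 ≤ b by have := he.down; omega)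
    exact he.inner_val_neg ha hb hab (by nlinarith)
  · exact absurd rfl hO
  · exact absurd rfl hE
  · rw [val_frame (by omega)]
    push_cast
    nlinarith

/-- The values far down, where the origin dominates. -/
theorem Admissible.val_neg_down (hm : m = 1) (h0 : z 0 ≤ 0) (h1 : z 1 ≤ -depth e - 7 * small e)
    {p : ℤ × ℤ} (hp : p ∈ (planar e l m).labels) (hO : p ≠ (0, 0)) (hE : p ≠ ((e : ℤ), 0)) :
    (planar e l m).val p z < 0 := by
  have hK := (depth_bounds he.one_le).1
  have e0 := (small_bounds he.one_le).1
  have h1e : (1 : ℝ) ≤ e := by exact_mod_cast he.one_le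
  rcases he.label_cases hp with ⟨a, b, rfl, ha, hb, hab⟩ | ⟨rfl, h⟩ | ⟨rfl, h⟩ | ⟨rfl, h⟩
  · have h2 : (0 : ℝ) ≤ a := by exact_mod_cast (show 0 ≤ a by have := he.left; omega)
    have h3 : (1 : ℝ) ≤ b := by exact_mod_cast (show 1 ≤ b by omega)
    exact he.inner_val_neg ha hb hab (by nlinarith)
  · exact absurd rfl hO
  · rw [val_frame (by omega)]
    push_cast
    nlinarith
  · exact absurd rfl hE

theorem Admissible.notMem_carrier_of_neg (h : l = 1 ∨ m = 1)
    (hneg : ∀ p ∈ (planar e l m).labels, p ≠ (0, 0) → (planar e l m).val p z < 0) :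
    z ∉ he.piece.carrier :=
  he.isRegular.notMem_carrier (r := (0, 0)) fun p hp hne =>
    ⟨_, he.origin_mem, (hneg p hp hne).trans_eq (val_origin (by omega) z).symm⟩

theorem Admissible.notMem_carrier_left (hl : l = 1) (h0 : z 0 ≤ -depth e - 7 * small e)
    (h1 : z 1 < 0) : z ∉ he.piece.carrier := by
  refine he.notMem_carrier_of_neg (Or.inl hl) fun p hp hO => ?_
  by_cases hE : p = (0, (e : ℤ))
  · have h1e : (1 : ℝ) ≤ e := by exact_mod_cast he.one_le
    rw [hE, val_frame (by omega)]
    push_cast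
    nlinarith
  · exact he.val_neg_left hl h0 h1.le hp hO hE

theorem Admissible.notMem_carrier_down (hm : m = 1) (h0 : z 0 < 0)
    (h1 : z 1 ≤ -depth e - 7 * small e) : z ∉ he.piece.carrier := by
  refine he.notMem_carrier_of_neg (Or.inr hm) fun p hp hO => ?_
  by_cases hE : p = ((e : ℤ), 0)
  · have h1e : (1 : ℝ) ≤ e := by exact_mod_cast he.one_le
    rw [hE, val_frame (by omega)]
    push_cast
    nlinarith
  · exact he.val_neg_down hm h0.le h1 hp hO hE

/-- A diagonal ray that starts on the continuation of an undivided side. -/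
theorem Admissible.notMem_carrier_diag {E : ℤ × ℤ} (hE : E.1 + E.2 = e) (hEm : E ∈ (planar e l m).labels)
    (h : l = 1 ∨ m = 1) (h0 : (planar e l m).val E z = 0) (hneg : ∀ p ∈ (planar e l m).labels,
      p ≠ (0, 0) → p ≠ E → (planar e l m).val p z < 0) {t : ℝ} (ht : 0 < t) :
    along z ![1, 1] t ∉ he.piece.carrier := by
  refine he.isRegular.notMem_carrier (r := E) fun p hp hne => ⟨E, hEm, ?_⟩
  have hE' : (E.1 : ℝ) + E.2 = e := by exact_mod_cast hE
  have h1e : (1 : ℝ) ≤ e := by exact_mod_cast he.one_le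
  -- In direction (1,1) a label grows with its coordinate sum. The label `E` has the largest
  -- possible sum and starts at the maximal value 0, so it dominates alone for positive time.
  rw [LabelledGraph.IsRegular.val_along, LabelledGraph.IsRegular.val_along, h0]
  simp only [Matrix.cons_val, Int.cast_one, mul_one, hE']
  by_cases hO : p = (0, 0)
  · rw [hO, val_origin (by omega)]
    push_cast
    nlinarith
  · have h1 := hneg p hp hO hne
    have h2 : (p.1 : ℝ) + p.2 ≤ e := by exact_mod_cast (mem_planar_labels.1 hp).2.2.1
    have h3 := mul_le_mul_of_nonneg_left h2 ht.le
    linarith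

end Planar

end TropGeo

namespace TropGeo

/-! ### The intersection of two consecutive planar curves -/

section Planar

open Triangle

variable {d e : ℕ} {l m : ℤ}

/-- The points where the bounded horizontal and vertical edges next to the frame of the curve of
degree `d` meet the curve of degree `e`. -/
def crossing (d e : ℕ) (l m : ℤ) : (ℤ × ℤ) ⊕ ℤ → Fin 2 → ℝ
  | .inl (j, a) =>
    let y := scale d * (2 * j + l - 2 * d - 1)
    -- For `a < l` the other edge is the frame edge between the labels (0,0) and (1, e-1); otherwise
    -- it is the diagonal ray between (a, e-a) and (a+1, e-a-1).
    ![if a < l then height e l m (1, e - 1) - (e - 1) * y else y + scale e * (2 * a + 1 - 3 * e), y]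
  | .inr i =>
    let x := scale d * (2 * i - 4 * d)
    ![x, height e l m (e - 1, 1) - (e - 1) * x]

/-- The indices of the crossings. -/
def crossingIndex (d e : ℕ) (l m : ℤ) : Finset ((ℤ × ℤ) ⊕ ℤ) :=
  (Finset.Icc m (d - 1 - l) ×ˢ Finset.Icc 0 (e - 1 - m)).disjSum
    (if m = 1 then Finset.Icc l (d - 2) else ∅)

theorem inl_mem_crossingIndex {j a : ℤ} : Sum.inl (j, a) ∈ crossingIndex d e l m ↔
    (m ≤ j ∧ j + l + 1 ≤ d) ∧ 0 ≤ a ∧ a + m + 1 ≤ e := by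
  simp only [crossingIndex, Finset.inl_mem_disjSum, Finset.mem_product, Finset.mem_Icc]
  omega

theorem inr_mem_crossingIndex {i : ℤ} : Sum.inr i ∈ crossingIndex d e l m ↔
    m = 1 ∧ l ≤ i ∧ i + 2 ≤ d := by
  rw [crossingIndex, Finset.inr_mem_disjSum]
  grind

theorem dir_of_corner {T : Triangle} (hT : T.Valid d l m) (s : Fin 3) {u : Fin 2 → ℤ}
    (hg : Int.gcd (T.corner d (s + 1) - T.corner d s).1 (T.corner d (s + 1) - T.corner d s).2 = 1)
    (hu : u = ![(T.corner d (s + 1) - T.corner d s).2, -(T.corner d (s + 1) - T.corner d s).1]) :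
    (planar d l m).wt (⟨T, hT⟩, s) = 1 ∧ (planar d l m).dir (⟨T, hT⟩, s) = u := by
  have h := IsSide.wt_dir (h := ((⟨T, hT⟩ : PlanarVertex d l m), s)) ⟨rfl, rfl⟩ hg
  refine ⟨h.1, h.2.trans ?_⟩
  rw [hu]
  simp [planar]

variable (hd : Admissible d l m) (he : Admissible e l m) (hde : d = e + 1) {z : Fin 2 → ℝ}

section Bounds

include he hde

theorem scale_of_succ : scale e = 16 * d * scale d := by
  rw [hde, scale_succ]
  push_cast
  ring

/-- The gap between consecutive depths outweighs the deviations of both frames, so the frame of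
degree `d` lies entirely where the origin dominates in degree `e`, apart from contacts on the axes.
-/
theorem depth_bound_of_succ : -depth d + 6 * (d ^ 2 * scale d) ≤ -depth e - 7 * small e ∧
    -depth d - 12 * small d ≤ 0 := by
  have h0 := scale_pos d
  have h1 : (1 : ℝ) ≤ e := by exact_mod_cast he.one_le
  have h2 : (d : ℝ) = e + 1 := by rw [hde]; push_cast; ring
  have h3 : (d : ℝ) ^ 2 * scale d ≤ small e := by
    rw [small, scale_of_succ he hde]
    have h4 : (e : ℝ) ≤ e ^ 3 := le_self_pow₀ h1 (by norm_num)
    have h5 : 0 ≤ (d : ℝ) * scale d := by positivity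
    nlinarith
  have h4 := small_le_depth_sub (d := e)
  have h5 := depth_succ e
  have h6 := (small_bounds he.one_le).1
  have h7 : 1 / (8 * 2 ^ e : ℝ) = 1 / (4 * 2 ^ e) / 2 := by grind
  have h8 := (small_bounds (d := d) (by omega)).1
  have h9 := depth_bounds (d := d) (by omega)
  rw [← hde] at h5
  constructor <;> linarith

theorem pos_A_frame {j : ℤ} (hT : (A j).Valid d l m) :
    let w := (planar d l m).pos ⟨A j, hT⟩;
    w 0 ≤ -depth e - 7 * small e ∧ w 1 ≤ 0 ∧ (j + 1 < d → w 1 < 0) ∧ (j + 1 = d → w 1 = 0) := by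
  have he1 := he.one_le
  obtain ⟨h0, h1, h2, h3⟩ := pos_A_bounds' (by omega) hT (by have := hT.2.2.2; omega)
  refine ⟨h3.trans (depth_bound_of_succ he hde).1, h1, fun h => ?_, fun h => ?_⟩
  · rw [pos_A_one, if_neg h.ne]
    have h4 : (j : ℝ) + 1 < d := by exact_mod_cast h
    exact mul_neg_of_pos_of_neg (scale_pos d) (by linarith)
  · rw [pos_A_one, if_pos h]

theorem pos_B_frame {i : ℤ} (hT : (B i).Valid d l m) :
    let w := (planar d l m).pos ⟨B i, hT⟩;
    w 0 ≤ 0 ∧ w 1 ≤ -depth e - 7 * small e ∧ (i + 1 < d → w 0 < 0) ∧ (i + 1 = d → w 0 = 0) := by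
  obtain ⟨h0, h1, h2, h3⟩ := pos_B_bounds (by omega) hT (by have := he.left; omega)
  refine ⟨h1, h3.trans (depth_bound_of_succ he hde).1, fun h => ?_, fun h => ?_⟩
  · rw [pos_B_zero, if_neg h.ne]
    have h4 : (i : ℝ) + 1 < d := by exact_mod_cast h
    exact mul_neg_of_pos_of_neg (scale_pos d) (by linarith)
  · rw [pos_B_zero, if_pos h]

theorem mem_crossing_horizontal (hz : z ∈ he.piece.carrier) {j : ℤ} (hj : m ≤ j) (hjd : j + l + 1 ≤ d)
    (h1 : z 1 = scale d * (2 * j + l - 2 * d - 1)) (h0 : z 0 < 0) :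
    ∃ c ∈ crossingIndex d e l m, z = crossing d e l m c := by
  have hs := scale_pos d
  have hS := scale_of_succ he hde
  have h2 : (j : ℝ) + l + 1 ≤ d := by exact_mod_cast hjd
  have h3 : (0 : ℝ) ≤ j := by exact_mod_cast (show 0 ≤ j by have := he.down; omega)
  have h4 : (0 : ℝ) ≤ l := by exact_mod_cast (show 0 ≤ l by have := he.left; omega)
  have h6 : -scale e < z 1 := by
    nlinarith
  have h7 : z 1 < 0 := by
    rw [h1]
    exact mul_neg_of_pos_of_neg hs (by linarith)
  rcases he.of_mem_horizontal hz h0 h6 h7 with ⟨a, ha, ham, h8⟩ | ⟨hl, hme, h8⟩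
  · refine ⟨.inl (j, a), inl_mem_crossingIndex.2 ⟨⟨hj, hjd⟩, by have := he.left; omega, by omega⟩, ?_⟩
    ext s
    fin_cases s
    · simp only [crossing, if_neg (not_lt.2 ha), ← h1]
      exact h8
    · exact h1
  · refine ⟨.inl (j, 0), inl_mem_crossingIndex.2 ⟨⟨hj, hjd⟩, by omega, by omega⟩, ?_⟩
    ext s
    fin_cases s
    · simp only [crossing, if_pos (show 0 < l by omega), ← h1]
      rw [LabelledGraph.val, show (planar e l m).height = height e l m from rfl] at h8
      push_cast at h8
      exact (by linarith : z 0 = height e l m (1, e - 1) - (e - 1) * z 1)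
    · exact h1

theorem mem_crossing_vertical (hm : m = 1) (hz : z ∈ he.piece.carrier) {i : ℤ} (hi : l ≤ i)
    (hid : i + 2 ≤ d) (h0 : z 0 = scale d * (2 * i - 4 * d)) (h1 : z 1 < 0) :
    ∃ c ∈ crossingIndex d e l m, z = crossing d e l m c := by
  have hs := scale_pos d
  have hS := scale_of_succ he hde
  have h2 : (i : ℝ) + 2 ≤ d := by exact_mod_cast hid
  have h3 : (0 : ℝ) ≤ i := by exact_mod_cast (show 0 ≤ i by have := he.left; omega)
  have h6 : -scale e < z 0 := by
    nlinarith
  have h7 : z 0 < 0 := by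
    rw [h0]
    exact mul_neg_of_pos_of_neg hs (by linarith)
  obtain ⟨h8, h9⟩ := he.of_mem_vertical hm hz h6 h7 h1
  refine ⟨.inr i, inr_mem_crossingIndex.2 ⟨hm, hi, hid⟩, ?_⟩
  ext s
  fin_cases s
  · exact h0
  · simp only [crossing, ← h0]
    rw [LabelledGraph.val, show (planar e l m).height = height e l m from rfl] at h9
    push_cast at h9
    exact (by linarith : z 1 = height e l m (e - 1, 1) - (e - 1) * z 0)

/-- The region that contains the bounded edges of the cluster. -/
theorem notMem_carrier_of_bounds (hle : l + m ≤ e) (h0 : -(5 * d) * scale d ≤ z 0)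
    (h1 : -(5 * d) * scale d ≤ z 0 - z 1)
    (h2 : m = 1 → -(5 * d) * scale d ≤ z 1 ∧ -(5 * d) * scale d ≤ z 1 - z 0) :
    z ∉ he.piece.carrier := by
  have h3 : 0 < d * scale d := mul_pos (by exact_mod_cast (by omega : 0 < d)) (scale_pos d)
  have hS := scale_of_succ he hde
  refine he.notMem_carrier_corner hle (by linarith) (by linarith) fun hm => ?_
  obtain ⟨h4, h5⟩ := h2 hm
  constructor <;> linarith

end Bounds

include hd in
theorem mem_segment_of_corner {T T' : Triangle} (h : T.Valid d l m) (h' : T'.Valid d l m) (s s' : Fin 3)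
    (h1 : T'.corner d s' = T.corner d (s + 1)) (h2 : T'.corner d (s' + 1) = T.corner d s)
    (hz : z ∈ hd.piece.edge (⟨T, h⟩, s)) : z ∈ hd.piece.edge (⟨T', h'⟩, s') ∧
      z ∈ segment ℝ ((planar d l m).pos ⟨T, h⟩) ((planar d l m).pos ⟨T', h'⟩) := by
  have ho : hd.piece.opp (⟨T, h⟩, s) = some (⟨T', h'⟩, s') := (hd.isRegular.opp_eq_some).2 ⟨h1, h2⟩
  have hT := hd.isRegular.isTropical
  refine ⟨(hT.edge_opp ho).symm ▸ hz, ?_⟩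
  exact (hT.edge_eq_segment ho) ▸ hz

end Planar

end TropGeo

namespace TropGeo

/-! ### Locating the common points of two consecutive planar curves -/

section Planar

open Triangle

variable {d e : ℕ} {l m : ℤ}

variable (hd : Admissible d l m) (he : Admissible e l m) (hde : d = e + 1) {z : Fin 2 → ℝ}

/-- The possible positions of a common point of two consecutive planar curves. -/
def Admissible.Meets (e : ℕ) (z : Fin 2 → ℝ) : Prop :=
  (∃ c ∈ crossingIndex d e l m, z = crossing d e l m c) ∨
    (l = 1 ∧ z ∈ hd.piece.edge hd.piece.left) ∨ (m = 1 ∧ z ∈ hd.piece.edge hd.piece.down)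

theorem exists_of_mem_edge {h : PlanarVertex d l m × Fin 3} (hz : z ∈ hd.piece.edge h)
    {u : Fin 2 → ℤ} (hu : (planar d l m).dir h = u) :
    ∃ t : ℝ, 0 ≤ t ∧ z = along ((planar d l m).pos h.1) u t ∧
      z 0 = (planar d l m).pos h.1 0 + t * u 0 ∧ z 1 = (planar d l m).pos h.1 1 + t * u 1 := by
  subst hu
  obtain ⟨⟨t, ht, rfl⟩, -⟩ := hz
  exact ⟨t, ht, rfl, by simp [along, toReal]; rfl, by simp [along, toReal]; rfl⟩

/-- The vertices of the cluster. -/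
def Triangle.Inner : Triangle → Prop
  | P _ _ => True
  | Q _ _ => True
  | _ => False

-- The honeycomb of degree `d` is small enough to lie in the convex region where one inner label of
-- the curve of degree `e` dominates. Bounds at the ends of an edge therefore suffice.
include hd he hde in
theorem Admissible.notMem_cluster {T T' : Triangle} (hT : T.Valid d l m) (hT' : T'.Valid d l m)
    (hi : T.Inner) (hi' : T'.Inner)
    (hz : z ∈ segment ℝ ((planar d l m).pos ⟨T, hT⟩) ((planar d l m).pos ⟨T', hT'⟩)) :
    z ∉ he.piece.carrier := by
  have key : ∀ {T : Triangle} (hT : T.Valid d l m), T.Inner → l + m + 1 ≤ d ∧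
      -(5 * d) * scale d ≤ (planar d l m).pos ⟨T, hT⟩ 0 ∧ (planar d l m).pos ⟨T, hT⟩ 0 ≤ 0 ∧
      -(3 * d) * scale d ≤ (planar d l m).pos ⟨T, hT⟩ 1 ∧ (planar d l m).pos ⟨T, hT⟩ 1 ≤ 0 := by
    intro T hT hi
    have hv : ∃ i j, T = P i j ∨ T = Q i j := by
      cases T with
      | P i j => exact ⟨i, j, Or.inl rfl⟩
      | Q i j => exact ⟨i, j, Or.inr rfl⟩
      | A j => exact hi.elim
      | B j => exact hi.elim
    obtain ⟨h1, h2, h3, h4⟩ := cluster_bounds hd.one_le hd.left hd.down ⟨T, hT⟩ hv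
    refine ⟨?_, h1, h2.le, h3, h4.le⟩
    obtain ⟨i, j, rfl | rfl⟩ := hv <;> obtain ⟨h5, h6, h7⟩ := hT <;> omega
  obtain ⟨h0, h1, h2, h3, h4⟩ := key hT hi
  obtain ⟨-, h1', h2', h3', h4'⟩ := key hT' hi'
  obtain ⟨a, b, ha, hb, hab, rfl⟩ := hz
  refine notMem_carrier_of_bounds he hde (by omega) ?_ ?_ fun _ => ⟨?_, ?_⟩ <;>
    simp only [Pi.add_apply, Pi.smul_apply, smul_eq_mul] <;> nlinarith

-- Along these rays none of the differences bounding the dominance region decreases, so a ray that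
-- starts in the honeycomb remains in that region.
include hd he hde in
theorem Admissible.notMem_rays {i j : ℤ} (hT : (P i j).Valid d l m) {u : Fin 2 → ℤ}
    (hu : u = ![1, 1] ∨ (m = 0 ∧ u = ![0, -1])) {t : ℝ} (ht : 0 ≤ t)
    (h0 : z 0 = (planar d l m).pos ⟨P i j, hT⟩ 0 + t * u 0)
    (h1 : z 1 = (planar d l m).pos ⟨P i j, hT⟩ 1 + t * u 1) : z ∉ he.piece.carrier := by
  obtain ⟨h2, h3, h4, h5⟩ := cluster_bounds hd.one_le hd.left hd.down ⟨_, hT⟩ ⟨i, j, Or.inl rfl⟩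
  obtain ⟨h6, h7, h8⟩ := id hT
  refine notMem_carrier_of_bounds he hde (by omega) ?_ ?_ fun hm => ?_
  · rcases hu with rfl | ⟨-, rfl⟩ <;> simp at h0 h1 <;> linarith
  · rcases hu with rfl | ⟨-, rfl⟩ <;> simp at h0 h1 <;> linarith
  · obtain rfl := hu.resolve_right fun h => by omega
    simp at h0 h1
    constructor <;> linarith

-- Edges to inverted triangles stay in the honeycomb, and diagonal rays stay in the same cell of the
-- other curve. Only the half-edges of the left column and of the bottom row run through the other
-- curve, on a horizontal or vertical line very close to an axis.
include hd he hde in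
theorem Admissible.meets_P {i j : ℤ} (hT : (P i j).Valid d l m) (s : Fin 3)
    (hz : z ∈ hd.piece.edge (⟨P i j, hT⟩, s)) (hz' : z ∈ he.piece.carrier) : hd.Meets e z := by
  obtain ⟨h6, h7, h8⟩ := id hT
  obtain ⟨h2, h3, h4, h5⟩ := cluster_bounds hd.one_le hd.left hd.down ⟨_, hT⟩ ⟨i, j, Or.inl rfl⟩
  fin_cases s
  · have hdir := (dir_of_corner hT 0 (u := ![0, -1]) (by simp [corner]) (by simp [corner])).2
    obtain ⟨t, ht, -, h0, h1⟩ := exists_of_mem_edge hd hz hdir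
    rcases h7.lt_or_eq with hj | rfl
    · have hQ : (Q i (j - 1)).Valid d l m := ⟨h6, by omega, by omega⟩
      exact absurd hz' (hd.notMem_cluster he hde hT hQ trivial trivial (mem_segment_of_corner hd
        hT hQ 0 1 (by simp [corner]) (by simp [corner]) hz).2)
    · rcases hd.down with rfl | rfl
      · exact absurd hz' (hd.notMem_rays he hde hT (Or.inr ⟨rfl, rfl⟩) ht h0 h1)
      · refine Or.inl (mem_crossing_vertical he hde rfl hz' h6 (by omega) ?_ ?_)
        · rw [h0, pos_P]
          simp
          left
          ring
        · push_cast at h1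
          linarith
  · have hdir := (dir_of_corner hT 1 (u := ![1, 1]) (by simp [corner]) (by simp [corner])).2
    obtain ⟨t, ht, -, h0, h1⟩ := exists_of_mem_edge hd hz hdir
    exact absurd hz' (hd.notMem_rays he hde hT (Or.inl rfl) ht h0 h1)
  · have hdir := (dir_of_corner hT 2 (u := ![-1, 0]) (by simp [corner]) (by simp [corner])).2
    obtain ⟨t, ht, -, h0, h1⟩ := exists_of_mem_edge hd hz hdir
    rcases h6.lt_or_eq with hi | rfl
    · have hQ : (Q (i - 1) j).Valid d l m := ⟨by omega, h7, by omega⟩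
      exact absurd hz' (hd.notMem_cluster he hde hT hQ trivial trivial (mem_segment_of_corner hd
        hT hQ 2 0 (by simp [corner]) (by simp [corner]) hz).2)
    · refine Or.inl (mem_crossing_horizontal he hde hz' h7 (by omega) ?_ ?_)
      · rw [h1, pos_P]
        simp
        left
        ring
      · push_cast at h0
        linarith

include hd he hde in
theorem Admissible.notMem_Q {i j : ℤ} (hT : (Q i j).Valid d l m) (s : Fin 3)
    (hz : z ∈ hd.piece.edge (⟨Q i j, hT⟩, s)) : z ∉ he.piece.carrier := by
  obtain ⟨h6, h7, h8⟩ := id hT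
  fin_cases s
  · have hP : (P (i + 1) j).Valid d l m := ⟨by omega, h7, by omega⟩
    exact hd.notMem_cluster he hde hT hP trivial trivial
      (mem_segment_of_corner hd hT hP 0 2 (by simp [corner]) (by simp [corner]) hz).2
  · have hP : (P i (j + 1)).Valid d l m := ⟨h6, by omega, by omega⟩
    exact hd.notMem_cluster he hde hT hP trivial trivial
      (mem_segment_of_corner hd hT hP 1 0 (by simp [corner]) (by simp [corner]) hz).2
  · have hP : (P i j).Valid d l m := ⟨h6, h7, by omega⟩
    exact hd.notMem_cluster he hde hT hP trivial trivial
      (mem_segment_of_corner hd hT hP 2 1 (by simp [corner]) (by simp [corner]) hz).2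

theorem Admissible.left_eq (hT : (A (d - 1)).Valid d l m) : hd.piece.left = (⟨A (d - 1), hT⟩, 2) :=
  (hd.isSide_left hT.1).eq hd ⟨by simp [planar, corner], by simp [planar, corner]⟩

theorem Admissible.down_eq (hT : (B (d - 1)).Valid d l m) : hd.piece.down = (⟨B (d - 1), hT⟩, 0) :=
  (hd.isSide_down hT.1).eq hd ⟨by simp [planar, corner], by simp [planar, corner]⟩

theorem Admissible.meets_pos_A (hT : (A (d - 1)).Valid d l m) (h : z = (planar d l m).pos ⟨A (d - 1), hT⟩) :
    hd.Meets e z := by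
  refine Or.inr (Or.inl ⟨hT.1, ?_⟩)
  rw [h, hd.left_eq hT]
  exact hd.isRegular.isTropical.pos_mem_edge _

theorem Admissible.meets_pos_B (hT : (B (d - 1)).Valid d l m) (h : z = (planar d l m).pos ⟨B (d - 1), hT⟩) :
    hd.Meets e z := by
  refine Or.inr (Or.inr ⟨hT.1, ?_⟩)
  rw [h, hd.down_eq hT]
  exact hd.isRegular.isTropical.pos_mem_edge _

include hd he hde in
/-- The edges of the frame to the left, apart from those that leave it. -/
theorem Admissible.meets_segment_A {j j' : ℤ} (hT : (A j).Valid d l m) (hT' : (A j').Valid d l m)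
    (hj : j' + 1 < d)
    (hz : z ∈ segment ℝ ((planar d l m).pos ⟨A j, hT⟩) ((planar d l m).pos ⟨A j', hT'⟩))
    (hz' : z ∈ he.piece.carrier) : hd.Meets e z := by
  obtain ⟨h1, h2, h3, h4⟩ := pos_A_frame he hde hT
  obtain ⟨g1, g2, g3, g4⟩ := pos_A_frame he hde hT'
  have g3 := g3 hj
  obtain ⟨a, b, ha, hb, hab, rfl⟩ := hz
  obtain rfl : a = 1 - b := by linarith
  rcases hb.eq_or_lt with rfl | hb
  · rcases hT.2.2.1.lt_or_eq with hj | hj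
    · refine absurd hz' (he.notMem_carrier_left hT.1 ?_ ?_) <;> simp
      exacts [h1, h3 hj]
    · obtain rfl : j = d - 1 := by omega
      exact hd.meets_pos_A hT (by simp)
  · refine absurd hz' (he.notMem_carrier_left hT.1 ?_ ?_) <;>
      simp only [Pi.add_apply, Pi.smul_apply, smul_eq_mul] <;> nlinarith

include hd he hde in
/-- The edges of the lower frame, apart from those that leave it. -/
theorem Admissible.meets_segment_B {i i' : ℤ} (hT : (B i).Valid d l m) (hT' : (B i').Valid d l m)
    (hi : i' + 1 < d)
    (hz : z ∈ segment ℝ ((planar d l m).pos ⟨B i, hT⟩) ((planar d l m).pos ⟨B i', hT'⟩))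
    (hz' : z ∈ he.piece.carrier) : hd.Meets e z := by
  obtain ⟨h1, h2, h3, h4⟩ := pos_B_frame he hde hT
  obtain ⟨g1, g2, g3, g4⟩ := pos_B_frame he hde hT'
  have g3 := g3 hi
  obtain ⟨a, b, ha, hb, hab, rfl⟩ := hz
  obtain rfl : a = 1 - b := by linarith
  rcases hb.eq_or_lt with rfl | hb
  · rcases hT.2.2.lt_or_eq with hi | hi
    · refine absurd hz' (he.notMem_carrier_down hT.1 ?_ ?_) <;> simp
      exacts [h3 hi, h2]
    · obtain rfl : i = d - 1 := by omega
      exact hd.meets_pos_B hT (by simp)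
  · refine absurd hz' (he.notMem_carrier_down hT.1 ?_ ?_) <;>
      simp only [Pi.add_apply, Pi.smul_apply, smul_eq_mul] <;> nlinarith

include hd he hde in
/-- The edge between the two parts of the frame. -/
theorem Admissible.meets_segment_AB (hT : (A 1).Valid d l m) (hT' : (B 1).Valid d l m)
    (hz : z ∈ segment ℝ ((planar d l m).pos ⟨A 1, hT⟩) ((planar d l m).pos ⟨B 1, hT'⟩))
    (hz' : z ∈ he.piece.carrier) : hd.Meets e z := by
  obtain ⟨h1, h2, h3, h4⟩ := pos_A_frame he hde hT
  obtain ⟨g1, g2, g3, g4⟩ := pos_B_frame he hde hT'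
  obtain ⟨a, b, ha, hb, hab, rfl⟩ := hz
  obtain rfl : a = 1 - b := by linarith
  rcases hb.eq_or_lt with rfl | hb
  · rcases hT.2.2.1.lt_or_eq with hj | hj
    · refine absurd hz' (he.notMem_carrier_left hT.1 ?_ ?_) <;> simp
      exacts [h1, h3 hj]
    · have hj : (1 : ℤ) = d - 1 := by omega
      have hT2 : (A (d - 1)).Valid d l m := hj ▸ hT
      refine hd.meets_pos_A hT2 ?_
      simp [← hj]
  rcases ha.eq_or_lt with ha | ha
  · obtain rfl : b = 1 := by linarith
    rcases hT'.2.2.lt_or_eq with hj | hj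
    · refine absurd hz' (he.notMem_carrier_down hT'.1 ?_ ?_) <;> simp
      exacts [g3 hj, g2]
    · have hj : (1 : ℤ) = d - 1 := by omega
      have hT2 : (B (d - 1)).Valid d l m := hj ▸ hT'
      refine hd.meets_pos_B hT2 ?_
      simp [← hj]
  refine absurd hz' (he.notMem_carrier_of_neg (Or.inl hT.1) fun p hp hO => ?_)
  -- Label values are affine along the segment. Each corner label (0, e), (e, 0) may vanish at one
  -- end but is negative at the other; all other labels except the origin are negative at both.
  have hval : (planar e l m).val p ((1 - b) • (planar d l m).pos ⟨A 1, hT⟩ +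
      b • (planar d l m).pos ⟨B 1, hT'⟩) = (1 - b) * (planar e l m).val p ((planar d l m).pos ⟨A 1, hT⟩) +
      b * (planar e l m).val p ((planar d l m).pos ⟨B 1, hT'⟩) := by
    simp only [LabelledGraph.val, Pi.add_apply, Pi.smul_apply, smul_eq_mul]
    ring
  have hl0 := hT.1
  have hm0 := hT'.1
  have h1e : (1 : ℝ) ≤ e := by exact_mod_cast he.one_le
  have hK := (depth_bounds he.one_le).1
  have e0 := (small_bounds he.one_le).1
  rw [hval]
  by_cases hp1 : p = (0, (e : ℤ))
  · subst hp1
    rw [val_frame (by omega), val_frame (by omega)]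
    push_cast
    have h5 : e * (planar d l m).pos ⟨A 1, hT⟩ 1 ≤ 0 := by nlinarith
    have h6 : e * (planar d l m).pos ⟨B 1, hT'⟩ 1 < 0 := by nlinarith
    nlinarith
  by_cases hp2 : p = ((e : ℤ), 0)
  · subst hp2
    rw [val_frame (by omega), val_frame (by omega)]
    push_cast
    have h5 : e * (planar d l m).pos ⟨A 1, hT⟩ 0 < 0 := by nlinarith
    have h6 : e * (planar d l m).pos ⟨B 1, hT'⟩ 0 ≤ 0 := by nlinarith
    nlinarith
  have h5 := he.val_neg_left hl0 h1 h2 hp hO hp1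
  have h6 := he.val_neg_down hm0 g1 g2 hp hO hp2
  nlinarith

include hd he hde in
theorem Admissible.meets_A {j : ℤ} (hT : (A j).Valid d l m) (s : Fin 3)
    (hz : z ∈ hd.piece.edge (⟨A j, hT⟩, s)) (hz' : z ∈ he.piece.carrier) : hd.Meets e z := by
  obtain ⟨h6, h7, h8, h9⟩ := id hT
  have he1 := he.one_le
  have hm := hd.down
  obtain ⟨h1, h2, h3, h4⟩ := pos_A_frame he hde hT
  fin_cases s
  · by_cases hmj : m < j
    · have hA : (A (j - 1)).Valid d l m := ⟨h6, by omega, by omega, by omega⟩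
      exact hd.meets_segment_A he hde hT hA (by omega) (mem_segment_of_corner hd hT hA 0 2
        (by simp [corner]; omega) (by simp [corner]) hz).2 hz'
    · rcases hm with rfl | rfl
      · obtain rfl : j = 0 := by omega
        have hdir := (dir_of_corner hT 0 (u := ![0, -1]) (by simp [corner]) (by simp [corner])).2
        obtain ⟨t, ht, -, h0, h1'⟩ := exists_of_mem_edge hd hz hdir
        have := h3 (by omega)
        push_cast at h0 h1'
        exact absurd hz' (he.notMem_carrier_left h6 (by linarith) (by linarith))
      · obtain rfl : j = 1 := by omega
        have hB : (B 1).Valid d l 1 := ⟨rfl, by omega, by omega⟩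
        exact hd.meets_segment_AB he hde hT hB (mem_segment_of_corner hd hT hB 0 2
          (by simp [corner]) (by simp [corner]) hz).2 hz'
  · rcases h8.lt_or_eq with hj | hj
    · have hP : (P 1 j).Valid d l m := ⟨by omega, by omega, by omega⟩
      exact hd.meets_P he hde hP 2 (mem_segment_of_corner hd hT hP 1 2
        (by simp [corner]; omega) (by simp [corner]) hz).1 hz'
    · obtain rfl : j = d - 1 := by omega
      have hdir := (dir_of_corner hT 1 (u := ![1, 1]) (by simp [corner]) (by simp [corner])).2
      obtain ⟨t, ht, h0, -⟩ := exists_of_mem_edge hd hz hdir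
      rcases ht.eq_or_lt with rfl | ht
      · exact hd.meets_pos_A hT (by rw [h0]; simp [along])
      -- The last frame vertex lies on the axis, hence on the weighted ray of the other curve, where
      -- the origin ties with (0, e). Its diagonal ray enters the cell of (0, e) at once.
      · refine absurd hz' (h0 ▸ he.notMem_carrier_diag (E := (0, e)) (by simp) ?_ (Or.inl h6) ?_
          (fun p hp hO hE => he.val_neg_left h6 h1 h2 hp hO hE) ht)
        · exact mem_planar_labels.2 ⟨le_rfl, by simp, by simp, fun _ => Or.inr rfl, fun _ => Or.inl rfl⟩
        · rw [val_frame (by omega), h4 hj]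
          simp
  · rcases h8.lt_or_eq with hj | hj
    · have hA : (A (j + 1)).Valid d l m := ⟨h6, by omega, by omega, by omega⟩
      have hz2 := (mem_segment_of_corner hd hT hA 2 0 (by simp [corner]) (by simp [corner]; omega) hz).2
      rw [segment_symm] at hz2
      exact hd.meets_segment_A he hde hA hT hj hz2 hz'
    · obtain rfl : j = d - 1 := by omega
      exact Or.inr (Or.inl ⟨h6, by rw [hd.left_eq hT]; exact hz⟩)

include hd he hde in
theorem Admissible.meets_B {i : ℤ} (hT : (B i).Valid d l m) (s : Fin 3)
    (hz : z ∈ hd.piece.edge (⟨B i, hT⟩, s)) (hz' : z ∈ he.piece.carrier) : hd.Meets e z := by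
  obtain ⟨h6, h7, h8⟩ := id hT
  have he1 := he.one_le
  have hl := hd.left
  obtain ⟨h1, h2, h3, h4⟩ := pos_B_frame he hde hT
  fin_cases s
  · rcases h8.lt_or_eq with hi | hi
    · have hB : (B (i + 1)).Valid d l m := ⟨h6, by omega, by omega⟩
      have hz2 := (mem_segment_of_corner hd hT hB 0 2 (by simp [corner]; omega) (by simp [corner]) hz).2
      rw [segment_symm] at hz2
      exact hd.meets_segment_B he hde hB hT hi hz2 hz'
    · obtain rfl : i = d - 1 := by omega
      exact Or.inr (Or.inr ⟨h6, by rw [hd.down_eq hT]; exact hz⟩)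
  · rcases h8.lt_or_eq with hi | hi
    · have hP : (P i 1).Valid d l m := ⟨by omega, by omega, by omega⟩
      exact hd.meets_P he hde hP 0 (mem_segment_of_corner hd hT hP 1 0
        (by simp [corner]) (by simp [corner]; omega) hz).1 hz'
    · obtain rfl : i = d - 1 := by omega
      have hdir := (dir_of_corner hT 1 (u := ![1, 1]) (by simp [corner]) (by simp [corner])).2
      obtain ⟨t, ht, h0, -⟩ := exists_of_mem_edge hd hz hdir
      rcases ht.eq_or_lt with rfl | ht
      · exact hd.meets_pos_B hT (by rw [h0]; simp [along])
      · refine absurd hz' (h0 ▸ he.notMem_carrier_diag (E := (e, 0)) (by simp) ?_ (Or.inr h6) ?_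
          (fun p hp hO hE => he.val_neg_down h6 h1 h2 hp hO hE) ht)
        · exact mem_planar_labels.2 ⟨by simp, le_rfl, by simp, fun _ => Or.inl rfl, fun _ => Or.inr rfl⟩
        · rw [val_frame (by omega), h4 hi]
          simp
  · by_cases hli : l < i
    · have hB : (B (i - 1)).Valid d l m := ⟨h6, by omega, by omega⟩
      exact hd.meets_segment_B he hde hT hB (by omega) (mem_segment_of_corner hd hT hB 2 0
        (by simp [corner]) (by simp [corner]; omega) hz).2 hz'
    · rcases hl with rfl | rfl
      · obtain rfl : i = 0 := by omega
        have hdir := (dir_of_corner hT 2 (u := ![-1, 0]) (by simp [corner]) (by simp [corner])).2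
        obtain ⟨t, ht, -, h0, h1'⟩ := exists_of_mem_edge hd hz hdir
        have := h3 (by omega)
        push_cast at h0 h1'
        exact absurd hz' (he.notMem_carrier_down h6 (by linarith) (by linarith))
      · obtain rfl : i = 1 := by omega
        have hA : (A 1).Valid d 1 m := ⟨rfl, by omega, by omega, by omega⟩
        have hz2 := (mem_segment_of_corner hd hT hA 2 0 (by simp [corner]) (by simp [corner]) hz).2
        rw [segment_symm] at hz2
        exact hd.meets_segment_AB he hde hA hT hz2 hz'

include hd he hde in
theorem Admissible.meets (hz : z ∈ hd.piece.carrier) (hz' : z ∈ he.piece.carrier) : hd.Meets e z := by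
  obtain ⟨⟨⟨T, hT⟩, s⟩, hz⟩ := hz
  cases T with
  | P i j => exact hd.meets_P he hde hT s hz hz'
  | Q i j => exact absurd hz' (hd.notMem_Q he hde hT s hz)
  | A j => exact hd.meets_A he hde hT s hz hz'
  | B i => exact hd.meets_B he hde hT s hz hz'

end Planar

end TropGeo

namespace TropGeo

/-! ### Transversality and number of the crossings -/

section Planar

open Triangle

variable {d e : ℕ} {l m : ℤ}

variable (hd : Admissible d l m) (he : Admissible e l m) (hde : d = e + 1) {z : Fin 2 → ℝ}

include he in
theorem Admissible.height_bounds {a b : ℤ} (ha : l ≤ a) (hb : m ≤ b) (hab : a + b ≤ e) {t : ℝ}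
    (ht : -scale e ≤ t) (ht0 : t ≤ 0) :
    -depth e - 6 * small e ≤ height e l m (a, b) - (e - 1) * t ∧
      height e l m (a, b) - (e - 1) * t ≤ -1 / 4 := by
  have hs := scale_pos e
  obtain ⟨e0, e1, -, e3, e4⟩ := small_bounds he.one_le
  have hK := (depth_bounds he.one_le).1
  have h1e : (1 : ℝ) ≤ e := by exact_mod_cast he.one_le
  have h1 : (0 : ℝ) ≤ a := by exact_mod_cast (show 0 ≤ a by have := he.left; omega)
  have h2 : (0 : ℝ) ≤ b := by exact_mod_cast (show 0 ≤ b by have := he.down; omega)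
  have h3 : (a : ℝ) + b ≤ e := by exact_mod_cast hab
  have h4 : -(6 * (e : ℝ) ^ 2) ≤ a ^ 2 + a * b + b ^ 2 - (4 * e + 2) * a - (2 * e + 2) * b := by
    nlinarith [mul_nonneg h1 h2, sq_nonneg (a : ℝ), sq_nonneg (b : ℝ)]
  have h5 : (a : ℝ) ^ 2 + a * b + b ^ 2 - (4 * e + 2) * a - (2 * e + 2) * b ≤ 0 := by nlinarith
  have h6 := mul_le_mul_of_nonneg_left h4 hs.le
  have h7 := mul_nonpos_of_nonneg_of_nonpos hs.le h5
  have h8 : 0 ≤ (e - 1) * -t := mul_nonneg (by linarith) (by linarith)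
  have h9 : (e - 1) * -t ≤ e * scale e := mul_le_mul (by linarith) (by linarith) (by linarith) (by linarith)
  rw [height_inner ha hb]
  constructor <;> linarith

include he hde in
theorem offset_bounds {n : ℤ} (hn : n ≤ -1) (hn' : -(5 * d) ≤ n) :
    -scale e < scale d * n ∧ scale d * n < 0 := by
  have hs := scale_pos d
  have h1 : (n : ℝ) ≤ -1 := by exact_mod_cast hn
  have h2 : -(5 * d : ℝ) ≤ n := by exact_mod_cast hn'
  rw [scale_of_succ he hde]
  constructor <;> nlinarith

theorem mem_openRay_of_dir {h : PlanarVertex d l m × Fin 3} {u : Fin 2 → ℤ} {t : ℝ} (ht : 0 < t)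
    (hu : (planar d l m).dir h = u) (h0 : z 0 = (planar d l m).pos h.1 0 + t * u 0)
    (h1 : z 1 = (planar d l m).pos h.1 1 + t * u 1) : z ∈ hd.piece.openRay h := by
  subst hu
  refine ⟨t, ht, ?_⟩
  ext s
  fin_cases s
  exacts [h0.symm, h1.symm]

include hd in
theorem mem_openEdge_of_corner {T T' : Triangle} {h : T.Valid d l m} (h' : T'.Valid d l m) (s s' : Fin 3)
    (h1 : T'.corner d s' = T.corner d (s + 1)) (h2 : T'.corner d (s' + 1) = T.corner d s)
    (hz : z ∈ hd.piece.openRay (⟨T, h⟩, s)) (hz' : z ∈ hd.piece.openRay (⟨T', h'⟩, s')) :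
    z ∈ hd.piece.openEdge (⟨T, h⟩, s) := by
  have ho : hd.piece.opp (⟨T, h⟩, s) = some (⟨T', h'⟩, s') := (hd.isRegular.opp_eq_some).2 ⟨h1, h2⟩
  refine ⟨hz, fun g hg => ?_⟩
  rw [ho, Option.some_inj] at hg
  exact hg ▸ hz'

include hd in
theorem mem_openEdge_of_boundary {T : Triangle} {h : T.Valid d l m} {s : Fin 3}
    (hb : BoundarySide d l m (T.corner d s) (T.corner d (s + 1)))
    (hz : z ∈ hd.piece.openRay (⟨T, h⟩, s)) : z ∈ hd.piece.openEdge (⟨T, h⟩, s) :=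
  ⟨hz, fun g hg => by
    have : hd.piece.opp (⟨T, h⟩, s) = none := (planar_opp_eq_none hd).2 ⟨_, _, ⟨rfl, rfl⟩, hb⟩
    rw [this] at hg
    cases hg⟩

theorem Admissible.mem_openRay {T : Triangle} (h : T.Valid d l m) (s : Fin 3)
    (h1 : (planar d l m).val (T.corner d (s + 1)) z = (planar d l m).val (T.corner d s) z)
    (h2 : (planar d l m).val (T.corner d (s + 2)) z < (planar d l m).val (T.corner d s) z) :
    z ∈ hd.piece.openRay (⟨T, h⟩, s) :=
  hd.isRegular.mem_openRay h1 h2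

/-- The edge of the left frame that meets the horizontal edges. -/
theorem Admissible.mem_openEdge_A (hl : l = 1) (hT : (A (e - 1)).Valid e l m) (hm : m + 1 ≤ e)
    (h0 : z 0 < 0) (h1 : -scale e < z 1) (h2 : z 1 < 0) (hz : z 0 = height e l m (1, e - 1) - (e - 1) * z 1) :
    z ∈ he.piece.openEdge (⟨A (e - 1), hT⟩, 0) := by
  have hv : (planar e l m).val (1, e - 1) z = 0 := by
    rw [LabelledGraph.val, show (planar e l m).height = height e l m from rfl, hz]
    push_cast
    ring
  have hO : (planar e l m).val (0, 0) z = 0 := val_origin (by omega) z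
  have h1e : (1 : ℝ) ≤ e := by exact_mod_cast he.one_le
  have hE : (planar e l m).val (0, e) z < 0 := by
    rw [val_frame (by omega)]
    push_cast
    nlinarith
  have hray := he.mem_openRay hT 0 (z := z) (by simp [corner, hv, hO]) (by simpa [corner, hO] using hE)
  -- The other end of this frame edge is the next triangle `A`. For small `e` the edge is instead
  -- unbounded (when `m = 0`) or ends at the first triangle `B` (when `m = 1`).
  by_cases hme : m + 2 ≤ e
  · have hA : (A (e - 2)).Valid e l m := ⟨hl, by have := he.down; omega, by omega, by omega⟩
    have hc : ((e : ℤ) - 2 + 1) = e - 1 := by ring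
    have h3 := he.val_up (z := z) (a := 1) (b := e - 2) (by omega) (by omega)
    rw [hc, hv] at h3
    push_cast at h3
    refine mem_openEdge_of_corner he hA 0 2 (by simp [corner, hc]) (by simp [corner]) hray
      (he.mem_openRay hA 2 ?_ ?_)
    · simp [corner, hc, hv, hO]
    · simp [corner, hc, hv]
      linarith
  · rcases he.down with rfl | rfl
    · obtain rfl : e = 1 := by omega
      exact mem_openEdge_of_boundary he (Or.inr (Or.inr (Or.inl
        ⟨rfl, 0, le_rfl, by simp, by simp [corner], by simp [corner]⟩))) hray
    · obtain rfl : e = 2 := by omega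
      have hB : (B 1).Valid 2 l 1 := ⟨rfl, by omega, by simp⟩
      refine mem_openEdge_of_corner he hB 0 2 (by simp [corner]) (by simp [corner]) hray
        (he.mem_openRay hB 2 ?_ ?_)
      · norm_num at hv
        simp [corner, hv, hO]
      · norm_num at hv
        simp only [corner]
        simp [hv]
        rw [val_frame (by omega)]
        push_cast
        linarith

/-- The edge of the lower frame that meets the vertical edges. -/
theorem Admissible.mem_openEdge_B (hT : (B (e - 1)).Valid e l m)
    (h0 : -scale e < z 0) (h1 : z 0 < 0) (h2 : z 1 < 0) (hz : z 1 = height e l m (e - 1, 1) - (e - 1) * z 0) :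
    z ∈ he.piece.openEdge (⟨B (e - 1), hT⟩, 2) := by
  obtain ⟨hm, hl, -⟩ := id hT
  have hv : (planar e l m).val (e - 1, 1) z = 0 := by
    rw [LabelledGraph.val, show (planar e l m).height = height e l m from rfl, hz]
    push_cast
    ring
  have hO : (planar e l m).val (0, 0) z = 0 := val_origin (by omega) z
  have h1e : (1 : ℝ) ≤ e := by exact_mod_cast he.one_le
  have hE : (planar e l m).val (e, 0) z < 0 := by
    rw [val_frame (by omega)]
    push_cast
    nlinarith
  have hray := he.mem_openRay hT 2 (z := z) (by simp [corner, hv, hO]) (by simpa [corner, hv] using hE)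
  by_cases hle : l + 2 ≤ e
  · have hB : (B (e - 2)).Valid e l m := ⟨hm, by omega, by omega⟩
    have hc : ((e : ℤ) - 2 + 1) = e - 1 := by ring
    have h3 := he.val_right (z := z) (a := e - 2) (b := 1) (by omega) (by omega)
    rw [hc, hv] at h3
    push_cast at h3
    refine mem_openEdge_of_corner he hB 2 0 (by simp [corner]) (by simp [corner, hc]) hray
      (he.mem_openRay hB 0 ?_ ?_)
    · simp [corner, hc, hv, hO]
    · simp [corner, hO]
      nlinarith
  · rcases he.left with rfl | rfl
    · obtain rfl : e = 1 := by omega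
      exact mem_openEdge_of_boundary he (Or.inr (Or.inl
        ⟨rfl, 0, le_rfl, by simp, by simp [corner], by simp [corner]⟩)) hray
    · obtain rfl : e = 2 := by omega
      have hA : (A 1).Valid 2 1 m := ⟨rfl, by simp, by simp, by omega⟩
      refine mem_openEdge_of_corner he hA 2 0 (by simp [corner]) (by simp [corner]) hray
        (he.mem_openRay hA 0 ?_ ?_)
      · norm_num at hv
        simp [corner, hv, hO]
      · simp only [corner]
        simp [hO]
        rw [val_frame (by omega)]
        push_cast
        linarith

-- For `l = 0` the edge is a ray to the left; for `l = 1` it ends at the frame of degree `d`, which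
-- is beyond the frame of degree `e`. Either way it covers the range of `x` in which the crossings
-- lie.
include hd he hde in
theorem Admissible.mem_openEdge_horizontal {j : ℤ} (hT : (P l j).Valid d l m)
    (hz : z 1 = scale d * (2 * j + l - 2 * d - 1)) (h0 : z 0 ≤ -2 * scale e)
    (h1 : -depth e - 6 * small e ≤ z 0) : z ∈ hd.piece.openEdge (⟨P l j, hT⟩, 2) := by
  obtain ⟨g1, g2, g3⟩ := id hT
  have hS := scale_of_succ he hde
  have hs := mul_pos (show (0 : ℝ) < d by exact_mod_cast hd.one_le) (scale_pos d)
  have h2 := (cluster_bounds hd.one_le hd.left hd.down ⟨_, hT⟩ ⟨l, j, Or.inl rfl⟩).1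
  have hray : z ∈ hd.piece.openRay (⟨P l j, hT⟩, 2) := by
    refine mem_openRay_of_dir hd (u := ![-1, 0]) (t := (planar d l m).pos ⟨P l j, hT⟩ 0 - z 0)
      (by linarith) (dir_of_corner hT 2 (by simp [corner]) (by simp [corner])).2 (by simp) ?_
    rw [hz, pos_P]
    simp
    left
    ring
  rcases hd.left with rfl | rfl
  · exact mem_openEdge_of_boundary hd (Or.inr (Or.inl
      ⟨rfl, j, by have := hd.down; omega, by omega, by simp [corner], by simp [corner]⟩)) hray
  · have hA : (A j).Valid d 1 m := ⟨rfl, by have := hd.down; omega, by omega, by omega⟩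
    obtain ⟨h3, -⟩ := pos_A_frame he hde hA
    have h4 := (small_bounds he.one_le).1
    refine mem_openEdge_of_corner hd hA 2 1 (by simp [corner]) (by simp [corner]; omega) hray ?_
    refine mem_openRay_of_dir hd (u := ![1, 0]) (t := z 0 - (planar d 1 m).pos ⟨A j, hA⟩ 0)
      (by linarith) (dir_of_corner hA 1 ?_ ?_).2 (by simp) ?_
    · simp [corner, show j + 1 ≠ d by omega]
    · simp [corner, show j + 1 ≠ d by omega]
    · rw [hz, pos_A_one, if_neg (by omega)]
      simp
      left
      ring

include hd he hde in
theorem Admissible.mem_openEdge_vertical (hm : m = 1) {i : ℤ} (hT : (P i 1).Valid d l m)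
    (hz : z 0 = scale d * (2 * i - 4 * d)) (h0 : z 1 ≤ -2 * scale e)
    (h1 : -depth e - 6 * small e ≤ z 1) : z ∈ hd.piece.openEdge (⟨P i 1, hT⟩, 0) := by
  obtain ⟨g1, g2, g3⟩ := id hT
  have hS := scale_of_succ he hde
  have hs := mul_pos (show (0 : ℝ) < d by exact_mod_cast hd.one_le) (scale_pos d)
  have h2 := (cluster_bounds hd.one_le hd.left hd.down ⟨_, hT⟩ ⟨i, 1, Or.inl rfl⟩).2.2.1
  have hB : (B i).Valid d l m := ⟨hm, g1, by omega⟩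
  obtain ⟨-, h3, -⟩ := pos_B_frame he hde hB
  have h4 := (small_bounds he.one_le).1
  refine mem_openEdge_of_corner hd hB 0 1 (by simp [corner]; omega) (by simp [corner]) ?_ ?_
  · refine mem_openRay_of_dir hd (u := ![0, -1]) (t := (planar d l m).pos ⟨P i 1, hT⟩ 1 - z 1)
      (by linarith) (dir_of_corner hT 0 (by simp [corner]) (by simp [corner])).2 ?_ (by simp)
    rw [hz, pos_P]
    simp
    left
    ring
  · refine mem_openRay_of_dir hd (u := ![0, 1]) (t := z 1 - (planar d l m).pos ⟨B i, hB⟩ 1)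
      (by linarith) (dir_of_corner hB 1 ?_ ?_).2 ?_ (by simp)
    · simp [corner, show i + 1 ≠ d by omega]
    · simp [corner, show i + 1 ≠ d by omega]
    · rw [hz, pos_B_zero, if_neg (by omega)]
      simp

include hd he hde in
/-- The two curves cross transversally at the crossings. -/
theorem Admissible.exists_crossing {c : (ℤ × ℤ) ⊕ ℤ} (hc : c ∈ crossingIndex d e l m) :
    ∃ h h', crossing d e l m c ∈ hd.piece.openEdge h ∧ crossing d e l m c ∈ he.piece.openEdge h' ∧
      (l = 1 → h ≠ hd.piece.left) ∧ (m = 1 → h ≠ hd.piece.down) ∧ hd.piece.wt h = 1 ∧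
      he.piece.wt h' = 1 ∧ IsUnit (hd.piece.dir h 0 * he.piece.dir h' 1 -
        hd.piece.dir h 1 * he.piece.dir h' 0) := by
  have hl01 := he.left
  have hm01 := he.down
  obtain ⟨e0, e1, e2, e3, -⟩ := small_bounds he.one_le
  have hK := (depth_bounds he.one_le).1
  -- The marked half-edges start at (0, d), with first coordinate less than `l`, or at (0, 0), with
  -- second coordinate 0. The half-edges used here do neither.
  have hport : ∀ {T : Triangle} (hT : T.Valid d l m) (s : Fin 3),
      l ≤ (T.corner d s).1 ∧ 0 < (T.corner d s).2 →
      (l = 1 → (⟨T, hT⟩, s) ≠ hd.piece.left) ∧ (m = 1 → (⟨T, hT⟩, s) ≠ hd.piece.down) := by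
    rintro T hT s ⟨h1, h2⟩
    refine ⟨fun hl h => ?_, fun hm h => ?_⟩
    · have h3 := (hd.isSide_left hl).1
      rw [← h] at h3
      change T.corner d s = _ at h3
      simp only [h3] at h1 h2
      omega
    · have h3 := (hd.isSide_down hm).1
      rw [← h] at h3
      change T.corner d s = _ at h3
      simp only [h3] at h1 h2
      omega
  rcases c with ⟨j, a⟩ | i
  · obtain ⟨⟨hj, hjd⟩, ha, ham⟩ := inl_mem_crossingIndex.1 hc
    have hT : (P l j).Valid d l m := ⟨le_rfl, hj, by omega⟩
    obtain ⟨hy, hy'⟩ := offset_bounds he hde (n := 2 * j + l - 2 * d - 1) (by omega) (by omega)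
    push_cast at hy hy'
    obtain ⟨hw, hdir⟩ := dir_of_corner hT 2 (u := ![-1, 0]) (by simp [corner]) (by simp [corner])
    obtain ⟨p1, p2⟩ := hport hT 2 (by simp [corner]; omega)
    by_cases hal : a < l
    · obtain rfl : a = 0 := by omega
      obtain rfl : l = 1 := by omega
      have hA : (A (e - 1)).Valid e 1 m := ⟨rfl, by omega, by omega, by omega⟩
      obtain ⟨b1, b2⟩ := he.height_bounds (a := 1) (b := e - 1) le_rfl (by omega) (by omega) hy.le hy'.le
      obtain ⟨hw', hdir'⟩ := dir_of_corner hA 0 (u := ![e - 1, -1]) (by simp [corner]) (by simp [corner])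
      refine ⟨_, _, hd.mem_openEdge_horizontal he hde hT ?_ ?_ ?_,
        he.mem_openEdge_A rfl hA (by omega) ?_ ?_ ?_ ?_, p1, p2, hw, hw', ?_⟩
      all_goals simp [crossing] at b1 b2 hy hy' ⊢
      any_goals linarith
      change IsUnit ((planar d 1 m).dir _ 0 * (planar e 1 m).dir _ 1 -
        (planar d 1 m).dir _ 1 * (planar e 1 m).dir _ 0)
      rw [hdir, hdir']
      simp
    · have hP : (P a (e - 1 - a)).Valid e l m := ⟨by omega, by omega, by omega⟩
      obtain ⟨hw', hdir'⟩ := dir_of_corner hP 1 (u := ![1, 1]) (by simp [corner]) (by simp [corner])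
      have ha0 : (0 : ℝ) ≤ a := by exact_mod_cast ha
      have ha1 : (a : ℝ) + 1 ≤ e := by exact_mod_cast (show a + 1 ≤ e by omega)
      -- The vertex `P a (e - 1 - a)` has second coordinate `-(a + 3)` units of `scale e`; the
      -- parameter `t` on its diagonal ray is the height difference to the horizontal edge.
      refine ⟨_, _, hd.mem_openEdge_horizontal he hde hT ?_ ?_ ?_,
        mem_openEdge_of_boundary (T := P a (e - 1 - a)) (h := hP) (s := 1) he
          (Or.inl ⟨a, ha, by omega, ?_, ?_⟩)
          (mem_openRay_of_dir he (u := ![1, 1]) (t := scale d * (2 * j + l - 2 * d - 1) + scale e * (a + 3))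
            ?_ hdir' ?_ ?_), p1, p2, hw, hw', ?_⟩
      · simp [crossing]
      · simp [crossing, hal]
        nlinarith
      · simp [crossing, hal]
        nlinarith
      · simp [corner]
      · simp [corner]
        ring
      · nlinarith
      · simp [crossing, hal, pos_P]
        ring
      · simp [crossing, pos_P]
        ring
      · change IsUnit ((planar d l m).dir _ 0 * (planar e l m).dir _ 1 -
          (planar d l m).dir _ 1 * (planar e l m).dir _ 0)
        rw [hdir, hdir']
        simp
  · obtain ⟨rfl, hi, hid⟩ := inr_mem_crossingIndex.1 hc
    have hT : (P i 1).Valid d l 1 := ⟨hi, le_rfl, by omega⟩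
    have hB : (B (e - 1)).Valid e l 1 := ⟨rfl, by omega, by omega⟩
    obtain ⟨hx, hx'⟩ := offset_bounds he hde (n := 2 * i - 4 * d) (by omega) (by omega)
    obtain ⟨hw, hdir⟩ := dir_of_corner hT 0 (u := ![0, -1]) (by simp [corner]) (by simp [corner])
    obtain ⟨hw', hdir'⟩ := dir_of_corner hB 2 (u := ![-1, e - 1]) (by simp [corner]) (by simp [corner])
    obtain ⟨p1, p2⟩ := hport hT 0 (by simp [corner]; omega)
    obtain ⟨b1, b2⟩ := he.height_bounds (a := e - 1) (b := 1) (by omega) le_rfl (by omega) hx.le hx'.le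
    refine ⟨_, _, hd.mem_openEdge_vertical he hde rfl hT ?_ ?_ ?_,
      he.mem_openEdge_B hB ?_ ?_ ?_ ?_, p1, p2, hw, hw', ?_⟩
    all_goals simp [crossing] at b1 b2 hx hx' ⊢
    any_goals linarith
    change IsUnit ((planar d l 1).dir _ 0 * (planar e l 1).dir _ 1 -
      (planar d l 1).dir _ 1 * (planar e l 1).dir _ 0)
    rw [hdir, hdir']
    simp

-- Crossings on vertical edges have second coordinate at most -1/4, those on horizontal edges are
-- within `scale e` of the axis. On one horizontal edge the frame crossing is likewise far to the
-- left of the diagonal ones, and the latter have different abscissae.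
include he hde in
theorem crossing_injOn : Set.InjOn (crossing d e l m) (crossingIndex d e l m) := by
  have hl01 := he.left
  have hm01 := he.down
  have hs := scale_pos e
  have hs' := (scale_pos d).ne'
  obtain ⟨e0, e1, e2, e3, -⟩ := small_bounds he.one_le
  have key : ∀ j a i : ℤ, Sum.inl (j, a) ∈ crossingIndex d e l m → Sum.inr i ∈ crossingIndex d e l m →
      crossing d e l m (.inl (j, a)) ≠ crossing d e l m (.inr i) := by
    intro j a i h1 h2 h
    obtain ⟨⟨hj, hjd⟩, ha, ham⟩ := inl_mem_crossingIndex.1 h1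
    obtain ⟨rfl, hi, hid⟩ := inr_mem_crossingIndex.1 h2
    obtain ⟨hy, -⟩ := offset_bounds he hde (n := 2 * j + l - 2 * d - 1) (by omega) (by omega)
    obtain ⟨hx, hx'⟩ := offset_bounds he hde (n := 2 * i - 4 * d) (by omega) (by omega)
    obtain ⟨-, b2⟩ := he.height_bounds (a := e - 1) (b := 1) (by omega) le_rfl (by omega) hx.le hx'.le
    have h3 := congrFun h 1
    simp [crossing] at h3 b2 hy
    linarith
  have key' : ∀ j a a' : ℤ, Sum.inl (j, a) ∈ crossingIndex d e l m → l ≤ a → a' < l → m + 1 ≤ e →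
      crossing d e l m (.inl (j, a)) ≠ crossing d e l m (.inl (j, a')) := by
    intro j a a' h1 hla hla' hm h
    obtain ⟨⟨hj, hjd⟩, ha, ham⟩ := inl_mem_crossingIndex.1 h1
    obtain ⟨hy, hy'⟩ := offset_bounds he hde (n := 2 * j + l - 2 * d - 1) (by omega) (by omega)
    obtain ⟨-, b2⟩ := he.height_bounds (a := 1) (b := e - 1) (by omega) (by omega) (by omega) hy.le hy'.le
    have ha0 : (0 : ℝ) ≤ a := by exact_mod_cast ha
    have h3 := congrFun h 0
    simp [crossing, not_lt.2 hla, hla'] at h3 b2 hy hy'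
    nlinarith
  rintro (⟨j, a⟩ | i) h1 (⟨j', a'⟩ | i') h2 h
  · have h3 := congrFun h 1
    simp [crossing, hs'] at h3
    subst h3
    obtain ⟨-, ha, ham⟩ := inl_mem_crossingIndex.1 h1
    obtain ⟨-, ha', ham'⟩ := inl_mem_crossingIndex.1 h2
    rcases lt_or_ge a l with hal | hal <;> rcases lt_or_ge a' l with hal' | hal'
    · grind
    · exact absurd h.symm (key' _ _ _ h2 hal' hal (by omega))
    · exact absurd h (key' _ _ _ h1 hal hal' (by omega))
    · have h4 := congrFun h 0
      simp [crossing, not_lt.2 hal, not_lt.2 hal', hs.ne'] at h4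
      rw [h4]
  · exact absurd h (key _ _ _ h1 h2)
  · exact absurd h.symm (key _ _ _ h2 h1)
  · have h3 := congrFun h 0
    simp [crossing, hs'] at h3
    rw [h3]

include hd he hde in
theorem card_crossingIndex : ((crossingIndex d e l m).card : ℤ) =
    (d - l - m) * (e - m) + m * (d - 1 - l) := by
  obtain ⟨h1, hl, hm⟩ := he
  rw [crossingIndex, Finset.card_disjSum, Finset.card_product, Int.card_Icc, Int.card_Icc]
  rcases hm with rfl | rfl
  · grind
  · rw [if_pos rfl, Int.card_Icc]
    grind

end Planar

end TropGeo

namespace TropGeo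

/-! ### Marked rays of consecutive degrees are nested -/

section Planar

open Triangle

variable {d e : ℕ} {l m : ℤ} (hd : Admissible d l m) (he : Admissible e l m) (hde : d = e + 1)
include he hde

/-- The frame of larger degree is further out, so its weighted ray starts later on the same axis and
is contained in the other one. In degree one with both sides undivided the other ray starts at the
origin. -/
theorem Admissible.left_pos_le (hl : l = 1) :
    hd.piece.pos hd.piece.left.1 0 ≤ he.piece.pos he.piece.left.1 0 := by
  have hs := scale_pos e
  have he1 := he.one_le
  have hm := he.down
  have hT : (A (d - 1)).Valid d l m := ⟨hl, by omega, by omega, by omega⟩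
  have hT' : (A (e - 1)).Valid e l m := ⟨hl, by omega, by omega, by omega⟩
  have h1 := (pos_A_frame he hde hT).1
  have h2 := (small_bounds he1).1
  have h3 := (depth_bounds he1).1
  have h4 : (planar e l m).pos ⟨A (e - 1), hT'⟩ 0 = height e l m (1, e - 1) := by simp [pos_A]
  have h5 : -depth e - 6 * small e ≤ height e l m (1, e - 1) := by
    by_cases hme : m + 1 ≤ e
    · have h6 := (he.height_bounds (a := 1) (b := e - 1) (by omega) (by omega) (by omega)
        (neg_nonpos.2 hs.le) le_rfl).1
      linarith
    · rw [height, if_pos (by omega)]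
      linarith
  rw [hd.left_eq hT, he.left_eq hT']
  change (planar d l m).pos ⟨A (d - 1), hT⟩ 0 ≤ (planar e l m).pos ⟨A (e - 1), hT'⟩ 0
  linarith

theorem Admissible.down_pos_le (hm : m = 1) :
    hd.piece.pos hd.piece.down.1 1 ≤ he.piece.pos he.piece.down.1 1 := by
  have hs := scale_pos e
  have he1 := he.one_le
  have hl := he.left
  have hT : (B (d - 1)).Valid d l m := ⟨hm, by omega, by omega⟩
  have h1 := (pos_B_frame he hde hT).2.1
  have h2 := (small_bounds he1).1
  have h3 := (depth_bounds he1).1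
  rw [hd.down_eq hT]
  change (planar d l m).pos ⟨B (d - 1), hT⟩ 1 ≤ _
  by_cases hle : l + 1 ≤ e
  · have hT' : (B (e - 1)).Valid e l m := ⟨hm, by omega, by omega⟩
    have h4 : (planar e l m).pos ⟨B (e - 1), hT'⟩ 1 = height e l m (e - 1, 1) := by simp [pos_B]
    have h6 := (he.height_bounds (a := e - 1) (b := 1) (by omega) (by omega) (by omega)
      (neg_nonpos.2 hs.le) le_rfl).1
    rw [he.down_eq hT']
    change _ ≤ (planar e l m).pos ⟨B (e - 1), hT'⟩ 1
    linarith
  · obtain rfl : e = 1 := by omega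
    have hT' : (A 0).Valid 1 l m := ⟨by omega, le_rfl, by simp, by simp⟩
    have h4 : he.piece.down = (⟨A 0, hT'⟩, 0) :=
      (he.isSide_down hm).eq he ⟨by simp [planar, corner], by simp [planar, corner]⟩
    have h5 : (planar 1 l m).pos ⟨A 0, hT'⟩ 1 = 0 := by simp [pos_A]
    rw [h4]
    change _ ≤ (planar 1 l m).pos ⟨A 0, hT'⟩ 1
    linarith

/-- From degree two on, the two marked half-edges start at different vertices. In degree one they
share the only vertex, and consecutive bridges would touch. -/
theorem Admissible.left_ne_down (hl : l = 1) (hm : m = 1) : hd.piece.left.1 ≠ hd.piece.down.1 := by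
  have he1 := he.one_le
  have hT : (A (d - 1)).Valid d l m := ⟨hl, by omega, by omega, by omega⟩
  have hT' : (B (d - 1)).Valid d l m := ⟨hm, by omega, by omega⟩
  rw [hd.left_eq hT, hd.down_eq hT']
  simp

end Planar

/-! ### The curves -/

/-- Whether the piece with index `j` is glued to the previous one. -/
def leftFlag (j : ℕ) : ℤ := if 0 < j then 1 else 0

/-- Whether the piece with index `j` is glued to the next one. -/
def downFlag (k j : ℕ) : ℤ := if j + 1 < k then 1 else 0

theorem leftFlag_eq_one {j : ℕ} : leftFlag j = 1 ↔ 0 < j := by simp [leftFlag]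

theorem downFlag_eq_one {k j : ℕ} : downFlag k j = 1 ↔ j + 1 < k := by simp [downFlag]

theorem admissible (e k j : ℕ) : Admissible (e + 1) (leftFlag j) (downFlag k j) where
  one_le := Nat.succ_pos e
  left := by rw [leftFlag]; split_ifs <;> simp
  down := by rw [downFlag]; split_ifs <;> simp

instance (e k j : ℕ) : Fintype (PlanarVertex (e + 1) (leftFlag j) (downFlag k j)) :=
  @Fintype.ofFinite _ (admissible e k j).finite

/-- The planar curves from which the curve of degree `e + 1` is glued. -/
def pieces (e k : ℕ) (j : Fin k) : Piece (PlanarVertex (e + 1) (leftFlag j) (downFlag k j)) :=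
  (admissible e k j).piece

theorem pieces_fits (e k : ℕ) (j : Fin k) : (pieces e k j).Fits k j (e + 1) :=
  (admissible e k j).fits rfl rfl

/-- The tropical curve of degree `e + 1`. -/
def gluedCurve (e k : ℕ) : TropicalCurve (k + 1) := (glue_isTropical (pieces_fits e k)).curve

section

variable {e k : ℕ}

theorem pieces_hasRays (j : Fin k) : (pieces e k j).HasRays k j (e + 1) :=
  (admissible e k j).hasRays rfl rfl j.2

theorem gluedCurve_genus (K : Type*) [Field K] (hk : 0 < k) :
    2 * ((gluedCurve e k).genus K : ℤ) = k * (e * (e - 1)) := by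
  have h := genus_glue (pieces_fits e k) pieces_hasRays K hk (fun j => (admissible e k j).connected)
    fun j => (admissible e k j).card
  rw [gluedCurve, h]
  push_cast
  ring

theorem mem_carrier_left {j : Fin k} {z : Fin 2 → ℝ} (hj : 0 < (j : ℕ))
    (hz : z ∈ (pieces (e + 1) k j).edge (pieces (e + 1) k j).left) : z ∈ (pieces e k j).carrier := by
  obtain ⟨t, ht, rfl⟩ := ((pieces_fits (e + 1) k j).mem_edge_left hj).1 hz
  exact ⟨_, ((pieces_fits e k j).mem_edge_left hj).2 ⟨t, ht.trans
    ((admissible (e + 1) k j).left_pos_le (admissible e k j) rfl (leftFlag_eq_one.2 hj)), rfl⟩⟩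

theorem mem_carrier_down {j : Fin k} {z : Fin 2 → ℝ} (hj : (j : ℕ) + 1 < k)
    (hz : z ∈ (pieces (e + 1) k j).edge (pieces (e + 1) k j).down) : z ∈ (pieces e k j).carrier := by
  obtain ⟨t, ht, rfl⟩ := ((pieces_fits (e + 1) k j).mem_edge_down hj).1 hz
  exact ⟨_, ((pieces_fits e k j).mem_edge_down hj).2 ⟨t, ht.trans
    ((admissible (e + 1) k j).down_pos_le (admissible e k j) rfl (downFlag_eq_one.2 hj)), rfl⟩⟩

/-- The crossings of a piece, together with the index of the piece. -/
def crossingIndices (e k : ℕ) : Finset (Σ _ : Fin k, (ℤ × ℤ) ⊕ ℤ) :=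
  Finset.univ.sigma fun j => crossingIndex (e + 2) (e + 1) (leftFlag j) (downFlag k j)

/-- A crossing as a point of the plane. -/
def crossingPoint (e k : ℕ) (c : Σ _ : Fin k, (ℤ × ℤ) ⊕ ℤ) : Fin (k + 1) → ℝ :=
  emb k c.1 (crossing (e + 2) (e + 1) (leftFlag c.1) (downFlag k c.1) c.2)

theorem exists_edges_of_crossing {c : Σ _ : Fin k, (ℤ × ℤ) ⊕ ℤ} (hc : c ∈ crossingIndices e k) :
    let z := crossing (e + 2) (e + 1) (leftFlag c.1) (downFlag k c.1) c.2;
    pair z ∈ chartInterior k c.1 ∧ ∃ h h', z ∈ (pieces (e + 1) k c.1).openEdge h ∧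
      z ∈ (pieces e k c.1).openEdge h' ∧ (pieces (e + 1) k c.1).wt h = 1 ∧
      (pieces e k c.1).wt h' = 1 ∧ IsUnit ((pieces (e + 1) k c.1).dir h 0 * (pieces e k c.1).dir h' 1 -
        (pieces (e + 1) k c.1).dir h 1 * (pieces e k c.1).dir h' 0) := by
  obtain ⟨j, c⟩ := c
  obtain ⟨h, h', h1, h2, h3, h4, h5⟩ := (admissible (e + 1) k j).exists_crossing (admissible e k j)
    rfl (Finset.mem_sigma.1 hc).2
  exact ⟨(pieces_fits (e + 1) k j).edge_subset (fun hj => h3 (leftFlag_eq_one.2 hj))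
    (fun hj => h4 (downFlag_eq_one.2 hj)) (TrivalentGraph.openEdge_subset h1), h, h', h1, h2, h5⟩

/-- All crossings lie in the interiors of the chart domains, which have pairwise disjoint images;
within one chart the planar statement applies. -/
theorem crossingPoint_injOn : Set.InjOn (crossingPoint e k) (crossingIndices e k) := by
  have key : ∀ c ∈ crossingIndices e k, ∀ c' ∈ crossingIndices e k, (c.1 : ℕ) < c'.1 →
      crossingPoint e k c ≠ crossingPoint e k c' := by
    intro c hc c' hc' hlt h
    have h1 := (exists_edges_of_crossing hc).1
    obtain ⟨h2, h3, -⟩ := chart_eq_chart hlt c'.1.2 (chartInterior_subset _ _ h1)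
      (chartInterior_subset _ _ (exists_edges_of_crossing hc').1) h
    have h4 := (h1.2 (by have := c'.1.2; omega)).1
    rw [h3] at h4
    exact lt_irrefl _ h4
  intro c hc c' hc' h
  rcases lt_trichotomy (c.1 : ℕ) c'.1 with hlt | heq | hlt
  · exact absurd h (key c hc c' hc' hlt)
  · obtain ⟨j, c⟩ := c
    obtain ⟨j', c'⟩ := c'
    obtain rfl : j = j' := Fin.ext heq
    exact congrArg _ (crossing_injOn (admissible e k j) rfl (Finset.mem_sigma.1 hc).2
      (Finset.mem_sigma.1 hc').2 (emb_injective j.2 h))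
  · exact absurd h.symm (key c' hc' c hc hlt)

/-- A piece without neighbours has `(e + 1)(e + 2)` crossings, and each undivided side removes `e +
1` of them. There are `2 (k - 1)` such sides. -/
theorem card_crossingIndices (hk : 0 < k) : ((crossingIndices e k).card : ℤ) =
    (e + 1) * (2 * (e + 1) + (k - 2) * e) := by
  have h : ∀ j : Fin k, ((crossingIndex (e + 2) (e + 1) (leftFlag j) (downFlag k j)).card : ℤ) =
      (e + 1) * (e + 2) - (e + 1) * ((if 0 < (j : ℕ) then (1 : ℤ) else 0) +
        if (j : ℕ) + 1 < k then 1 else 0) := by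
    intro j
    rw [card_crossingIndex (admissible (e + 1) k j) (admissible e k j) rfl]
    push_cast
    simp only [leftFlag, downFlag]
    split_ifs <;> ring
  rw [crossingIndices, Finset.card_sigma, Nat.cast_sum, Finset.sum_congr rfl fun j _ => h j,
    Finset.sum_sub_distrib, Finset.sum_const, ← Finset.mul_sum, sum_ports hk, Finset.card_univ,
    Fintype.card_fin, nsmul_eq_mul]
  ring

/-- The edge between two consecutive pieces. -/
def bridge (e k : ℕ) (i : Fin (k - 1)) : Set (Fin (k + 1) → ℝ) :=
  (glue (pieces e k)).edge (inj ⟨i, by omega⟩ (pieces e k ⟨i, by omega⟩).down)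

theorem bridge_opp (e k : ℕ) (i : Fin (k - 1)) :
    (glue (pieces e k)).opp (inj ⟨i, by omega⟩ (pieces e k ⟨i, by omega⟩).down) =
      some (inj ⟨i + 1, by omega⟩ (pieces e k ⟨i + 1, by omega⟩).left) :=
  glue_opp_down (pieces_fits e k) (by omega)

theorem isSegment_bridge (i : Fin (k - 1)) : IsSegment (bridge e k i) :=
  have hG := glue_isTropical (pieces_fits e k)
  ⟨_, _, hG.pos_ne_of_opp (bridge_opp e k i), hG.edge_eq_segment (bridge_opp e k i)⟩

/-- Bridges can meet only in a vertex. Two bridges ending in the same piece use its left and its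
lower marked vertex, which differ because the degree is at least two. -/
theorem disjoint_bridge {i i' : Fin (k - 1)} (hne : i ≠ i') :
    Disjoint (bridge (e + 1) k i) (bridge (e + 1) k i') := by
  have hG := glue_isTropical (pieces_fits (e + 1) k)
  have hports : ∀ j j' : Fin k, 0 < (j : ℕ) → (j' : ℕ) + 1 < k →
      (⟨j, (pieces (e + 1) k j).left.1⟩ : Σ j : Fin k,
        PlanarVertex (e + 1 + 1) (leftFlag j) (downFlag k j)) ≠ ⟨j', (pieces (e + 1) k j').down.1⟩ := by
    intro j j' h0 h1 h
    obtain rfl : j = j' := congrArg Sigma.fst h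
    exact (admissible (e + 1) k j).left_ne_down (admissible e k j) rfl (leftFlag_eq_one.2 h0)
      (downFlag_eq_one.2 h1) (eq_of_heq (Sigma.mk.inj h).2)
  have hlt : ∀ i : Fin (k - 1), (i : ℕ) + 1 < k := fun i => by omega
  have hopen : ∀ i i' : Fin (k - 1), i ≠ i' → ∀ x, x ∈ (glue (pieces (e + 1) k)).openEdge
      (inj ⟨i, by omega⟩ (pieces (e + 1) k ⟨i, by omega⟩).down) → x ∉ bridge (e + 1) k i' := by
    intro i i' hne x hx hx'
    rcases hG.noncrossing _ _ x hx hx' with h | h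
    · exact hne (Fin.ext (congrArg Fin.val (index_eq_of_inj_eq h)).symm)
    · rw [bridge_opp, Option.some_inj] at h
      exact hports _ _ (Nat.succ_pos _) (hlt _) (congrArg Prod.fst h)
  refine Set.disjoint_left.2 fun x hx hx' => ?_
  rcases hG.mem_edge_iff.1 hx with h | h | ⟨H, ho, h⟩
  · rcases hG.mem_edge_iff.1 hx' with h' | h' | ⟨H', ho', h'⟩
    · have h1 := hG.pos_injective (h.symm.trans h')
      exact hne (Fin.ext (congrArg (fun v => (v.1 : ℕ)) h1))
    · exact hopen _ _ hne.symm x h' hx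
    · rw [bridge_opp, Option.some_inj] at ho'
      subst ho'
      exact hports _ _ (Nat.succ_pos _) (hlt _) (hG.pos_injective (h'.symm.trans h))
  · exact hopen _ _ hne x h hx'
  · rw [bridge_opp, Option.some_inj] at ho
    subst ho
    rcases hG.mem_edge_iff.1 hx' with h' | h' | ⟨H', ho', h'⟩
    · exact hports _ _ (Nat.succ_pos _) (hlt _) (hG.pos_injective (h.symm.trans h'))
    · exact hopen _ _ hne.symm x h' hx
    · rw [bridge_opp, Option.some_inj] at ho'
      subst ho'
      have h1 := congrArg (fun v => (v.1 : ℕ)) (hG.pos_injective (h.symm.trans h'))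
      exact hne (Fin.ext (Nat.succ_injective h1))

-- In a chart, a common point is a crossing or lies on a marked ray of the curve of larger degree.
-- That ray is contained in the smaller curve, so the whole bridge of the larger curve is common to
-- both.
open Classical in
theorem gluedCurve_inter : (gluedCurve (e + 1) k).support ∩ (gluedCurve e k).support =
    (((crossingIndices e k).image (crossingPoint e k) : Finset _) : Set (Fin (k + 1) → ℝ)) ∪
      ⋃ i, bridge (e + 1) k i := by
  have hP := pieces_fits (e + 1) k
  ext x
  refine (mem_support_glue_inter hP (pieces_fits e k)).trans ?_
  simp only [Finset.coe_image, Set.mem_union, Set.mem_image, Set.mem_iUnion]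
  constructor
  · rintro ⟨j, z, ⟨hz, hz'⟩, hzd, rfl⟩
    rcases (admissible (e + 1) k j).meets (admissible e k j) rfl hz hz' with ⟨c, hc, rfl⟩ | ⟨hj, h⟩ | ⟨hj, h⟩
    · exact Or.inl ⟨⟨j, c⟩, Finset.mem_sigma.2 ⟨Finset.mem_univ j, hc⟩, rfl⟩
    · obtain ⟨j, hjk⟩ := j
      rw [leftFlag_eq_one] at hj
      obtain ⟨i, rfl⟩ : ∃ i, j = i + 1 := ⟨j - 1, by simp at hj; omega⟩
      refine Or.inr ⟨⟨i, by omega⟩, ?_⟩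
      rw [bridge, ← (glue_isTropical hP).edge_opp (bridge_opp (e + 1) k ⟨i, by omega⟩)]
      exact mem_glue_edge hP h hzd
    · rw [downFlag_eq_one] at hj
      exact Or.inr ⟨⟨j, by omega⟩, mem_glue_edge hP h hzd⟩
  · rintro (⟨c, hc, rfl⟩ | ⟨i, hi⟩)
    · obtain ⟨h1, h, h', h2, h3, -⟩ := exists_edges_of_crossing hc
      exact ⟨c.1, _, ⟨⟨h, TrivalentGraph.openEdge_subset h2⟩, h', TrivalentGraph.openEdge_subset h3⟩,
        chartInterior_subset _ _ h1, rfl⟩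
    · rcases exists_of_mem_glue_edge_port hP (i := i) (by omega) hi.1 (hi.2 _ (bridge_opp _ _ _)) with
        ⟨z, hz, hzd, rfl⟩ | ⟨z, hz, hzd, rfl⟩
      · exact ⟨_, z, ⟨⟨_, hz⟩, mem_carrier_down (by simp; omega) hz⟩, hzd, rfl⟩
      · exact ⟨_, z, ⟨⟨_, hz⟩, mem_carrier_left (Nat.succ_pos _) hz⟩, hzd, rfl⟩

theorem isTransverseAt_crossingPoint {c : Σ _ : Fin k, (ℤ × ℤ) ⊕ ℤ} (hc : c ∈ crossingIndices e k) :
    IsTransverseAt (planeVariety (isValuated_spread (n := k + 1))) (gluedCurve (e + 1) k)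
      (gluedCurve e k) (crossingPoint e k c) := by
  obtain ⟨h1, h, h', h2, h3, h4, h5, h6⟩ := exists_edges_of_crossing hc
  exact isTransverseAt_glue (pieces_fits (e + 1) k) (pieces_fits e k) h2 h3 h1 h4 h5 h6

end

end TropGeo

end

open TropGeo
theorem mainTheorem8 (K : Type*) [Field K] (k : ℕ) (hk : 1 ≤ k) :
    ∃ (L : TropicalVariety (k + 1) 2) (C : ℕ → TropicalCurve (k + 1)),
      IsTropicalPlane L ∧
      (∀ d : ℕ, 1 ≤ d →
        (C d).support ⊆ L.support ∧
        (C d).curveDegree = d ∧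
        ((C d).genus K : ℚ) = (k : ℚ) * (((d : ℚ) - 1) * ((d : ℚ) - 2) / 2) ∧
        (C d).recessionFan = d • fanLine (k + 1)) ∧
      (∀ d : ℕ, 2 ≤ d →
        ∃ (T : Finset (Fin (k + 1) → ℝ)) (S : Fin (k - 1) → Set (Fin (k + 1) → ℝ)),
          (C d).support ∩ (C (d - 1)).support = (T : Set (Fin (k + 1) → ℝ)) ∪ ⋃ i, S i ∧
          (∀ p ∈ T, IsTransverseAt L (C d) (C (d - 1)) p) ∧
          (T.card : ℤ) =
            ((d : ℤ) - 1) * (2 * ((d : ℤ) - 1) + ((k : ℤ) - 2) * ((d : ℤ) - 2)) ∧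
          (∀ i, IsSegment (S i)) ∧
          (∀ i j, i ≠ j → Disjoint (S i) (S j))) := by
  classical
  -- The curve of degree `d` is `gluedCurve (d - 1)`, because pieces are indexed by degree minus
  -- one; the value at `d = 0` is arbitrary.
  refine ⟨planeVariety (isValuated_spread (n := k + 1)), fun d => gluedCurve (d - 1) k,
    isTropicalPlane_planeVariety _ (by omega), fun d hd => ?_, fun d hd => ?_⟩
  · obtain ⟨e, rfl⟩ : ∃ e, d = e + 1 := ⟨d - 1, by omega⟩
    simp only [Nat.add_sub_cancel]
    refine ⟨support_glue_subset (pieces_fits e k), curveDegree_glue (pieces_fits e k) pieces_hasRays hk, ?_,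
      recessionFan_glue (pieces_fits e k) pieces_hasRays hk⟩
    have h : 2 * ((gluedCurve e k).genus K : ℚ) = k * (e * (e - 1)) := by
      exact_mod_cast gluedCurve_genus (e := e) K hk
    push_cast
    linarith
  · obtain ⟨e, rfl⟩ : ∃ e, d = e + 2 := ⟨d - 2, by omega⟩
    refine ⟨(crossingIndices e k).image (crossingPoint e k), bridge (e + 1) k, gluedCurve_inter, ?_, ?_,
      isSegment_bridge, fun i j => disjoint_bridge⟩
    · intro p hp
      obtain ⟨c, hc, rfl⟩ := Finset.mem_image.1 hp
      exact isTransverseAt_crossingPoint hc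
    · rw [Finset.card_image_of_injOn crossingPoint_injOn, card_crossingIndices hk]
      push_cast
      ring
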